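/- **Conventions.** A *diagram* is an oriented link or tangle diagram which may contain positive, negative and virtual crossings, cut by marks into arcs and crossings; at a crossing drawn with both strands upwards, $x_1,x_2$ are the incoming ends (bottom left, bottom right) and $y_1,y_2$ the outgoing ends (top left, top right), and in a positive crossing the strand from $x_1$ to $y_2$ is the upper one. Every mark and endpoint is a variable of quantum degree $q^2$. For elements $p_1,p_2$ of degrees $n_1,n_2$ of a graded polynomial ring $R$ over $\mathbb Q$ let $[p_1]=(q^{n_1}aR\xrightarrow{p_1}R)$ and $[p_1,p_2]=[p_1]\otimes_R[p_2]$ be the Koszul complexes (differential $d_g$; $q^ia^jt^k$ denotes a shift by $i,j,k$ in the quantum, Hochschild and homological grading). Put $$C(\text{arc } x\to y)=[y-x],\quad C(\text{virtual})=[y_1-x_2,\;y_2-x_1],$$ $$C(\text{parallel arcs})=[y_1-x_1,\;y_2-x_2],\quad C(\text{wide edge})=[(y_1-x_1)(y_1-x_2),\;y_1+y_2-x_1-x_2],$$ $$C(\text{positive})=\bigl(C(\text{parallel arcs})\xrightarrow{\chi_i}tq^{-2}C(\text{wide edge})\bigr),\quad C(\text{negative})=\bigl(t^{-1}C(\text{wide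 edge})\xrightarrow{\chi_o}C(\text{parallel arcs})\bigr),$$ where $\chi_i,\chi_o$ are the Khovanov–Rozansky chain maps, of degree $0$, which in Hochschild degree $0$ are multiplication by $y_1-x_2$ and by $1$; explicitly, in the bases in which $d_g$ of $[p_1,p_2]$ is $1\mapsto(p_1,p_2)$, $(u,v)\mapsto -p_2u+p_1v$, they are in Hochschild degrees $0,1,2$ $$\chi_i:\ y_1-x_2,\ \begin{pmatrix}y_1-x_2&0\\1&1\end{pmatrix},\ 1;\qquad \chi_o:\ 1,\ \begin{pmatrix}1&0\\-1&y_1-x_2\end{pmatrix},\ y_1-x_2 .$$ For a diagram $\tau$ the bicomplex $C(\tau)$, with commuting differentials $d_g$ and $d_c$ ($d_c$ built from $\chi_i,\chi_o$), is the tensor product of the bicomplexes of its pieces over the polynomial ring in all marks and endpoints; it is a bicomplex of graded modules over the polynomial ring $E(\tau)$ in the endpoints. Two bicomplexes are *homotopy equivalent* ($\simeq$) if they are isomorphic in the homotopy category of complexes (differential $d_c$) over the homotopy category of complexes (differential $d_g$) of graded $E(\tau)$-modules. The HOMFLY-PT homology of a link diagram $D$ is the triply graded vector space $\mathcal H(D)=H_{d_{c*}}(H_{d_g}(C(D)))$.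 Consider three tangles with incoming ends $a$ (bottom left), $c$ (top right) and outgoing ends $b$ (top left), $e$ (bottom right): * $\tau_1$: a positive crossing on the left, with both strands upwards, next to a negative crossing on the right, with both strands downwards (the two antiparallel strands of a Reidemeister IIb move); * $\tau_2$: two uncrossed arcs $a\to e$ and $c\to b$; * $\tau_3$: $\tau_1$ with the positive crossing replaced by a virtual one. **Theorem.** 1. $C(\tau_1)\simeq t\,q^{-2}\,C(\tau_3)$. 2. $C(\tau_1)\not\simeq C(\tau_2)$, and $C(\tau_1)\not\simeq q^la^mt^nC(\tau_2)$ for all $l,m,n\in\mathbb Z$. 3. If $D_1,D_2,D_3$ are link diagrams (possibly with virtual crossings) which are identical except near one point, where they are $\tau_1,\tau_2,\tau_3$ respectively, then $\mathcal H(D_1)\cong t\,q^{-2}\,\mathcal H(D_3)$ as triply graded vector spaces. 4. In general $\mathcal H(D_1)\not\cong\mathcal H(D_2)$, even up to a grading shift. Namely, write $X^{\pm}(x_1,x_2;y_1,y_2)$ for a positive or negative crossing with the indicated marks, and let $D$ be the planar link diagram with marks $0,\dots,9$ and the five crossings $$X^+(4,8;0,9),\quad X^-(7,9;6,8),\quad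 X^-(0,1;2,3),\quad X^-(2,3;4,5),\quad X^+(6,5;7,1),$$ the first two of which form a tangle $\tau_1$ with $(a,b,c,e)=(4,0,7,6)$. Let $D_2$ be the diagram obtained from $D$ by replacing this tangle with $\tau_2$, let $O$ be the standard circle and let $T$ be the left-handed trefoil, presented as the closure of the two-strand braid with three negative crossings. Then $D$ and $D_2$ are planar diagrams of the unknot, that is, $D$ is related to $D_2$ and to $O$ by planar isotopies and oriented Reidemeister moves; $\mathcal H(D)\cong t^2q^{-4}\,\mathcal H(T)$; and $\mathcal H(D)$ is isomorphic neither to $\mathcal H(D_2)$ nor to $\mathcal H(O)$, even up to a shift of the three gradings. -/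

import Mathlib

open scoped Kronecker

namespace KR

/-! ## Triply graded bicomplexes of free modules over a polynomial ring -/

section Bicomplexes

/-- The weight giving every mark variable quantum degree `2`. -/
def qWeight (V : Type) : V → ℤ := fun _ => 2

/-- The sign `(-1)^n`. -/
noncomputable def sgn (V : Type) (n : ℤ) : MvPolynomial V ℚ := if Even n then 1 else -1

/-- A bicomplex of finitely generated free graded modules over the total ring `ℚ[V]`
(`deg_q v = 2` for every mark `v : V`) with commuting differentials. The basis element `i` has
quantum degree `q i`, Hochschild degree `a i` and homological degree `t i`. The matrix entry in row
`i` and column `j` is the coefficient of `i` in the differential of `j`. The differential `dg` has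
degree `q^0 a^{-1} t^0` and the differential `dc` has degree `q^0 a^0 t^1`. -/
structure Bicomplex (V : Type) where
  ι : Type
  [fintype : Fintype ι]
  [decEq : DecidableEq ι]
  q : ι → ℤ
  a : ι → ℤ
  t : ι → ℤ
  dg : Matrix ι ι (MvPolynomial V ℚ)
  dc : Matrix ι ι (MvPolynomial V ℚ)
  dg_q : ∀ i j, MvPolynomial.IsWeightedHomogeneous (qWeight V) (dg i j) (q j - q i)
  dc_q : ∀ i j, MvPolynomial.IsWeightedHomogeneous (qWeight V) (dc i j) (q j - q i)
  dg_at : ∀ i j, dg i j ≠ 0 → a j = a i + 1 ∧ t j = t i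
  dc_at : ∀ i j, dc i j ≠ 0 → a j = a i ∧ t i = t j + 1
  dg_dg : dg * dg = 0
  dc_dc : dc * dc = 0
  dg_dc : dg * dc = dc * dg

attribute [instance] Bicomplex.fintype Bicomplex.decEq

variable {V W B : Type}

/-- The underlying module, free over `ℚ[V]` on the basis `C.ι`. -/
abbrev Bicomplex.Mod (C : Bicomplex V) : Type := C.ι → MvPolynomial V ℚ

/-- The differential `d_g` as a linear map. -/
noncomputable def Bicomplex.dgMap (C : Bicomplex V) : C.Mod →ₗ[ℚ] C.Mod :=
  (Matrix.mulVecLin C.dg).restrictScalars ℚ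

/-- The differential `d_c` as a linear map. -/
noncomputable def Bicomplex.dcMap (C : Bicomplex V) : C.Mod →ₗ[ℚ] C.Mod :=
  (Matrix.mulVecLin C.dc).restrictScalars ℚ

/-- The elements of degree `q^i a^j t^k`. -/
def Bicomplex.gr (C : Bicomplex V) (i j k : ℤ) : Submodule ℚ C.Mod where
  carrier := {x | ∀ b, x b ∈ MvPolynomial.weightedHomogeneousSubmodule ℚ (qWeight V) (i - C.q b) ∧
    (x b ≠ 0 → C.a b = j ∧ C.t b = k)}
  zero_mem' := fun b => ⟨Submodule.zero_mem _, fun h => absurd rfl h⟩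
  add_mem' := by
    intro x y hx hy b
    refine ⟨Submodule.add_mem _ (hx b).1 (hy b).1, fun h => ?_⟩
    by_cases h0 : x b = 0
    · exact (hy b).2 (fun h1 => h (by simp [h0, h1]))
    · exact (hx b).2 h0
  smul_mem' := by
    intro c x hx b
    refine ⟨Submodule.smul_mem _ c (hx b).1, fun h => (hx b).2 (fun h0 => h (by simp [h0]))⟩

/-- The grading shift `q^l a^m t^n C`: a generator of degree `(q, a, t)` is moved to degree
`(q + l, a + m, t + n)`. -/
def Bicomplex.shift (C : Bicomplex V) (l m n : ℤ) : Bicomplex V where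
  ι := C.ι
  q := fun i => C.q i + l
  a := fun i => C.a i + m
  t := fun i => C.t i + n
  dg := C.dg
  dc := C.dc
  dg_q := fun i j => by simpa using C.dg_q i j
  dc_q := fun i j => by simpa using C.dc_q i j
  dg_at := fun i j h => by have := C.dg_at i j h; omega
  dc_at := fun i j h => by have := C.dc_at i j h; omega
  dg_dg := C.dg_dg
  dc_dc := C.dc_dc
  dg_dc := C.dg_dc

/-! ### Homotopy equivalence of bicomplexes

Let `B` be the set of endpoints of a tangle and `β : B → V` its inclusion into the set of marks.
A bicomplex over `ℚ[V]` is a bicomplex of graded modules over the edge ring `ℚ[B]`. It is read as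
a complex (differential `d_c`) in the homotopy category of complexes (differential `d_g`) of graded
`ℚ[B]`-modules, and two bicomplexes are homotopy equivalent if they are isomorphic in the homotopy
category of such complexes. -/

/-- Linearity over the edge ring `ℚ[B]`. -/
def EdgeLinear (β : B → V) (β' : B → W) {C : Bicomplex V} {D : Bicomplex W}
    (f : C.Mod →ₗ[ℚ] D.Mod) : Prop :=
  ∀ (p : MvPolynomial B ℚ) (x : C.Mod),
    f (MvPolynomial.rename β p • x) = MvPolynomial.rename β' p • f x

/-- The map `f` is homogeneous of degree `q^0 a^m t^n`. -/
def HasDegree {C : Bicomplex V} {D : Bicomplex W} (m n : ℤ) (f : C.Mod →ₗ[ℚ] D.Mod) : Prop :=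
  ∀ i j k, ∀ x ∈ C.gr i j k, f x ∈ D.gr i (j + m) (k + n)

/-- Morphisms: `f` is a chain map for `d_g`, and commutes with `d_c` up to a homotopy for `d_g`. -/
def IsMorphism (β : B → V) (β' : B → W) {C : Bicomplex V} {D : Bicomplex W}
    (f : C.Mod →ₗ[ℚ] D.Mod) : Prop :=
  EdgeLinear β β' f ∧ HasDegree 0 0 f ∧ f ∘ₗ C.dgMap = D.dgMap ∘ₗ f ∧
  ∃ h : C.Mod →ₗ[ℚ] D.Mod, EdgeLinear β β' h ∧ HasDegree 1 1 h ∧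
    f ∘ₗ C.dcMap - D.dcMap ∘ₗ f = D.dgMap ∘ₗ h + h ∘ₗ C.dgMap

/-- The endomorphism `f` is homotopic to the identity: up to a homotopy `u` for `d_g`, the map
`f - 1` is `d_c s + s d_c` with `s` a chain map for `d_g`. -/
def HomotopicToId (β : B → V) {C : Bicomplex V} (f : C.Mod →ₗ[ℚ] C.Mod) : Prop :=
  ∃ s u : C.Mod →ₗ[ℚ] C.Mod,
    EdgeLinear β β s ∧ HasDegree 0 (-1) s ∧ s ∘ₗ C.dgMap = C.dgMap ∘ₗ s ∧
    EdgeLinear β β u ∧ HasDegree 1 0 u ∧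
    f - LinearMap.id = (C.dcMap ∘ₗ s + s ∘ₗ C.dcMap) + (C.dgMap ∘ₗ u + u ∘ₗ C.dgMap)

/-- Homotopy equivalence of bicomplexes of graded `ℚ[B]`-modules. -/
def HomotopyEquivalent (β : B → V) (β' : B → W) (C : Bicomplex V) (D : Bicomplex W) : Prop :=
  ∃ (f : C.Mod →ₗ[ℚ] D.Mod) (g : D.Mod →ₗ[ℚ] C.Mod),
    IsMorphism β β' f ∧ IsMorphism β' β g ∧
    HomotopicToId β (g ∘ₗ f) ∧ HomotopicToId β' (f ∘ₗ g)

/-! ### The homology `H_{d_c*}(H_{d_g}(C))` -/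

/-- `ker d / im d`. -/
abbrev Homology {M : Type} [AddCommGroup M] [Module ℚ M] (d : M →ₗ[ℚ] M) : Type :=
  LinearMap.ker d ⧸ (LinearMap.range d).submoduleOf (LinearMap.ker d)

/-- The classes in `ker d / im d` of the cycles that lie in `S`. -/
def homologyPart {M : Type} [AddCommGroup M] [Module ℚ M] (d : M →ₗ[ℚ] M) (S : Submodule ℚ M) :
    Submodule ℚ (Homology d) :=
  (S.submoduleOf (LinearMap.ker d)).map
    ((LinearMap.range d).submoduleOf (LinearMap.ker d)).mkQ

/-- The map induced on `ker d / im d` by a map that commutes with `d`. -/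
def homologyMap {M : Type} [AddCommGroup M] [Module ℚ M] (d f : M →ₗ[ℚ] M)
    (h : ∀ x, d (f x) = f (d x)) : Homology d →ₗ[ℚ] Homology d :=
  Submodule.mapQ _ _
    (f.restrict (p := LinearMap.ker d) (q := LinearMap.ker d) (fun x hx => by
      rw [LinearMap.mem_ker] at hx ⊢
      rw [h, hx, map_zero]))
    (by
      rintro ⟨x, hx⟩ hy
      obtain ⟨y, hy⟩ := hy
      exact ⟨f y, by rw [h, hy]; rfl⟩)

theorem Bicomplex.dgMap_dcMap (C : Bicomplex V) (x : C.Mod) :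
    C.dgMap (C.dcMap x) = C.dcMap (C.dgMap x) := by
  simp [Bicomplex.dgMap, Bicomplex.dcMap, Matrix.mulVec_mulVec, C.dg_dc]

/-- The differential induced by `d_c` on `H_{d_g}(C)`. -/
noncomputable def Bicomplex.dcStar (C : Bicomplex V) : Homology C.dgMap →ₗ[ℚ] Homology C.dgMap :=
  homologyMap C.dgMap C.dcMap C.dgMap_dcMap

/-- The HOMFLY-PT homology `H_{d_c*}(H_{d_g}(C))` of a bicomplex. -/
abbrev Bicomplex.HH (C : Bicomplex V) : Type := Homology C.dcStar

/-- The part of degree `q^i a^j t^k` of the homology. -/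
noncomputable def Bicomplex.grHH (C : Bicomplex V) (i j k : ℤ) : Submodule ℚ C.HH :=
  homologyPart C.dcStar (homologyPart C.dgMap (C.gr i j k))

/-- The homologies are isomorphic as triply graded vector spaces. -/
def HHIso (C : Bicomplex V) (D : Bicomplex W) : Prop :=
  ∃ e : C.HH ≃ₗ[ℚ] D.HH, ∀ i j k, (C.grHH i j k).map (e : C.HH →ₗ[ℚ] D.HH) = D.grHH i j k

/-! ### Constructions of bicomplexes -/

/-- The bicomplex `ℚ[V]` in degree `q^0 a^0 t^0`. -/
noncomputable def unitBicomplex (V : Type) : Bicomplex V where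
  ι := Unit
  q := 0
  a := 0
  t := 0
  dg := 0
  dc := 0
  dg_q := fun _ _ => MvPolynomial.isWeightedHomogeneous_zero _ _ _
  dc_q := fun _ _ => MvPolynomial.isWeightedHomogeneous_zero _ _ _
  dg_at := fun _ _ h => absurd rfl h
  dc_at := fun _ _ h => absurd rfl h
  dg_dg := by simp
  dc_dc := by simp
  dg_dc := by simp

/-- The Koszul complex `[p]` of an element `p` of degree `n`: `q^n a R → R`, in degree `t^0`. -/
noncomputable def koszul1 (p : MvPolynomial V ℚ) (n : ℤ)
    (hp : MvPolynomial.IsWeightedHomogeneous (qWeight V) p n) : Bicomplex V where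
  ι := Fin 2
  q := ![0, n]
  a := ![0, 1]
  t := 0
  dg := !![0, p; 0, 0]
  dc := 0
  dg_q := by
    intro i j
    fin_cases i <;> fin_cases j <;>
      simp [MvPolynomial.isWeightedHomogeneous_zero, hp]
  dc_q := fun _ _ => MvPolynomial.isWeightedHomogeneous_zero _ _ _
  dg_at := by
    intro i j
    fin_cases i <;> fin_cases j <;> simp
  dc_at := fun _ _ h => absurd rfl h
  dg_dg := by
    ext i j
    fin_cases i <;> fin_cases j <;> simp [Matrix.mul_apply]
  dc_dc := by simp
  dg_dc := by simp

/-- The matrix of the Koszul differential `1 ↦ (p₁, p₂)`, `(u, v) ↦ -p₂ u + p₁ v`. -/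
noncomputable def koszulMatrix (p₁ p₂ : MvPolynomial V ℚ) :
    Matrix (Fin 4) (Fin 4) (MvPolynomial V ℚ) :=
  !![0, -p₂, p₁, 0;
     0, 0, 0, p₁;
     0, 0, 0, p₂;
     0, 0, 0, 0]

/-- The Koszul complex of `p₁, p₂` of degrees `n₁, n₂`, in degree `t^0`:
`q^(n₁+n₂) a² R → q^n₂ a R ⊕ q^n₁ a R → R`, `1 ↦ (p₁, p₂)`, `(u, v) ↦ -p₂ u + p₁ v`. -/
noncomputable def koszul2 (p₁ p₂ : MvPolynomial V ℚ) (n₁ n₂ : ℤ)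
    (h₁ : MvPolynomial.IsWeightedHomogeneous (qWeight V) p₁ n₁)
    (h₂ : MvPolynomial.IsWeightedHomogeneous (qWeight V) p₂ n₂) : Bicomplex V where
  ι := Fin 4
  q := ![0, n₂, n₁, n₁ + n₂]
  a := ![0, 1, 1, 2]
  t := 0
  dg := koszulMatrix p₁ p₂
  dc := 0
  dg_q := by
    have h₃ : MvPolynomial.IsWeightedHomogeneous (qWeight V) (-p₂) n₂ :=
      (MvPolynomial.weightedHomogeneousSubmodule ℚ (qWeight V) n₂).neg_mem h₂
    intro i j
    fin_cases i <;> fin_cases j <;>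
      simp [koszulMatrix, MvPolynomial.isWeightedHomogeneous_zero, h₁, h₂, h₃]
  dc_q := fun _ _ => MvPolynomial.isWeightedHomogeneous_zero _ _ _
  dg_at := by
    intro i j
    fin_cases i <;> fin_cases j <;> simp [koszulMatrix]
  dc_at := fun _ _ h => absurd rfl h
  dg_dg := by
    ext i j
    fin_cases i <;> fin_cases j <;> simp [koszulMatrix, Matrix.mul_apply, Fin.sum_univ_four, mul_comm]
  dc_dc := by simp
  dg_dc := by simp

/-- The bicomplex `K → t L` whose `d_c` is a chain map `χ : K → L` of degree zero, where `K` and `L`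
are concentrated in homological degree zero. -/
noncomputable def twoTerm (K L : Bicomplex V) (_hK : K.t = 0) (_hL : L.t = 0) (_hKc : K.dc = 0)
    (_hLc : L.dc = 0)
    (χ : Matrix L.ι K.ι (MvPolynomial V ℚ))
    (χ_q : ∀ i j, MvPolynomial.IsWeightedHomogeneous (qWeight V) (χ i j) (K.q j - L.q i))
    (χ_a : ∀ i j, χ i j ≠ 0 → K.a j = L.a i)
    (χ_dg : L.dg * χ = χ * K.dg) : Bicomplex V where
  ι := K.ι ⊕ L.ι
  q := Sum.elim K.q L.q
  a := Sum.elim K.a L.a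
  t := Sum.elim (fun _ => 0) (fun _ => 1)
  dg := Matrix.fromBlocks K.dg 0 0 L.dg
  dc := Matrix.fromBlocks 0 0 χ 0
  dg_q := by
    rintro (i | i) (j | j)
    · exact K.dg_q i j
    · exact MvPolynomial.isWeightedHomogeneous_zero _ _ _
    · exact MvPolynomial.isWeightedHomogeneous_zero _ _ _
    · exact L.dg_q i j
  dc_q := by
    rintro (i | i) (j | j)
    · exact MvPolynomial.isWeightedHomogeneous_zero _ _ _
    · exact MvPolynomial.isWeightedHomogeneous_zero _ _ _
    · exact χ_q i j
    · exact MvPolynomial.isWeightedHomogeneous_zero _ _ _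
  dg_at := by
    rintro (i | i) (j | j) h
    · exact ⟨(K.dg_at i j h).1, rfl⟩
    · exact absurd rfl h
    · exact absurd rfl h
    · exact ⟨(L.dg_at i j h).1, rfl⟩
  dc_at := by
    rintro (i | i) (j | j) h
    · exact absurd rfl h
    · exact absurd rfl h
    · exact ⟨χ_a i j h, by simp⟩
    · exact absurd rfl h
  dg_dg := by simp [Matrix.fromBlocks_multiply, K.dg_dg, L.dg_dg]
  dc_dc := by simp [Matrix.fromBlocks_multiply]
  dg_dc := by simp [Matrix.fromBlocks_multiply, χ_dg]

/-- The diagonal matrix of the signs `(-1)^(n i)`. -/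
noncomputable def sgnMatrix (V : Type) {ι : Type} [DecidableEq ι] (n : ι → ℤ) :
    Matrix ι ι (MvPolynomial V ℚ) :=
  Matrix.diagonal fun i => sgn V (n i)

theorem sgnMatrix_sq {ι : Type} [Fintype ι] [DecidableEq ι] (n : ι → ℤ) :
    sgnMatrix V n * sgnMatrix V n = 1 := by
  rw [sgnMatrix, Matrix.diagonal_mul_diagonal, ← Matrix.diagonal_one]
  congr 1
  ext1 i
  unfold sgn
  split_ifs <;> simp

theorem sgnMatrix_comm {ι : Type} [Fintype ι] [DecidableEq ι] (n : ι → ℤ)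
    (M : Matrix ι ι (MvPolynomial V ℚ)) (h : ∀ i j, M i j ≠ 0 → n i = n j) :
    sgnMatrix V n * M = M * sgnMatrix V n := by
  ext1 i j
  rw [sgnMatrix, Matrix.diagonal_mul, Matrix.mul_diagonal]
  by_cases h0 : M i j = 0
  · simp [h0]
  · rw [h i j h0, mul_comm]

theorem sgnMatrix_anticomm {ι : Type} [Fintype ι] [DecidableEq ι] (n : ι → ℤ)
    (M : Matrix ι ι (MvPolynomial V ℚ)) (h : ∀ i j, M i j ≠ 0 → n j = n i + 1 ∨ n i = n j + 1) :
    sgnMatrix V n * M + M * sgnMatrix V n = 0 := by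
  ext1 i j
  rw [Matrix.add_apply, sgnMatrix, Matrix.diagonal_mul, Matrix.mul_diagonal]
  by_cases h0 : M i j = 0
  · simp [h0]
  · rcases h i j h0 with h1 | h1 <;> rw [h1] <;> unfold sgn <;>
      simp only [Int.even_add_one] <;> split_ifs <;> simp

theorem sgnMatrix_q {ι : Type} [DecidableEq ι] (n q : ι → ℤ) (i j : ι) :
    MvPolynomial.IsWeightedHomogeneous (qWeight V) (sgnMatrix V n i j) (q j - q i) := by
  unfold sgnMatrix
  by_cases h : i = j
  · subst h
    rw [Matrix.diagonal_apply_eq, sub_self]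
    unfold sgn
    split_ifs
    · exact MvPolynomial.isWeightedHomogeneous_one _ _
    · exact (MvPolynomial.weightedHomogeneousSubmodule ℚ (qWeight V) 0).neg_mem
        (MvPolynomial.isWeightedHomogeneous_one _ _)
  · rw [Matrix.diagonal_apply_ne _ h]
    exact MvPolynomial.isWeightedHomogeneous_zero _ _ _

theorem one_q {ι : Type} [DecidableEq ι] (q : ι → ℤ) (i j : ι) :
    MvPolynomial.IsWeightedHomogeneous (qWeight V)
      ((1 : Matrix ι ι (MvPolynomial V ℚ)) i j) (q j - q i) := by
  by_cases h : i = j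
  · subst h
    rw [Matrix.one_apply_eq, sub_self]
    exact MvPolynomial.isWeightedHomogeneous_one _ _
  · rw [Matrix.one_apply_ne h]
    exact MvPolynomial.isWeightedHomogeneous_zero _ _ _

theorem tensor_q {ι κ : Type} (q : ι → ℤ) (q' : κ → ℤ)
    (M N : Matrix ι ι (MvPolynomial V ℚ)) (M' N' : Matrix κ κ (MvPolynomial V ℚ))
    (hM : ∀ i j, MvPolynomial.IsWeightedHomogeneous (qWeight V) (M i j) (q j - q i))
    (hN : ∀ i j, MvPolynomial.IsWeightedHomogeneous (qWeight V) (N i j) (q j - q i))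
    (hM' : ∀ i j, MvPolynomial.IsWeightedHomogeneous (qWeight V) (M' i j) (q' j - q' i))
    (hN' : ∀ i j, MvPolynomial.IsWeightedHomogeneous (qWeight V) (N' i j) (q' j - q' i))
    (i j : ι × κ) :
    MvPolynomial.IsWeightedHomogeneous (qWeight V) ((M ⊗ₖ M' + N ⊗ₖ N') i j)
      ((q j.1 + q' j.2) - (q i.1 + q' i.2)) := by
  have e : (q j.1 + q' j.2) - (q i.1 + q' i.2) = (q j.1 - q i.1) + (q' j.2 - q' i.2) := by ring
  rw [e]
  exact (MvPolynomial.weightedHomogeneousSubmodule ℚ (qWeight V) _).add_mem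
    ((hM i.1 j.1).mul (hM' i.2 j.2)) ((hN i.1 j.1).mul (hN' i.2 j.2))

/-- The tensor product over `ℚ[V]` of two bicomplexes, seen as complexes (differential `d_c`) of
complexes (differential `d_g`): `d_g (x ⊗ y) = d_g x ⊗ y + (-1)^{deg_a x} x ⊗ d_g y` and
`d_c (x ⊗ y) = d_c x ⊗ y + (-1)^{deg_t x} x ⊗ d_c y`. -/
noncomputable def Bicomplex.tensor (C D : Bicomplex V) : Bicomplex V where
  ι := C.ι × D.ι
  q := fun i => C.q i.1 + D.q i.2
  a := fun i => C.a i.1 + D.a i.2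
  t := fun i => C.t i.1 + D.t i.2
  dg := C.dg ⊗ₖ (1 : Matrix D.ι D.ι (MvPolynomial V ℚ)) + sgnMatrix V C.a ⊗ₖ D.dg
  dc := C.dc ⊗ₖ (1 : Matrix D.ι D.ι (MvPolynomial V ℚ)) + sgnMatrix V C.t ⊗ₖ D.dc
  dg_q := tensor_q _ _ _ _ _ _ C.dg_q (sgnMatrix_q _ _) (one_q _) D.dg_q
  dc_q := tensor_q _ _ _ _ _ _ C.dc_q (sgnMatrix_q _ _) (one_q _) D.dc_q
  dg_at := by
    rintro ⟨i, i'⟩ ⟨j, j'⟩ h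
    simp only [Matrix.add_apply, Matrix.kroneckerMap_apply] at h
    by_cases h1 : C.dg i j * (1 : Matrix D.ι D.ι (MvPolynomial V ℚ)) i' j' = 0
    · rw [h1, zero_add] at h
      have h2 := D.dg_at i' j' (right_ne_zero_of_mul h)
      have h3 : i = j := by
        by_contra hne
        exact left_ne_zero_of_mul h (Matrix.diagonal_apply_ne _ hne)
      subst h3
      dsimp only
      omega
    · have h2 := C.dg_at i j (left_ne_zero_of_mul h1)
      have h3 : i' = j' := by
        by_contra hne
        exact right_ne_zero_of_mul h1 (Matrix.one_apply_ne hne)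
      subst h3
      dsimp only
      omega
  dc_at := by
    rintro ⟨i, i'⟩ ⟨j, j'⟩ h
    simp only [Matrix.add_apply, Matrix.kroneckerMap_apply] at h
    by_cases h1 : C.dc i j * (1 : Matrix D.ι D.ι (MvPolynomial V ℚ)) i' j' = 0
    · rw [h1, zero_add] at h
      have h2 := D.dc_at i' j' (right_ne_zero_of_mul h)
      have h3 : i = j := by
        by_contra hne
        exact left_ne_zero_of_mul h (Matrix.diagonal_apply_ne _ hne)
      subst h3
      dsimp only
      omega
    · have h2 := C.dc_at i j (left_ne_zero_of_mul h1)
      have h3 : i' = j' := by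
        by_contra hne
        exact right_ne_zero_of_mul h1 (Matrix.one_apply_ne hne)
      subst h3
      dsimp only
      omega
  dg_dg := by
    have h := sgnMatrix_anticomm C.a C.dg (fun i j h => Or.inl (C.dg_at i j h).1)
    simp only [add_mul, mul_add, ← Matrix.mul_kronecker_mul, C.dg_dg, D.dg_dg, one_mul, mul_one,
      Matrix.zero_kronecker, Matrix.kronecker_zero, zero_add, add_zero]
    rw [← Matrix.add_kronecker, h, Matrix.zero_kronecker]
  dc_dc := by
    have h := sgnMatrix_anticomm C.t C.dc (fun i j h => Or.inr (C.dc_at i j h).2)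
    simp only [add_mul, mul_add, ← Matrix.mul_kronecker_mul, C.dc_dc, D.dc_dc, one_mul, mul_one,
      Matrix.zero_kronecker, Matrix.kronecker_zero, zero_add, add_zero]
    rw [← Matrix.add_kronecker, h, Matrix.zero_kronecker]
  dg_dc := by
    have h1 := sgnMatrix_comm C.t C.dg (fun i j h => ((C.dg_at i j h).2).symm)
    have h2 := sgnMatrix_comm C.a C.dc (fun i j h => ((C.dc_at i j h).1).symm)
    have h3 : sgnMatrix V C.a * sgnMatrix V C.t = sgnMatrix V C.t * sgnMatrix V C.a := by
      simp only [sgnMatrix, Matrix.diagonal_mul_diagonal, mul_comm]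
    simp only [add_mul, mul_add, ← Matrix.mul_kronecker_mul, one_mul, mul_one, C.dg_dc, D.dg_dc,
      h1, h2, h3]
    abel

end Bicomplexes

/-! ## Tangle and link diagrams -/

section Diagrams

/-- The kinds of crossings: positive, negative, virtual. -/
inductive Kind
  | pos
  | neg
  | vir

/-- The elementary pieces into which the marks `V` cut a diagram. `arc x y` is an arc from `x` to
`y`. In `crossing k x₁ x₂ y₁ y₂` both strands are drawn upwards, with incoming ends `x₁` (bottom
left) and `x₂` (bottom right) and outgoing ends `y₁` (top left) and `y₂` (top right); the strand
from `x₁` to `y₂` passes over the other one if the crossing is positive, and under it if the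
crossing is negative. -/
inductive Piece (V : Type)
  | arc (x y : V)
  | crossing (k : Kind) (x₁ x₂ y₁ y₂ : V)

variable {V W : Type}

/-- Change of marks. -/
def Piece.map (f : V → W) : Piece V → Piece W
  | .arc x y => .arc (f x) (f y)
  | .crossing k x₁ x₂ y₁ y₂ => .crossing k (f x₁) (f x₂) (f y₁) (f y₂)

/-- The marks at the incoming ends of a piece. -/
def Piece.ins : Piece V → List V
  | .arc x _ => [x]
  | .crossing _ x₁ x₂ _ _ => [x₁, x₂]

/-- The marks at the outgoing ends of a piece. -/
def Piece.outs : Piece V → List V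
  | .arc _ y => [y]
  | .crossing _ _ _ y₁ y₂ => [y₁, y₂]

/-- The piece is not a virtual crossing. -/
def Piece.Classical : Piece V → Prop
  | .arc _ _ => True
  | .crossing k _ _ _ _ => k ≠ .vir

/-- An end of a piece is a pair `(v, b)`, where `v` is its mark and `b` tells whether it is incoming
(`true`) or outgoing (`false`). The list consists of all pairs of an end and the next end
counterclockwise around the piece. -/
def Piece.turns : Piece V → List ((V × Bool) × (V × Bool))
  | .arc x y => [((x, true), (y, false)), ((y, false), (x, true))]
  | .crossing _ x₁ x₂ y₁ y₂ =>
    [((x₁, true), (x₂, true)), ((x₂, true), (y₂, false)),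
     ((y₂, false), (y₁, false)), ((y₁, false), (x₁, true))]

/-- The pieces form an oriented (virtual) link diagram marked by `V`: each mark is the outgoing end
of exactly one piece and the incoming end of exactly one piece, which are glued there. -/
def IsLinkDiagram (l : List (Piece V)) : Prop :=
  (l.flatMap Piece.ins).Nodup ∧ (∀ v, v ∈ l.flatMap Piece.ins) ∧
  (l.flatMap Piece.outs).Nodup ∧ (∀ v, v ∈ l.flatMap Piece.outs)

/-- Consecutive ends on the boundary of a face: go along the edge of the mark to its other end and
turn to the next end there. -/
def faceStep (l : List (Piece V)) (d d' : V × Bool) : Prop :=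
  ∃ p ∈ l, ((d.1, !d.2), d') ∈ p.turns

/-- Two marks lie on the same piece. -/
def pieceStep (l : List (Piece V)) (v w : V) : Prop :=
  ∃ p ∈ l, v ∈ p.ins ++ p.outs ∧ w ∈ p.ins ++ p.outs

/-- A planar (classical) link diagram: there is no virtual crossing, and every connected component
of the underlying graph, with the cyclic orders of the edges at its vertices, has genus zero. The
genus is computed from the Euler characteristic: vertices (pieces) minus edges (marks) plus faces is
twice the number of components. -/
def IsPlanarLinkDiagram (l : List (Piece V)) : Prop :=
  IsLinkDiagram l ∧ (∀ p ∈ l, p.Classical) ∧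
  (l.length : ℤ) - Nat.card V + Nat.card (Quot (faceStep l)) = 2 * Nat.card (Quot (pieceStep l))

/-! ### Reidemeister moves -/

/-- A list of pieces together with its set of marks. -/
structure Diagram where
  Mark : Type
  pieces : List (Piece Mark)

/-- The pieces of a diagram with marks `V`, seen among the marks `V ⊕ Fin n`. -/
def lift (n : ℕ) (l : List (Piece V)) : List (Piece (V ⊕ Fin n)) := l.map (Piece.map Sum.inl)

open Piece Sum in
/-- Elementary moves of oriented link diagrams: change of names of the marks and of the order of the
pieces, removal of a mark, and the oriented Reidemeister moves. The type II moves `R2c`, `R2d` are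
those with antiparallel strands. The remaining oriented type III moves are compositions of those
listed and type II moves. -/
inductive Move : Diagram → Diagram → Prop
  | relabel {V W : Type} (e : V ≃ W) (l : List (Piece V)) (l' : List (Piece W))
      (h : (l.map (Piece.map e)).Perm l') : Move ⟨V, l⟩ ⟨W, l'⟩
  | unmark {V : Type} (v : V) (l : List (Piece (Option V))) :
      Move ⟨Option V, arc (some v) none :: l⟩ ⟨V, l.map (Piece.map fun o => o.getD v)⟩
  | R1right {V : Type} (k : Kind) (hk : k ≠ .vir) (x y : V) (l : List (Piece V)) :
      Move ⟨V ⊕ Fin 1, crossing k (inl x) (inr 0) (inl y) (inr 0) :: lift 1 l⟩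
        ⟨V, arc x y :: l⟩
  | R1left {V : Type} (k : Kind) (hk : k ≠ .vir) (x y : V) (l : List (Piece V)) :
      Move ⟨V ⊕ Fin 1, crossing k (inr 0) (inl x) (inr 0) (inl y) :: lift 1 l⟩
        ⟨V, arc x y :: l⟩
  | R2a {V : Type} (x₁ x₂ y₁ y₂ : V) (l : List (Piece V)) :
      Move ⟨V ⊕ Fin 2, crossing .pos (inl x₁) (inl x₂) (inr 0) (inr 1) ::
          crossing .neg (inr 0) (inr 1) (inl y₁) (inl y₂) :: lift 2 l⟩
        ⟨V, arc x₁ y₁ :: arc x₂ y₂ :: l⟩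
  | R2b {V : Type} (x₁ x₂ y₁ y₂ : V) (l : List (Piece V)) :
      Move ⟨V ⊕ Fin 2, crossing .neg (inl x₁) (inl x₂) (inr 0) (inr 1) ::
          crossing .pos (inr 0) (inr 1) (inl y₁) (inl y₂) :: lift 2 l⟩
        ⟨V, arc x₁ y₁ :: arc x₂ y₂ :: l⟩
  | R2c {V : Type} (a b c e : V) (l : List (Piece V)) :
      Move ⟨V ⊕ Fin 2, crossing .pos (inl a) (inr 0) (inl b) (inr 1) ::
          crossing .neg (inl c) (inr 1) (inl e) (inr 0) :: lift 2 l⟩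
        ⟨V, arc a e :: arc c b :: l⟩
  | R2d {V : Type} (a b c e : V) (l : List (Piece V)) :
      Move ⟨V ⊕ Fin 2, crossing .pos (inr 0) (inl a) (inr 1) (inl b) ::
          crossing .neg (inr 1) (inl c) (inr 0) (inl e) :: lift 2 l⟩
        ⟨V, arc a e :: arc c b :: l⟩
  | R3 {V : Type} (k₁ k₂ k₃ : Kind) (h₁ : k₁ ≠ .vir) (h₂ : k₂ ≠ .vir) (h₃ : k₃ ≠ .vir)
      (h : k₁ = k₂ ∨ k₂ = k₃) (x₁ x₂ x₃ y₁ y₂ y₃ : V) (l : List (Piece V)) :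
      Move ⟨V ⊕ Fin 3, crossing k₁ (inl x₁) (inl x₂) (inr 0) (inr 1) ::
          crossing k₂ (inr 1) (inl x₃) (inr 2) (inl y₃) ::
          crossing k₃ (inr 0) (inr 2) (inl y₁) (inl y₂) :: lift 3 l⟩
        ⟨V ⊕ Fin 3, crossing k₃ (inl x₂) (inl x₃) (inr 0) (inr 1) ::
          crossing k₂ (inl x₁) (inr 0) (inl y₁) (inr 2) ::
          crossing k₁ (inr 2) (inr 1) (inl y₂) (inl y₃) :: lift 3 l⟩

/-- Two planar link diagrams are related by a sequence of moves through planar link diagrams. -/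
def Isotopic (D D' : Diagram) : Prop :=
  Relation.EqvGen (fun D D' => IsPlanarLinkDiagram D.pieces ∧ IsPlanarLinkDiagram D'.pieces ∧
    Move D D') D D'

/-! ### The bicomplex of a diagram -/

open MvPolynomial in
theorem lin_q (x y : V) : IsWeightedHomogeneous (qWeight V) (X y - X x : MvPolynomial V ℚ) 2 :=
  (weightedHomogeneousSubmodule ℚ (qWeight V) 2).sub_mem
    (isWeightedHomogeneous_X ℚ (qWeight V) y) (isWeightedHomogeneous_X ℚ (qWeight V) x)

open MvPolynomial in
theorem sum_q (x₁ x₂ y₁ y₂ : V) :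
    IsWeightedHomogeneous (qWeight V) (X y₁ + X y₂ - X x₁ - X x₂ : MvPolynomial V ℚ) 2 := by
  have h : (X y₁ + X y₂ - X x₁ - X x₂ : MvPolynomial V ℚ) = (X y₁ - X x₁) + (X y₂ - X x₂) := by
    ring
  rw [h]
  exact (weightedHomogeneousSubmodule ℚ (qWeight V) 2).add_mem (lin_q _ _) (lin_q _ _)

open MvPolynomial in
theorem quad_q (x₁ x₂ y₁ : V) :
    IsWeightedHomogeneous (qWeight V)
      ((X y₁ - X x₁) * (X y₁ - X x₂) : MvPolynomial V ℚ) 4 :=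
  (lin_q x₁ y₁).mul (lin_q x₂ y₁)

open MvPolynomial in
/-- `C` of an arc: `[y - x]`. -/
noncomputable def arcComplex (x y : V) : Bicomplex V :=
  koszul1 (X y - X x) 2 (lin_q x y)

open MvPolynomial in
/-- `C` of two parallel arcs `x₁ → y₁`, `x₂ → y₂`. -/
noncomputable def parComplex (x₁ x₂ y₁ y₂ : V) : Bicomplex V :=
  koszul2 (X y₁ - X x₁) (X y₂ - X x₂) 2 2 (lin_q _ _) (lin_q _ _)

open MvPolynomial in
/-- `C` of a virtual crossing. -/
noncomputable def virComplex (x₁ x₂ y₁ y₂ : V) : Bicomplex V :=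
  koszul2 (X y₁ - X x₂) (X y₂ - X x₁) 2 2 (lin_q _ _) (lin_q _ _)

open MvPolynomial in
/-- `C` of the four-valent vertex of Murakami, Ohtsuki and Yamada (the wide edge). -/
noncomputable def wideComplex (x₁ x₂ y₁ y₂ : V) : Bicomplex V :=
  koszul2 ((X y₁ - X x₁) * (X y₁ - X x₂)) (X y₁ + X y₂ - X x₁ - X x₂) 4 2
    (quad_q _ _ _) (sum_q _ _ _ _)

open MvPolynomial in
/-- The matrix of the chain map `χ_i` from the parallel arcs to `q⁻²` of the wide edge. -/
noncomputable def chiIn (x₂ y₁ : V) : Matrix (Fin 4) (Fin 4) (MvPolynomial V ℚ) :=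
  !![X y₁ - X x₂, 0, 0, 0;
     0, X y₁ - X x₂, 0, 0;
     0, 1, 1, 0;
     0, 0, 0, 1]

open MvPolynomial in
/-- The matrix of the chain map `χ_o` from the wide edge to the parallel arcs. -/
noncomputable def chiOut (x₂ y₁ : V) : Matrix (Fin 4) (Fin 4) (MvPolynomial V ℚ) :=
  !![1, 0, 0, 0;
     0, 1, 0, 0;
     0, -1, X y₁ - X x₂, 0;
     0, 0, 0, X y₁ - X x₂]

open MvPolynomial in
theorem chiIn_comm (x₁ x₂ y₁ y₂ : V) :
    koszulMatrix ((X y₁ - X x₁) * (X y₁ - X x₂)) (X y₁ + X y₂ - X x₁ - X x₂) * chiIn x₂ y₁ =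
      chiIn x₂ y₁ * koszulMatrix (X y₁ - X x₁) (X y₂ - X x₂) := by
  ext1 i j
  fin_cases i <;> fin_cases j <;>
    simp [chiIn, koszulMatrix, Matrix.mul_apply, Fin.sum_univ_four] <;> ring

open MvPolynomial in
theorem chiOut_comm (x₁ x₂ y₁ y₂ : V) :
    koszulMatrix (X y₁ - X x₁) (X y₂ - X x₂) * chiOut x₂ y₁ =
      chiOut x₂ y₁ *
        koszulMatrix ((X y₁ - X x₁) * (X y₁ - X x₂)) (X y₁ + X y₂ - X x₁ - X x₂) := by
  ext1 i j
  fin_cases i <;> fin_cases j <;>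
    simp [chiOut, koszulMatrix, Matrix.mul_apply, Fin.sum_univ_four] <;> ring

open MvPolynomial in
/-- `C` of a positive crossing: `χ_i : C(arcs) → t q⁻² C(wide edge)`. -/
noncomputable def posComplex (x₁ x₂ y₁ y₂ : V) : Bicomplex V :=
  twoTerm (parComplex x₁ x₂ y₁ y₂) ((wideComplex x₁ x₂ y₁ y₂).shift (-2) 0 0)
    rfl (by funext i; rfl) rfl rfl (chiIn x₂ y₁)
    (by
      have h := lin_q x₂ y₁
      have h1 := isWeightedHomogeneous_one ℚ (qWeight V)
      have h0 := isWeightedHomogeneous_zero ℚ (qWeight V)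
      intro (i : Fin 4) (j : Fin 4)
      fin_cases i <;> fin_cases j <;>
        first
          | exact h0 _
          | exact h
          | exact h1)
    (by
      intro (i : Fin 4) (j : Fin 4)
      fin_cases i <;> fin_cases j <;>
        simp [chiIn, parComplex, wideComplex, koszul2, Bicomplex.shift])
    (chiIn_comm x₁ x₂ y₁ y₂)

open MvPolynomial in
/-- `C` of a negative crossing: `χ_o : t⁻¹ C(wide edge) → C(arcs)`. -/
noncomputable def negComplex (x₁ x₂ y₁ y₂ : V) : Bicomplex V :=
  (twoTerm (wideComplex x₁ x₂ y₁ y₂) (parComplex x₁ x₂ y₁ y₂) rfl rfl rfl rfl (chiOut x₂ y₁)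
    (by
      have h := lin_q x₂ y₁
      have h1 := isWeightedHomogeneous_one ℚ (qWeight V)
      have h2 := (weightedHomogeneousSubmodule ℚ (qWeight V) 0).neg_mem h1
      have h0 := isWeightedHomogeneous_zero ℚ (qWeight V)
      intro (i : Fin 4) (j : Fin 4)
      fin_cases i <;> fin_cases j <;>
        first
          | exact h0 _
          | exact h
          | exact h1
          | exact h2)
    (by
      intro (i : Fin 4) (j : Fin 4)
      fin_cases i <;> fin_cases j <;>
        simp [chiOut, parComplex, wideComplex, koszul2])
    (chiOut_comm x₁ x₂ y₁ y₂)).shift 0 0 (-1)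

/-- `C` of an elementary piece, over the total ring. -/
noncomputable def Piece.complex : Piece V → Bicomplex V
  | .arc x y => arcComplex x y
  | .crossing .pos x₁ x₂ y₁ y₂ => posComplex x₁ x₂ y₁ y₂
  | .crossing .neg x₁ x₂ y₁ y₂ => negComplex x₁ x₂ y₁ y₂
  | .crossing .vir x₁ x₂ y₁ y₂ => virComplex x₁ x₂ y₁ y₂

/-- The bicomplex `C` of a marked tangle or link diagram: the tensor product over the total ring of
the bicomplexes of its pieces. Gluing is done by giving the same mark to the ends that are glued. -/
noncomputable def cpx : List (Piece V) → Bicomplex V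
  | [] => unitBicomplex V
  | p :: l => p.complex.tensor (cpx l)

/-! ### The type IIb configuration -/

open Piece Sum in
/-- Two antiparallel strands cross twice: a positive crossing on the left (strands upwards) next to
a negative crossing on the right (strands downwards). The strands enter at `a` (bottom left) and `c`
(top right) and leave at `b` (top left) and `e` (bottom right). The rest `l` of the diagram is
arbitrary. -/
def posNegIIb (a b c e : V) (l : List (Piece V)) : List (Piece (V ⊕ Fin 2)) :=
  crossing .pos (inl a) (inr 0) (inl b) (inr 1) ::
    crossing .neg (inl c) (inr 1) (inl e) (inr 0) :: lift 2 l

open Piece Sum in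
/-- The same with the positive crossing replaced by a virtual crossing. -/
def virNegIIb (a b c e : V) (l : List (Piece V)) : List (Piece (V ⊕ Fin 2)) :=
  crossing .vir (inl a) (inr 0) (inl b) (inr 1) ::
    crossing .neg (inl c) (inr 1) (inl e) (inr 0) :: lift 2 l

open Piece in
/-- The same with the strands pulled apart: an arc from `a` to `e` and an arc from `c` to `b`. -/
def arcsIIb (a b c e : V) (l : List (Piece V)) : List (Piece V) :=
  arc a e :: arc c b :: l

/-! ### Explicit diagrams -/

open Piece in
/-- The part outside a type IIb configuration of a diagram of the unknot with five crossings. -/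
def exampleRest : List (Piece (Fin 8)) :=
  [crossing .neg 0 1 2 3, crossing .neg 2 3 4 5, crossing .pos 6 5 7 1]

/-- The diagram of the unknot with five crossings. -/
def exampleUnknot : List (Piece (Fin 8 ⊕ Fin 2)) := posNegIIb 4 0 7 6 exampleRest

open Piece in
/-- The circle, with two marks. -/
def circle : List (Piece (Fin 2)) := [arc 0 1, arc 1 0]

open Piece in
/-- The left-handed trefoil: the closure of the braid on two strands with three negative
crossings. -/
def leftTrefoil : List (Piece (Fin 6)) :=
  [crossing .neg 0 1 2 3, crossing .neg 2 3 4 5, crossing .neg 4 5 0 1]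

end Diagrams

end KR

/-! Up to homotopy, a crossing `(x₁,x₂;y₁,y₂)` is a Koszul factor `[σ]`, with `σ = y₁+y₂-x₁-x₂`,
tensored with a square on four corners in which only `p = y₁-x₁` and `ζ = y₁-x₂` occur. On the wide
edge `d_g : w1 → w0` is `pζ`, and on the arcs `d_g : p1 → p0` is `p`. From `w` to `p` the
differential `d_c` of a negative crossing is `1, ζ`; from `p` to `w` that of a positive one is `ζ,
1` (`Equivalent.neg`, `Equivalent.pos`). Two tools make these squares computable. A factor `[ξ]`
with `ξ` linear removes a mark up to homotopy (`Elimination.equivalent`), and next to `[σ]` all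
other entries matter only modulo `σ` (`Equivalent.koszul_congr`).

For `τ₁` with inner marks `z`, `w`, the linear factor of the positive crossing gives `w = a+z-b`.
The other linear factor becomes `e+b-c-a`, which is free of `z`. Modulo it the two crossings have
opposite `p`, namely `b-a` and `a-b`, and their `ζ` are `ξ = b-z` and `ξ+η` with `η = e-a`. In the
positive square `p1 → w1` is an isomorphism, and `p0 → w0` is multiplication by `ξ`, which is
injective with cokernel the ring where `z = b`. What survives is the corner `w0`, in degree `t q⁻²`,
times the negative square at `ξ = 0` (`Elimination.antiparallel`). Hence `τ₁` is `t q⁻²` times the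
single negative crossing `(c,a;e,b)` (`HomotopyEquivalent.posNegIIb`). With a virtual crossing
instead, both inner marks are removed by arcs and the same negative crossing remains, unshifted
(`HomotopyEquivalent.virNegIIb`). The rest of a diagram is a tensor factor without inner marks and
is carried along. This proves the first and third claims.

The second claim follows from homological degrees. The open negative crossing has homology in degree
-1, and its closure by two arcs has homology in degree 0. A diagram of arcs lives in one homological
degree, which closing does not change. So no shift fits both before and after closing
(`posNegIIb_not_arcs`).

For the example, a type IIb reduction and then a mirrored one turn `D` into the left-handed trefoil.
The diagram `D₂` reduces by the parallel type II equivalence (`HomotopyEquivalent.negPos`) to a curl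
with one negative crossing, whose homology sits in degree 0 only. The trefoil has homology in
degrees -2 and 0, by explicit cycles detected by functionals that read constant or linear terms.
That `D` is an unknot is an explicit chain of moves, with planarity of each diagram certified by a
table of its faces. -/

namespace KR

open MvPolynomial

section Maps

variable {V W U B B' : Type}

/-! ## Degrees -/

/-- The homogeneous polynomials of degree `d` if `P` holds, and zero otherwise. -/
def cell (V : Type) (d : ℤ) (P : Prop) : Submodule ℚ (MvPolynomial V ℚ) where
  carrier := {y | y ∈ weightedHomogeneousSubmodule ℚ (qWeight V) d ∧ (y ≠ 0 → P)}
  zero_mem' := ⟨Submodule.zero_mem _, fun h => absurd rfl h⟩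
  add_mem' := by
    intro x y hx hy
    refine ⟨Submodule.add_mem _ hx.1 hy.1, fun h => ?_⟩
    by_cases h0 : x = 0
    · exact hy.2 (fun h1 => h (by simp [h0, h1]))
    · exact hx.2 h0
  smul_mem' := by
    intro c x hx
    exact ⟨Submodule.smul_mem _ c hx.1, fun h => hx.2 (fun h0 => h (by simp [h0]))⟩

theorem cell.mono {d d' : ℤ} {P P' : Prop} {y : MvPolynomial V ℚ} (h : y ∈ cell V d P)
    (hd : d = d') (hP : P → P') : y ∈ cell V d' P' := by
  subst hd
  exact ⟨h.1, fun h0 => hP (h.2 h0)⟩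

theorem cell.mul {d n : ℤ} {P : Prop} {p y : MvPolynomial V ℚ}
    (hp : IsWeightedHomogeneous (qWeight V) p n) (h : y ∈ cell V d P) :
    p * y ∈ cell V (n + d) P :=
  ⟨hp.mul h.1, fun h0 => h.2 (right_ne_zero_of_mul h0)⟩

/-- The sign `(-1)^n` as a rational number. -/
def sg (n : ℤ) : ℚ := if Even n then 1 else -1

theorem sgn_eq (n : ℤ) : sgn V n = C (sg n) := by
  unfold sgn sg; split_ifs <;> simp

theorem sg_add (m n : ℤ) : sg (m + n) = sg m * sg n := by
  unfold sg
  by_cases h1 : Even m <;> by_cases h2 : Even n <;> simp [Int.even_add, h1, h2]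

theorem sg_mul_self (n : ℤ) : sg n * sg n = 1 := by
  unfold sg; split_ifs <;> simp

theorem sg_neg (n : ℤ) : sg (-n) = sg n := by
  unfold sg; simp

@[simp] theorem sg_zero : sg 0 = 1 := by simp [sg]
@[simp] theorem sg_one : sg 1 = -1 := by simp [sg]

theorem gr_single (C : Bicomplex V) (b : C.ι) {n : ℤ} {p : MvPolynomial V ℚ}
    (hp : IsWeightedHomogeneous (qWeight V) p n) :
    (Pi.single b p : C.Mod) ∈ C.gr (n + C.q b) (C.a b) (C.t b) := by
  intro b'
  by_cases h : b' = b
  · subst h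
    simpa using hp
  · simp [h]

/-- Monomial multiples of basis elements are homogeneous and span the module. Identities of maps can
therefore be checked on homogeneous elements, where the sign operators below are scalars. -/
theorem Bicomplex.hom_ext {C : Bicomplex V} {M : Type} [AddCommGroup M] [Module ℚ M]
    {f g : C.Mod →ₗ[ℚ] M} (h : ∀ i j k, ∀ x ∈ C.gr i j k, f x = g x) : f = g := by
  refine LinearMap.pi_ext fun b p => ?_
  have h1 : f ∘ₗ LinearMap.single ℚ _ b = g ∘ₗ LinearMap.single ℚ _ b := by
    refine MvPolynomial.linearMap_ext fun s => LinearMap.ext fun r => ?_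
    exact h _ _ _ _ (gr_single C b (isWeightedHomogeneous_monomial (qWeight V) s r rfl))
  exact LinearMap.congr_fun h1 p

/-- The operator that multiplies the coordinate `b` by `(-1)^(n b)`. -/
noncomputable def signOp {ι : Type} (V : Type) (n : ι → ℤ) :
    (ι → MvPolynomial V ℚ) →ₗ[ℚ] (ι → MvPolynomial V ℚ) where
  toFun x := fun b => sg (n b) • x b
  map_add' x y := by ext1 b; simp
  map_smul' c x := by ext1 b; simp [smul_comm c]

theorem signOp_apply {ι : Type} (n : ι → ℤ) (x : ι → MvPolynomial V ℚ) (b : ι) :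
    signOp V n x b = sg (n b) • x b := rfl

theorem signOp_a_gr {C : Bicomplex V} {i j k : ℤ} {x : C.Mod} (h : x ∈ C.gr i j k) :
    signOp V C.a x = sg j • x := by
  ext1 b
  rw [signOp_apply, Pi.smul_apply]
  by_cases h0 : x b = 0
  · simp [h0]
  · rw [((h b).2 h0).1]

theorem signOp_t_gr {C : Bicomplex V} {i j k : ℤ} {x : C.Mod} (h : x ∈ C.gr i j k) :
    signOp V C.t x = sg k • x := by
  ext1 b
  rw [signOp_apply, Pi.smul_apply]
  by_cases h0 : x b = 0
  · simp [h0]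
  · rw [((h b).2 h0).2]

/-- The sign operators carry the Koszul signs of tensor products. Passing them costs a map of
Hochschild degree `m` the factor `(-1)^m`: maps of degree 0 commute with the other tensor factor,
homotopies of degree 1 anticommute. -/
theorem HasDegree.signOp_a {C : Bicomplex V} {D : Bicomplex W} {m n : ℤ} {f : C.Mod →ₗ[ℚ] D.Mod}
    (hf : HasDegree m n f) : f ∘ₗ signOp V C.a = sg m • (signOp W D.a ∘ₗ f) := by
  refine Bicomplex.hom_ext fun i j k x hx => ?_
  rw [LinearMap.comp_apply, signOp_a_gr hx, LinearMap.smul_apply, LinearMap.comp_apply,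
    signOp_a_gr (hf i j k x hx), map_smul, sg_add, smul_smul, mul_comm (sg j), ← mul_assoc,
    sg_mul_self, one_mul]

theorem HasDegree.signOp_t {C : Bicomplex V} {D : Bicomplex W} {m n : ℤ} {f : C.Mod →ₗ[ℚ] D.Mod}
    (hf : HasDegree m n f) : f ∘ₗ signOp V C.t = sg n • (signOp W D.t ∘ₗ f) := by
  refine Bicomplex.hom_ext fun i j k x hx => ?_
  rw [LinearMap.comp_apply, signOp_t_gr hx, LinearMap.smul_apply, LinearMap.comp_apply,
    signOp_t_gr (hf i j k x hx), map_smul, sg_add, smul_smul, mul_comm (sg k), ← mul_assoc,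
    sg_mul_self, one_mul]

/-! ## Calculus of maps -/

section Calculus

variable {C : Bicomplex V} {D : Bicomplex W} {E : Bicomplex U}
variable {β : B → V} {β' : B → W} {β'' : B → U}

theorem EdgeLinear.id : EdgeLinear β β (LinearMap.id : C.Mod →ₗ[ℚ] C.Mod) := fun _ _ => rfl

theorem EdgeLinear.zero : EdgeLinear β β' (0 : C.Mod →ₗ[ℚ] D.Mod) := fun _ _ => by simp

theorem EdgeLinear.comp {g : D.Mod →ₗ[ℚ] E.Mod} {f : C.Mod →ₗ[ℚ] D.Mod}
    (hg : EdgeLinear β' β'' g) (hf : EdgeLinear β β' f) : EdgeLinear β β'' (g ∘ₗ f) :=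
  fun p x => by rw [LinearMap.comp_apply, hf, hg, LinearMap.comp_apply]

theorem EdgeLinear.add {g f : C.Mod →ₗ[ℚ] D.Mod}
    (hg : EdgeLinear β β' g) (hf : EdgeLinear β β' f) : EdgeLinear β β' (g + f) :=
  fun p x => by simp only [LinearMap.add_apply, hf p x, hg p x, smul_add]

theorem EdgeLinear.neg {f : C.Mod →ₗ[ℚ] D.Mod}
    (hf : EdgeLinear β β' f) : EdgeLinear β β' (-f) :=
  fun p x => by simp only [LinearMap.neg_apply, hf p x, smul_neg]

theorem EdgeLinear.restrict {f : C.Mod →ₗ[ℚ] D.Mod} (hf : EdgeLinear β β' f) (γ : B' → B) :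
    EdgeLinear (β ∘ γ) (β' ∘ γ) f := fun p x => by
  rw [← rename_rename, ← rename_rename, hf]

theorem HasDegree.id : HasDegree 0 0 (LinearMap.id : C.Mod →ₗ[ℚ] C.Mod) :=
  fun i j k x hx => by simpa using hx

theorem HasDegree.zero {m n : ℤ} : HasDegree m n (0 : C.Mod →ₗ[ℚ] D.Mod) :=
  fun _ _ _ _ _ => Submodule.zero_mem _

theorem HasDegree.comp {m n m' n' m'' n'' : ℤ} {g : D.Mod →ₗ[ℚ] E.Mod} {f : C.Mod →ₗ[ℚ] D.Mod}
    (hg : HasDegree m' n' g) (hf : HasDegree m n f) (hm : m + m' = m'') (hn : n + n' = n'') :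
    HasDegree m'' n'' (g ∘ₗ f) := fun i j k x hx => by
  have := hg _ _ _ _ (hf i j k x hx)
  rwa [add_assoc, add_assoc, hm, hn] at this

theorem HasDegree.add {m n : ℤ} {g f : C.Mod →ₗ[ℚ] D.Mod} (hg : HasDegree m n g)
    (hf : HasDegree m n f) : HasDegree m n (g + f) := fun i j k x hx =>
  Submodule.add_mem _ (hg i j k x hx) (hf i j k x hx)

theorem HasDegree.neg {m n : ℤ} {f : C.Mod →ₗ[ℚ] D.Mod}
    (hf : HasDegree m n f) : HasDegree m n (-f) := fun i j k x hx =>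
  Submodule.neg_mem _ (hf i j k x hx)

theorem dgMap_apply (x : C.Mod) (i : C.ι) : C.dgMap x i = ∑ j, C.dg i j * x j := rfl

theorem dcMap_apply (x : C.Mod) (i : C.ι) : C.dcMap x i = ∑ j, C.dc i j * x j := rfl

end Calculus

/-! ## Homotopy equivalences -/

namespace HomotopyEquivalent

variable {C : Bicomplex V} {D : Bicomplex W} {E : Bicomplex U}
variable {β : B → V} {β' : B → W} {β'' : B → U}

theorem refl (β : B → V) (C : Bicomplex V) : HomotopyEquivalent β β C C := by
  have h : IsMorphism β β (LinearMap.id : C.Mod →ₗ[ℚ] C.Mod) :=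
    ⟨EdgeLinear.id, HasDegree.id, rfl, 0, EdgeLinear.zero, HasDegree.zero, by simp⟩
  have h' : HomotopicToId β (LinearMap.id ∘ₗ (LinearMap.id : C.Mod →ₗ[ℚ] C.Mod)) :=
    ⟨0, 0, EdgeLinear.zero, HasDegree.zero, by simp, EdgeLinear.zero, HasDegree.zero, by simp⟩
  exact ⟨LinearMap.id, LinearMap.id, h, h, h', h'⟩

theorem symm (h : HomotopyEquivalent β β' C D) : HomotopyEquivalent β' β D C := by
  obtain ⟨f, g, hf, hg, hgf, hfg⟩ := h
  exact ⟨g, f, hg, hf, hfg, hgf⟩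

/-- Marks are removed one at a time, and each elimination is linear only over the marks that remain.
Restriction of scalars lets such steps be composed. -/
theorem restrict (h : HomotopyEquivalent β β' C D) (γ : B' → B) :
    HomotopyEquivalent (β ∘ γ) (β' ∘ γ) C D := by
  obtain ⟨f, g, ⟨f1, f2, f3, fh, f4, f5, f6⟩, ⟨g1, g2, g3, gh, g4, g5, g6⟩,
    ⟨s, u, s1, s2, s3, u1, u2, u3⟩, ⟨s', u', s1', s2', s3', u1', u2', u3'⟩⟩ := h
  exact ⟨f, g, ⟨f1.restrict γ, f2, f3, fh, f4.restrict γ, f5, f6⟩,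
    ⟨g1.restrict γ, g2, g3, gh, g4.restrict γ, g5, g6⟩,
    ⟨s, u, s1.restrict γ, s2, s3, u1.restrict γ, u2, u3⟩,
    ⟨s', u', s1'.restrict γ, s2', s3', u1'.restrict γ, u2', u3'⟩⟩

end HomotopyEquivalent

/-! ### Composition of homotopy equivalences -/

section Trans

variable {C : Bicomplex V} {D : Bicomplex W} {E : Bicomplex U}
variable {β : B → V} {β' : B → W} {β'' : B → U}

theorem IsMorphism.comp {g : D.Mod →ₗ[ℚ] E.Mod} {f : C.Mod →ₗ[ℚ] D.Mod}
    (hg : IsMorphism β' β'' g) (hf : IsMorphism β β' f) : IsMorphism β β'' (g ∘ₗ f) := by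
  obtain ⟨f1, f2, f3, fh, f4, f5, f6⟩ := hf
  obtain ⟨g1, g2, g3, gh, g4, g5, g6⟩ := hg
  -- The defect of `g ∘ f` against `d_c` is `g` applied to the defect of `f` plus the defect of `g`
  -- evaluated at `f`; the homotopies add up in the same way.
  refine ⟨g1.comp f1, g2.comp f2 rfl rfl, ?_, g ∘ₗ fh + gh ∘ₗ f, (g1.comp f4).add (g4.comp f1),
    (g2.comp f5 rfl rfl).add (g5.comp f2 rfl rfl), ?_⟩
  · rw [LinearMap.comp_assoc, f3, ← LinearMap.comp_assoc, g3, LinearMap.comp_assoc]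
  · refine LinearMap.ext fun x => ?_
    have e1 := LinearMap.congr_fun f6 x
    have e2 := LinearMap.congr_fun g6 (f x)
    have e3 := LinearMap.congr_fun f3 x
    have e4 := LinearMap.congr_fun g3 (fh x)
    simp only [LinearMap.sub_apply, LinearMap.add_apply, LinearMap.comp_apply] at *
    have e5 := congrArg g e1
    rw [map_sub, map_add, e4] at e5
    rw [e3, map_add, ← sub_add_sub_cancel _ (g (D.dcMap (f x))), e5, e2]
    abel

/-- Write `g k f - 1 = g (k - 1) f + (g f - 1)`. Moving `d_c` out of `g (d_c s + s d_c) f` uses that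
`f` and `g` commute with `d_c` up to `fh` and `gh`. This adds `gh s f` and `-g s fh` to the homotopy
for `d_g`. -/
theorem HomotopicToId.conj {f : C.Mod →ₗ[ℚ] D.Mod} {g : D.Mod →ₗ[ℚ] C.Mod}
    {k : D.Mod →ₗ[ℚ] D.Mod} (hf : IsMorphism β β' f) (hg : IsMorphism β' β g)
    (hk : HomotopicToId β' k) (hgf : HomotopicToId β (g ∘ₗ f)) :
    HomotopicToId β (g ∘ₗ k ∘ₗ f) := by
  obtain ⟨f1, f2, f3, fh, f4, f5, f6⟩ := hf
  obtain ⟨g1, g2, g3, gh, g4, g5, g6⟩ := hg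
  obtain ⟨s, u, s1, s2, s3, u1, u2, u3⟩ := hk
  obtain ⟨s', u', s1', s2', s3', u1', u2', u3'⟩ := hgf
  refine ⟨s' + g ∘ₗ s ∘ₗ f, u' + g ∘ₗ u ∘ₗ f + gh ∘ₗ s ∘ₗ f + -(g ∘ₗ s ∘ₗ fh),
    s1'.add (g1.comp (s1.comp f1)), s2'.add (g2.comp (s2.comp f2 rfl rfl) rfl rfl), ?_,
    ((u1'.add (g1.comp (u1.comp f1))).add (g4.comp (s1.comp f1))).add (g1.comp (s1.comp f4)).neg,
    ((u2'.add (g2.comp (u2.comp f2 rfl rfl) rfl rfl)).add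
      (g5.comp (s2.comp f2 rfl rfl) rfl rfl)).add (g2.comp (s2.comp f5 rfl rfl) rfl rfl).neg, ?_⟩
  · refine LinearMap.ext fun x => ?_
    have e1 := LinearMap.congr_fun s3' x
    have e2 := LinearMap.congr_fun s3 (f x)
    have e3 := LinearMap.congr_fun f3 x
    have e4 := LinearMap.congr_fun g3 (s (f x))
    simp only [LinearMap.add_apply, LinearMap.comp_apply, map_add] at *
    rw [e1, e3, e2, e4]
  · refine LinearMap.ext fun x => ?_
    have a1 := LinearMap.congr_fun u3' x
    have a2 := congrArg g (LinearMap.congr_fun u3 (f x))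
    have a3 := LinearMap.congr_fun g6 (s (f x))
    have a4 := congrArg (fun y => g (s y)) (LinearMap.congr_fun f6 x)
    have a5 := LinearMap.congr_fun g3 (u (f x))
    have a6 := LinearMap.congr_fun f3 x
    have a7 := LinearMap.congr_fun s3 (f x)
    have a8 := LinearMap.congr_fun g3 (s (fh x))
    have a9 := LinearMap.congr_fun s3 (fh x)
    simp only [LinearMap.add_apply, LinearMap.comp_apply, map_add, LinearMap.sub_apply, map_sub,
      LinearMap.neg_apply, LinearMap.id_apply, map_neg] at *
    rw [a9, a8] at a4
    rw [a5] at a2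
    rw [← a7] at a3
    rw [a6]
    rw [← sub_add_sub_cancel _ (g (f x)), a1, a2, sub_eq_iff_eq_add.1 a3,
      sub_eq_iff_eq_add.1 a4]
    abel

theorem HomotopyEquivalent.trans (h : HomotopyEquivalent β β' C D)
    (h' : HomotopyEquivalent β' β'' D E) : HomotopyEquivalent β β'' C E := by
  obtain ⟨f, g, hf, hg, hgf, hfg⟩ := h
  obtain ⟨f', g', hf', hg', hgf', hfg'⟩ := h'
  have h1 := hgf'.conj hf hg hgf
  have h2 := hfg.conj hg' hf' hfg'
  refine ⟨f' ∘ₗ f, g ∘ₗ g', hf'.comp hf, hg.comp hg', ?_, ?_⟩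
  · simpa only [LinearMap.comp_assoc] using h1
  · simpa only [LinearMap.comp_assoc] using h2

end Trans

/-! ## Grading shifts -/

section Shift

variable {C : Bicomplex V} {D : Bicomplex W}
variable {β : B → V} {β' : B → W}

theorem gr_shift (C : Bicomplex V) (l m n i j k : ℤ) :
    (C.shift l m n).gr i j k = C.gr (i - l) (j - m) (k - n) := by
  ext x
  refine forall_congr' fun b => ?_
  change (_ ∈ weightedHomogeneousSubmodule ℚ _ (i - (C.q b + l)) ∧
    (_ → C.a b + m = j ∧ C.t b + n = k)) ↔ _
  have e : i - (C.q b + l) = i - l - C.q b := by ring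
  rw [e]
  refine and_congr Iff.rfl (imp_congr Iff.rfl ?_)
  constructor <;> rintro ⟨h1, h2⟩ <;> constructor <;> omega

theorem HasDegree.shift {m n : ℤ} {f : C.Mod →ₗ[ℚ] D.Mod} (hf : HasDegree m n f) (l' m' n' : ℤ) :
    HasDegree (C := C.shift l' m' n') (D := D.shift l' m' n') m n f := fun i j k x hx => by
  rw [gr_shift] at hx
  have := hf _ _ _ x hx
  rw [gr_shift]
  have e : ∀ p q r : ℤ, p - q + r = p + r - q := fun p q r => by ring
  rwa [e, e] at this

theorem HomotopyEquivalent.shift (h : HomotopyEquivalent β β' C D) (l m n : ℤ) :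
    HomotopyEquivalent β β' (C.shift l m n) (D.shift l m n) := by
  obtain ⟨f, g, ⟨f1, f2, f3, fh, f4, f5, f6⟩, ⟨g1, g2, g3, gh, g4, g5, g6⟩,
    ⟨s, u, s1, s2, s3, u1, u2, u3⟩, ⟨s', u', s1', s2', s3', u1', u2', u3'⟩⟩ := h
  exact ⟨f, g, ⟨f1, f2.shift l m n, f3, fh, f4, f5.shift l m n, f6⟩,
    ⟨g1, g2.shift l m n, g3, gh, g4, g5.shift l m n, g6⟩,
    ⟨s, u, s1, s2.shift l m n, s3, u1, u2.shift l m n, u3⟩,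
    ⟨s', u', s1', s2'.shift l m n, s3', u1', u2'.shift l m n, u3'⟩⟩

end Shift

/-! ## Homology -/

section Homology

variable {C : Bicomplex V} {D : Bicomplex W} {E : Bicomplex U}

/-- The elements of `C` that represent homology classes. -/
noncomputable def Bicomplex.cycles (C : Bicomplex V) : Submodule ℚ C.Mod :=
  LinearMap.ker C.dgMap ⊓ (LinearMap.range C.dgMap).comap C.dcMap

/-- The elements of `C` that represent the zero class. -/
noncomputable def Bicomplex.boundaries (C : Bicomplex V) : Submodule ℚ C.Mod :=
  LinearMap.range C.dgMap ⊔ (LinearMap.ker C.dgMap).map C.dcMap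

theorem mem_cycles {x : C.Mod} : x ∈ C.cycles ↔ C.dgMap x = 0 ∧ ∃ y, C.dgMap y = C.dcMap x :=
  Iff.rfl

theorem mem_boundaries {x : C.Mod} :
    x ∈ C.boundaries ↔ ∃ y z, C.dgMap z = 0 ∧ C.dgMap y + C.dcMap z = x := by
  rw [Bicomplex.boundaries, Submodule.mem_sup]
  constructor
  · rintro ⟨_, ⟨y, rfl⟩, _, ⟨z, hz, rfl⟩, rfl⟩
    exact ⟨y, z, hz, rfl⟩
  · rintro ⟨y, z, hz, rfl⟩
    exact ⟨_, ⟨y, rfl⟩, _, ⟨z, hz, rfl⟩, rfl⟩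

/-- The class in `ker d / im d` of a cycle. -/
abbrev homologyClass {M : Type} [AddCommGroup M] [Module ℚ M] (d : M →ₗ[ℚ] M) :
    LinearMap.ker d →ₗ[ℚ] Homology d :=
  ((LinearMap.range d).submoduleOf (LinearMap.ker d)).mkQ

theorem homologyClass_eq_zero {M : Type} [AddCommGroup M] [Module ℚ M] {d : M →ₗ[ℚ] M}
    (x : LinearMap.ker d) : homologyClass d x = 0 ↔ ∃ y, d y = x := by
  rw [Submodule.mkQ_apply, Submodule.Quotient.mk_eq_zero]
  rfl

theorem homologyClass_surjective {M : Type} [AddCommGroup M] [Module ℚ M] (d : M →ₗ[ℚ] M) :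
    Function.Surjective (homologyClass d) := Submodule.mkQ_surjective _

theorem dcStar_class (x : LinearMap.ker C.dgMap) (h : C.dgMap (C.dcMap x) = 0) :
    C.dcStar (homologyClass _ x) = homologyClass C.dgMap ⟨C.dcMap x, h⟩ := rfl

theorem dgMap_dcMap_of_ker (x : LinearMap.ker C.dgMap) : C.dgMap (C.dcMap x) = 0 := by
  rw [C.dgMap_dcMap, x.2, map_zero]

theorem dcStar_class_eq_zero (x : C.Mod) (hx : x ∈ C.cycles) :
    C.dcStar (homologyClass _ ⟨x, hx.1⟩) = 0 := by
  rw [dcStar_class _ (dgMap_dcMap_of_ker _), homologyClass_eq_zero]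
  exact (mem_cycles.1 hx).2

/-- The class in the homology of an element that represents one. -/
noncomputable def Bicomplex.class (C : Bicomplex V) : C.cycles →ₗ[ℚ] C.HH :=
  homologyClass C.dcStar ∘ₗ LinearMap.codRestrict (LinearMap.ker C.dcStar)
    (homologyClass C.dgMap ∘ₗ Submodule.inclusion inf_le_left)
    (fun x => dcStar_class_eq_zero x.1 x.2)

theorem class_apply (x : C.cycles) : C.class x = homologyClass C.dcStar
    ⟨homologyClass C.dgMap ⟨x, x.2.1⟩, dcStar_class_eq_zero x.1 x.2⟩ := rfl

theorem class_surjective : Function.Surjective C.class := by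
  intro z
  obtain ⟨⟨w, hw⟩, rfl⟩ := homologyClass_surjective _ z
  obtain ⟨⟨x, hx⟩, rfl⟩ := homologyClass_surjective _ w
  have h : ∃ y, C.dgMap y = C.dcMap x := by
    rw [LinearMap.mem_ker, dcStar_class _ (dgMap_dcMap_of_ker _), homologyClass_eq_zero] at hw
    exact hw
  exact ⟨⟨x, hx, h⟩, rfl⟩

/-- Together with surjectivity of the class map, this turns the iterated homology into the single
quotient of `cycles` by `boundaries`. All later arguments use representatives only. -/
theorem class_eq_zero (x : C.cycles) : C.class x = 0 ↔ (x : C.Mod) ∈ C.boundaries := by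
  rw [class_apply, homologyClass_eq_zero, mem_boundaries]
  constructor
  · rintro ⟨w, hw⟩
    obtain ⟨z, rfl⟩ := homologyClass_surjective _ w
    rw [dcStar_class _ (dgMap_dcMap_of_ker _), ← sub_eq_zero, ← map_sub,
      homologyClass_eq_zero] at hw
    obtain ⟨y, hy⟩ := hw
    refine ⟨-y, z, z.2, ?_⟩
    rw [map_neg, hy]
    simp
  · rintro ⟨y, z, hz, h⟩
    refine ⟨homologyClass _ ⟨z, hz⟩, ?_⟩
    rw [dcStar_class _ (dgMap_dcMap_of_ker ⟨z, hz⟩), ← sub_eq_zero, ← map_sub,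
      homologyClass_eq_zero]
    refine ⟨-y, ?_⟩
    rw [map_neg]
    change -(C.dgMap y) = C.dcMap z - (x : C.Mod)
    rw [← h]
    abel

theorem mem_grHH {i j k : ℤ} {z : C.HH} :
    z ∈ C.grHH i j k ↔ ∃ x : C.cycles, (x : C.Mod) ∈ C.gr i j k ∧ C.class x = z := by
  constructor
  · rintro ⟨⟨w, hw⟩, hw', rfl⟩
    obtain ⟨⟨x, hx⟩, hx', rfl⟩ := hw'
    have h : ∃ y, C.dgMap y = C.dcMap x := by
      rw [LinearMap.mem_ker, dcStar_class _ (dgMap_dcMap_of_ker _), homologyClass_eq_zero] at hw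
      exact hw
    exact ⟨⟨x, hx, h⟩, hx', rfl⟩
  · rintro ⟨x, hx, rfl⟩
    exact ⟨⟨_, dcStar_class_eq_zero x.1 x.2⟩, ⟨⟨x, x.2.1⟩, hx, rfl⟩, rfl⟩

/-- Maps that preserve degrees, representatives of classes and representatives of zero, and are
inverse to each other up to representatives of zero, induce an isomorphism of homology. -/
theorem HHIso.of_maps (f : C.Mod →ₗ[ℚ] D.Mod) (g : D.Mod →ₗ[ℚ] C.Mod)
    (hf : HasDegree 0 0 f) (hg : HasDegree 0 0 g)
    (fZ : ∀ x ∈ C.cycles, f x ∈ D.cycles) (gZ : ∀ x ∈ D.cycles, g x ∈ C.cycles)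
    (fB : ∀ x ∈ C.boundaries, f x ∈ D.boundaries) (gB : ∀ x ∈ D.boundaries, g x ∈ C.boundaries)
    (hgf : ∀ x ∈ C.cycles, g (f x) - x ∈ C.boundaries)
    (hfg : ∀ x ∈ D.cycles, f (g x) - x ∈ D.boundaries) : HHIso C D := by
  -- The homology is `cycles` modulo the kernel of the class map, so a map that respects both kinds
  -- of representatives descends.
  have key : ∀ {V W : Type} {C : Bicomplex V} {D : Bicomplex W} (f : C.Mod →ₗ[ℚ] D.Mod)
      (fZ : ∀ x ∈ C.cycles, f x ∈ D.cycles) (fB : ∀ x ∈ C.boundaries, f x ∈ D.boundaries),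
      ∃ F : C.HH →ₗ[ℚ] D.HH, ∀ x : C.cycles, F (C.class x) = D.class ⟨f x, fZ x x.2⟩ := by
    intro V W C D f fZ fB
    let e := C.class.quotKerEquivOfSurjective class_surjective
    let f' : C.cycles →ₗ[ℚ] D.HH := D.class ∘ₗ f.restrict fZ
    have hf' : LinearMap.ker C.class ≤ LinearMap.ker f' := by
      intro x hx
      rw [LinearMap.mem_ker, class_eq_zero] at hx
      rw [LinearMap.mem_ker]
      exact (class_eq_zero _).2 (fB _ hx)
    refine ⟨(LinearMap.ker C.class).liftQ f' hf' ∘ₗ e.symm.toLinearMap, fun x => ?_⟩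
    have h1 : e (Submodule.Quotient.mk x) = C.class x := rfl
    rw [← h1, LinearMap.comp_apply, LinearEquiv.coe_coe, LinearEquiv.symm_apply_apply]
    rfl
  obtain ⟨F, hF⟩ := key f fZ fB
  obtain ⟨G, hG⟩ := key g gZ gB
  have h1 : G ∘ₗ F = LinearMap.id := by
    refine LinearMap.ext fun z => ?_
    obtain ⟨x, rfl⟩ := class_surjective z
    rw [LinearMap.comp_apply, hF, hG, LinearMap.id_apply, ← sub_eq_zero, ← map_sub, class_eq_zero]
    exact hgf x x.2
  have h2 : F ∘ₗ G = LinearMap.id := by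
    refine LinearMap.ext fun z => ?_
    obtain ⟨x, rfl⟩ := class_surjective z
    rw [LinearMap.comp_apply, hG, hF, LinearMap.id_apply, ← sub_eq_zero, ← map_sub, class_eq_zero]
    exact hfg x x.2
  refine ⟨LinearEquiv.ofLinearMap F G h2 h1, fun i j k => le_antisymm ?_ ?_⟩
  · rintro _ ⟨z, hz, rfl⟩
    obtain ⟨x, hx, rfl⟩ := mem_grHH.1 hz
    refine mem_grHH.2 ⟨⟨f x, fZ x x.2⟩, ?_, (hF x).symm⟩
    simpa using hf _ _ _ _ hx
  · intro z hz
    obtain ⟨x, hx, rfl⟩ := mem_grHH.1 hz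
    refine ⟨G (D.class x), mem_grHH.2 ⟨⟨g x, gZ x x.2⟩, ?_, (hG x).symm⟩, ?_⟩
    · simpa using hg _ _ _ _ hx
    · exact LinearMap.congr_fun h2 _

theorem HHIso.trans (h : HHIso C D) (h' : HHIso D E) : HHIso C E := by
  obtain ⟨e, he⟩ := h
  obtain ⟨e', he'⟩ := h'
  refine ⟨e.trans e', fun i j k => ?_⟩
  rw [← he', ← he, ← Submodule.map_comp]
  rfl

theorem HHIso.symm (h : HHIso C D) : HHIso D C := by
  obtain ⟨e, he⟩ := h
  refine ⟨e.symm, fun i j k => ?_⟩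
  rw [← he, ← Submodule.map_comp]
  simp

theorem HHIso.shift (h : HHIso C D) (l m n : ℤ) : HHIso (C.shift l m n) (D.shift l m n) := by
  obtain ⟨e, he⟩ := h
  refine ⟨e, fun i j k => ?_⟩
  have key : ∀ {V : Type} (C : Bicomplex V), (C.shift l m n).grHH i j k =
      C.grHH (i - l) (j - m) (k - n) := by
    intro V C
    change homologyPart C.dcStar (homologyPart C.dgMap ((C.shift l m n).gr i j k)) = _
    rw [gr_shift]
    rfl
  rw [key, key]
  exact he _ _ _

/-- If `d_g x = 0` and `d_c x = d_g y`, the homotopy gives `d_c (f x) = d_g (f y - h x)`. Commuting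
with `d_c` up to homotopy is therefore enough. -/
theorem IsMorphism.cycles {β : B → V} {β' : B → W} {f : C.Mod →ₗ[ℚ] D.Mod}
    (hf : IsMorphism β β' f) (x : C.Mod) (hx : x ∈ C.cycles) : f x ∈ D.cycles := by
  obtain ⟨f1, f2, f3, fh, f4, f5, f6⟩ := hf
  obtain ⟨h1, y, hy⟩ := mem_cycles.1 hx
  have e3 := LinearMap.congr_fun f3
  have e6 := LinearMap.congr_fun f6 x
  simp only [LinearMap.sub_apply, LinearMap.add_apply, LinearMap.comp_apply] at e3 e6
  refine mem_cycles.2 ⟨by rw [← e3, h1, map_zero], f y - fh x, ?_⟩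
  rw [map_sub, ← e3, hy, sub_eq_iff_eq_add.1 e6, h1, map_zero]
  abel

theorem IsMorphism.boundaries {β : B → V} {β' : B → W} {f : C.Mod →ₗ[ℚ] D.Mod}
    (hf : IsMorphism β β' f) (x : C.Mod) (hx : x ∈ C.boundaries) : f x ∈ D.boundaries := by
  obtain ⟨f1, f2, f3, fh, f4, f5, f6⟩ := hf
  obtain ⟨y, z, hz, rfl⟩ := mem_boundaries.1 hx
  have e3 := LinearMap.congr_fun f3
  have e6 := LinearMap.congr_fun f6 z
  simp only [LinearMap.sub_apply, LinearMap.add_apply, LinearMap.comp_apply] at e3 e6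
  refine mem_boundaries.2 ⟨f y + fh z, f z, by rw [← e3, hz, map_zero], ?_⟩
  rw [map_add, map_add, ← e3, sub_eq_iff_eq_add.1 e6, hz, map_zero]
  abel

/-- On a cycle with `d_c x = d_g y`, the term `s d_c x` equals `d_g s y` because `s` is a chain map
for `d_g`. What remains is `d_g (s y + u x) + d_c (s x)`, with `s x` a `d_g`-cycle. -/
theorem HomotopicToId.boundaries {β : B → V} {f : C.Mod →ₗ[ℚ] C.Mod}
    (hf : HomotopicToId β f) (x : C.Mod) (hx : x ∈ C.cycles) : f x - x ∈ C.boundaries := by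
  obtain ⟨s, u, s1, s2, s3, u1, u2, u3⟩ := hf
  obtain ⟨h1, y, hy⟩ := mem_cycles.1 hx
  have e3 := LinearMap.congr_fun s3
  have e6 := LinearMap.congr_fun u3 x
  simp only [LinearMap.sub_apply, LinearMap.add_apply, LinearMap.comp_apply,
    LinearMap.id_apply] at e3 e6
  rw [e6]
  refine mem_boundaries.2 ⟨s y + u x, s x, by rw [← e3, h1, map_zero], ?_⟩
  rw [map_add, ← e3, hy, h1, map_zero]
  abel

theorem HomotopyEquivalent.hhIso {β : B → V} {β' : B → W} (h : HomotopyEquivalent β β' C D) :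
    HHIso C D := by
  obtain ⟨f, g, hf, hg, hgf, hfg⟩ := h
  exact HHIso.of_maps f g hf.2.1 hg.2.1 hf.cycles hg.cycles hf.boundaries hg.boundaries
    hgf.boundaries hfg.boundaries

end Homology

end Maps

end KR


namespace KR

open MvPolynomial

section Tensor

variable {V W U B : Type}

/-! ## Maps of tensor products -/

/-- The map `f ⊗ 1`. -/
noncomputable def tensorMap {ι ι' : Type} (κ : Type)
    (f : (ι → MvPolynomial V ℚ) →ₗ[ℚ] (ι' → MvPolynomial W ℚ)) :
    (ι × κ → MvPolynomial V ℚ) →ₗ[ℚ] (ι' × κ → MvPolynomial W ℚ) where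
  toFun x := fun b => f (fun c => x (c, b.2)) b.1
  map_add' x y := by
    ext1 b
    exact congrFun (map_add f (fun c => x (c, b.2)) (fun c => y (c, b.2))) b.1
  map_smul' r x := by
    ext1 b
    exact congrFun (map_smul f r (fun c => x (c, b.2))) b.1

/-- The map `(-1)^n ⊗ M`. -/
noncomputable def rightOp {ι κ : Type} [Fintype κ] (n : ι → ℤ) (M : Matrix κ κ (MvPolynomial V ℚ)) :
    (ι × κ → MvPolynomial V ℚ) →ₗ[ℚ] (ι × κ → MvPolynomial V ℚ) where
  toFun x := fun b => ∑ e, M b.2 e * (sg (n b.1) • x (b.1, e))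
  map_add' x y := by
    ext1 b
    simp [mul_add, Finset.sum_add_distrib]
  map_smul' r x := by
    ext1 b
    simp [Finset.smul_sum, smul_comm r]

section

variable {ι ι' κ : Type}

theorem tensorMap_apply (f : (ι → MvPolynomial V ℚ) →ₗ[ℚ] (ι' → MvPolynomial W ℚ))
    (x : ι × κ → MvPolynomial V ℚ) (b : ι' × κ) :
    tensorMap κ f x b = f (fun c => x (c, b.2)) b.1 := rfl

theorem tensorMap_add (f g : (ι → MvPolynomial V ℚ) →ₗ[ℚ] (ι' → MvPolynomial W ℚ)) :
    tensorMap κ (f + g) = tensorMap κ f + tensorMap κ g := rfl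

theorem neg_one_smul_map (f : (ι → MvPolynomial V ℚ) →ₗ[ℚ] (ι' → MvPolynomial W ℚ)) :
    (-1 : ℚ) • f = -f := by
  refine LinearMap.ext fun x => ?_
  rw [LinearMap.smul_apply, LinearMap.neg_apply, neg_one_smul]

theorem rightOp_apply [Fintype κ] (n : ι → ℤ) (M : Matrix κ κ (MvPolynomial V ℚ))
    (x : ι × κ → MvPolynomial V ℚ) (b : ι × κ) :
    rightOp n M x b = ∑ e, M b.2 e * (sg (n b.1) • x (b.1, e)) := rfl

/-- The entries of `M` come from the edge ring, so the edge-linear map `f` passes them. The only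
price is the factor `r` from the sign operator. -/
theorem tensorMap_rightOp [Fintype κ] (β : B → V) (β' : B → W)
    (f : (ι → MvPolynomial V ℚ) →ₗ[ℚ] (ι' → MvPolynomial W ℚ))
    (hf : ∀ (p : MvPolynomial B ℚ) (x : ι → MvPolynomial V ℚ),
      f (rename β p • x) = rename β' p • f x)
    (n : ι → ℤ) (n' : ι' → ℤ) (r : ℚ) (h : f ∘ₗ signOp V n = r • (signOp W n' ∘ₗ f))
    (M : Matrix κ κ (MvPolynomial B ℚ)) :
    tensorMap κ f ∘ₗ rightOp n (M.map (rename β)) =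
      r • (rightOp n' (M.map (rename β')) ∘ₗ tensorMap κ f) := by
  refine LinearMap.ext fun x => funext fun b => ?_
  have e1 : (fun c => rightOp n (M.map (rename β)) x (c, b.2)) =
      ∑ e, rename β (M b.2 e) • signOp V n (fun c => x (c, e)) := by
    ext1 c
    simp [rightOp_apply, signOp_apply, Finset.sum_apply]
  rw [LinearMap.comp_apply, tensorMap_apply, e1, map_sum, LinearMap.smul_apply,
    LinearMap.comp_apply, Pi.smul_apply, rightOp_apply, Finset.sum_apply, Finset.smul_sum]
  refine Finset.sum_congr rfl fun e _ => ?_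
  rw [hf]
  have e2 := LinearMap.congr_fun h (fun c => x (c, e))
  rw [LinearMap.comp_apply] at e2
  rw [e2]
  simp [signOp_apply, tensorMap_apply]

end

theorem tensor_dg_apply (C E : Bicomplex V) (x : C.ι × E.ι → MvPolynomial V ℚ) (i : C.ι)
    (e : E.ι) : (C.tensor E).dgMap x (i, e) =
      ∑ j, C.dg i j * x (j, e) + sg (C.a i) • ∑ e', E.dg e e' * x (i, e') := by
  refine (Fintype.sum_prod_type _).trans ?_
  change ∑ j, ∑ k, (C.dg i j * (1 : Matrix E.ι E.ι (MvPolynomial V ℚ)) e k +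
    sgnMatrix V C.a i j * E.dg e k) * x (j, k) = _
  simp only [add_mul, Finset.sum_add_distrib]
  congr 1
  · refine Finset.sum_congr rfl fun c _ => ?_
    rw [Finset.sum_eq_single e]
    · simp
    · intro k _ hk
      rw [Matrix.one_apply_ne hk.symm]; simp
    · simp
  · rw [Finset.sum_eq_single i]
    · rw [Finset.smul_sum]
      refine Finset.sum_congr rfl fun k _ => ?_
      rw [sgnMatrix, Matrix.diagonal_apply_eq, sgn_eq, smul_eq_C_mul]
      ring
    · intro c _ hc
      rw [sgnMatrix, Matrix.diagonal_apply_ne _ hc.symm]; simp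
    · simp

theorem tensor_dc_apply (C E : Bicomplex V) (x : C.ι × E.ι → MvPolynomial V ℚ) (i : C.ι)
    (e : E.ι) : (C.tensor E).dcMap x (i, e) =
      ∑ j, C.dc i j * x (j, e) + sg (C.t i) • ∑ e', E.dc e e' * x (i, e') := by
  refine (Fintype.sum_prod_type _).trans ?_
  change ∑ j, ∑ k, (C.dc i j * (1 : Matrix E.ι E.ι (MvPolynomial V ℚ)) e k +
    sgnMatrix V C.t i j * E.dc e k) * x (j, k) = _
  simp only [add_mul, Finset.sum_add_distrib]
  congr 1
  · refine Finset.sum_congr rfl fun c _ => ?_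
    rw [Finset.sum_eq_single e]
    · simp
    · intro k _ hk
      rw [Matrix.one_apply_ne hk.symm]; simp
    · simp
  · rw [Finset.sum_eq_single i]
    · rw [Finset.smul_sum]
      refine Finset.sum_congr rfl fun k _ => ?_
      rw [sgnMatrix, Matrix.diagonal_apply_eq, sgn_eq, smul_eq_C_mul]
      ring
    · intro c _ hc
      rw [sgnMatrix, Matrix.diagonal_apply_ne _ hc.symm]; simp
    · simp

/-! ## Change of the base ring -/

/-- A ring homomorphism that preserves degrees. -/
def IsGraded (φ : MvPolynomial V ℚ →ₐ[ℚ] MvPolynomial W ℚ) : Prop :=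
  ∀ (p : MvPolynomial V ℚ) (n : ℤ), IsWeightedHomogeneous (qWeight V) p n →
    IsWeightedHomogeneous (qWeight W) (φ p) n

/-- A monomial is built from a constant by multiplying with variables, each of degree 2. The degree
found in this way is the given one, since a nonzero polynomial has only one degree. -/
theorem wh_induction {P : ℤ → MvPolynomial V ℚ → Prop} (zero : ∀ n, P n 0)
    (add : ∀ n p q, P n p → P n q → P n (p + q)) (const : ∀ r, P 0 (C r))
    (mulX : ∀ n p v, P n p → P (n + 2) (p * X v)) {n : ℤ} {p : MvPolynomial V ℚ}
    (h : IsWeightedHomogeneous (qWeight V) p n) : P n p := by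
  refine h.induction_on (motive := fun p _ => P n p) (zero n) (fun p q _ _ => add n p q) ?_
  intro d r hr
  have h1 : ∃ m, IsWeightedHomogeneous (qWeight V) (monomial d r) m ∧ P m (monomial d r) := by
    refine induction_on_monomial (motive := fun p =>
      ∃ m, IsWeightedHomogeneous (qWeight V) p m ∧ P m p) ?_ ?_ d r
    · exact fun r => ⟨0, isWeightedHomogeneous_C _ _, const r⟩
    · rintro p v ⟨m, h1, h2⟩
      exact ⟨m + 2, h1.mul (isWeightedHomogeneous_X ℚ (qWeight V) v), mulX m p v h2⟩
  obtain ⟨m, h1, h2⟩ := h1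
  by_cases hr0 : monomial d r = 0
  · rw [hr0]; exact zero n
  · rwa [h1.inj_right hr0 (isWeightedHomogeneous_monomial _ d r hr)] at h2

theorem isGraded_aeval (ρ : V → MvPolynomial W ℚ)
    (hρ : ∀ v, IsWeightedHomogeneous (qWeight W) (ρ v) 2) : IsGraded (aeval ρ) := by
  intro p n hp
  refine wh_induction (P := fun n p => IsWeightedHomogeneous (qWeight W) (aeval ρ p) n)
    ?_ ?_ ?_ ?_ hp
  · intro n; rw [map_zero]; exact isWeightedHomogeneous_zero _ _ _
  · intro n p q h1 h2; rw [map_add]; exact h1.add h2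
  · intro r; rw [aeval_C]; exact isWeightedHomogeneous_C _ _
  · intro n p v h1; rw [map_mul, aeval_X]; exact h1.mul (hρ v)

theorem isGraded_rename (β : V → W) : IsGraded (rename (R := ℚ) β) := by
  have h : rename (R := ℚ) β = aeval (fun v => X (β v)) := by
    ext v; simp
  rw [h]
  exact isGraded_aeval _ fun v => isWeightedHomogeneous_X ℚ (qWeight W) (β v)

/-- Change of the base ring. -/
noncomputable def Bicomplex.map (C : Bicomplex V) (φ : MvPolynomial V ℚ →ₐ[ℚ] MvPolynomial W ℚ)
    (hφ : IsGraded φ) : Bicomplex W where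
  ι := C.ι
  q := C.q
  a := C.a
  t := C.t
  dg := C.dg.map φ
  dc := C.dc.map φ
  dg_q := fun i j => hφ _ _ (C.dg_q i j)
  dc_q := fun i j => hφ _ _ (C.dc_q i j)
  dg_at := fun i j h => C.dg_at i j fun h0 => h (by rw [Matrix.map_apply, h0, map_zero])
  dc_at := fun i j h => C.dc_at i j fun h0 => h (by rw [Matrix.map_apply, h0, map_zero])
  dg_dg := by rw [← Matrix.map_mul, C.dg_dg, Matrix.map_zero _ (map_zero φ)]
  dc_dc := by rw [← Matrix.map_mul, C.dc_dc, Matrix.map_zero _ (map_zero φ)]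
  dg_dc := by rw [← Matrix.map_mul, C.dg_dc, Matrix.map_mul]

/-- Change of the names of the marks. -/
noncomputable def Bicomplex.rename (C : Bicomplex V) (β : V → W) : Bicomplex W :=
  C.map (MvPolynomial.rename β) (isGraded_rename β)

section

variable {C : Bicomplex V} {D : Bicomplex W} {β : B → V} {β' : B → W} (E : Bicomplex B)

theorem EdgeLinear.tensorMap {f : C.Mod →ₗ[ℚ] D.Mod} (hf : EdgeLinear β β' f) :
    EdgeLinear (C := C.tensor (E.rename β)) (D := D.tensor (E.rename β')) β β'
      (tensorMap E.ι f) := fun p x => funext fun b => by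
  exact congrFun (hf p (fun c => x (c, b.2))) b.1

theorem HasDegree.tensorMap {m n : ℤ} {f : C.Mod →ₗ[ℚ] D.Mod} (hf : HasDegree m n f) :
    HasDegree (C := C.tensor (E.rename β)) (D := D.tensor (E.rename β')) m n
      (tensorMap E.ι f) := by
  intro i j k x hx b
  have h1 : (fun c => x (c, b.2)) ∈ C.gr (i - E.q b.2) (j - E.a b.2) (k - E.t b.2) := by
    intro c
    refine cell.mono (hx (c, b.2)) ?_ ?_
    · change i - (C.q c + E.q b.2) = _
      ring
    · change C.a c + E.a b.2 = _ ∧ C.t c + E.t b.2 = _ → _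
      omega
  refine cell.mono (hf _ _ _ _ h1 b.1) ?_ ?_
  · change _ = i - (D.q b.1 + E.q b.2)
    ring
  · change _ → D.a b.1 + E.a b.2 = _ ∧ D.t b.1 + E.t b.2 = _
    omega

theorem tensorMap_rightOp_a {m n : ℤ} {f : C.Mod →ₗ[ℚ] D.Mod} (h : EdgeLinear β β' f)
    (h' : HasDegree m n f) (M : Matrix E.ι E.ι (MvPolynomial B ℚ)) :
    tensorMap E.ι f ∘ₗ rightOp C.a (M.map (MvPolynomial.rename β)) =
      sg m • (rightOp D.a (M.map (MvPolynomial.rename β')) ∘ₗ tensorMap E.ι f) :=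
  tensorMap_rightOp β β' f h _ _ _ h'.signOp_a M

theorem tensorMap_rightOp_t {m n : ℤ} {f : C.Mod →ₗ[ℚ] D.Mod} (h : EdgeLinear β β' f)
    (h' : HasDegree m n f) (M : Matrix E.ι E.ι (MvPolynomial B ℚ)) :
    tensorMap E.ι f ∘ₗ rightOp C.t (M.map (MvPolynomial.rename β)) =
      sg n • (rightOp D.t (M.map (MvPolynomial.rename β')) ∘ₗ tensorMap E.ι f) :=
  tensorMap_rightOp β β' f h _ _ _ h'.signOp_t M

/-- The differential of `C ⊗ E`, where `E` is defined over the edge ring. -/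
noncomputable def tensorDg (C : Bicomplex V) (E : Bicomplex B) (β : B → V) :
    (C.ι × E.ι → MvPolynomial V ℚ) →ₗ[ℚ] (C.ι × E.ι → MvPolynomial V ℚ) :=
  (C.tensor (E.rename β)).dgMap

theorem tensorDg_eq (C : Bicomplex V) (β : B → V) : tensorDg C E β =
    tensorMap E.ι C.dgMap + rightOp C.a (E.dg.map (MvPolynomial.rename β)) := by
  refine LinearMap.ext fun x => funext fun b => ?_
  refine (tensor_dg_apply C (E.rename β) x b.1 b.2).trans ?_
  rw [LinearMap.add_apply, Pi.add_apply, tensorMap_apply, rightOp_apply, dgMap_apply,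
    Finset.smul_sum]
  simp only [mul_smul_comm]
  rfl

/-- In Hochschild degree 0 the part of the differential that comes from `E` commutes with `f ⊗ 1`,
so only the commutator of `f` itself survives. -/
theorem tensorMap_dg_comm {n : ℤ} {f : C.Mod →ₗ[ℚ] D.Mod} (h : EdgeLinear β β' f)
    (h' : HasDegree 0 n f) : tensorMap E.ι f ∘ₗ tensorDg C E β -
      tensorDg D E β' ∘ₗ tensorMap E.ι f = tensorMap E.ι (f ∘ₗ C.dgMap - D.dgMap ∘ₗ f) := by
  have h2 := tensorMap_rightOp_a E h h' E.dg
  rw [sg_zero, one_smul] at h2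
  rw [tensorDg_eq, tensorDg_eq, LinearMap.comp_add, LinearMap.add_comp, h2,
    add_sub_add_right_eq_sub]
  rfl

/-- In Hochschild degree 1 the Koszul sign makes the part from `E` cancel in the sum. This is why a
homotopy for `d_g` stays one after tensoring with `E`. -/
theorem tensorMap_dg_anticomm {n : ℤ} {f : C.Mod →ₗ[ℚ] D.Mod} (h : EdgeLinear β β' f)
    (h' : HasDegree 1 n f) : tensorDg D E β' ∘ₗ tensorMap E.ι f +
      tensorMap E.ι f ∘ₗ tensorDg C E β = tensorMap E.ι (D.dgMap ∘ₗ f + f ∘ₗ C.dgMap) := by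
  have h2 := tensorMap_rightOp_a E h h' E.dg
  rw [sg_one] at h2
  replace h2 := h2.trans (neg_one_smul_map _)
  rw [tensorDg_eq, tensorDg_eq, LinearMap.comp_add, LinearMap.add_comp, h2,
    add_add_add_comm, add_neg_cancel, add_zero]
  rfl

/-- The differential of `C ⊗ E`, where `E` is defined over the edge ring. -/
noncomputable def tensorDc (C : Bicomplex V) (E : Bicomplex B) (β : B → V) :
    (C.ι × E.ι → MvPolynomial V ℚ) →ₗ[ℚ] (C.ι × E.ι → MvPolynomial V ℚ) :=
  (C.tensor (E.rename β)).dcMap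

theorem tensorDc_eq (C : Bicomplex V) (β : B → V) : tensorDc C E β =
    tensorMap E.ι C.dcMap + rightOp C.t (E.dc.map (MvPolynomial.rename β)) := by
  refine LinearMap.ext fun x => funext fun b => ?_
  refine (tensor_dc_apply C (E.rename β) x b.1 b.2).trans ?_
  rw [LinearMap.add_apply, Pi.add_apply, tensorMap_apply, rightOp_apply, dcMap_apply,
    Finset.smul_sum]
  simp only [mul_smul_comm]
  rfl

theorem tensorMap_dc_comm {m : ℤ} {f : C.Mod →ₗ[ℚ] D.Mod} (h : EdgeLinear β β' f)
    (h' : HasDegree m 0 f) : tensorMap E.ι f ∘ₗ tensorDc C E β -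
      tensorDc D E β' ∘ₗ tensorMap E.ι f = tensorMap E.ι (f ∘ₗ C.dcMap - D.dcMap ∘ₗ f) := by
  have h2 := tensorMap_rightOp_t E h h' E.dc
  rw [sg_zero, one_smul] at h2
  rw [tensorDc_eq, tensorDc_eq, LinearMap.comp_add, LinearMap.add_comp, h2,
    add_sub_add_right_eq_sub]
  rfl

/-- The same cancellation for `d_c`, where the homological degree -1 of the homotopy provides the
sign. -/
theorem tensorMap_dc_anticomm {m : ℤ} {f : C.Mod →ₗ[ℚ] D.Mod} (h : EdgeLinear β β' f)
    (h' : HasDegree m (-1) f) : tensorDc D E β' ∘ₗ tensorMap E.ι f +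
      tensorMap E.ι f ∘ₗ tensorDc C E β = tensorMap E.ι (D.dcMap ∘ₗ f + f ∘ₗ C.dcMap) := by
  have h2 := tensorMap_rightOp_t E h h' E.dc
  rw [sg_neg, sg_one] at h2
  replace h2 := h2.trans (neg_one_smul_map _)
  rw [tensorDc_eq, tensorDc_eq, LinearMap.comp_add, LinearMap.add_comp, h2,
    add_add_add_comm, add_neg_cancel, add_zero]
  rfl

theorem IsMorphism.tensorMap {f : C.Mod →ₗ[ℚ] D.Mod} (hf : IsMorphism β β' f) :
    IsMorphism (C := C.tensor (E.rename β)) (D := D.tensor (E.rename β')) β β'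
      (tensorMap E.ι f) := by
  obtain ⟨f1, f2, f3, h, f4, f5, f6⟩ := hf
  refine ⟨f1.tensorMap E, f2.tensorMap E, ?_, KR.tensorMap E.ι h,
    f4.tensorMap E, f5.tensorMap E, ?_⟩
  · have h1 := tensorMap_dg_comm E f1 f2
    rw [f3, sub_self] at h1
    exact sub_eq_zero.1 h1
  · refine (tensorMap_dc_comm E f1 f2).trans ?_
    rw [f6]
    exact (tensorMap_dg_anticomm E f4 f5).symm

theorem HomotopicToId.tensorMap {f : C.Mod →ₗ[ℚ] C.Mod} (hf : HomotopicToId β f) :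
    HomotopicToId (C := C.tensor (E.rename β)) β (tensorMap E.ι f) := by
  obtain ⟨s, u, s1, s2, s3, u1, u2, u3⟩ := hf
  refine ⟨KR.tensorMap E.ι s, KR.tensorMap E.ι u, s1.tensorMap E, s2.tensorMap E,
    ?_, u1.tensorMap E, u2.tensorMap E, ?_⟩
  · have h1 := tensorMap_dg_comm E s1 s2
    rw [s3, sub_self] at h1
    exact sub_eq_zero.1 h1
  · refine (congrArg (KR.tensorMap E.ι) u3).trans ?_
    rw [tensorMap_add, ← tensorMap_dc_anticomm E s1 s2, ← tensorMap_dg_anticomm E u1 u2]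
    rfl

/-- Homotopy equivalences are preserved by the tensor product over the edge ring. -/
theorem HomotopyEquivalent.tensor (h : HomotopyEquivalent β β' C D) :
    HomotopyEquivalent β β' (C.tensor (E.rename β)) (D.tensor (E.rename β')) := by
  obtain ⟨f, g, hf, hg, hgf, hfg⟩ := h
  exact ⟨tensorMap E.ι f, tensorMap E.ι g, hf.tensorMap E, hg.tensorMap E, hgf.tensorMap E,
    hfg.tensorMap E⟩

end

end Tensor

end KR


namespace KR

open MvPolynomial

section Structural

variable {V W U B : Type}

/-! ## Isomorphisms of bicomplexes -/

/-- Homotopy equivalence over the total ring. -/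
abbrev Equivalent (C D : Bicomplex V) : Prop := HomotopyEquivalent (id : V → V) id C D

/-- Mutually inverse linear maps of degree zero that commute with `d_g`, and with `d_c` up to a
homotopy for `d_g`, are homotopy equivalences. -/
theorem HomotopyEquivalent.ofIso {C : Bicomplex V} {D : Bicomplex W} {β : B → V} {β' : B → W}
    (f : C.Mod →ₗ[ℚ] D.Mod) (g : D.Mod →ₗ[ℚ] C.Mod)
    (hf : EdgeLinear β β' f) (hg : EdgeLinear β' β g) (df : HasDegree 0 0 f) (dg : HasDegree 0 0 g)
    (hgf : ∀ x, g (f x) = x) (hfg : ∀ x, f (g x) = x) (cg : ∀ x, f (C.dgMap x) = D.dgMap (f x))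
    (h : C.Mod →ₗ[ℚ] D.Mod) (hh : EdgeLinear β β' h) (dh : HasDegree 1 1 h)
    (cc : ∀ x, f (C.dcMap x) - D.dcMap (f x) = D.dgMap (h x) + h (C.dgMap x)) :
    HomotopyEquivalent β β' C D := by
  have cg' : ∀ y, g (D.dgMap y) = C.dgMap (g y) := fun y => by
    rw [← hgf (C.dgMap (g y)), cg, hfg]
  have hgf' : g ∘ₗ f = LinearMap.id := LinearMap.ext hgf
  have hfg' : f ∘ₗ g = LinearMap.id := LinearMap.ext hfg
  -- Conjugating the relation for `f` by the inverse map shows that `g` commutes with `d_c` up to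
  -- `-g h g`.
  refine ⟨f, g, ⟨hf, df, LinearMap.ext cg, h, hh, dh, LinearMap.ext cc⟩,
    ⟨hg, dg, LinearMap.ext cg', -(g ∘ₗ h ∘ₗ g), (hg.comp (hh.comp hg)).neg,
      (dg.comp (dh.comp dg rfl rfl) rfl rfl).neg, LinearMap.ext fun y => ?_⟩, ?_, ?_⟩
  · have e1 := congrArg g (cc (g y))
    rw [map_sub, map_add, hgf, hfg, cg'] at e1
    simp only [LinearMap.sub_apply, LinearMap.add_apply, LinearMap.comp_apply,
      LinearMap.neg_apply, map_neg, cg']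
    rw [← neg_sub, e1]
    abel
  · rw [hgf']
    exact ⟨0, 0, EdgeLinear.zero, HasDegree.zero, by simp, EdgeLinear.zero, HasDegree.zero,
      by simp⟩
  · rw [hfg']
    exact ⟨0, 0, EdgeLinear.zero, HasDegree.zero, by simp, EdgeLinear.zero, HasDegree.zero,
      by simp⟩

/-- Bicomplexes that differ by the names and the signs of the basis elements. -/
theorem Equivalent.ofEquiv {C D : Bicomplex V} (e : C.ι ≃ D.ι) (n : C.ι → ℤ)
    (hq : ∀ i, D.q (e i) = C.q i) (ha : ∀ i, D.a (e i) = C.a i) (ht : ∀ i, D.t (e i) = C.t i)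
    (hg : ∀ i j, D.dg (e i) (e j) = (sg (n i) * sg (n j)) • C.dg i j)
    (hc : ∀ i j, D.dc (e i) (e j) = (sg (n i) * sg (n j)) • C.dc i j) : Equivalent C D := by
  let f : C.Mod →ₗ[ℚ] D.Mod :=
    { toFun := fun x d => sg (n (e.symm d)) • x (e.symm d)
      map_add' := fun x y => by ext1 d; simp
      map_smul' := fun r x => by ext1 d; simp [smul_comm r] }
  let g : D.Mod →ₗ[ℚ] C.Mod :=
    { toFun := fun x c => sg (n c) • x (e c)
      map_add' := fun x y => by ext1 d; simp
      map_smul' := fun r x => by ext1 d; simp [smul_comm r] }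
  have key : ∀ (M : Matrix C.ι C.ι (MvPolynomial V ℚ)) (N : Matrix D.ι D.ι (MvPolynomial V ℚ))
      (_ : ∀ i j, N (e i) (e j) = (sg (n i) * sg (n j)) • M i j) (x : C.Mod) (d : D.ι),
      sg (n (e.symm d)) • ∑ j, M (e.symm d) j * x j = ∑ j, N d j * f x j := by
    intro M N h x d
    obtain ⟨c, rfl⟩ := e.surjective d
    rw [← Equiv.sum_comp e, Finset.smul_sum, e.symm_apply_apply]
    refine Finset.sum_congr rfl fun j _ => ?_
    change _ = N _ _ * sg (n (e.symm (e j))) • x (e.symm (e j))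
    rw [e.symm_apply_apply, h, smul_mul_smul_comm, mul_assoc, sg_mul_self, mul_one]
  refine HomotopyEquivalent.ofIso f g ?_ ?_ ?_ ?_ ?_ ?_ ?_ 0 EdgeLinear.zero HasDegree.zero ?_
  · intro p x
    ext1 d
    change sg (n (e.symm d)) • (rename id p * x (e.symm d)) =
      rename id p * (sg (n (e.symm d)) • x (e.symm d))
    rw [mul_smul_comm]
  · intro p x
    ext1 c
    change sg (n c) • (rename id p * x (e c)) = rename id p * (sg (n c) • x (e c))
    rw [mul_smul_comm]
  · intro i j k x hx d
    refine Submodule.smul_mem _ _ (cell.mono (hx (e.symm d)) ?_ ?_)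
    · rw [← hq, e.apply_symm_apply]
    · rw [← ha, ← ht, e.apply_symm_apply]
      omega
  · intro i j k x hx c
    refine Submodule.smul_mem _ _ (cell.mono (hx (e c)) ?_ ?_)
    · rw [hq]
    · rw [ha, ht]
      omega
  · intro x
    ext1 c
    change sg _ • (sg (n (e.symm (e c))) • x (e.symm (e c))) = x c
    rw [e.symm_apply_apply, smul_smul, sg_mul_self, one_smul]
  · intro x
    ext1 c
    change sg _ • (sg _ • x (e (e.symm c))) = x c
    rw [e.apply_symm_apply, smul_smul, sg_mul_self, one_smul]
  · exact fun x => funext fun d => key _ _ hg x d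
  · intro x
    rw [LinearMap.zero_apply, map_zero, LinearMap.zero_apply, add_zero, sub_eq_zero]
    exact funext fun d => key _ _ hc x d

theorem Equivalent.ofEntries {C D : Bicomplex V} (e : C.ι ≃ D.ι)
    (hq : ∀ i, D.q (e i) = C.q i) (ha : ∀ i, D.a (e i) = C.a i) (ht : ∀ i, D.t (e i) = C.t i)
    (hg : ∀ i j, D.dg (e i) (e j) = C.dg i j)
    (hc : ∀ i j, D.dc (e i) (e j) = C.dc i j) : Equivalent C D :=
  Equivalent.ofEquiv e (fun _ => 0) hq ha ht (fun i j => by simp [hg]) (fun i j => by simp [hc])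

theorem tensor_dg_entry (C D : Bicomplex V) (i j : C.ι) (i' j' : D.ι) :
    (C.tensor D).dg (i, i') (j, j') = (if i' = j' then C.dg i j else 0) +
      if i = j then sg (C.a i) • D.dg i' j' else 0 := by
  change C.dg i j * (1 : Matrix D.ι D.ι (MvPolynomial V ℚ)) i' j' +
    sgnMatrix V C.a i j * D.dg i' j' = _
  congr 1
  · rw [Matrix.one_apply, mul_ite, mul_one, mul_zero]
  · rw [sgnMatrix, Matrix.diagonal_apply, ite_mul, zero_mul, sgn_eq, smul_eq_C_mul]

theorem tensor_dc_entry (C D : Bicomplex V) (i j : C.ι) (i' j' : D.ι) :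
    (C.tensor D).dc (i, i') (j, j') = (if i' = j' then C.dc i j else 0) +
      if i = j then sg (C.t i) • D.dc i' j' else 0 := by
  change C.dc i j * (1 : Matrix D.ι D.ι (MvPolynomial V ℚ)) i' j' +
    sgnMatrix V C.t i j * D.dc i' j' = _
  congr 1
  · rw [Matrix.one_apply, mul_ite, mul_one, mul_zero]
  · rw [sgnMatrix, Matrix.diagonal_apply, ite_mul, zero_mul, sgn_eq, smul_eq_C_mul]

/-- Commutativity of the tensor product. -/
theorem Equivalent.tensor_comm (C D : Bicomplex V) : Equivalent (C.tensor D) (D.tensor C) := by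
  -- Exchanging basis elements of bidegrees `(a, t)` and `(a', t')` costs the sign `(-1)^(aa'+tt')`,
  -- one exponent for each differential.
  refine Equivalent.ofEquiv (Equiv.prodComm _ _)
    (fun i => C.a i.1 * D.a i.2 + C.t i.1 * D.t i.2) (fun i => add_comm _ _)
    (fun i => add_comm _ _) (fun i => add_comm _ _) ?_ ?_
  · rintro ⟨i, i'⟩ ⟨j, j'⟩
    refine (tensor_dg_entry D C i' j' i j).trans ?_
    rw [tensor_dg_entry, smul_add, add_comm]
    congr 1
    · by_cases h : i' = j'
      · subst h
        rw [if_pos rfl, if_pos rfl]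
        by_cases h0 : C.dg i j = 0
        · simp [h0]
        · obtain ⟨h1, h2⟩ := C.dg_at i j h0
          congr 1
          simp only [h1, h2, add_mul, one_mul, sg_add]
          rw [mul_mul_mul_comm, sg_mul_self, mul_one, ← mul_assoc, sg_mul_self, one_mul]
      · rw [if_neg h, if_neg h, smul_zero]
    · by_cases h : i = j
      · subst h
        rw [if_pos rfl, if_pos rfl, smul_smul]
        by_cases h0 : D.dg i' j' = 0
        · simp [h0]
        · obtain ⟨h1, h2⟩ := D.dg_at i' j' h0
          have : sg (C.a i * D.a i' + C.t i * D.t i') * sg (C.a i * D.a j' + C.t i * D.t j') *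
              sg (C.a i) = 1 := by
            simp only [h1, h2, mul_add, mul_one, sg_add]
            rw [mul_mul_mul_comm, sg_mul_self, mul_one, ← mul_assoc, sg_mul_self, one_mul,
              sg_mul_self]
          rw [this, one_smul]
      · rw [if_neg h, if_neg h, smul_zero]
  · rintro ⟨i, i'⟩ ⟨j, j'⟩
    refine (tensor_dc_entry D C i' j' i j).trans ?_
    rw [tensor_dc_entry, smul_add, add_comm]
    congr 1
    · by_cases h : i' = j'
      · subst h
        rw [if_pos rfl, if_pos rfl]
        by_cases h0 : C.dc i j = 0
        · simp [h0]
        · obtain ⟨h1, h2⟩ := C.dc_at i j h0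
          congr 1
          simp only [h1, h2, add_mul, one_mul, sg_add]
          rw [mul_mul_mul_comm, sg_mul_self, one_mul, mul_right_comm, sg_mul_self, one_mul]
      · rw [if_neg h, if_neg h, smul_zero]
    · by_cases h : i = j
      · subst h
        rw [if_pos rfl, if_pos rfl, smul_smul]
        by_cases h0 : D.dc i' j' = 0
        · simp [h0]
        · obtain ⟨h1, h2⟩ := D.dc_at i' j' h0
          have : sg (C.a i * D.a i' + C.t i * D.t i') * sg (C.a i * D.a j' + C.t i * D.t j') *
              sg (C.t i) = 1 := by
            simp only [h1, h2, mul_add, mul_one, sg_add]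
            rw [mul_mul_mul_comm, sg_mul_self, one_mul, mul_right_comm, mul_assoc (sg _),
              mul_right_comm, sg_mul_self, one_mul, sg_mul_self]
          rw [this, one_smul]
      · rw [if_neg h, if_neg h, smul_zero]

/-- Associativity of the tensor product. -/
theorem Equivalent.tensor_assoc (C D E : Bicomplex V) :
    Equivalent ((C.tensor D).tensor E) (C.tensor (D.tensor E)) := by
  refine Equivalent.ofEntries (Equiv.prodAssoc _ _ _) (fun i => (add_assoc _ _ _).symm)
    (fun i => (add_assoc _ _ _).symm) (fun i => (add_assoc _ _ _).symm) ?_ ?_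
  · rintro ⟨⟨i, i'⟩, i''⟩ ⟨⟨j, j'⟩, j''⟩
    refine (tensor_dg_entry C (D.tensor E) i j (i', i'') (j', j'')).trans ?_
    refine Eq.trans ?_ (tensor_dg_entry (C.tensor D) E (i, i') (j, j') i'' j'').symm
    rw [tensor_dg_entry, tensor_dg_entry]
    change ((if ((i', i'') : D.ι × E.ι) = (j', j'') then C.dg i j else 0) + if i = j then
        sg (C.a i) • ((if i'' = j'' then D.dg i' j' else 0) +
          if i' = j' then sg (D.a i') • E.dg i'' j'' else 0) else 0) =
      (if i'' = j'' then (if i' = j' then C.dg i j else 0) +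
        (if i = j then sg (C.a i) • D.dg i' j' else 0) else 0) +
      if ((i, i') : C.ι × D.ι) = (j, j') then sg (C.a i + D.a i') • E.dg i'' j'' else 0
    simp only [Prod.mk.injEq, sg_add]
    by_cases h1 : i = j <;> by_cases h2 : i' = j' <;> by_cases h3 : i'' = j'' <;>
      simp [h1, h2, h3, smul_smul, add_assoc]
  · rintro ⟨⟨i, i'⟩, i''⟩ ⟨⟨j, j'⟩, j''⟩
    refine (tensor_dc_entry C (D.tensor E) i j (i', i'') (j', j'')).trans ?_
    refine Eq.trans ?_ (tensor_dc_entry (C.tensor D) E (i, i') (j, j') i'' j'').symm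
    rw [tensor_dc_entry, tensor_dc_entry]
    change ((if ((i', i'') : D.ι × E.ι) = (j', j'') then C.dc i j else 0) + if i = j then
        sg (C.t i) • ((if i'' = j'' then D.dc i' j' else 0) +
          if i' = j' then sg (D.t i') • E.dc i'' j'' else 0) else 0) =
      (if i'' = j'' then (if i' = j' then C.dc i j else 0) +
        (if i = j then sg (C.t i) • D.dc i' j' else 0) else 0) +
      if ((i, i') : C.ι × D.ι) = (j, j') then sg (C.t i + D.t i') • E.dc i'' j'' else 0
    simp only [Prod.mk.injEq, sg_add]
    by_cases h1 : i = j <;> by_cases h2 : i' = j' <;> by_cases h3 : i'' = j'' <;>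
      simp [h1, h2, h3, smul_smul, add_assoc]

theorem Equivalent.tensor_unit (C : Bicomplex V) :
    Equivalent (C.tensor (unitBicomplex V)) C := by
  refine Equivalent.ofEntries (Equiv.prodPUnit _) (fun i => (add_zero _).symm)
    (fun i => (add_zero _).symm) (fun i => (add_zero _).symm) ?_ ?_
  · rintro ⟨i, (i' : Unit)⟩ ⟨j, (j' : Unit)⟩
    refine Eq.trans ?_ (tensor_dg_entry C (unitBicomplex V) i j i' j').symm
    change C.dg i j = (if i' = j' then C.dg i j else 0) +
      if i = j then sg (C.a i) • (0 : MvPolynomial V ℚ) else 0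
    simp
  · rintro ⟨i, (i' : Unit)⟩ ⟨j, (j' : Unit)⟩
    refine Eq.trans ?_ (tensor_dc_entry C (unitBicomplex V) i j i' j').symm
    change C.dc i j = (if i' = j' then C.dc i j else 0) +
      if i = j then sg (C.t i) • (0 : MvPolynomial V ℚ) else 0
    simp

/-- Shifting the left factor multiplies the right-hand parts of `d_g` and `d_c` by `(-1)^m` and
`(-1)^n`. Rescaling the basis by `(-1)^(ma'+nt')`, with `a'`, `t'` the degrees in the right factor,
absorbs both signs. -/
theorem Equivalent.shift_tensor (C E : Bicomplex V) (l m n : ℤ) :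
    Equivalent ((C.shift l m n).tensor E) ((C.tensor E).shift l m n) := by
  refine Equivalent.ofEquiv (Equiv.refl _) (fun i => m * E.a i.2 + n * E.t i.2)
    (fun i => add_right_comm _ _ _) (fun i => add_right_comm _ _ _)
    (fun i => add_right_comm _ _ _) ?_ ?_
  · rintro ⟨(i : C.ι), i'⟩ ⟨(j : C.ι), j'⟩
    refine (tensor_dg_entry C E i j i' j').trans ?_
    refine Eq.trans ?_ (congrArg _ (tensor_dg_entry (C.shift l m n) E i j i' j').symm)
    rw [smul_add]
    change (if i' = j' then C.dg i j else 0) + (if i = j then sg (C.a i) • E.dg i' j' else 0) =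
      ((sg (m * E.a i' + n * E.t i') * sg (m * E.a j' + n * E.t j')) •
        if i' = j' then C.dg i j else 0) +
      (sg (m * E.a i' + n * E.t i') * sg (m * E.a j' + n * E.t j')) •
        if i = j then sg (C.a i + m) • E.dg i' j' else 0
    congr 1
    · by_cases h : i' = j'
      · subst h
        rw [if_pos rfl, sg_mul_self, one_smul]
      · rw [if_neg h, smul_zero]
    · by_cases h : i = j
      · subst h
        rw [if_pos rfl, if_pos rfl, smul_smul]
        by_cases h0 : E.dg i' j' = 0
        · simp [h0]
        · obtain ⟨h1, h2⟩ := E.dg_at i' j' h0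
          congr 1
          simp only [h1, h2, mul_add, mul_one, sg_add]
          have e1 := sg_mul_self (m * E.a i')
          have e2 := sg_mul_self (n * E.t i')
          have e3 := sg_mul_self m
          linear_combination (-sg (C.a i)) * (sg (n * E.t i') ^ 2 * sg m ^ 2) * e1 -
            sg (C.a i) * sg m ^ 2 * e2 - sg (C.a i) * e3
      · rw [if_neg h, if_neg h, smul_zero]
  · rintro ⟨(i : C.ι), i'⟩ ⟨(j : C.ι), j'⟩
    refine (tensor_dc_entry C E i j i' j').trans ?_
    refine Eq.trans ?_ (congrArg _ (tensor_dc_entry (C.shift l m n) E i j i' j').symm)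
    rw [smul_add]
    change (if i' = j' then C.dc i j else 0) + (if i = j then sg (C.t i) • E.dc i' j' else 0) =
      ((sg (m * E.a i' + n * E.t i') * sg (m * E.a j' + n * E.t j')) •
        if i' = j' then C.dc i j else 0) +
      (sg (m * E.a i' + n * E.t i') * sg (m * E.a j' + n * E.t j')) •
        if i = j then sg (C.t i + n) • E.dc i' j' else 0
    congr 1
    · by_cases h : i' = j'
      · subst h
        rw [if_pos rfl, sg_mul_self, one_smul]
      · rw [if_neg h, smul_zero]
    · by_cases h : i = j
      · subst h
        rw [if_pos rfl, if_pos rfl, smul_smul]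
        by_cases h0 : E.dc i' j' = 0
        · simp [h0]
        · obtain ⟨h1, h2⟩ := E.dc_at i' j' h0
          congr 1
          simp only [h1, h2, mul_add, mul_one, sg_add]
          have e1 := sg_mul_self (m * E.a i')
          have e2 := sg_mul_self (n * E.t j')
          have e3 := sg_mul_self n
          linear_combination (-sg (C.t i)) * (sg (n * E.t j') ^ 2 * sg n ^ 2) * e1 -
            sg (C.t i) * sg n ^ 2 * e2 - sg (C.t i) * e3
      · rw [if_neg h, if_neg h, smul_zero]

theorem Equivalent.map_tensor (C E : Bicomplex V) (φ : MvPolynomial V ℚ →ₐ[ℚ] MvPolynomial W ℚ)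
    (hφ : IsGraded φ) :
    Equivalent ((C.tensor E).map φ hφ) ((C.map φ hφ).tensor (E.map φ hφ)) := by
  refine Equivalent.ofEntries (Equiv.refl _) (fun i => rfl) (fun i => rfl) (fun i => rfl) ?_ ?_
  · rintro ⟨i, i'⟩ ⟨j, j'⟩
    refine (tensor_dg_entry (C.map φ hφ) (E.map φ hφ) i j i' j').trans ?_
    refine Eq.trans ?_ (congrArg φ (tensor_dg_entry C E i j i' j')).symm
    rw [map_add, apply_ite φ, apply_ite φ, map_zero, map_smul]
    rfl
  · rintro ⟨i, i'⟩ ⟨j, j'⟩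
    refine (tensor_dc_entry (C.map φ hφ) (E.map φ hφ) i j i' j').trans ?_
    refine Eq.trans ?_ (congrArg φ (tensor_dc_entry C E i j i' j')).symm
    rw [map_add, apply_ite φ, apply_ite φ, map_zero, map_smul]
    rfl

theorem Equivalent.map_map {C : Bicomplex V} (φ : MvPolynomial V ℚ →ₐ[ℚ] MvPolynomial W ℚ)
    (hφ : IsGraded φ) (ψ : MvPolynomial W ℚ →ₐ[ℚ] MvPolynomial U ℚ) (hψ : IsGraded ψ)
    (χ : MvPolynomial V ℚ →ₐ[ℚ] MvPolynomial U ℚ) (hχ : IsGraded χ) (h : ∀ p, ψ (φ p) = χ p) :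
    Equivalent ((C.map φ hφ).map ψ hψ) (C.map χ hχ) :=
  Equivalent.ofEntries (Equiv.refl _) (fun _ => rfl) (fun _ => rfl) (fun _ => rfl)
    (fun _ _ => (h _).symm) (fun _ _ => (h _).symm)

theorem Equivalent.rename_id (C : Bicomplex V) : Equivalent (C.rename id) C :=
  Equivalent.ofEntries (Equiv.refl _) (fun _ => rfl) (fun _ => rfl) (fun _ => rfl)
    (fun _ _ => (rename_id_apply _).symm) (fun _ _ => (rename_id_apply _).symm)

/-- The tensor product of equivalent bicomplexes with a bicomplex on the right. -/
theorem Equivalent.tensor_right {C D : Bicomplex V} (h : Equivalent C D) (E : Bicomplex V) :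
    Equivalent (C.tensor E) (D.tensor E) := by
  -- `HomotopyEquivalent.tensor` takes its right factor from the edge ring. Here that ring is the
  -- total ring, and `E.rename id` has the same entries as `E`.
  have key : ∀ C : Bicomplex V, Equivalent (C.tensor (E.rename id)) (C.tensor E) := by
    intro C
    refine Equivalent.ofEntries (Equiv.refl _) (fun _ => rfl) (fun _ => rfl) (fun _ => rfl) ?_ ?_
    · rintro ⟨i, i'⟩ ⟨j, j'⟩
      refine (tensor_dg_entry C E i j i' j').trans ?_
      refine Eq.trans ?_ (tensor_dg_entry C (E.rename id) i j i' j').symm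
      rw [show (E.rename id).dg i' j' = E.dg i' j' from rename_id_apply _]
      rfl
    · rintro ⟨i, i'⟩ ⟨j, j'⟩
      refine (tensor_dc_entry C E i j i' j').trans ?_
      refine Eq.trans ?_ (tensor_dc_entry C (E.rename id) i j i' j').symm
      rw [show (E.rename id).dc i' j' = E.dc i' j' from rename_id_apply _]
      rfl
  exact ((key C).symm.trans (HomotopyEquivalent.tensor E h)).trans (key D)

theorem Equivalent.tensor_left {C D : Bicomplex V} (h : Equivalent C D) (E : Bicomplex V) :
    Equivalent (E.tensor C) (E.tensor D) :=
  ((Equivalent.tensor_comm E C).trans (h.tensor_right E)).trans (Equivalent.tensor_comm D E)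

theorem Equivalent.tensor_left_comm (C D E : Bicomplex V) :
    Equivalent (C.tensor (D.tensor E)) (D.tensor (C.tensor E)) :=
  (((Equivalent.tensor_assoc C D E).symm).trans
    ((Equivalent.tensor_comm C D).tensor_right E)).trans (Equivalent.tensor_assoc D C E)

/-- Change of the names of the marks by a bijection. -/
theorem HomotopyEquivalent.relabel (C : Bicomplex V) (e : V ≃ W) :
    HomotopyEquivalent (id : V → V) e C (C.rename e) := by
  have key : ∀ (M : Matrix C.ι C.ι (MvPolynomial V ℚ)) (x : C.Mod) (i : C.ι),
      rename e (∑ j, M i j * x j) = ∑ j, rename e (M i j) * rename e (x j) := by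
    intro M x i
    simp
  have h1 : ∀ p : MvPolynomial V ℚ, rename e.symm (rename e p) = p := fun p => by
    rw [rename_rename, e.symm_comp_self, rename_id_apply]
  have h2 : ∀ p : MvPolynomial W ℚ, rename e (rename e.symm p) = p := fun p => by
    rw [rename_rename, e.self_comp_symm, rename_id_apply]
  let f : C.Mod →ₗ[ℚ] (C.rename e).Mod :=
    { toFun := fun x d => rename e (x d)
      map_add' := fun x y => by ext1 d; exact map_add _ _ _
      map_smul' := fun r x => by ext1 d; exact map_smul (rename e) r (x d) }
  let g : (C.rename e).Mod →ₗ[ℚ] C.Mod :=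
    { toFun := fun x d => rename e.symm (x d)
      map_add' := fun x y => by ext1 d; exact map_add _ _ _
      map_smul' := fun r x => by ext1 d; exact map_smul (rename e.symm) r (x d) }
  refine HomotopyEquivalent.ofIso f g ?_ ?_ ?_ ?_ ?_ ?_ ?_ 0 EdgeLinear.zero HasDegree.zero ?_
  · intro p x
    ext1 d
    change rename e (rename id p * x d) = _ * rename e (x d)
    rw [rename_id_apply, map_mul]
  · intro p x
    ext1 d
    change rename e.symm (rename e p * x d) = rename id p * rename e.symm (x d)
    rw [rename_id_apply, map_mul, h1]
  · intro i j k x hx d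
    refine ⟨isGraded_rename _ _ _ (hx d).1, fun h0 => ?_⟩
    rw [add_zero, add_zero]
    exact (hx d).2 (fun h => h0 (by change rename e (x d) = 0; rw [h, map_zero]))
  · intro i j k x hx d
    refine ⟨isGraded_rename _ _ _ (hx d).1, fun h0 => ?_⟩
    rw [add_zero, add_zero]
    exact (hx d).2 (fun h => h0 (by change rename e.symm (x d) = 0; rw [h, map_zero]))
  · exact fun x => funext fun d => h1 _
  · exact fun x => funext fun d => h2 _
  · exact fun x => funext fun d => key C.dg x d
  · intro x
    rw [LinearMap.zero_apply, map_zero, LinearMap.zero_apply, add_zero, sub_eq_zero]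
    exact funext fun d => key C.dc x d

end Structural

end KR


namespace KR

open MvPolynomial

section Eliminate

variable {V U : Type}

/-! ## Elimination of a variable -/

/-- A linear polynomial `ξ` over the marks `U`, and the retraction of `ℚ[U]` onto the polynomial
ring in the marks `V` that divides out `ξ`. -/
structure Elimination (β : V → U) where
  ρ : U → MvPolynomial V ℚ
  ξ : MvPolynomial U ℚ
  ρ_deg : ∀ u, IsWeightedHomogeneous (qWeight V) (ρ u) 2
  ξ_deg : IsWeightedHomogeneous (qWeight U) ξ 2
  ρ_section : ∀ v, ρ (β v) = X v
  ξ_ne : ξ ≠ 0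
  ξ_kills : aeval ρ ξ = 0
  coeff : U → ℚ
  coeff_spec : ∀ u, X u = rename β (ρ u) + C (coeff u) * ξ

namespace Elimination

variable {β : V → U} (L : Elimination β)

/-- The retraction. -/
noncomputable def ε : MvPolynomial U ℚ →ₐ[ℚ] MvPolynomial V ℚ := aeval L.ρ

theorem ε_graded : IsGraded L.ε := isGraded_aeval _ L.ρ_deg

theorem ε_rename (p : MvPolynomial V ℚ) : L.ε (rename β p) = p := by
  unfold ε
  rw [aeval_rename, show L.ρ ∘ β = X from funext L.ρ_section, aeval_X_left_apply]

theorem ε_ξ : L.ε L.ξ = 0 := L.ξ_kills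

/-- Every variable differs from its retraction by a multiple of `ξ`, hence so does every polynomial.
This splits `ℚ[U]` over `ℚ[V]` as the image of `ℚ[V]` plus the multiples of `ξ`. -/
theorem exists_quotient (h : MvPolynomial U ℚ) : ∃ k, h = rename β (L.ε h) + L.ξ * k := by
  induction h using MvPolynomial.induction_on with
  | C r => exact ⟨0, by simp [ε]⟩
  | add p q hp hq =>
    obtain ⟨k, hk⟩ := hp
    obtain ⟨l, hl⟩ := hq
    refine ⟨k + l, ?_⟩
    rw [map_add, map_add]
    linear_combination hk + hl
  | mul_X p u hp =>
    obtain ⟨k, hk⟩ := hp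
    refine ⟨k * X u + rename β (L.ε p) * C (L.coeff u), ?_⟩
    have h1 : L.ε (X u) = L.ρ u := aeval_X _ _
    rw [map_mul, map_mul, h1]
    linear_combination X u * hk + rename β (L.ε p) * L.coeff_spec u

theorem quotient_unique {k l : MvPolynomial U ℚ} (h : L.ξ * k = L.ξ * l) : k = l :=
  mul_left_cancel₀ L.ξ_ne h

/-- The quotient by `ξ` of the difference of a polynomial and its retraction. -/
noncomputable def δ : MvPolynomial U ℚ →ₗ[ℚ] MvPolynomial U ℚ where
  toFun h := (L.exists_quotient h).choose
  map_add' p q := by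
    apply L.quotient_unique
    have h1 := (L.exists_quotient (p + q)).choose_spec
    have h2 := (L.exists_quotient p).choose_spec
    have h3 := (L.exists_quotient q).choose_spec
    have h4 := congrArg (rename β) (map_add L.ε p q)
    have h5 := map_add (rename β) (L.ε p) (L.ε q)
    linear_combination h2 + h3 - h1 - h4 - h5
  map_smul' r p := by
    apply L.quotient_unique
    have h1 := (L.exists_quotient (r • p)).choose_spec
    have h2 := (L.exists_quotient p).choose_spec
    have h4 := congrArg (rename β) (map_smul L.ε r p)
    have h5 := map_smul (rename β) r (L.ε p)
    have h6 := smul_eq_C_mul p r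
    rw [RingHom.id_apply, smul_eq_C_mul (Exists.choose _)]
    rw [smul_eq_C_mul (rename β (L.ε p))] at h5
    linear_combination C r * h2 - h1 - h4 - h5 + h6

theorem spec (h : MvPolynomial U ℚ) : h = rename β (L.ε h) + L.ξ * L.δ h :=
  (L.exists_quotient h).choose_spec

theorem δ_eq {h k : MvPolynomial U ℚ} (e : L.ξ * k = h - rename β (L.ε h)) : L.δ h = k := by
  apply L.quotient_unique
  rw [e]
  linear_combination - L.spec h

theorem δ_ξ_mul (h : MvPolynomial U ℚ) : L.δ (L.ξ * h) = h := by
  refine L.δ_eq ?_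
  rw [map_mul, L.ε_ξ]
  simp

/-- Division by `ξ` is a twisted derivation: `gh - ε(g)ε(h)` is `g (h - ε h)` plus `(g - ε g) ε(h)`.
This rule replaces linearity over `ℚ[U]`, which `δ` does not have. -/
theorem δ_mul (g h : MvPolynomial U ℚ) :
    L.δ (g * h) = g * L.δ h + L.δ g * rename β (L.ε h) := by
  refine L.δ_eq ?_
  rw [map_mul, map_mul]
  linear_combination (-rename β (L.ε h)) * L.spec g - g * L.spec h

theorem δ_rename (p : MvPolynomial V ℚ) : L.δ (rename β p) = 0 := by
  refine L.δ_eq ?_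
  rw [L.ε_rename]
  simp

theorem δ_rename_mul (p : MvPolynomial V ℚ) (h : MvPolynomial U ℚ) :
    L.δ (rename β p * h) = rename β p * L.δ h := by
  rw [L.δ_mul, L.δ_rename]
  ring

theorem δ_deg {n : ℤ} {h : MvPolynomial U ℚ} (hh : IsWeightedHomogeneous (qWeight U) h n) :
    IsWeightedHomogeneous (qWeight U) (L.δ h) (n - 2) := by
  -- Homogeneity of the polynomial itself is carried along, because the product rule brings in its
  -- retraction, whose degree must be known.
  refine wh_induction (P := fun n p => IsWeightedHomogeneous (qWeight U) (L.δ p) (n - 2) ∧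
    IsWeightedHomogeneous (qWeight U) p n) ?_ ?_ ?_ ?_ hh |>.1
  · intro n
    rw [map_zero]
    exact ⟨isWeightedHomogeneous_zero _ _ _, isWeightedHomogeneous_zero _ _ _⟩
  · intro n p q h1 h2
    rw [map_add]
    exact ⟨h1.1.add h2.1, h1.2.add h2.2⟩
  · intro r
    rw [show (C r : MvPolynomial U ℚ) = rename β (C r) from (rename_C _ _).symm, L.δ_rename,
      rename_C]
    exact ⟨isWeightedHomogeneous_zero _ _ _, isWeightedHomogeneous_C _ _⟩
  · intro n p u h1
    have hX : L.δ (X u) = C (L.coeff u) := by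
      refine L.δ_eq ?_
      rw [show L.ε (X u) = L.ρ u from aeval_X _ _]
      linear_combination - L.coeff_spec u
    rw [mul_comm p, L.δ_mul, hX]
    have hu := isWeightedHomogeneous_X ℚ (qWeight U) u
    refine ⟨Submodule.add_mem (weightedHomogeneousSubmodule ℚ (qWeight U) _) ?_ ?_, ?_⟩
    · rw [show n + 2 - 2 = 2 + (n - 2) by ring]
      exact hu.mul h1.1
    · rw [show n + 2 - 2 = 0 + n by ring]
      exact (isWeightedHomogeneous_C (qWeight U) _).mul
        (isGraded_rename β _ _ (L.ε_graded _ _ h1.2))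
    · rw [add_comm]
      exact hu.mul h1.2

theorem ε_cell {d : ℤ} {P : Prop} {y : MvPolynomial U ℚ} (h : y ∈ cell U d P) :
    L.ε y ∈ cell V d P :=
  ⟨L.ε_graded _ _ h.1, fun h0 => h.2 fun h1 => h0 (by rw [h1, map_zero])⟩

theorem rename_cell (β : V → U) {d : ℤ} {P : Prop} {y : MvPolynomial V ℚ} (h : y ∈ cell V d P) :
    rename β y ∈ cell U d P :=
  ⟨isGraded_rename β _ _ h.1, fun h0 => h.2 fun h1 => h0 (by rw [h1, map_zero])⟩

theorem δ_cell {d d' : ℤ} {P P' : Prop} {y : MvPolynomial U ℚ} (h : y ∈ cell U d P)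
    (hd : d - 2 = d') (hP : P → P') : L.δ y ∈ cell U d' P' := by
  subst hd
  exact ⟨L.δ_deg h.1, fun h0 => hP (h.2 fun h1 => h0 (by rw [h1, map_zero]))⟩

theorem δ_sum {ι : Type} [Fintype ι] (M x : ι → MvPolynomial U ℚ) :
    L.δ (∑ i, M i * x i) = ∑ i, M i * L.δ (x i) + ∑ i, L.δ (M i) * rename β (L.ε (x i)) := by
  rw [map_sum, ← Finset.sum_add_distrib]
  exact Finset.sum_congr rfl fun i _ => L.δ_mul _ _

theorem spec_sum {ι : Type} [Fintype ι] (M x : ι → MvPolynomial U ℚ) :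
    ∑ i, M i * x i = ∑ i, rename β (L.ε (M i)) * x i + L.ξ * ∑ i, L.δ (M i) * x i := by
  rw [Finset.mul_sum, ← Finset.sum_add_distrib]
  refine Finset.sum_congr rfl fun i _ => ?_
  linear_combination x i * L.spec (M i)

/-- Applied to `d_g² = 0` and to `d_g d_c = d_c d_g`, this yields the identities that make the
inclusion of the reduced complex a morphism. -/
theorem δ_matrix_mul {ι : Type} [Fintype ι] (M N : Matrix ι ι (MvPolynomial U ℚ)) :
    (M * N).map L.δ = M * N.map L.δ + M.map L.δ * (N.map L.ε).map (rename β) := by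
  ext1 i j
  exact L.δ_sum (M i) (fun k => N k j)

end Elimination

end Eliminate

/-! ### Tensor products with the Koszul complex of one element -/

section Koszul

variable {V U : Type}

theorem tensor_dgMap (C E : Bicomplex V) (x : C.ι × E.ι → MvPolynomial V ℚ) (i : C.ι) (e : E.ι) :
    (C.tensor E).dgMap x (i, e) =
      C.dgMap (fun c => x (c, e)) i + sg (C.a i) • E.dgMap (fun e' => x (i, e')) e :=
  tensor_dg_apply C E x i e

theorem tensor_dcMap (C E : Bicomplex V) (x : C.ι × E.ι → MvPolynomial V ℚ) (i : C.ι) (e : E.ι) :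
    (C.tensor E).dcMap x (i, e) =
      C.dcMap (fun c => x (c, e)) i + sg (C.t i) • E.dcMap (fun e' => x (i, e')) e :=
  tensor_dc_apply C E x i e

variable (ξ : MvPolynomial U ℚ) {n : ℤ} (hξ : IsWeightedHomogeneous (qWeight U) ξ n)

theorem koszul1_dg_zero (y : Fin 2 → MvPolynomial U ℚ) :
    (koszul1 ξ n hξ).dgMap y (0 : Fin 2) = ξ * y 1 := by
  refine (Fin.sum_univ_two fun j : Fin 2 => !![0, ξ; 0, 0] 0 j * y j).trans ?_
  simp

theorem koszul1_dg_one (y : Fin 2 → MvPolynomial U ℚ) :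
    (koszul1 ξ n hξ).dgMap y (1 : Fin 2) = 0 := by
  refine (Fin.sum_univ_two fun j : Fin 2 => !![0, ξ; 0, 0] 1 j * y j).trans ?_
  simp

theorem koszul1_dc (y : Fin 2 → MvPolynomial U ℚ) (i : Fin 2) :
    (koszul1 ξ n hξ).dcMap y i = 0 := by
  refine (Fin.sum_univ_two fun j : Fin 2 => (0 : MvPolynomial U ℚ) * y j).trans ?_
  simp

variable (C : Bicomplex U) (x : Fin 2 × C.ι → MvPolynomial U ℚ)

theorem koszul_tensor_dg_zero (c : C.ι) :
    ((koszul1 ξ n hξ).tensor C).dgMap x ((0 : Fin 2), c) =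
      ξ * x (1, c) + C.dgMap (fun c' => x (0, c')) c := by
  have h1 := koszul1_dg_zero ξ hξ (fun i => x (i, c))
  have h2 : sg 0 • C.dgMap (fun c' => x (0, c')) c = C.dgMap (fun c' => x (0, c')) c := by
    rw [sg_zero, one_smul]
  exact (tensor_dgMap (koszul1 ξ n hξ) C x (0 : Fin 2) c).trans (congrArg₂ (· + ·) h1 h2)

theorem koszul_tensor_dg_one (c : C.ι) :
    ((koszul1 ξ n hξ).tensor C).dgMap x ((1 : Fin 2), c) = - C.dgMap (fun c' => x (1, c')) c := by
  have h1 := koszul1_dg_one ξ hξ (fun i => x (i, c))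
  have h2 : sg 1 • C.dgMap (fun c' => x (1, c')) c = - C.dgMap (fun c' => x (1, c')) c := by
    rw [sg_one, neg_one_smul]
  exact ((tensor_dgMap (koszul1 ξ n hξ) C x (1 : Fin 2) c).trans
    (congrArg₂ (· + ·) h1 h2)).trans (zero_add _)

theorem koszul_tensor_dc (i : Fin 2) (c : C.ι) :
    ((koszul1 ξ n hξ).tensor C).dcMap x (i, c) = C.dcMap (fun c' => x (i, c')) c := by
  have h1 := koszul1_dc ξ hξ (fun i => x (i, c)) i
  have h2 : sg 0 • C.dcMap (fun c' => x (i, c')) c = C.dcMap (fun c' => x (i, c')) c := by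
    rw [sg_zero, one_smul]
  exact ((tensor_dcMap (koszul1 ξ n hξ) C x i c).trans
    (congrArg₂ (· + ·) h1 h2)).trans (zero_add _)

end Koszul

end KR


namespace KR

open MvPolynomial

/-! ### Elimination of a linear Koszul factor up to homotopy -/

section EliminateKoszul

variable {V U : Type} {β : V → U} (L : Elimination β)

namespace Elimination

variable {ι : Type} [Fintype ι]

theorem rename_mulVec (β : V → U) (M : Matrix ι ι (MvPolynomial V ℚ)) (y : ι → MvPolynomial V ℚ) :
    (fun i => rename β (M.mulVec y i)) = (M.map (rename β)).mulVec fun i => rename β (y i) := by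
  ext1 i
  simp [Matrix.mulVec, dotProduct]

theorem ε_mulVec (M : Matrix ι ι (MvPolynomial U ℚ)) (x : ι → MvPolynomial U ℚ) :
    (fun i => L.ε (M.mulVec x i)) = (M.map L.ε).mulVec fun i => L.ε (x i) := by
  ext1 i
  simp [Matrix.mulVec, dotProduct]

theorem δ_mulVec (M : Matrix ι ι (MvPolynomial U ℚ)) (x : ι → MvPolynomial U ℚ) :
    (fun i => L.δ (M.mulVec x i)) = (M.mulVec fun i => L.δ (x i)) +
      (M.map L.δ).mulVec fun i => rename β (L.ε (x i)) :=
  funext fun i => L.δ_sum (M i) x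

theorem spec_mulVec (M : Matrix ι ι (MvPolynomial U ℚ)) (x : ι → MvPolynomial U ℚ) :
    M.mulVec x = ((M.map L.ε).map (rename β)).mulVec x + L.ξ • (M.map L.δ).mulVec x :=
  funext fun i => L.spec_sum (M i) x

end Elimination

open Elimination

/-- The Koszul complex of a linear polynomial, tensored with a bicomplex. -/
noncomputable abbrev Elimination.source (C : Bicomplex U) : Bicomplex U :=
  (koszul1 L.ξ 2 L.ξ_deg).tensor C

/-- The bicomplex over the ring where the linear polynomial is divided out. -/
noncomputable abbrev Elimination.target (C : Bicomplex U) : Bicomplex V := C.map L.ε L.ε_graded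

/-- The linear map with prescribed components in the two parts of the tensor product. -/
noncomputable def pairMap {ι M : Type} [AddCommGroup M] [Module ℚ M] (f₀ f₁ :
    M →ₗ[ℚ] ι → MvPolynomial U ℚ) :
    M →ₗ[ℚ] Fin 2 × ι → MvPolynomial U ℚ where
  toFun y b := if b.1 = 0 then f₀ y b.2 else f₁ y b.2
  map_add' x y := by
    ext1 b
    by_cases h : b.1 = 0 <;> simp [h]
  map_smul' r x := by
    ext1 b
    by_cases h : b.1 = 0 <;> simp [h]

theorem pair_ext {ι R : Type} {x y : Fin 2 × ι → R} (h0 : ∀ c, x (0, c) = y (0, c))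
    (h1 : ∀ c, x (1, c) = y (1, c)) : x = y := by
  ext1 ⟨i, c⟩
  fin_cases i
  · exact h0 c
  · exact h1 c

theorem pair_forall {ι : Type} {P : Fin 2 × ι → Prop} (h0 : ∀ c, P (0, c)) (h1 : ∀ c, P (1, c)) :
    ∀ b, P b := by
  rintro ⟨i, c⟩
  fin_cases i
  · exact h0 c
  · exact h1 c

/-- A linear operator applied to each coefficient. -/
noncomputable def coeffwise (ι : Type) (f : MvPolynomial V ℚ →ₗ[ℚ] MvPolynomial U ℚ) :
    (ι → MvPolynomial V ℚ) →ₗ[ℚ] ι → MvPolynomial U ℚ where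
  toFun x i := f (x i)
  map_add' _ _ := funext fun _ => map_add f _ _
  map_smul' _ _ := funext fun _ => map_smul f _ _

/-- A matrix as a linear map. -/
noncomputable def matrixMap {ι : Type} [Fintype ι] (M : Matrix ι ι (MvPolynomial U ℚ)) :
    (ι → MvPolynomial U ℚ) →ₗ[ℚ] ι → MvPolynomial U ℚ :=
  (Matrix.mulVecLin M).restrictScalars ℚ

/-- The coefficients in the first part of the tensor product. -/
noncomputable def firstPart (ι : Type) :
    (Fin 2 × ι → MvPolynomial U ℚ) →ₗ[ℚ] ι → MvPolynomial U ℚ :=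
  LinearMap.funLeft ℚ _ fun c => (0, c)

/-- The projection. -/
noncomputable def Elimination.proj (C : Bicomplex U) : (L.source C).Mod →ₗ[ℚ] (L.target C).Mod :=
  coeffwise C.ι L.ε.toLinearMap ∘ₗ firstPart C.ι

/-- The inclusion. -/
noncomputable def Elimination.incl (C : Bicomplex U) : (L.target C).Mod →ₗ[ℚ] (L.source C).Mod :=
  pairMap (coeffwise C.ι (rename β).toLinearMap)
    (-(matrixMap (C.dg.map L.δ) ∘ₗ coeffwise C.ι (rename β).toLinearMap))

/-- The homotopy by which the inclusion commutes with `d_c`. -/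
noncomputable def Elimination.inclHomotopy (C : Bicomplex U) :
    (L.target C).Mod →ₗ[ℚ] (L.source C).Mod :=
  pairMap 0 (-(matrixMap (C.dc.map L.δ) ∘ₗ coeffwise C.ι (rename β).toLinearMap))

/-- The contraction onto the image of the inclusion. -/
noncomputable def Elimination.contraction (C : Bicomplex U) :
    (L.source C).Mod →ₗ[ℚ] (L.source C).Mod :=
  pairMap 0 (-(coeffwise C.ι L.δ ∘ₗ firstPart C.ι))

/-- Reduction modulo `ξ` kills the Koszul part of `d_g` and is a ring homomorphism on all matrix
entries, so the projection commutes strictly with both differentials. -/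
theorem Elimination.proj_isMorphism (C : Bicomplex U) : IsMorphism β id (L.proj C) := by
  refine ⟨?_, ?_, ?_, 0, EdgeLinear.zero, HasDegree.zero, ?_⟩
  · intro p (x : Fin 2 × C.ι → MvPolynomial U ℚ)
    ext1 c
    change L.ε (rename β p * x (0, c)) = rename id p * L.ε (x (0, c))
    rw [map_mul, L.ε_rename, rename_id_apply]
  · intro i j k x hx c
    refine L.ε_cell (cell.mono (hx ((0 : Fin 2), c)) ?_ ?_)
    · change i - (0 + C.q c) = i - C.q c
      ring
    · change 0 + C.a c = j ∧ 0 + C.t c = k → C.a c = j + 0 ∧ C.t c = k + 0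
      omega
  · refine LinearMap.ext fun (x : Fin 2 × C.ι → MvPolynomial U ℚ) => funext fun (c : C.ι) => ?_
    refine (congrArg L.ε (koszul_tensor_dg_zero L.ξ L.ξ_deg C x c)).trans ?_
    rw [map_add, map_mul, L.ε_ξ, zero_mul, zero_add]
    exact congrFun (L.ε_mulVec C.dg fun c => x (0, c)) c
  · rw [LinearMap.comp_zero, LinearMap.zero_comp, add_zero, sub_eq_zero]
    refine LinearMap.ext fun (x : Fin 2 × C.ι → MvPolynomial U ℚ) => funext fun (c : C.ι) => ?_
    refine (congrArg L.ε (koszul_tensor_dc L.ξ L.ξ_deg C x 0 c)).trans ?_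
    exact congrFun (L.ε_mulVec C.dc fun c => x (0, c)) c

/-- Lifting coefficients by `rename β` misses `d_g` by `ξ δ(d_g)`; the component `-δ(d_g)` in the
second part makes up for this through the Koszul differential. The analogous error `ξ δ(d_c)` is a
`d_g`-boundary, so `d_c` is respected only up to `inclHomotopy`. Here equivalence in the homotopy
category, and not strict isomorphism, is needed. -/
theorem Elimination.incl_isMorphism (C : Bicomplex U) : IsMorphism id β (L.incl C) := by
  -- The twisted product rule applied to `d_g² = 0`, and below to `d_g d_c = d_c d_g`.
  have hg : C.dg * C.dg.map L.δ + C.dg.map L.δ * (C.dg.map L.ε).map (rename β) = 0 := by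
    rw [← L.δ_matrix_mul, C.dg_dg]
    ext1 i j
    exact map_zero L.δ
  have hgc : C.dg * C.dc.map L.δ + C.dg.map L.δ * (C.dc.map L.ε).map (rename β) =
      C.dc * C.dg.map L.δ + C.dc.map L.δ * (C.dg.map L.ε).map (rename β) := by
    rw [← L.δ_matrix_mul, ← L.δ_matrix_mul, C.dg_dc]
  have lin : ∀ (M : Matrix C.ι C.ι (MvPolynomial U ℚ)) (p : MvPolynomial V ℚ)
      (x : C.ι → MvPolynomial V ℚ) (c : C.ι), -M.mulVec (fun c => rename β (rename id p * x c)) c =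
      rename β p * -M.mulVec (fun c => rename β (x c)) c := by
    intro M p x c
    simp only [rename_id_apply, map_mul]
    rw [mul_neg]
    exact congrArg (- ·) (congrFun (Matrix.mulVec_smul M (rename β p) fun c => rename β (x c)) c)
  -- Entries of `δ M` have degree two less than those of `M`, which is compensated by the degree 2
  -- of the Koszul generator.
  have deg : ∀ (M : Matrix C.ι C.ι (MvPolynomial U ℚ))
      (_ : ∀ c c', IsWeightedHomogeneous (qWeight U) (M c c') (C.q c' - C.q c)) (P Q : C.ι → Prop)
      (_ : ∀ c c', M c c' ≠ 0 → Q c' → P c)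
      (i : ℤ) (x : C.ι → MvPolynomial V ℚ) (_ : ∀ c, x c ∈ cell V (i - C.q c) (Q c)) (c : C.ι),
      -(M.map L.δ).mulVec (fun c => rename β (x c)) c ∈ cell U (i - (2 + C.q c)) (P c) := by
    intro M hM P Q hP i x hx c
    refine Submodule.neg_mem _ (Submodule.sum_mem _ fun c' _ => ?_)
    have h1 : M c c' = 0 ∨ M c c' ≠ 0 := em _
    rcases h1 with h1 | h1
    · change L.δ (M c c') * _ ∈ _
      rw [h1, map_zero, zero_mul]
      exact Submodule.zero_mem _
    · exact cell.mono (cell.mul (L.δ_deg (hM c c')) (rename_cell β (hx c'))) (by ring)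
        (hP c c' h1)
  refine ⟨?_, ?_, ?_, L.inclHomotopy C, ?_, ?_, ?_⟩
  · intro p x
    refine pair_ext (fun c => ?_) fun c => lin _ p x c
    change rename β (rename id p * x c) = rename β p * rename β (x c)
    rw [rename_id_apply, map_mul]
  · intro i j k x hx
    refine pair_forall (fun c => cell.mono (rename_cell β (hx c)) ?_ ?_)
      (fun c => deg C.dg C.dg_q (fun c => 1 + C.a c = j + 0 ∧ 0 + C.t c = k + 0) _ ?_ i x hx c)
    · change i - C.q c = i - (0 + C.q c)
      ring
    · change C.a c = j ∧ C.t c = k → 0 + C.a c = j + 0 ∧ 0 + C.t c = k + 0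
      omega
    · intro c c' h0
      have := C.dg_at c c' h0
      change C.a c' = j ∧ C.t c' = k → 1 + C.a c = j + 0 ∧ 0 + C.t c = k + 0
      omega
  · refine LinearMap.ext fun (y : C.ι → MvPolynomial V ℚ) => ?_
    refine pair_ext (fun c => ?_) fun c => ?_
    · refine Eq.trans ?_ (koszul_tensor_dg_zero L.ξ L.ξ_deg C (L.incl C y) c).symm
      refine (congrFun (rename_mulVec β (C.dg.map L.ε) y) c).trans ?_
      have := congrFun (L.spec_mulVec C.dg fun c => rename β (y c)) c
      change _ = L.ξ * -(C.dg.map L.δ).mulVec (fun c => rename β (y c)) c +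
        C.dg.mulVec (fun c => rename β (y c)) c
      rw [this, mul_neg]
      change _ = _ + (_ + L.ξ * _)
      ring
    · refine Eq.trans ?_ (koszul_tensor_dg_one L.ξ L.ξ_deg C (L.incl C y) c).symm
      change -(C.dg.map L.δ).mulVec (fun c => rename β ((C.dg.map L.ε).mulVec y c)) c =
        -C.dg.mulVec (-(C.dg.map L.δ).mulVec (fun c => rename β (y c))) c
      rw [rename_mulVec, Matrix.mulVec_mulVec, Matrix.mulVec_neg, Matrix.mulVec_mulVec]
      have := congrFun (congrArg (fun M => M.mulVec fun c => rename β (y c)) hg) c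
      simp only [Matrix.add_mulVec, Matrix.zero_mulVec, Pi.add_apply, Pi.zero_apply] at this
      rw [Pi.neg_apply]
      linear_combination -this
  · intro p x
    refine pair_ext (fun c => ?_) fun c => lin _ p x c
    exact (mul_zero _).symm
  · intro i j k x hx
    refine pair_forall (fun c => Submodule.zero_mem (cell U _ _))
      (fun c => deg C.dc C.dc_q (fun c => 1 + C.a c = j + 1 ∧ 0 + C.t c = k + 1) _ ?_ i x hx c)
    intro c c' h0
    have := C.dc_at c c' h0
    change C.a c' = j ∧ C.t c' = k → 1 + C.a c = j + 1 ∧ 0 + C.t c = k + 1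
    omega
  · refine LinearMap.ext fun (y : C.ι → MvPolynomial V ℚ) => ?_
    refine pair_ext (fun c => ?_) fun c => ?_
    · have h1 := koszul_tensor_dc L.ξ L.ξ_deg C (L.incl C y) 0 c
      have h2 := koszul_tensor_dg_zero L.ξ L.ξ_deg C (L.inclHomotopy C y) c
      refine (congrArg (_ - ·) h1).trans (Eq.trans ?_ (congrArg (· + _) h2).symm)
      change rename β ((C.dc.map L.ε).mulVec y c) - C.dc.mulVec (fun c => rename β (y c)) c =
        L.ξ * -(C.dc.map L.δ).mulVec (fun c => rename β (y c)) c +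
          C.dg.mulVec (0 : C.ι → MvPolynomial U ℚ) c + 0
      have h3 := congrFun (rename_mulVec β (C.dc.map L.ε) y) c
      have h4 := congrFun (L.spec_mulVec C.dc fun c => rename β (y c)) c
      rw [h3, h4, Matrix.mulVec_zero, Pi.zero_apply]
      change _ - (_ + L.ξ * _) = _
      ring
    · have h1 := koszul_tensor_dc L.ξ L.ξ_deg C (L.incl C y) 1 c
      have h2 := koszul_tensor_dg_one L.ξ L.ξ_deg C (L.inclHomotopy C y) c
      refine (congrArg (_ - ·) h1).trans (Eq.trans ?_ (congrArg (· + _) h2).symm)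
      change -(C.dg.map L.δ).mulVec (fun c => rename β ((C.dc.map L.ε).mulVec y c)) c -
          C.dc.mulVec (-(C.dg.map L.δ).mulVec (fun c => rename β (y c))) c =
        -C.dg.mulVec (-(C.dc.map L.δ).mulVec (fun c => rename β (y c))) c +
          -(C.dc.map L.δ).mulVec (fun c => rename β ((C.dg.map L.ε).mulVec y c)) c
      rw [rename_mulVec, rename_mulVec, Matrix.mulVec_mulVec, Matrix.mulVec_neg,
        Matrix.mulVec_mulVec, Matrix.mulVec_neg, Matrix.mulVec_mulVec, Matrix.mulVec_mulVec]
      have := congrFun (congrArg (fun M => M.mulVec fun c => rename β (y c)) hgc) c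
      simp only [Matrix.add_mulVec, Pi.add_apply] at this
      rw [Pi.neg_apply, Pi.neg_apply]
      linear_combination -this

/-- The identity `h = ε h + ξ δ h` says that `-δ`, from the first part to the second, contracts the
complex for `d_g` onto the image of the inclusion. No homotopy for `d_c` is involved. -/
theorem Elimination.incl_proj (C : Bicomplex U) : HomotopicToId β (L.incl C ∘ₗ L.proj C) := by
  refine ⟨0, L.contraction C, EdgeLinear.zero, HasDegree.zero, by simp, ?_, ?_, ?_⟩
  · intro p (x : Fin 2 × C.ι → MvPolynomial U ℚ)
    refine pair_ext (fun c => ?_) fun c => ?_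
    · exact (mul_zero _).symm
    · change -L.δ (rename β p * x (0, c)) = rename β p * -L.δ (x (0, c))
      rw [L.δ_rename_mul, mul_neg]
  · intro i j k x hx
    refine pair_forall (fun c => Submodule.zero_mem (cell U _ _)) fun c => ?_
    refine Submodule.neg_mem _ (L.δ_cell (hx ((0 : Fin 2), c)) ?_ ?_)
    · change i - (0 + C.q c) - 2 = i - (2 + C.q c)
      ring
    · change 0 + C.a c = j ∧ 0 + C.t c = k → 1 + C.a c = j + 1 ∧ 0 + C.t c = k + 0
      omega
  · rw [LinearMap.comp_zero, LinearMap.zero_comp, add_zero, zero_add]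
    refine LinearMap.ext fun (x : Fin 2 × C.ι → MvPolynomial U ℚ) => ?_
    refine pair_ext (fun c => ?_) fun c => ?_
    · have h1 := koszul_tensor_dg_zero L.ξ L.ξ_deg C (L.contraction C x) c
      refine Eq.trans ?_ (congrArg (· + _) h1).symm
      change rename β (L.ε (x (0, c))) - x (0, c) = L.ξ * -L.δ (x (0, c)) +
        C.dg.mulVec (0 : C.ι → MvPolynomial U ℚ) c + 0
      rw [Matrix.mulVec_zero, Pi.zero_apply]
      linear_combination - L.spec (x (0, c))
    · have h1 := koszul_tensor_dg_one L.ξ L.ξ_deg C (L.contraction C x) c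
      have h2 : L.contraction C ((L.source C).dgMap x) ((1 : Fin 2), c) =
          - L.δ (L.ξ * x (1, c) + C.dgMap (fun c' => x (0, c')) c) :=
        congrArg (fun p => - L.δ p) (koszul_tensor_dg_zero L.ξ L.ξ_deg C x c)
      have h3 := congrFun (L.δ_mulVec C.dg fun c => x (0, c)) c
      have h4 : -(C.dg.map L.δ).mulVec (fun c => rename β (L.ε (x (0, c)))) c - x (1, c) =
          - C.dgMap (fun c' => L.contraction C x ((1 : Fin 2), c')) c +
          - L.δ (L.ξ * x (1, c) + C.dgMap (fun c' => x (0, c')) c) := by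
        rw [map_add, L.δ_ξ_mul]
        change _ = -C.dg.mulVec (-fun c => L.δ (x (0, c))) c +
            -(x (1, c) + L.δ (C.dg.mulVec (fun c => x (0, c)) c))
        rw [h3, Matrix.mulVec_neg, Pi.neg_apply, Pi.add_apply]
        ring
      exact h4.trans (congrArg₂ (· + ·) h1 h2).symm

theorem HomotopicToId.of_forall {W B : Type} {γ : B → W} {D : Bicomplex W} {f : D.Mod →ₗ[ℚ] D.Mod}
    (h : ∀ x, f x = x) : HomotopicToId γ f := by
  have h' : f = LinearMap.id := LinearMap.ext h
  rw [h']
  exact ⟨0, 0, EdgeLinear.zero, HasDegree.zero, by simp, EdgeLinear.zero, HasDegree.zero, by simp⟩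

theorem Elimination.proj_incl_apply (C : Bicomplex U) (y : C.ι → MvPolynomial V ℚ) :
    L.proj C (L.incl C y) = y := by
  funext (c : C.ι)
  exact L.ε_rename (y c)

theorem Elimination.proj_incl (C : Bicomplex U) : HomotopicToId id (L.proj C ∘ₗ L.incl C) :=
  HomotopicToId.of_forall (L.proj_incl_apply C)

/-- Elimination of a variable by a linear Koszul factor. -/
theorem Elimination.equivalent (C : Bicomplex U) :
    HomotopyEquivalent β id (L.source C) (L.target C) :=
  ⟨L.proj C, L.incl C, L.proj_isMorphism C, L.incl_isMorphism C, L.incl_proj C, L.proj_incl C⟩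

end EliminateKoszul

end KR


namespace KR

open MvPolynomial

section Formulas

variable {V U : Type}

/-! ## Bicomplexes given by explicit formulas -/

theorem cell.move {i q q' a a' t t' j k : ℤ} {y : MvPolynomial V ℚ} {m n : ℤ}
    (h : y ∈ cell V (i - q) (a = j ∧ t = k)) (hq : q' = q) (ha : a' = a + m) (ht : t' = t + n) :
    y ∈ cell V (i - q') (a' = j + m ∧ t' = k + n) :=
  cell.mono h (by rw [hq]) (by omega)

theorem cell.place {i q q' a a' t t' j k : ℤ} {y : MvPolynomial V ℚ}
    (h : y ∈ cell V (i - q) (a = j ∧ t = k)) (hq : q' = q) (ha : a' = a) (ht : t' = t) :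
    y ∈ cell V (i - q') (a' = j + 0 ∧ t' = k + 0) :=
  cell.mono h (by rw [hq]) (by omega)

theorem cell.neg_place {i q q' a a' t t' j k : ℤ} {y : MvPolynomial V ℚ}
    (h : y ∈ cell V (i - q) (a = j ∧ t = k)) (hq : q' = q) (ha : a' = a) (ht : t' = t) :
    -y ∈ cell V (i - q') (a' = j + 0 ∧ t' = k + 0) :=
  Submodule.neg_mem _ (cell.place h hq ha ht)

/-- The differentials and the signs of a bicomplex are given by formulas. -/
structure Bicomplex.HasFormula (C : Bicomplex V) (dg dc : C.Mod → C.Mod)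
    (s τ : C.ι → MvPolynomial V ℚ) : Prop where
  dg_eq : ∀ x, C.dgMap x = dg x
  dc_eq : ∀ x, C.dcMap x = dc x
  sgn_a : ∀ i, MvPolynomial.C (sg (C.a i)) = s i
  sgn_t : ∀ i, MvPolynomial.C (sg (C.t i)) = τ i

/-- The formula for a differential of a tensor product. -/
def tensorFormula {R ι κ : Type} [CommRing R] (d : (ι → R) → ι → R) (s : ι → R)
    (d' : (κ → R) → κ → R) (x : ι × κ → R) (b : ι × κ) : R :=
  d (fun c => x (c, b.2)) b.1 + s b.1 * d' (fun c => x (b.1, c)) b.2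

theorem Bicomplex.HasFormula.tensor {C D : Bicomplex V} {dg dc : C.Mod → C.Mod}
    {s τ : C.ι → MvPolynomial V ℚ} {dg' dc' : D.Mod → D.Mod} {s' τ' : D.ι → MvPolynomial V ℚ}
    (h : C.HasFormula dg dc s τ) (h' : D.HasFormula dg' dc' s' τ') :
    (C.tensor D).HasFormula (tensorFormula dg s dg') (tensorFormula dc τ dc')
      (fun b => s b.1 * s' b.2) (fun b => τ b.1 * τ' b.2) := by
  refine ⟨fun (x : C.ι × D.ι → _) => funext fun (b : C.ι × D.ι) => ?_,
    fun (x : C.ι × D.ι → _) => funext fun (b : C.ι × D.ι) => ?_, fun (b : C.ι × D.ι) => ?_,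
    fun (b : C.ι × D.ι) => ?_⟩
  · refine (tensor_dgMap C D x b.1 b.2).trans ?_
    rw [h.dg_eq, h'.dg_eq, tensorFormula, ← h.sgn_a, smul_eq_C_mul]
  · refine (tensor_dcMap C D x b.1 b.2).trans ?_
    rw [h.dc_eq, h'.dc_eq, tensorFormula, ← h.sgn_t, smul_eq_C_mul]
  · rw [← h.sgn_a, ← h'.sgn_a, ← C_mul, ← sg_add]
    rfl
  · rw [← h.sgn_t, ← h'.sgn_t, ← C_mul, ← sg_add]
    rfl

/-- Mutually inverse maps over the total ring that commute with both differentials. -/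
theorem Equivalent.ofFormula {C D : Bicomplex V} {dg dc : C.Mod → C.Mod}
    {s τ : C.ι → MvPolynomial V ℚ} {dg' dc' : D.Mod → D.Mod} {s' τ' : D.ι → MvPolynomial V ℚ}
    (h : C.HasFormula dg dc s τ) (h' : D.HasFormula dg' dc' s' τ')
    (f : C.Mod →ₗ[MvPolynomial V ℚ] D.Mod) (g : D.Mod →ₗ[MvPolynomial V ℚ] C.Mod)
    (deg_f : HasDegree 0 0 (f.restrictScalars ℚ)) (deg_g : HasDegree 0 0 (g.restrictScalars ℚ))
    (hgf : ∀ x, g (f x) = x) (hfg : ∀ x, f (g x) = x) (cg : ∀ x, f (dg x) = dg' (f x))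
    (cc : ∀ x, f (dc x) = dc' (f x)) : Equivalent C D := by
  refine HomotopyEquivalent.ofIso (f.restrictScalars ℚ) (g.restrictScalars ℚ)
    (fun p x => ?_) (fun p x => ?_) deg_f deg_g hgf hfg ?_ 0 EdgeLinear.zero HasDegree.zero fun x =>
        ?_
  · rw [rename_id_apply]
    exact map_smul f p x
  · rw [rename_id_apply]
    exact map_smul g p x
  · intro x
    rw [h.dg_eq, h'.dg_eq]
    exact cg x
  · rw [LinearMap.zero_apply, map_zero, LinearMap.zero_apply, add_zero, sub_eq_zero,
      h.dc_eq, h'.dc_eq]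
    exact cc x

theorem C_sg_even {n : ℤ} (h : Even n) : (C (sg n) : MvPolynomial V ℚ) = 1 := by
  simp [sg, h]

theorem C_sg_odd {n : ℤ} (h : ¬ Even n) : (C (sg n) : MvPolynomial V ℚ) = -1 := by
  simp [sg, h]

theorem forall_fin_four {P : Fin 4 → Prop} (h0 : P 0) (h1 : P 1) (h2 : P 2) (h3 : P 3) :
    ∀ i, P i := by
  intro i
  fin_cases i
  · exact h0
  · exact h1
  · exact h2
  · exact h3

theorem forall_fin_two {P : Fin 2 → Prop} (h0 : P 0) (h1 : P 1) : ∀ i, P i := by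
  intro i
  fin_cases i
  · exact h0
  · exact h1

/-- The differential of `[p]`. -/
noncomputable def koszul1Dg (p : MvPolynomial V ℚ) (x : Fin 2 → MvPolynomial V ℚ) :
    Fin 2 → MvPolynomial V ℚ
  | 0 => p * x 1
  | 1 => 0

/-- The signs of the basis elements of `[p]`. -/
noncomputable def koszul1Sign (V : Type) : Fin 2 → MvPolynomial V ℚ
  | 0 => 1
  | 1 => -1

/-- The differential of `[p₁, p₂]`. -/
noncomputable def koszul2Dg (p₁ p₂ : MvPolynomial V ℚ) (x : Fin 4 → MvPolynomial V ℚ) :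
    Fin 4 → MvPolynomial V ℚ
  | 0 => -p₂ * x 1 + p₁ * x 2
  | 1 => p₁ * x 3
  | 2 => p₂ * x 3
  | 3 => 0

/-- The signs of the basis elements of `[p₁, p₂]`. -/
noncomputable def koszul2Sign (V : Type) : Fin 4 → MvPolynomial V ℚ
  | 0 => 1
  | 1 => -1
  | 2 => -1
  | 3 => 1

variable {p₁ p₂ : MvPolynomial V ℚ} {n₁ n₂ : ℤ} (h₁ : IsWeightedHomogeneous (qWeight V) p₁ n₁)
  (h₂ : IsWeightedHomogeneous (qWeight V) p₂ n₂)

theorem koszul1_formula : (koszul1 p₁ n₁ h₁).HasFormula (koszul1Dg p₁) (fun _ => 0)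
    (koszul1Sign V) (fun _ => 1) := by
  refine ⟨fun x => funext ?_, fun x => funext ?_, ?_, fun i => C_sg_even (n := 0) (by decide)⟩
  · exact forall_fin_two (koszul1_dg_zero p₁ h₁ x) (koszul1_dg_one p₁ h₁ x)
  · exact fun i => koszul1_dc p₁ h₁ x i
  · exact forall_fin_two (C_sg_even (n := 0) (by decide)) (C_sg_odd (n := 1) (by decide))

theorem koszul2_dg (x : Fin 4 → MvPolynomial V ℚ) :
    (koszul2 p₁ p₂ n₁ n₂ h₁ h₂).dgMap x = koszul2Dg p₁ p₂ x := by
  have key : ∀ i : Fin 4, (koszul2 p₁ p₂ n₁ n₂ h₁ h₂).dgMap x i = koszulMatrix p₁ p₂ i 0 * x 0 +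
      koszulMatrix p₁ p₂ i 1 * x 1 + koszulMatrix p₁ p₂ i 2 * x 2 + koszulMatrix p₁ p₂ i 3 * x 3 :=
    fun i => Fin.sum_univ_four fun j : Fin 4 => koszulMatrix p₁ p₂ i j * x j
  refine funext (forall_fin_four ?_ ?_ ?_ ?_) <;> refine (key _).trans ?_ <;>
    simp [koszulMatrix, koszul2Dg]

theorem koszul2_formula : (koszul2 p₁ p₂ n₁ n₂ h₁ h₂).HasFormula (koszul2Dg p₁ p₂)
    (fun _ => 0) (koszul2Sign V) (fun _ => 1) := by
  refine ⟨koszul2_dg h₁ h₂, fun (x : Fin 4 → _) => funext fun (i : Fin 4) => ?_, ?_,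
    fun i => C_sg_even (n := 0) (by decide)⟩
  · refine (Fin.sum_univ_four fun j : Fin 4 => (0 : MvPolynomial V ℚ) * x j).trans ?_
    change _ = (0 : MvPolynomial V ℚ)
    ring
  · exact forall_fin_four (C_sg_even (n := 0) (by decide)) (C_sg_odd (n := 1) (by decide))
      (C_sg_odd (n := 1) (by decide)) (C_sg_even (n := 2) (by decide))

/-- A Koszul complex of two elements is a tensor product. -/
theorem Equivalent.koszul2 : Equivalent (koszul2 p₁ p₂ n₁ n₂ h₁ h₂)
    ((koszul1 p₂ n₂ h₂).tensor (koszul1 p₁ n₁ h₁)) := by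
  -- The sign at the basis element 1 converts the convention `-p₂ u + p₁ v` of `koszulMatrix` into
  -- that of the tensor product.
  let f : (Fin 4 → MvPolynomial V ℚ) →ₗ[MvPolynomial V ℚ] (Fin 2 × Fin 2 → MvPolynomial V ℚ) :=
    LinearMap.pi fun
      | (0, 0) => LinearMap.proj 0
      | (0, 1) => LinearMap.proj 2
      | (1, 0) => -LinearMap.proj 1
      | (1, 1) => LinearMap.proj 3
  let g : (Fin 2 × Fin 2 → MvPolynomial V ℚ) →ₗ[MvPolynomial V ℚ] (Fin 4 → MvPolynomial V ℚ) :=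
    LinearMap.pi fun
      | 0 => LinearMap.proj (0, 0)
      | 1 => -LinearMap.proj (1, 0)
      | 2 => LinearMap.proj (0, 1)
      | 3 => LinearMap.proj (1, 1)
  have e1 : n₂ + 0 = n₂ := add_zero _
  have e2 : 0 + n₁ = n₁ := zero_add _
  have e3 : n₂ + n₁ = n₁ + n₂ := add_comm _ _
  refine Equivalent.ofFormula (koszul2_formula h₁ h₂)
    ((koszul1_formula h₂).tensor (koszul1_formula h₁)) f g ?_ ?_ ?_ ?_ ?_ ?_
  · intro i j k x hx
    refine pair_forall (forall_fin_two ?_ ?_) (forall_fin_two ?_ ?_)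
    · exact cell.place (hx (0 : Fin 4)) rfl rfl rfl
    · exact cell.place (hx (2 : Fin 4)) e2 rfl rfl
    · exact (cell.neg_place (hx (1 : Fin 4)) e1 rfl rfl)
    · exact cell.place (hx (3 : Fin 4)) e3 rfl rfl
  · intro i j k x hx
    refine forall_fin_four ?_ ?_ ?_ ?_
    · exact cell.place (hx ((0 : Fin 2), (0 : Fin 2))) rfl rfl rfl
    · exact (cell.neg_place (hx ((1 : Fin 2), (0 : Fin 2))) e1.symm rfl rfl)
    · exact cell.place (hx ((0 : Fin 2), (1 : Fin 2))) e2.symm rfl rfl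
    · exact cell.place (hx ((1 : Fin 2), (1 : Fin 2))) e3.symm rfl rfl
  · exact fun x => funext (forall_fin_four rfl (neg_neg _) rfl rfl)
  · exact fun x => pair_ext (forall_fin_two rfl rfl) (forall_fin_two (neg_neg _) rfl)
  · intro (x : Fin 4 → MvPolynomial V ℚ)
    refine pair_ext (forall_fin_two ?_ ?_) (forall_fin_two ?_ ?_)
    · change -p₂ * x 1 + p₁ * x 2 = p₂ * - x 1 + 1 * (p₁ * x 2)
      ring
    · change p₂ * x 3 = p₂ * x 3 + 1 * 0
      ring
    · change -(p₁ * x 3) = 0 + -1 * (p₁ * x 3)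
      ring
    · change (0 : MvPolynomial V ℚ) = 0 + -1 * 0
      ring
  · intro (x : Fin 4 → MvPolynomial V ℚ)
    have h0 : (0 : MvPolynomial V ℚ) = 0 + 1 * 0 := by ring
    refine pair_ext (forall_fin_two h0 h0) (forall_fin_two ?_ h0)
    exact neg_zero.trans h0

end Formulas

end KR


namespace KR

open MvPolynomial

/-! ### The reduced complexes with four corners -/

section Corners

variable {V : Type}

/-- The basis elements of the reduced complexes of crossings: two in the wide edge and two in the
parallel arcs. -/
inductive Corner
  | w0 | w1 | p0 | p1
  deriving DecidableEq

open Corner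

instance : Fintype Corner := ⟨{w0, w1, p0, p1}, fun x => by cases x <;> decide⟩

theorem Corner.sum {M : Type} [AddCommMonoid M] (f : Corner → M) :
    ∑ i, f i = f w0 + f w1 + f p0 + f p1 := by
  have h : (Finset.univ : Finset Corner) = {w0, w1, p0, p1} := rfl
  rw [h]
  simp [add_assoc]

theorem forall_corner {P : Corner → Prop} (h0 : P w0) (h1 : P w1) (h2 : P p0) (h3 : P p1) :
    ∀ i, P i
  | w0 => h0
  | w1 => h1
  | p0 => h2
  | p1 => h3

/-- The matrix of `d_g` in the reduced complexes. -/
noncomputable def cornerDgMatrix (p ζ : MvPolynomial V ℚ) : Matrix Corner Corner (MvPolynomial V ℚ)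
  | w0, w1 => p * ζ
  | p0, p1 => p
  | _, _ => 0

/-- The differential `d_g` in the reduced complexes. -/
noncomputable def cornerDg (p ζ : MvPolynomial V ℚ) (x : Corner → MvPolynomial V ℚ) :
    Corner → MvPolynomial V ℚ
  | w0 => p * ζ * x w1
  | w1 => 0
  | p0 => p * x p1
  | p1 => 0

theorem cornerDgMatrix_mulVec (p ζ : MvPolynomial V ℚ) (x : Corner → MvPolynomial V ℚ) :
    (cornerDgMatrix p ζ).mulVec x = cornerDg p ζ x := by
  funext i
  refine (Corner.sum _).trans ?_
  cases i <;> simp [cornerDgMatrix, cornerDg]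

/-- The matrix of `d_c` in the reduced complex of a negative crossing. -/
noncomputable def negDcMatrix (ζ : MvPolynomial V ℚ) : Matrix Corner Corner (MvPolynomial V ℚ)
  | p0, w0 => 1
  | p1, w1 => ζ
  | _, _ => 0

/-- The differential `d_c` in the reduced complex of a negative crossing. -/
noncomputable def negDc (ζ : MvPolynomial V ℚ) (x : Corner → MvPolynomial V ℚ) :
    Corner → MvPolynomial V ℚ
  | w0 => 0
  | w1 => 0
  | p0 => x w0
  | p1 => ζ * x w1

theorem negDcMatrix_mulVec (ζ : MvPolynomial V ℚ) (x : Corner → MvPolynomial V ℚ) :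
    (negDcMatrix ζ).mulVec x = negDc ζ x := by
  funext i
  refine (Corner.sum _).trans ?_
  cases i <;> simp [negDcMatrix, negDc]

/-- The matrix of `d_c` in the reduced complex of a positive crossing. -/
noncomputable def posDcMatrix (ζ : MvPolynomial V ℚ) : Matrix Corner Corner (MvPolynomial V ℚ)
  | w0, p0 => ζ
  | w1, p1 => 1
  | _, _ => 0

/-- The differential `d_c` in the reduced complex of a positive crossing. -/
noncomputable def posDc (ζ : MvPolynomial V ℚ) (x : Corner → MvPolynomial V ℚ) :
    Corner → MvPolynomial V ℚ
  | w0 => ζ * x p0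
  | w1 => x p1
  | p0 => 0
  | p1 => 0

theorem posDcMatrix_mulVec (ζ : MvPolynomial V ℚ) (x : Corner → MvPolynomial V ℚ) :
    (posDcMatrix ζ).mulVec x = posDc ζ x := by
  funext i
  refine (Corner.sum _).trans ?_
  cases i <;> simp [posDcMatrix, posDc]

/-- The Hochschild degrees in the reduced complexes. -/
def cornerA : Corner → ℤ
  | w0 => 0
  | w1 => 1
  | p0 => 0
  | p1 => 1

/-- The quantum degrees in the reduced complex of a negative crossing. -/
def negQ : Corner → ℤ
  | w0 => 0
  | w1 => 4
  | p0 => 0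
  | p1 => 2

/-- The homological degrees in the reduced complex of a negative crossing. -/
def negT : Corner → ℤ
  | w0 => -1
  | w1 => -1
  | p0 => 0
  | p1 => 0

/-- The quantum degrees in the reduced complex of a positive crossing. -/
def posQ : Corner → ℤ
  | w0 => -2
  | w1 => 2
  | p0 => 0
  | p1 => 2

/-- The homological degrees in the reduced complex of a positive crossing. -/
def posT : Corner → ℤ
  | w0 => 1
  | w1 => 1
  | p0 => 0
  | p1 => 0

/-- The signs of the basis elements in the reduced complexes with respect to the Hochschild
degree. -/
noncomputable def cornerSignA (V : Type) : Corner → MvPolynomial V ℚ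
  | w0 => 1
  | w1 => -1
  | p0 => 1
  | p1 => -1

/-- The signs of the basis elements in the reduced complexes with respect to the homological
degree. -/
noncomputable def cornerSignT (V : Type) : Corner → MvPolynomial V ℚ
  | w0 => -1
  | w1 => -1
  | p0 => 1
  | p1 => 1

variable (p ζ : MvPolynomial V ℚ)

theorem cornerDgMatrix_sq : cornerDgMatrix p ζ * cornerDgMatrix p ζ = 0 := by
  ext1 i j
  refine (Corner.sum _).trans ?_
  cases i <;> cases j <;> simp [cornerDgMatrix]

theorem negDcMatrix_sq : negDcMatrix ζ * negDcMatrix ζ = 0 := by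
  ext1 i j
  refine (Corner.sum _).trans ?_
  cases i <;> cases j <;> simp [negDcMatrix]

theorem posDcMatrix_sq : posDcMatrix ζ * posDcMatrix ζ = 0 := by
  ext1 i j
  refine (Corner.sum _).trans ?_
  cases i <;> cases j <;> simp [posDcMatrix]

theorem cornerDgMatrix_negDcMatrix :
    cornerDgMatrix p ζ * negDcMatrix ζ = negDcMatrix ζ * cornerDgMatrix p ζ := by
  ext1 i j
  refine (Corner.sum _).trans (Eq.trans ?_ (Corner.sum _).symm)
  cases i <;> cases j <;> simp [cornerDgMatrix, negDcMatrix]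

theorem cornerDgMatrix_posDcMatrix :
    cornerDgMatrix p ζ * posDcMatrix ζ = posDcMatrix ζ * cornerDgMatrix p ζ := by
  ext1 i j
  refine (Corner.sum _).trans (Eq.trans ?_ (Corner.sum _).symm)
  cases i <;> cases j <;> simp [cornerDgMatrix, posDcMatrix, mul_comm]

variable {p ζ} (hp : IsWeightedHomogeneous (qWeight V) p 2)
  (hζ : IsWeightedHomogeneous (qWeight V) ζ 2)

/-- The reduced complex of a negative crossing. -/
noncomputable def redNeg (p ζ : MvPolynomial V ℚ) (hp : IsWeightedHomogeneous (qWeight V) p 2)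
    (hζ : IsWeightedHomogeneous (qWeight V) ζ 2) : Bicomplex V where
  ι := Corner
  q := negQ
  a := cornerA
  t := negT
  dg := cornerDgMatrix p ζ
  dc := negDcMatrix ζ
  dg_q := by
    have h0 := isWeightedHomogeneous_zero ℚ (qWeight V)
    intro i j
    cases i <;> cases j <;> first | exact h0 _ | exact hp | exact hp.mul hζ
  dc_q := by
    have h0 := isWeightedHomogeneous_zero ℚ (qWeight V)
    intro i j
    cases i <;> cases j <;>
      first | exact h0 _ | exact hζ | exact isWeightedHomogeneous_one ℚ (qWeight V)
  dg_at := by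
    intro i j
    cases i <;> cases j <;>
      first | exact fun _ => ⟨rfl, rfl⟩ | exact fun h => absurd rfl h
  dc_at := by
    intro i j
    cases i <;> cases j <;>
      first | exact fun _ => ⟨rfl, rfl⟩ | exact fun h => absurd rfl h
  dg_dg := cornerDgMatrix_sq p ζ
  dc_dc := negDcMatrix_sq ζ
  dg_dc := cornerDgMatrix_negDcMatrix p ζ

/-- The reduced complex of a positive crossing. -/
noncomputable def redPos (p ζ : MvPolynomial V ℚ) (hp : IsWeightedHomogeneous (qWeight V) p 2)
    (hζ : IsWeightedHomogeneous (qWeight V) ζ 2) : Bicomplex V where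
  ι := Corner
  q := posQ
  a := cornerA
  t := posT
  dg := cornerDgMatrix p ζ
  dc := posDcMatrix ζ
  dg_q := by
    have h0 := isWeightedHomogeneous_zero ℚ (qWeight V)
    intro i j
    cases i <;> cases j <;> first | exact h0 _ | exact hp | exact hp.mul hζ
  dc_q := by
    have h0 := isWeightedHomogeneous_zero ℚ (qWeight V)
    intro i j
    cases i <;> cases j <;>
      first | exact h0 _ | exact hζ | exact isWeightedHomogeneous_one ℚ (qWeight V)
  dg_at := by
    intro i j
    cases i <;> cases j <;>
      first | exact fun _ => ⟨rfl, rfl⟩ | exact fun h => absurd rfl h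
  dc_at := by
    intro i j
    cases i <;> cases j <;>
      first | exact fun _ => ⟨rfl, rfl⟩ | exact fun h => absurd rfl h
  dg_dg := cornerDgMatrix_sq p ζ
  dc_dc := posDcMatrix_sq ζ
  dg_dc := cornerDgMatrix_posDcMatrix p ζ

theorem C_sg_cornerA : ∀ i, (C (sg (cornerA i)) : MvPolynomial V ℚ) = cornerSignA V i :=
  forall_corner (C_sg_even (n := 0) (by decide)) (C_sg_odd (n := 1) (by decide))
    (C_sg_even (n := 0) (by decide)) (C_sg_odd (n := 1) (by decide))

theorem redNeg_formula : (redNeg p ζ hp hζ).HasFormula (cornerDg p ζ) (negDc ζ)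
    (cornerSignA V) (cornerSignT V) :=
  ⟨cornerDgMatrix_mulVec p ζ, negDcMatrix_mulVec ζ, C_sg_cornerA,
    forall_corner (C_sg_odd (n := -1) (by decide)) (C_sg_odd (n := -1) (by decide))
      (C_sg_even (n := 0) (by decide)) (C_sg_even (n := 0) (by decide))⟩

theorem redPos_formula : (redPos p ζ hp hζ).HasFormula (cornerDg p ζ) (posDc ζ)
    (cornerSignA V) (cornerSignT V) :=
  ⟨cornerDgMatrix_mulVec p ζ, posDcMatrix_mulVec ζ, C_sg_cornerA,
    forall_corner (C_sg_odd (n := 1) (by decide)) (C_sg_odd (n := 1) (by decide))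
      (C_sg_even (n := 0) (by decide)) (C_sg_even (n := 0) (by decide))⟩

end Corners

/-! ### A crossing as a Koszul factor times a reduced complex -/

section Crossings

variable {V : Type}

open Corner Sum

/-- The differential `d_g` of a complex with two terms. -/
def twoTermDg {R : Type} (f g : (Fin 4 → R) → Fin 4 → R) (x : Fin 4 ⊕ Fin 4 → R) :
    Fin 4 ⊕ Fin 4 → R :=
  Sum.elim (f fun i => x (inl i)) (g fun i => x (inr i))

/-- The differential `d_c` of a complex with two terms. -/
def twoTermDc {R : Type} [Zero R] (f : (Fin 4 → R) → Fin 4 → R) (x : Fin 4 ⊕ Fin 4 → R) :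
    Fin 4 ⊕ Fin 4 → R :=
  Sum.elim (fun _ => 0) (f fun i => x (inl i))

theorem fromBlocks_diag_mulVec {ι κ R : Type} [Fintype ι] [Fintype κ] [CommRing R]
    (M : Matrix ι ι R) (N : Matrix κ κ R) (x : ι ⊕ κ → R) :
    (Matrix.fromBlocks M 0 0 N).mulVec x =
      Sum.elim (M.mulVec fun i => x (inl i)) (N.mulVec fun i => x (inr i)) := by
  rw [Matrix.fromBlocks_mulVec]
  simp
  rfl

theorem fromBlocks_lower_mulVec {ι κ R : Type} [Fintype ι] [Fintype κ] [CommRing R]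
    (M : Matrix κ ι R) (x : ι ⊕ κ → R) :
    (Matrix.fromBlocks (0 : Matrix ι ι R) (0 : Matrix ι κ R) M 0).mulVec x = Sum.elim (fun _ => 0)
        (M.mulVec fun i => x (inl i)) := by
  rw [Matrix.fromBlocks_mulVec]
  simp
  rfl

/-- The formula for `χ_i`. -/
noncomputable def chiInMap (ζ : MvPolynomial V ℚ) (x : Fin 4 → MvPolynomial V ℚ) :
    Fin 4 → MvPolynomial V ℚ
  | 0 => ζ * x 0
  | 1 => ζ * x 1
  | 2 => x 1 + x 2
  | 3 => x 3

/-- The formula for `χ_o`. -/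
noncomputable def chiOutMap (ζ : MvPolynomial V ℚ) (x : Fin 4 → MvPolynomial V ℚ) :
    Fin 4 → MvPolynomial V ℚ
  | 0 => x 0
  | 1 => x 1
  | 2 => -x 1 + ζ * x 2
  | 3 => ζ * x 3

theorem chiIn_mulVec (x₂ y₁ : V) (x : Fin 4 → MvPolynomial V ℚ) :
    (chiIn x₂ y₁).mulVec x = chiInMap (X y₁ - X x₂) x := by
  refine funext (forall_fin_four ?_ ?_ ?_ ?_) <;> refine (Fin.sum_univ_four _).trans ?_ <;>
    simp [chiIn, chiInMap]

theorem chiOut_mulVec (x₂ y₁ : V) (x : Fin 4 → MvPolynomial V ℚ) :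
    (chiOut x₂ y₁).mulVec x = chiOutMap (X y₁ - X x₂) x := by
  refine funext (forall_fin_four ?_ ?_ ?_ ?_) <;> refine (Fin.sum_univ_four _).trans ?_ <;>
    simp [chiOut, chiOutMap]

variable (x₁ x₂ y₁ y₂ : V)

theorem koszul2Sign_eq : ∀ i : Fin 4, ∀ n₁ n₂ n₃ n₄ : ℤ,
    n₁ = 0 → n₂ = 1 → n₃ = 1 → n₄ = 2 →
    (C (sg (![n₁, n₂, n₃, n₄] i)) : MvPolynomial V ℚ) = koszul2Sign V i := by
  rintro i n₁ n₂ n₃ n₄ rfl rfl rfl rfl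
  revert i
  exact forall_fin_four (C_sg_even (n := 0) (by decide)) (C_sg_odd (n := 1) (by decide))
      (C_sg_odd (n := 1) (by decide)) (C_sg_even (n := 2) (by decide))

theorem negComplex_formula : (negComplex x₁ x₂ y₁ y₂).HasFormula
    (twoTermDg (koszul2Dg ((X y₁ - X x₁) * (X y₁ - X x₂)) (X y₁ + X y₂ - X x₁ - X x₂))
      (koszul2Dg (X y₁ - X x₁) (X y₂ - X x₂)))
    (twoTermDc (chiOutMap (X y₁ - X x₂)))
    (Sum.elim (koszul2Sign V) (koszul2Sign V)) (Sum.elim (fun _ => -1) (fun _ => 1)) := by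
  refine ⟨fun (x : Fin 4 ⊕ Fin 4 → _) => ?_, fun (x : Fin 4 ⊕ Fin 4 → _) => ?_, ?_, ?_⟩
  · refine (fromBlocks_diag_mulVec _ _ x).trans ?_
    exact congrArg₂ Sum.elim
      (koszul2_dg (quad_q x₁ x₂ y₁) (sum_q x₁ x₂ y₁ y₂) fun i => x (inl i))
      (koszul2_dg (lin_q x₁ y₁) (lin_q x₂ y₂) fun i => x (inr i))
  · refine (fromBlocks_lower_mulVec _ x).trans ?_
    exact congrArg (Sum.elim fun _ => 0) (chiOut_mulVec x₂ y₁ fun i => x (inl i))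
  · rintro (i | i)
    all_goals
      change C (sg (_ + 0)) = _
      rw [add_zero]
      exact koszul2Sign_eq i _ _ _ _ rfl rfl rfl rfl
  · rintro (i | i)
    · exact C_sg_odd (n := -1) (by decide)
    · exact C_sg_even (n := 0) (by decide)

theorem posComplex_formula : (posComplex x₁ x₂ y₁ y₂).HasFormula
    (twoTermDg (koszul2Dg (X y₁ - X x₁) (X y₂ - X x₂))
      (koszul2Dg ((X y₁ - X x₁) * (X y₁ - X x₂)) (X y₁ + X y₂ - X x₁ - X x₂)))
    (twoTermDc (chiInMap (X y₁ - X x₂)))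
    (Sum.elim (koszul2Sign V) (koszul2Sign V)) (Sum.elim (fun _ => 1) (fun _ => -1)) := by
  refine ⟨fun (x : Fin 4 ⊕ Fin 4 → _) => ?_, fun (x : Fin 4 ⊕ Fin 4 → _) => ?_, ?_, ?_⟩
  · refine (fromBlocks_diag_mulVec _ _ x).trans ?_
    exact congrArg₂ Sum.elim
      (koszul2_dg (lin_q x₁ y₁) (lin_q x₂ y₂) fun i => x (inl i))
      (koszul2_dg (quad_q x₁ x₂ y₁) (sum_q x₁ x₂ y₁ y₂) fun i => x (inr i))
  · refine (fromBlocks_lower_mulVec _ x).trans ?_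
    exact congrArg (Sum.elim fun _ => 0) (chiIn_mulVec x₂ y₁ fun i => x (inl i))
  · rintro (i | i)
    · exact koszul2Sign_eq i _ _ _ _ rfl rfl rfl rfl
    · change C (sg (_ + 0)) = _
      rw [add_zero]
      exact koszul2Sign_eq i _ _ _ _ rfl rfl rfl rfl
  · rintro (i | i)
    · exact C_sg_even (n := 0) (by decide)
    · exact C_sg_odd (n := 1) (by decide)

theorem sum_forall {P : Fin 4 ⊕ Fin 4 → Prop} (h : ∀ i, P (inl i)) (h' : ∀ i, P (inr i)) :
    ∀ i, P i :=
  fun i => Sum.casesOn i h h'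

/-- The coordinate functions. -/
def coordMap (R : Type) [CommRing R] {ι : Type} (c : ι) : (ι → R) →ₗ[R] R := LinearMap.proj c

theorem coordMap_apply (R : Type) [CommRing R] {ι : Type} (c : ι) (x : ι → R) :
    coordMap R c x = x c := rfl

/-- The coordinates in the reduced complex of an element of the complex of a crossing. -/
noncomputable def toRedCoord (R : Type) [CommRing R] :
    Fin 2 × Corner → ((Fin 4 ⊕ Fin 4 → R) →ₗ[R] R)
  | (0, w0) => coordMap R (inl 0)
  | (0, w1) => coordMap R (inl 2)
  | (0, p0) => coordMap R (inr 0)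
  | (0, p1) => coordMap R (inr 1) + coordMap R (inr 2)
  | (1, w0) => -coordMap R (inl 1)
  | (1, w1) => coordMap R (inl 3)
  | (1, p0) => -coordMap R (inr 1)
  | (1, p1) => coordMap R (inr 3)

/-- The coordinates in the complex of a crossing of an element of the reduced complex. -/
noncomputable def ofRedCoord (R : Type) [CommRing R] :
    Fin 4 ⊕ Fin 4 → ((Fin 2 × Corner → R) →ₗ[R] R)
  | inl 0 => coordMap R (0, w0)
  | inl 1 => -coordMap R (1, w0)
  | inl 2 => coordMap R (0, w1)
  | inl 3 => coordMap R (1, w1)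
  | inr 0 => coordMap R (0, p0)
  | inr 1 => -coordMap R (1, p0)
  | inr 2 => coordMap R (0, p1) + coordMap R (1, p0)
  | inr 3 => coordMap R (1, p1)

/-- The coordinate change between the complex of a negative crossing and its reduced complex. -/
noncomputable def negToRed (R : Type) [CommRing R] :
    (Fin 4 ⊕ Fin 4 → R) →ₗ[R] (Fin 2 × Corner → R) :=
  LinearMap.pi (toRedCoord R)

/-- The inverse of `negToRed`. -/
noncomputable def redToNeg (R : Type) [CommRing R] :
    (Fin 2 × Corner → R) →ₗ[R] (Fin 4 ⊕ Fin 4 → R) :=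
  LinearMap.pi (ofRedCoord R)

/-- Both terms of a crossing contain the equation `σ`: the wide edge by definition, the arcs after
replacing `y₂-x₂ = σ-p` by `σ`. That replacement adds coordinate 1 to coordinate 2 on the arcs only.
-/
theorem negToRed_dg (p ζ σ : MvPolynomial V ℚ) (x : Fin 4 ⊕ Fin 4 → MvPolynomial V ℚ) :
    negToRed _ (twoTermDg (koszul2Dg (p * ζ) σ) (koszul2Dg p (σ - p)) x) = 
      tensorFormula (koszul1Dg σ) (koszul1Sign V) (cornerDg p ζ) (negToRed _ x) := by
  refine pair_ext (forall_corner ?_ ?_ ?_ ?_) (forall_corner ?_ ?_ ?_ ?_)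
  all_goals
    simp only [negToRed, toRedCoord, LinearMap.pi_apply, coordMap_apply, LinearMap.add_apply,
      LinearMap.neg_apply, Sum.elim_inl, Sum.elim_inr, koszul1Sign, tensorFormula, koszul1Dg,
          twoTermDg,
      koszul2Dg, cornerDg]
    ring

/-- The off-diagonal entry of `χ_o` cancels in the new basis. What is left is diagonal and acts in
the same way on both parts of the Koszul factor. -/
theorem negToRed_dc (ζ : MvPolynomial V ℚ) (x : Fin 4 ⊕ Fin 4 → MvPolynomial V ℚ) :
    negToRed _ (twoTermDc (chiOutMap ζ) x) = 
      tensorFormula (fun _ => 0) (fun _ => 1) (negDc ζ) (negToRed _ x) := by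
  refine pair_ext (forall_corner ?_ ?_ ?_ ?_) (forall_corner ?_ ?_ ?_ ?_)
  all_goals
    simp only [negToRed, toRedCoord, LinearMap.pi_apply, coordMap_apply, LinearMap.add_apply,
      LinearMap.neg_apply, Sum.elim_inl, Sum.elim_inr, tensorFormula, twoTermDc,
      chiOutMap, negDc, Pi.zero_apply]
    ring

/-- The same coordinates serve for a positive crossing, whose arcs come first in the two-term
complex; hence the swap of the summands. -/
theorem posToRed_dg (p ζ σ : MvPolynomial V ℚ) (x : Fin 4 ⊕ Fin 4 → MvPolynomial V ℚ) :
    negToRed _ (fun b => twoTermDg (koszul2Dg p (σ - p)) (koszul2Dg (p * ζ) σ) x b.swap) = 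
      tensorFormula (koszul1Dg σ) (koszul1Sign V) (cornerDg p ζ) (negToRed _ fun b => x b.swap) :=
          by
  refine pair_ext (forall_corner ?_ ?_ ?_ ?_) (forall_corner ?_ ?_ ?_ ?_)
  all_goals
    simp only [negToRed, toRedCoord, LinearMap.pi_apply, coordMap_apply, LinearMap.add_apply,
      LinearMap.neg_apply, Sum.elim_inl, Sum.elim_inr, koszul1Sign, tensorFormula, koszul1Dg,
          twoTermDg,
      koszul2Dg, cornerDg, Sum.swap_inl, Sum.swap_inr]
    ring

theorem posToRed_dc (ζ : MvPolynomial V ℚ) (x : Fin 4 ⊕ Fin 4 → MvPolynomial V ℚ) :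
    negToRed _ (fun b => twoTermDc (chiInMap ζ) x b.swap) = 
      tensorFormula (fun _ => 0) (fun _ => 1) (posDc ζ) (negToRed _ fun b => x b.swap) := by
  refine pair_ext (forall_corner ?_ ?_ ?_ ?_) (forall_corner ?_ ?_ ?_ ?_)
  all_goals
    simp only [negToRed, toRedCoord, LinearMap.pi_apply, coordMap_apply, LinearMap.add_apply,
      LinearMap.neg_apply, Sum.elim_inl, Sum.elim_inr, tensorFormula, twoTermDc,
      chiInMap, posDc, Sum.swap_inl, Sum.swap_inr, Pi.zero_apply]
    ring

theorem cell.add_place {i q q' q'' a a' a'' t t' t'' j k : ℤ} {y z : MvPolynomial V ℚ}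
    (h : y ∈ cell V (i - q) (a = j ∧ t = k)) (h' : z ∈ cell V (i - q'') (a'' = j ∧ t'' = k))
    (hq : q' = q) (ha : a' = a) (ht : t' = t) (hq' : q' = q'') (ha' : a' = a'') (ht' : t' = t'') :
    y + z ∈ cell V (i - q') (a' = j + 0 ∧ t' = k + 0) :=
  Submodule.add_mem _ (cell.place h hq ha ht) (cell.place h' hq' ha' ht')

/-- Splitting off the common equation leaves a square that depends on `p` and `ζ` only. All
computations with crossings take place in such squares. -/
theorem Equivalent.neg : Equivalent (negComplex x₁ x₂ y₁ y₂)
    ((koszul1 (X y₁ + X y₂ - X x₁ - X x₂) 2 (sum_q x₁ x₂ y₁ y₂)).tensor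
      (redNeg (X y₁ - X x₁) (X y₁ - X x₂) (lin_q x₁ y₁) (lin_q x₂ y₁))) := by
  refine Equivalent.ofFormula (negComplex_formula x₁ x₂ y₁ y₂)
    ((koszul1_formula (sum_q x₁ x₂ y₁ y₂)).tensor (redNeg_formula (lin_q x₁ y₁) (lin_q x₂ y₁)))
    (negToRed _) (redToNeg _) ?_ ?_ ?_ ?_ ?_ ?_
  · intro i j k x hx
    refine pair_forall (forall_corner ?_ ?_ ?_ ?_) (forall_corner ?_ ?_ ?_ ?_)
    · exact cell.place (hx (inl (0 : Fin 4))) rfl rfl rfl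
    · exact cell.place (hx (inl (2 : Fin 4))) rfl rfl rfl
    · exact cell.place (hx (inr (0 : Fin 4))) rfl rfl rfl
    · exact cell.add_place (hx (inr (1 : Fin 4))) (hx (inr (2 : Fin 4))) rfl rfl rfl rfl rfl rfl
    · exact cell.neg_place (hx (inl (1 : Fin 4))) rfl rfl rfl
    · exact cell.place (hx (inl (3 : Fin 4))) rfl rfl rfl
    · exact cell.neg_place (hx (inr (1 : Fin 4))) rfl rfl rfl
    · exact cell.place (hx (inr (3 : Fin 4))) rfl rfl rfl
  · intro i j k x hx
    refine sum_forall (forall_fin_four ?_ ?_ ?_ ?_) (forall_fin_four ?_ ?_ ?_ ?_)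
    · exact cell.place (hx ((0 : Fin 2), w0)) rfl rfl rfl
    · exact cell.neg_place (hx ((1 : Fin 2), w0)) rfl rfl rfl
    · exact cell.place (hx ((0 : Fin 2), w1)) rfl rfl rfl
    · exact cell.place (hx ((1 : Fin 2), w1)) rfl rfl rfl
    · exact cell.place (hx ((0 : Fin 2), p0)) rfl rfl rfl
    · exact cell.neg_place (hx ((1 : Fin 2), p0)) rfl rfl rfl
    · exact cell.add_place (hx ((0 : Fin 2), p1)) (hx ((1 : Fin 2), p0)) rfl rfl rfl rfl rfl rfl
    · exact cell.place (hx ((1 : Fin 2), p1)) rfl rfl rfl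
  · intro (x : Fin 4 ⊕ Fin 4 → _)
    refine funext (sum_forall (forall_fin_four rfl (neg_neg _) rfl rfl)
      (forall_fin_four rfl (neg_neg _) ?_ rfl))
    change x (inr 1) + x (inr 2) + -x (inr 1) = x (inr 2)
    ring
  · intro (x : Fin 2 × Corner → _)
    refine pair_ext (forall_corner rfl rfl rfl ?_) (forall_corner (neg_neg _) rfl (neg_neg _) rfl)
    change -x (1, p0) + (x (0, p1) + x (1, p0)) = x (0, p1)
    ring
  · intro x
    have e : (X y₂ - X x₂ : MvPolynomial V ℚ) = X y₁ + X y₂ - X x₁ - X x₂ - (X y₁ - X x₁) := by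
      ring
    rw [e]
    exact negToRed_dg _ _ _ x
  · exact fun x => negToRed_dc _ x

theorem Equivalent.pos : Equivalent (posComplex x₁ x₂ y₁ y₂)
    ((koszul1 (X y₁ + X y₂ - X x₁ - X x₂) 2 (sum_q x₁ x₂ y₁ y₂)).tensor
      (redPos (X y₁ - X x₁) (X y₁ - X x₂) (lin_q x₁ y₁) (lin_q x₂ y₁))) := by
  refine Equivalent.ofFormula (posComplex_formula x₁ x₂ y₁ y₂)
    ((koszul1_formula (sum_q x₁ x₂ y₁ y₂)).tensor (redPos_formula (lin_q x₁ y₁) (lin_q x₂ y₁)))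
    (negToRed _ ∘ₗ LinearMap.funLeft _ _ Sum.swap)
    (LinearMap.funLeft _ _ Sum.swap ∘ₗ redToNeg _) ?_ ?_ ?_ ?_ ?_ ?_
  · intro i j k x hx
    refine pair_forall (forall_corner ?_ ?_ ?_ ?_) (forall_corner ?_ ?_ ?_ ?_)
    · exact cell.place (hx (inr (0 : Fin 4))) rfl rfl rfl
    · exact cell.place (hx (inr (2 : Fin 4))) rfl rfl rfl
    · exact cell.place (hx (inl (0 : Fin 4))) rfl rfl rfl
    · exact cell.add_place (hx (inl (1 : Fin 4))) (hx (inl (2 : Fin 4))) rfl rfl rfl rfl rfl rfl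
    · exact cell.neg_place (hx (inr (1 : Fin 4))) rfl rfl rfl
    · exact cell.place (hx (inr (3 : Fin 4))) rfl rfl rfl
    · exact cell.neg_place (hx (inl (1 : Fin 4))) rfl rfl rfl
    · exact cell.place (hx (inl (3 : Fin 4))) rfl rfl rfl
  · intro i j k x hx
    refine sum_forall (forall_fin_four ?_ ?_ ?_ ?_) (forall_fin_four ?_ ?_ ?_ ?_)
    · exact cell.place (hx ((0 : Fin 2), p0)) rfl rfl rfl
    · exact cell.neg_place (hx ((1 : Fin 2), p0)) rfl rfl rfl
    · exact cell.add_place (hx ((0 : Fin 2), p1)) (hx ((1 : Fin 2), p0)) rfl rfl rfl rfl rfl rfl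
    · exact cell.place (hx ((1 : Fin 2), p1)) rfl rfl rfl
    · exact cell.place (hx ((0 : Fin 2), w0)) rfl rfl rfl
    · exact cell.neg_place (hx ((1 : Fin 2), w0)) rfl rfl rfl
    · exact cell.place (hx ((0 : Fin 2), w1)) rfl rfl rfl
    · exact cell.place (hx ((1 : Fin 2), w1)) rfl rfl rfl
  · intro (x : Fin 4 ⊕ Fin 4 → _)
    refine funext (sum_forall (forall_fin_four rfl (neg_neg _) ?_ rfl)
      (forall_fin_four rfl (neg_neg _) rfl rfl))
    change x (inl 1) + x (inl 2) + -x (inl 1) = x (inl 2)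
    ring
  · intro (x : Fin 2 × Corner → _)
    refine pair_ext (forall_corner rfl rfl rfl ?_) (forall_corner (neg_neg _) rfl (neg_neg _) rfl)
    change -x (1, p0) + (x (0, p1) + x (1, p0)) = x (0, p1)
    ring
  · intro x
    have e : (X y₂ - X x₂ : MvPolynomial V ℚ) = X y₁ + X y₂ - X x₁ - X x₂ - (X y₁ - X x₁) := by
      ring
    rw [e]
    exact posToRed_dg _ _ _ x
  · exact fun x => posToRed_dc _ x

end Crossings

end KR


namespace KR

open MvPolynomial

section Deform

variable {V : Type}

/-! ## Change of a bicomplex modulo a Koszul factor -/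

/-- The bicomplex with the same basis and other differentials. -/
noncomputable def Bicomplex.replace (C : Bicomplex V) (dg dc : Matrix C.ι C.ι (MvPolynomial V ℚ))
    (dg_q : ∀ i j, IsWeightedHomogeneous (qWeight V) (dg i j) (C.q j - C.q i))
    (dc_q : ∀ i j, IsWeightedHomogeneous (qWeight V) (dc i j) (C.q j - C.q i))
    (dg_at : ∀ i j, dg i j ≠ 0 → C.a j = C.a i + 1 ∧ C.t j = C.t i)
    (dc_at : ∀ i j, dc i j ≠ 0 → C.a j = C.a i ∧ C.t i = C.t j + 1)
    (dg_dg : dg * dg = 0) (dc_dc : dc * dc = 0) (dg_dc : dg * dc = dc * dg) : Bicomplex V where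
  ι := C.ι
  q := C.q
  a := C.a
  t := C.t
  dg := dg
  dc := dc
  dg_q := dg_q
  dc_q := dc_q
  dg_at := dg_at
  dc_at := dc_at
  dg_dg := dg_dg
  dc_dc := dc_dc
  dg_dc := dg_dc

/-- The map of the tensor product with a Koszul complex that is the identity on both parts, plus a
matrix from the first to the second part. -/
noncomputable def shear {ι : Type} [Fintype ι] (A : Matrix ι ι (MvPolynomial V ℚ)) :
    (Fin 2 × ι → MvPolynomial V ℚ) →ₗ[ℚ] Fin 2 × ι → MvPolynomial V ℚ :=
  pairMap (firstPart ι) (LinearMap.funLeft ℚ _ (fun c => (1, c)) + matrixMap A ∘ₗ firstPart ι)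

/-- A matrix from the first to the second part of the tensor product with a Koszul complex. -/
noncomputable def shearPart {ι : Type} [Fintype ι] (A : Matrix ι ι (MvPolynomial V ℚ)) :
    (Fin 2 × ι → MvPolynomial V ℚ) →ₗ[ℚ] Fin 2 × ι → MvPolynomial V ℚ :=
  pairMap 0 (matrixMap A ∘ₗ firstPart ι)

section

variable {ι : Type} [Fintype ι] (A : Matrix ι ι (MvPolynomial V ℚ))
  (x : Fin 2 × ι → MvPolynomial V ℚ) (c : ι)

theorem shear_zero : shear A x (0, c) = x (0, c) := rfl

theorem shear_one : shear A x (1, c) = x (1, c) + A.mulVec (fun c => x (0, c)) c := rfl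

theorem shearPart_zero : shearPart A x (0, c) = 0 := rfl

theorem shearPart_one : shearPart A x (1, c) = A.mulVec (fun c => x (0, c)) c := rfl

theorem shear_neg : shear (-A) (shear A x) = x := by
  refine pair_ext (fun c => rfl) fun c => ?_
  rw [shear_one, shear_one, Matrix.neg_mulVec]
  change x (1, c) + A.mulVec (fun c => x (0, c)) c + -A.mulVec (fun c => x (0, c)) c = _
  ring

theorem shear_smul (p : MvPolynomial V ℚ) : shear A (p • x) = p • shear A x := by
  refine pair_ext (fun c => rfl) fun c => ?_
  rw [shear_one]
  have h := congrFun (Matrix.mulVec_smul A p fun c => x (0, c)) c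
  change p * x (1, c) + A.mulVec (p • fun c => x (0, c)) c =
    p * (x (1, c) + A.mulVec (fun c => x (0, c)) c)
  rw [h, mul_add]
  rfl

theorem shearPart_smul (p : MvPolynomial V ℚ) : shearPart A (p • x) = p • shearPart A x := by
  refine pair_ext (fun c => (mul_zero _).symm) fun c => ?_
  exact congrFun (Matrix.mulVec_smul A p fun c => x (0, c)) c

end

section

variable {ι : Type} [Fintype ι] (σ : MvPolynomial V ℚ) (M : Matrix ι ι (MvPolynomial V ℚ))
  (x : Fin 2 × ι → MvPolynomial V ℚ)

/-- The formula for `d_g` in a tensor product with a Koszul complex. -/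
noncomputable def koszulTensorDg (b : Fin 2 × ι) : MvPolynomial V ℚ :=
  if b.1 = 0 then σ * x (1, b.2) + M.mulVec (fun c => x (0, c)) b.2
  else -M.mulVec (fun c => x (1, c)) b.2

/-- The formula for `d_c` in a tensor product with a Koszul complex. -/
noncomputable def koszulTensorDc (b : Fin 2 × ι) : MvPolynomial V ℚ :=
  M.mulVec (fun c => x (b.1, c)) b.2

theorem koszulTensorDg_zero (c : ι) : koszulTensorDg σ M x (0, c) =
    σ * x (1, c) + M.mulVec (fun c => x (0, c)) c := rfl

theorem koszulTensorDg_one (c : ι) : koszulTensorDg σ M x (1, c) =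
    -M.mulVec (fun c => x (1, c)) c := rfl

theorem koszulTensorDc_apply (i : Fin 2) (c : ι) : koszulTensorDc M x (i, c) =
    M.mulVec (fun c => x (i, c)) c := rfl

theorem koszul_tensor_dg {n : ℤ} (hσ : IsWeightedHomogeneous (qWeight V) σ n) (C : Bicomplex V)
    (x : Fin 2 × C.ι → MvPolynomial V ℚ) :
    ((koszul1 σ n hσ).tensor C).dgMap x = koszulTensorDg σ C.dg x :=
  pair_ext (fun c => koszul_tensor_dg_zero σ hσ C x c) fun c => koszul_tensor_dg_one σ hσ C x c

theorem koszul_tensor_dc' {n : ℤ} (hσ : IsWeightedHomogeneous (qWeight V) σ n) (C : Bicomplex V)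
    (x : Fin 2 × C.ι → MvPolynomial V ℚ) :
    ((koszul1 σ n hσ).tensor C).dcMap x = koszulTensorDc C.dc x :=
  funext fun b => koszul_tensor_dc σ hσ C x b.1 b.2

variable {σ M} {M' A N N' B : Matrix ι ι (MvPolynomial V ℚ)}

/-- The difference `σ A` of the two differentials is null-homotopic next to `[σ]`, and `1 - A` from
the first to the second part absorbs it. The second hypothesis is what `d_g² = 0`, for both
differentials, leaves after division by `σ`. -/
theorem shear_dg (h : M' = M + σ • A) (e : A * M + M' * A = 0) :
    shear (-A) (koszulTensorDg σ M x) = koszulTensorDg σ M' (shear (-A) x) := by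
  have e' : ∀ y : ι → MvPolynomial V ℚ, A.mulVec (M.mulVec y) + M'.mulVec (A.mulVec y) = 0 := by
    intro y
    rw [Matrix.mulVec_mulVec, Matrix.mulVec_mulVec, ← Matrix.add_mulVec, e, Matrix.zero_mulVec]
  have h' : ∀ y : ι → MvPolynomial V ℚ, M'.mulVec y = M.mulVec y + σ • A.mulVec y := by
    intro y
    rw [h, Matrix.add_mulVec, Matrix.smul_mulVec]
  refine pair_ext (fun c => ?_) fun c => ?_
  · rw [shear_zero, koszulTensorDg_zero, koszulTensorDg_zero, shear_one]
    change _ = _ + M'.mulVec (fun c => x (0, c)) c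
    rw [h', Matrix.neg_mulVec]
    change _ = σ * (_ + -_) + (_ + σ * _)
    ring
  · rw [shear_one, koszulTensorDg_one, koszulTensorDg_one]
    have e1 : (fun c => koszulTensorDg σ M x (0, c)) =
      σ • (fun c => x (1, c)) + M.mulVec fun c => x (0, c) := rfl
    have e2 : (fun c => shear (-A) x (1, c)) =
        (fun c => x (1, c)) - A.mulVec fun c => x (0, c) := by
      rw [sub_eq_add_neg, ← Matrix.neg_mulVec]
      rfl
    have e3 := congrFun (e' fun c => x (0, c)) c
    rw [e1, e2, Matrix.mulVec_sub, Matrix.mulVec_add, Matrix.mulVec_smul, h' fun c => x (1, c)]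
    rw [Matrix.neg_mulVec, Matrix.neg_mulVec]
    simp only [Pi.add_apply, Pi.sub_apply, Pi.neg_apply, Pi.smul_apply, smul_eq_mul,
      Pi.zero_apply] at e3 ⊢
    linear_combination -e3

/-- A change of `d_c` by `σ B` is a boundary for `d_g`, so the shear commutes with `d_c` only up to
the homotopy given by `-B`. The second hypothesis is the commutation of the differentials, divided
by `σ`. -/
theorem shear_dc (k : N' = N + σ • B) (e : N' * A - A * N = M' * B - B * M) :
    shear (-A) (koszulTensorDc N x) - koszulTensorDc N' (shear (-A) x) =
      koszulTensorDg σ M' (shearPart (-B) x) + shearPart (-B) (koszulTensorDg σ M x) := by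
  have e' : ∀ y : ι → MvPolynomial V ℚ, N'.mulVec (A.mulVec y) - A.mulVec (N.mulVec y) =
      M'.mulVec (B.mulVec y) - B.mulVec (M.mulVec y) := by
    intro y
    simp only [Matrix.mulVec_mulVec, ← Matrix.sub_mulVec, e]
  have k' : ∀ y : ι → MvPolynomial V ℚ, N'.mulVec y = N.mulVec y + σ • B.mulVec y := by
    intro y
    rw [k, Matrix.add_mulVec, Matrix.smul_mulVec]
  refine pair_ext (fun c => ?_) fun c => ?_
  · rw [Pi.sub_apply, Pi.add_apply, shear_zero, shearPart_zero, koszulTensorDg_zero,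
      shearPart_one, koszulTensorDc_apply, koszulTensorDc_apply]
    change _ - N'.mulVec (fun c => x (0, c)) c = _ + M'.mulVec 0 c + 0
    rw [k', Matrix.neg_mulVec, Matrix.mulVec_zero]
    change _ - (_ + σ * _) = σ * -_ + 0 + 0
    ring
  · rw [Pi.sub_apply, Pi.add_apply, shear_one, shearPart_one, koszulTensorDg_one,
      koszulTensorDc_apply, koszulTensorDc_apply]
    have e1 : (fun c => koszulTensorDg σ M x (0, c)) =
      σ • (fun c => x (1, c)) + M.mulVec fun c => x (0, c) := rfl
    have e2 : (fun c => shear (-A) x (1, c)) =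
        (fun c => x (1, c)) - A.mulVec fun c => x (0, c) := by
      rw [sub_eq_add_neg, ← Matrix.neg_mulVec]
      rfl
    have e3 := congrFun (e' fun c => x (0, c)) c
    have e4 : (fun c => shearPart (-B) x (1, c)) = (-B).mulVec fun c => x (0, c) := rfl
    have e5 : (fun c => koszulTensorDc N x (0, c)) = N.mulVec fun c => x (0, c) := rfl
    rw [e1, e2, e4, e5, Matrix.mulVec_sub, Matrix.mulVec_add, Matrix.mulVec_smul,
      k' fun c => x (1, c)]
    simp only [Matrix.neg_mulVec, Matrix.mulVec_neg]
    simp only [Pi.add_apply, Pi.sub_apply, Pi.neg_apply, Pi.smul_apply, smul_eq_mul] at e3 ⊢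
    linear_combination e3

theorem mulVec_cell {q : ι → ℤ}
    (hM : ∀ c c', IsWeightedHomogeneous (qWeight V) (M c c') (q c' - q c - 2))
    {P Q : ι → Prop} (hP : ∀ c c', M c c' ≠ 0 → Q c' → P c) {i : ℤ}
    {x : ι → MvPolynomial V ℚ} (hx : ∀ c, x c ∈ cell V (i - (0 + q c)) (Q c)) (c : ι) :
    M.mulVec x c ∈ cell V (i - (2 + q c)) (P c) := by
  refine Submodule.sum_mem _ fun c' _ => ?_
  change M c c' * x c' ∈ _
  by_cases h1 : M c c' = 0
  · rw [h1, zero_mul]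
    exact Submodule.zero_mem _
  · exact cell.mono (cell.mul (hM c c') (hx c')) (by ring) (hP c c' h1)

end

/-- The condition for degree `q^i a^j t^k` in a tensor product with a Koszul complex. -/
def TensorCell {ι : Type} (q a t : ι → ℤ) (i j k : ℤ) (x : Fin 2 × ι → MvPolynomial V ℚ) : Prop :=
  ∀ b, x b ∈ cell V (i - ((![0, 2] : Fin 2 → ℤ) b.1 + q b.2))
    ((![0, 1] : Fin 2 → ℤ) b.1 + a b.2 = j ∧ 0 + t b.2 = k)

theorem mem_tensor_gr {σ : MvPolynomial V ℚ} (hσ : IsWeightedHomogeneous (qWeight V) σ 2)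
    (C : Bicomplex V) (i j k : ℤ) (x : Fin 2 × C.ι → MvPolynomial V ℚ) :
    x ∈ ((koszul1 σ 2 hσ).tensor C).gr i j k ↔ TensorCell C.q C.a C.t i j k x := Iff.rfl

section

variable {ι : Type} [Fintype ι] {q a t : ι → ℤ} {A : Matrix ι ι (MvPolynomial V ℚ)}
  {i j k : ℤ} {x : Fin 2 × ι → MvPolynomial V ℚ}

theorem shear_gr
    (hA : ∀ i j, IsWeightedHomogeneous (qWeight V) (A i j) (q j - q i - 2))
    (hx : TensorCell q a t i j k x)
    (A_at : ∀ i j, A i j ≠ 0 → a j = a i + 1 ∧ t j = t i) :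
    TensorCell q a t i (j + 0) (k + 0) (shear A x) := by
  refine pair_forall (fun c => cell.place (hx ((0 : Fin 2), c)) rfl rfl rfl) fun c => ?_
  refine Submodule.add_mem _ (cell.place (hx ((1 : Fin 2), c)) rfl rfl rfl)
    (mulVec_cell hA (P := fun c => 1 + a c = j + 0 ∧ 0 + t c = k + 0)
      (Q := fun c => 0 + a c = j ∧ 0 + t c = k) (fun c c' h => ?_)
      (fun c => hx ((0 : Fin 2), c)) c)
  have := A_at c c' h
  omega

theorem shearPart_gr
    (hA : ∀ i j, IsWeightedHomogeneous (qWeight V) (A i j) (q j - q i - 2))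
    (hx : TensorCell q a t i j k x)
    (A_at : ∀ i j, A i j ≠ 0 → a j = a i ∧ t i = t j + 1) :
    TensorCell q a t i (j + 1) (k + 1) (shearPart A x) := by
  refine pair_forall (fun c => Submodule.zero_mem (cell V _ _)) fun c => ?_
  refine (mulVec_cell hA (P := fun c => 1 + a c = j + 1 ∧ 0 + t c = k + 1)
      (Q := fun c => 0 + a c = j ∧ 0 + t c = k) (fun c c' h => ?_)
      (fun c => hx ((0 : Fin 2), c)) c)
  have := A_at c c' h
  omega

end

/-- Tensored with a Koszul complex `[σ]`, a bicomplex may be changed by multiples of `σ`. -/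
theorem Equivalent.koszul_congr {σ : MvPolynomial V ℚ} (hσ : IsWeightedHomogeneous (qWeight V) σ 2)
    (σ_ne : σ ≠ 0) (C : Bicomplex V) {dg dc : Matrix C.ι C.ι (MvPolynomial V ℚ)}
    (dg_q : ∀ i j, IsWeightedHomogeneous (qWeight V) (dg i j) (C.q j - C.q i))
    (dc_q : ∀ i j, IsWeightedHomogeneous (qWeight V) (dc i j) (C.q j - C.q i))
    (dg_at : ∀ i j, dg i j ≠ 0 → C.a j = C.a i + 1 ∧ C.t j = C.t i)
    (dc_at : ∀ i j, dc i j ≠ 0 → C.a j = C.a i ∧ C.t i = C.t j + 1)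
    (dg_dg : dg * dg = 0) (dc_dc : dc * dc = 0) (dg_dc : dg * dc = dc * dg)
    (A B : Matrix C.ι C.ι (MvPolynomial V ℚ))
    (hA : ∀ i j, IsWeightedHomogeneous (qWeight V) (A i j) (C.q j - C.q i - 2))
    (hB : ∀ i j, IsWeightedHomogeneous (qWeight V) (B i j) (C.q j - C.q i - 2))
    (eA : dg = C.dg + σ • A) (eB : dc = C.dc + σ • B) :
    Equivalent ((koszul1 σ 2 hσ).tensor C)
      ((koszul1 σ 2 hσ).tensor (C.replace dg dc dg_q dc_q dg_at dc_at dg_dg dc_dc dg_dc)) := by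
  -- The identities needed for `A` and `B` hold after multiplication by `σ`, a nonzero element of a
  -- domain.
  have cancel : ∀ M N : Matrix C.ι C.ι (MvPolynomial V ℚ), σ • M = σ • N → M = N := by
    intro M N h
    ext1 i j
    exact mul_left_cancel₀ σ_ne (congrFun (congrFun h i) j)
  have entry : ∀ {M N A : Matrix C.ι C.ι (MvPolynomial V ℚ)} (_ : M = N + σ • A) (i j : C.ι)
      (_ : A i j ≠ 0) (_ : N i j = 0), M i j ≠ 0 := by
    rintro M N A rfl i j h h1
    change N i j + σ * A i j ≠ 0
    rw [h1, zero_add]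
    exact mul_ne_zero σ_ne h
  -- A nonzero entry of `A` forces a nonzero entry of the old or the new differential at the same
  -- place, and inherits its degrees.
  have A_at : ∀ i j, A i j ≠ 0 → C.a j = C.a i + 1 ∧ C.t j = C.t i := by
    intro i j h
    by_cases h1 : C.dg i j = 0
    · exact dg_at i j (entry eA i j h h1)
    · exact C.dg_at i j h1
  have B_at : ∀ i j, B i j ≠ 0 → C.a j = C.a i ∧ C.t i = C.t j + 1 := by
    intro i j h
    by_cases h1 : C.dc i j = 0
    · exact dc_at i j (entry eB i j h h1)
    · exact C.dc_at i j h1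
  have h1 : σ • A = dg - C.dg := by rw [eA]; abel
  have h2 : σ • B = dc - C.dc := by rw [eB]; abel
  have e1 : A * C.dg + dg * A = 0 := by
    apply cancel
    rw [smul_zero, smul_add, ← Matrix.smul_mul, ← Matrix.mul_smul, h1, sub_mul, mul_sub, dg_dg,
      C.dg_dg]
    abel
  have e2 : dc * A - A * C.dc = dg * B - B * C.dg := by
    apply cancel
    rw [smul_sub, smul_sub, ← Matrix.mul_smul, ← Matrix.smul_mul, ← Matrix.mul_smul,
      ← Matrix.smul_mul, h1, h2, mul_sub, sub_mul, mul_sub, sub_mul, dg_dc, C.dg_dc]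
    abel
  have nA : ∀ i j, IsWeightedHomogeneous (qWeight V) ((-A) i j) (C.q j - C.q i - 2) :=
    fun i j => Submodule.neg_mem (weightedHomogeneousSubmodule ℚ (qWeight V) _) (hA i j)
  have nA' : ∀ i j, (-A) i j ≠ 0 → C.a j = C.a i + 1 ∧ C.t j = C.t i :=
    fun i j h => A_at i j (neg_ne_zero.mp h)
  have nB : ∀ i j, IsWeightedHomogeneous (qWeight V) ((-B) i j) (C.q j - C.q i - 2) :=
    fun i j => Submodule.neg_mem (weightedHomogeneousSubmodule ℚ (qWeight V) _) (hB i j)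
  have nB' : ∀ i j, (-B) i j ≠ 0 → C.a j = C.a i ∧ C.t i = C.t j + 1 :=
    fun i j h => B_at i j (neg_ne_zero.mp h)
  set D := C.replace dg dc dg_q dc_q dg_at dc_at dg_dg dc_dc dg_dc
  have df : HasDegree (C := (koszul1 σ 2 hσ).tensor C) (D := (koszul1 σ 2 hσ).tensor D) 0 0
      (shear (-A)) :=
    fun i j k x hx => (mem_tensor_gr hσ D _ _ _ _).mpr
      (shear_gr nA ((mem_tensor_gr hσ C _ _ _ _).mp hx) nA')
  have dg : HasDegree (C := (koszul1 σ 2 hσ).tensor D) (D := (koszul1 σ 2 hσ).tensor C) 0 0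
      (shear A) :=
    fun i j k x hx => (mem_tensor_gr hσ C _ _ _ _).mpr
      (shear_gr hA ((mem_tensor_gr hσ D _ _ _ _).mp hx) A_at)
  have dh : HasDegree (C := (koszul1 σ 2 hσ).tensor C) (D := (koszul1 σ 2 hσ).tensor D) 1 1
      (shearPart (-B)) :=
    fun i j k x hx => (mem_tensor_gr hσ D _ _ _ _).mpr
      (shearPart_gr nB ((mem_tensor_gr hσ C _ _ _ _).mp hx) nB')
  have cg : ∀ x : Fin 2 × C.ι → MvPolynomial V ℚ,
      shear (-A) (((koszul1 σ 2 hσ).tensor C).dgMap x) =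
        ((koszul1 σ 2 hσ).tensor D).dgMap (shear (-A) x) := fun x =>
    (congrArg (shear (-A)) (koszul_tensor_dg σ hσ C x)).trans
      ((shear_dg x eA e1).trans (koszul_tensor_dg σ hσ D (shear (-A) x)).symm)
  have cc : ∀ x : Fin 2 × C.ι → MvPolynomial V ℚ,
      shear (-A) (((koszul1 σ 2 hσ).tensor C).dcMap x) -
          (show Fin 2 × C.ι → MvPolynomial V ℚ from
            ((koszul1 σ 2 hσ).tensor D).dcMap (shear (-A) x)) =
        (show Fin 2 × C.ι → MvPolynomial V ℚ from
          ((koszul1 σ 2 hσ).tensor D).dgMap (shearPart (-B) x)) +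
          shearPart (-B) (((koszul1 σ 2 hσ).tensor C).dgMap x) := fun x =>
    (congrArg₂ (fun y z => shear (-A) y - z) (koszul_tensor_dc' σ hσ C x)
      (koszul_tensor_dc' σ hσ D (shear (-A) x))).trans
      ((shear_dc x eB e2).trans
        (congrArg₂ (fun y z : Fin 2 × C.ι → MvPolynomial V ℚ => y + shearPart (-B) z)
            (koszul_tensor_dg σ hσ D (shearPart (-B) x))
          (koszul_tensor_dg σ hσ C x)).symm)
  exact HomotopyEquivalent.ofIso (C := (koszul1 σ 2 hσ).tensor C) (D := (koszul1 σ 2 hσ).tensor D)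
    (shear (-A)) (shear A)
    (fun p x => shear_smul (-A) x (rename id p)) (fun p x => shear_smul A x (rename id p))
    df dg (fun x => (congrArg (fun M => shear M (shear (-A) x)) (neg_neg A).symm).trans
      (shear_neg (-A) x)) (fun x => shear_neg A x) cg (shearPart (-B))
    (fun p x => shearPart_smul (-B) x (rename id p)) dh cc

end Deform

end KR


namespace KR

open MvPolynomial

/-! ### Reduced complexes: base change, signs, congruence modulo a Koszul factor -/

section Reduced

variable {V W : Type} {p p' ζ ζ' : MvPolynomial V ℚ}

open Corner

theorem Equivalent.koszul1_eq {n : ℤ} (hp : IsWeightedHomogeneous (qWeight V) p n)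
    (hp' : IsWeightedHomogeneous (qWeight V) p' n) (h : p = p') :
    Equivalent (koszul1 p n hp) (koszul1 p' n hp') := by
  subst h
  exact HomotopyEquivalent.refl _ _

theorem Equivalent.redNeg_eq (hp : IsWeightedHomogeneous (qWeight V) p 2)
    (hζ : IsWeightedHomogeneous (qWeight V) ζ 2) (hp' : IsWeightedHomogeneous (qWeight V) p' 2)
    (hζ' : IsWeightedHomogeneous (qWeight V) ζ' 2) (h : p = p') (h' : ζ = ζ') :
    Equivalent (redNeg p ζ hp hζ) (redNeg p' ζ' hp' hζ') := by
  subst h h'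
  exact HomotopyEquivalent.refl _ _

theorem Equivalent.redPos_eq (hp : IsWeightedHomogeneous (qWeight V) p 2)
    (hζ : IsWeightedHomogeneous (qWeight V) ζ 2) (hp' : IsWeightedHomogeneous (qWeight V) p' 2)
    (hζ' : IsWeightedHomogeneous (qWeight V) ζ' 2) (h : p = p') (h' : ζ = ζ') :
    Equivalent (redPos p ζ hp hζ) (redPos p' ζ' hp' hζ') := by
  subst h h'
  exact HomotopyEquivalent.refl _ _

theorem Equivalent.koszul1_map {n : ℤ} (hp : IsWeightedHomogeneous (qWeight V) p n)
    (φ : MvPolynomial V ℚ →ₐ[ℚ] MvPolynomial W ℚ) (hφ : IsGraded φ) :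
    Equivalent ((koszul1 p n hp).map φ hφ) (koszul1 (φ p) n (hφ p n hp)) := by
  refine Equivalent.ofEntries (Equiv.refl _) (fun _ => rfl) (fun _ => rfl) (fun _ => rfl) ?_ ?_
  · intro (i : Fin 2) (j : Fin 2)
    fin_cases i <;> fin_cases j <;> first | rfl | exact (map_zero φ).symm
  · exact fun _ _ => (map_zero φ).symm

theorem Equivalent.redNeg_map (hp : IsWeightedHomogeneous (qWeight V) p 2)
    (hζ : IsWeightedHomogeneous (qWeight V) ζ 2)
    (φ : MvPolynomial V ℚ →ₐ[ℚ] MvPolynomial W ℚ) (hφ : IsGraded φ) :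
    Equivalent ((redNeg p ζ hp hζ).map φ hφ)
      (redNeg (φ p) (φ ζ) (hφ p 2 hp) (hφ ζ 2 hζ)) := by
  refine Equivalent.ofEntries (Equiv.refl _) (fun _ => rfl) (fun _ => rfl) (fun _ => rfl) ?_ ?_
  · intro (i : Corner) (j : Corner)
    cases i <;> cases j <;> first | rfl | exact (map_zero φ).symm | exact (map_mul φ _ _).symm
  · intro (i : Corner) (j : Corner)
    cases i <;> cases j <;> first | rfl | exact (map_zero φ).symm | exact (map_one φ).symm

theorem Equivalent.redPos_map (hp : IsWeightedHomogeneous (qWeight V) p 2)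
    (hζ : IsWeightedHomogeneous (qWeight V) ζ 2)
    (φ : MvPolynomial V ℚ →ₐ[ℚ] MvPolynomial W ℚ) (hφ : IsGraded φ) :
    Equivalent ((redPos p ζ hp hζ).map φ hφ)
      (redPos (φ p) (φ ζ) (hφ p 2 hp) (hφ ζ 2 hζ)) := by
  refine Equivalent.ofEntries (Equiv.refl _) (fun _ => rfl) (fun _ => rfl) (fun _ => rfl) ?_ ?_
  · intro (i : Corner) (j : Corner)
    cases i <;> cases j <;> first | rfl | exact (map_zero φ).symm | exact (map_mul φ _ _).symm
  · intro (i : Corner) (j : Corner)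
    cases i <;> cases j <;> first | rfl | exact (map_zero φ).symm | exact (map_one φ).symm

theorem isWeightedHomogeneous_neg (hp : IsWeightedHomogeneous (qWeight V) p 2) :
    IsWeightedHomogeneous (qWeight V) (-p) 2 :=
  (weightedHomogeneousSubmodule ℚ (qWeight V) 2).neg_mem hp

/-- Rescaling the basis by `(-1)^a` reverses `d_g` and leaves `d_c` alone. -/
theorem Equivalent.redNeg_neg (hp : IsWeightedHomogeneous (qWeight V) p 2)
    (hζ : IsWeightedHomogeneous (qWeight V) ζ 2) :
    Equivalent (redNeg p ζ hp hζ) (redNeg (-p) ζ (isWeightedHomogeneous_neg hp) hζ) := by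
  refine Equivalent.ofEquiv (Equiv.refl _) (redNeg p ζ hp hζ).a (fun _ => rfl) (fun _ => rfl)
    (fun _ => rfl) ?_ ?_
  · intro (i : Corner) (j : Corner)
    change cornerDgMatrix (-p) ζ i j = (sg (cornerA i) * sg (cornerA j)) • cornerDgMatrix p ζ i j
    cases i <;> cases j <;> simp [cornerDgMatrix, cornerA, sg]
  · intro (i : Corner) (j : Corner)
    change negDcMatrix ζ i j = (sg (cornerA i) * sg (cornerA j)) • negDcMatrix ζ i j
    cases i <;> cases j <;> simp [negDcMatrix, cornerA, sg]

/-- The difference of two matrices of `d_g`, divided by `σ`. -/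
noncomputable def cornerDgShift (x y : MvPolynomial V ℚ) :
    Matrix Corner Corner (MvPolynomial V ℚ)
  | w0, w1 => x
  | p0, p1 => y
  | _, _ => 0

/-- The difference of two matrices of `d_c`, divided by `σ`. -/
noncomputable def negDcShift (y : MvPolynomial V ℚ) : Matrix Corner Corner (MvPolynomial V ℚ)
  | p1, w1 => y
  | _, _ => 0

theorem isWeightedHomogeneous_C_mul (k : ℚ) {n : ℤ} (hp : IsWeightedHomogeneous (qWeight V) p n) :
    IsWeightedHomogeneous (qWeight V) (C k * p) n := by
  rw [← smul_eq_C_mul]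
  exact (weightedHomogeneousSubmodule ℚ (qWeight V) n).smul_mem k hp

/-- In the presence of a Koszul factor `[σ]`, the polynomials in the reduced complex of a negative
crossing matter only modulo `σ`. -/
theorem Equivalent.redNeg_congr {σ : MvPolynomial V ℚ} (hσ : IsWeightedHomogeneous (qWeight V) σ 2)
    (hp : IsWeightedHomogeneous (qWeight V) p 2)
    (hζ : IsWeightedHomogeneous (qWeight V) ζ 2) (hp' : IsWeightedHomogeneous (qWeight V) p' 2)
    (hζ' : IsWeightedHomogeneous (qWeight V) ζ' 2) (k l : ℚ) (h : p' = p + C k * σ)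
    (h' : ζ' = ζ + C l * σ) :
    Equivalent ((koszul1 σ 2 hσ).tensor (redNeg p ζ hp hζ))
      ((koszul1 σ 2 hσ).tensor (redNeg p' ζ' hp' hζ')) := by
  -- In closed diagrams `σ` may vanish, as for a curl. Then the two pairs of polynomials coincide.
  by_cases σ_ne : σ = 0
  · exact (Equivalent.redNeg_eq hp hζ hp' hζ' (by rw [h, σ_ne, mul_zero, add_zero])
      (by rw [h', σ_ne, mul_zero, add_zero])).tensor_left _
  · have h0 := isWeightedHomogeneous_zero ℚ (qWeight V)
    have h1 : ∀ k : ℚ, IsWeightedHomogeneous (qWeight V) (C k : MvPolynomial V ℚ) 0 :=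
      isWeightedHomogeneous_C _
    -- On the wide edge `p'ζ' - pζ = σ (kζ + lp')`, on the arcs `p' - p = kσ`, and in `d_c` only `ζ'
    -- - ζ = lσ` changes.
    refine Equivalent.koszul_congr hσ σ_ne (redNeg p ζ hp hζ) (redNeg p' ζ' hp' hζ').dg_q
      (redNeg p' ζ' hp' hζ').dc_q (redNeg p' ζ' hp' hζ').dg_at (redNeg p' ζ' hp' hζ').dc_at
      (redNeg p' ζ' hp' hζ').dg_dg (redNeg p' ζ' hp' hζ').dc_dc (redNeg p' ζ' hp' hζ').dg_dc
      (cornerDgShift (C k * ζ + C l * p') (C k)) (negDcShift (C l)) ?_ ?_ ?_ ?_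
    · intro (i : Corner) (j : Corner)
      cases i <;> cases j <;>
        first
          | exact h0 _
          | exact h1 k
          | exact (weightedHomogeneousSubmodule ℚ (qWeight V) 2).add_mem
              (isWeightedHomogeneous_C_mul k hζ) (isWeightedHomogeneous_C_mul l hp')
    · intro (i : Corner) (j : Corner)
      cases i <;> cases j <;> first | exact h0 _ | exact h1 l
    · ext1 (i : Corner) (j : Corner)
      change cornerDgMatrix p' ζ' i j = cornerDgMatrix p ζ i j + σ * cornerDgShift _ _ i j
      cases i <;> cases j <;> simp only [cornerDgMatrix, cornerDgShift, h, h'] <;> ring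
    · ext1 (i : Corner) (j : Corner)
      change negDcMatrix ζ' i j = negDcMatrix ζ i j + σ * negDcShift _ i j
      cases i <;> cases j <;> simp only [negDcMatrix, negDcShift, h'] <;> ring

end Reduced

/-! ### Elimination of a mark by a linear equation -/

section Marks

variable {V U : Type}

/-- Elimination of the mark `u₀` by a linear equation. -/
noncomputable def Elimination.ofMark (β : V → U) (u₀ : U) (γ : U → V) (hγ : ∀ u, u ≠ u₀ → β
    (γ u) = u)
    (hβ : ∀ v, γ (β v) = v) (hu : ∀ v, β v ≠ u₀) (r : MvPolynomial V ℚ) (ξ : MvPolynomial U ℚ)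
    (hr : IsWeightedHomogeneous (qWeight V) r 2) (hξ : IsWeightedHomogeneous (qWeight U) ξ 2)
    (k : ℚ) (hk : k ≠ 0) (h : X u₀ = MvPolynomial.rename β r + C k * ξ) : Elimination β := by
  classical
  exact
  { ρ := fun u => if u = u₀ then r else X (γ u)
    ξ := ξ
    ρ_deg := fun u => by
      split_ifs
      · exact hr
      · exact isWeightedHomogeneous_X ℚ (qWeight V) _
    ξ_deg := hξ
    ρ_section := fun v => by rw [if_neg (hu v), hβ]
    -- If `ξ` were zero, the variable `u₀` would be a polynomial in the others. Its values 0 and 1,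
    -- with all other marks at 0, rule this out.
    ξ_ne := fun h0 => by
      rw [h0, mul_zero, add_zero] at h
      have e1 : ∀ c : ℚ, c = eval (fun _ => 0) r := fun c => by
        have := congrArg (eval fun u => if u = u₀ then c else 0) h
        rw [eval_X, if_pos rfl, eval_rename] at this
        rw [this]
        congr 2
        funext v
        exact if_neg (hu v)
      exact zero_ne_one ((e1 0).trans (e1 1).symm)
    -- Applying the retraction to the defining equation leaves `k` times the image of `ξ` equal to
    -- zero.
    ξ_kills := by
      have := congrArg (aeval fun u => if u = u₀ then r else X (γ u)) h
      rw [aeval_X, if_pos rfl, map_add, aeval_rename] at this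
      have e : ((fun u => if u = u₀ then r else X (γ u)) ∘ β : V → MvPolynomial V ℚ) = X := by
        funext v
        change (if β v = u₀ then r else X (γ (β v))) = X v
        rw [if_neg (hu v), hβ]
      rw [e, aeval_X_left_apply, left_eq_add, map_mul, aeval_C] at this
      exact (mul_eq_zero.mp this).resolve_left fun h1 => hk (by simpa using h1)
    coeff := fun u => if u = u₀ then k else 0
    coeff_spec := fun u => by
      by_cases hu : u = u₀
      · rw [if_pos hu, if_pos hu, hu, h]
      · rw [if_neg hu, if_neg hu, C_0, zero_mul, add_zero, rename_X, hγ u hu] }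

/-- A factor that does not involve the eliminated mark passes through unchanged, because the
retraction is a left inverse of `rename β`. -/
theorem Elimination.equivalent_tensor {β : V → U} (L : Elimination β) (D : Bicomplex U)
    (E : Bicomplex V) :
    HomotopyEquivalent β id (L.source (D.tensor (E.rename β))) ((L.target D).tensor E) :=
  (L.equivalent _).trans ((Equivalent.map_tensor D (E.rename β) L.ε L.ε_graded).trans
    (Equivalent.tensor_left ((Equivalent.map_map (MvPolynomial.rename β) (isGraded_rename β) L.ε
      L.ε_graded (MvPolynomial.rename id) (isGraded_rename id) fun p => (L.ε_rename p).trans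
        (rename_id_apply p).symm).trans (Equivalent.rename_id E)) _))

end Marks

end KR


namespace KR

open MvPolynomial

/-! ### Homotopy equivalences from explicit retracts -/

section Retract

variable {V W B : Type}

/-- A homotopy equivalence given by explicit formulas, where one of the composites is the
identity. -/
theorem HomotopyEquivalent.ofRetract {C : Bicomplex V} {D : Bicomplex W} {β : B → V} {β' : B → W}
    {dg dc : C.Mod → C.Mod} {dg' dc' : D.Mod → D.Mod}
    (C_dg : ∀ x, C.dgMap x = dg x) (C_dc : ∀ x, C.dcMap x = dc x)
    (D_dg : ∀ x, D.dgMap x = dg' x) (D_dc : ∀ x, D.dcMap x = dc' x)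
    (f : C.Mod →ₗ[ℚ] D.Mod) (g : D.Mod →ₗ[ℚ] C.Mod) (h : C.Mod →ₗ[ℚ] D.Mod)
    (k : D.Mod →ₗ[ℚ] C.Mod) (s u : C.Mod →ₗ[ℚ] C.Mod)
    (lf : EdgeLinear β β' f) (lg : EdgeLinear β' β g) (lh : EdgeLinear β β' h)
    (lk : EdgeLinear β' β k) (ls : EdgeLinear β β s) (lu : EdgeLinear β β u)
    (df : HasDegree 0 0 f) (dg₀ : HasDegree 0 0 g) (dh : HasDegree 1 1 h) (dk : HasDegree 1 1 k)
    (ds : HasDegree 0 (-1) s) (du : HasDegree 1 0 u)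
    (f_dg : ∀ x, f (dg x) = dg' (f x)) (g_dg : ∀ x, g (dg' x) = dg (g x))
    (f_dc : ∀ x, f (dc x) - dc' (f x) = dg' (h x) + h (dg x))
    (g_dc : ∀ x, g (dc' x) - dc (g x) = dg (k x) + k (dg' x))
    (s_dg : ∀ x, s (dg x) = dg (s x))
    (gf : ∀ x, x - g (f x) = (dc (s x) + s (dc x)) + (dg (u x) + u (dg x)))
    (fg : ∀ x, f (g x) = x) : HomotopyEquivalent β β' C D := by
  refine ⟨f, g, ⟨lf, df, LinearMap.ext fun x => ?_, h, lh, dh, LinearMap.ext fun x => ?_⟩,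
    ⟨lg, dg₀, LinearMap.ext fun x => ?_, k, lk, dk, LinearMap.ext fun x => ?_⟩,
    ⟨-s, -u, ls.neg, ds.neg, LinearMap.ext fun x => ?_, lu.neg, du.neg,
      LinearMap.ext fun x => ?_⟩, HomotopicToId.of_forall fg⟩
  · exact (congrArg f (C_dg x)).trans ((f_dg x).trans (D_dg _).symm)
  · simp only [LinearMap.sub_apply, LinearMap.add_apply, LinearMap.comp_apply, C_dg, C_dc, D_dg,
      D_dc, f_dc]
  · exact (congrArg g (D_dg x)).trans ((g_dg x).trans (C_dg _).symm)
  · simp only [LinearMap.sub_apply, LinearMap.add_apply, LinearMap.comp_apply, C_dg, C_dc, D_dg,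
      D_dc, g_dc]
  · have := s_dg x
    rw [← C_dg, ← C_dg] at this
    simp only [LinearMap.neg_apply, LinearMap.comp_apply, map_neg, this]
  · have := gf x
    simp only [← C_dg, ← C_dc] at this
    simp only [LinearMap.sub_apply, LinearMap.add_apply, LinearMap.neg_apply,
      LinearMap.comp_apply, LinearMap.id_apply, map_neg]
    rw [← neg_sub, this]
    abel

/-- A homotopy equivalence given by explicit formulas, where the maps are chain maps for both
differentials and one of the composites is the identity. -/
theorem HomotopyEquivalent.ofStrictRetract {C : Bicomplex V} {D : Bicomplex W} {β : B → V}
    {β' : B → W} {dg dc : C.Mod → C.Mod} {dg' dc' : D.Mod → D.Mod}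
    (C_dg : ∀ x, C.dgMap x = dg x) (C_dc : ∀ x, C.dcMap x = dc x)
    (D_dg : ∀ x, D.dgMap x = dg' x) (D_dc : ∀ x, D.dcMap x = dc' x)
    (f : C.Mod →ₗ[ℚ] D.Mod) (g : D.Mod →ₗ[ℚ] C.Mod) (s : C.Mod →ₗ[ℚ] C.Mod)
    (lf : EdgeLinear β β' f) (lg : EdgeLinear β' β g) (ls : EdgeLinear β β s)
    (df : HasDegree 0 0 f) (dg₀ : HasDegree 0 0 g) (ds : HasDegree 0 (-1) s)
    (f_dg : ∀ x, f (dg x) = dg' (f x)) (g_dg : ∀ x, g (dg' x) = dg (g x))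
    (f_dc : ∀ x, f (dc x) = dc' (f x)) (g_dc : ∀ x, g (dc' x) = dc (g x))
    (s_dg : ∀ x, s (dg x) = dg (s x))
    (gf : ∀ x, x - g (f x) = dc (s x) + s (dc x))
    (fg : ∀ x, f (g x) = x) : HomotopyEquivalent β β' C D :=
  HomotopyEquivalent.ofRetract C_dg C_dc D_dg D_dc f g 0 0 s 0 lf lg EdgeLinear.zero EdgeLinear.zero
    ls EdgeLinear.zero df dg₀ HasDegree.zero HasDegree.zero ds HasDegree.zero f_dg g_dg
    (fun x => by rw [f_dc, sub_self, LinearMap.zero_apply, LinearMap.zero_apply, ← D_dg, map_zero,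
      add_zero])
    (fun x => by rw [g_dc, sub_self, LinearMap.zero_apply, LinearMap.zero_apply, ← C_dg, map_zero,
      add_zero])
    s_dg
    (fun x => by rw [gf, LinearMap.zero_apply, LinearMap.zero_apply, ← C_dg 0, map_zero,
      add_zero, add_zero])
    fg

/-- The linear map with prescribed coordinates. -/
noncomputable def ofCoords {M ι : Type} [AddCommGroup M] [Module ℚ M] (f :
    ι → M →ₗ[ℚ] MvPolynomial V ℚ) :
    M →ₗ[ℚ] ι → MvPolynomial V ℚ := LinearMap.pi f

theorem ofCoords_apply {M ι : Type} [AddCommGroup M] [Module ℚ M]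
    (f : ι → M →ₗ[ℚ] MvPolynomial V ℚ) (x : M) (i : ι) : ofCoords f x i = f i x := rfl

/-- A coordinate. -/
noncomputable def coord {ι : Type} (i : ι) : (ι → MvPolynomial V ℚ) →ₗ[ℚ] MvPolynomial V ℚ :=
    LinearMap.proj i

theorem coord_apply {ι : Type} (i : ι) (x : ι → MvPolynomial V ℚ) : coord i x = x i := rfl

end Retract

/-! ### The cancellation behind the antiparallel type II move -/

section Antiparallel

variable {V U : Type} {β : V → U} (L : Elimination β)

open Corner

namespace Elimination

/-- The retraction, as a linear map. -/
noncomputable def εL : MvPolynomial U ℚ →ₗ[ℚ] MvPolynomial V ℚ := L.ε.toLinearMap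

theorem εL_apply (p : MvPolynomial U ℚ) : L.εL p = L.ε p := rfl

end Elimination

/-- The change of marks, as a linear map. -/
noncomputable def renameL (β : V → U) : MvPolynomial V ℚ →ₗ[ℚ] MvPolynomial U ℚ :=
  (rename β).toLinearMap

theorem renameL_apply (β : V → U) (p : MvPolynomial V ℚ) : renameL β p = rename β p := rfl

namespace Elimination

/-- The coordinates of the projection for the antiparallel type II move. -/
noncomputable def antiProjCoord : Corner → (Corner × Corner → MvPolynomial U ℚ) →ₗ[ℚ]
    MvPolynomial V ℚ
  | w0 => -L.εL ∘ₗ coord (w0, w0)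
  | w1 => -L.εL ∘ₗ coord (w0, w1)
  | p0 => L.εL ∘ₗ coord (w0, p0)
  | p1 => L.εL ∘ₗ coord (w0, p1)

/-- The coordinates of the inclusion for the antiparallel type II move. -/
noncomputable def antiInclCoord (β : V → U) : Corner × Corner → (Corner → MvPolynomial V ℚ) →ₗ[ℚ]
    MvPolynomial U ℚ
  | (w0, p0) => renameL β ∘ₗ coord p0
  | (w0, p1) => renameL β ∘ₗ coord p1
  | (w0, w0) => -renameL β ∘ₗ coord w0
  | (w0, w1) => -renameL β ∘ₗ coord w1
  | (w1, w0) => -renameL β ∘ₗ coord w1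
  | (p0, p1) => -renameL β ∘ₗ coord w1
  | (p1, p0) => -renameL β ∘ₗ coord w1
  | _ => 0

/-- The coordinates of the homotopy for the antiparallel type II move. -/
noncomputable def antiHomotopyCoord : Corner × Corner → (Corner × Corner → MvPolynomial U ℚ) →ₗ[ℚ]
    MvPolynomial U ℚ
  | (p0, p0) => L.δ ∘ₗ coord (w0, p0)
  | (p0, p1) => L.δ ∘ₗ coord (w0, p1)
  | (p1, p0) => coord (w1, p0)
  | (p1, p1) => coord (w1, p1)
  | (p0, w0) => L.δ ∘ₗ coord (w0, w0)
  | (p0, w1) => L.δ ∘ₗ coord (w0, w1)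
  | (p1, w0) => coord (w1, w0) - renameL β ∘ₗ L.εL ∘ₗ coord (w0, w1)
  | (p1, w1) => coord (w1, w1)
  | _ => 0

variable (p η : MvPolynomial V ℚ)

/-- `d_g` in the tensor product of the reduced complexes of a positive and a negative crossing. -/
noncomputable def antiDg (p₁ ζ₁ p₂ ζ₂ : MvPolynomial U ℚ) :
    (Corner × Corner → MvPolynomial U ℚ) → Corner × Corner → MvPolynomial U ℚ :=
  tensorFormula (cornerDg p₁ ζ₁) (cornerSignA U) (cornerDg p₂ ζ₂)

/-- `d_c` in the tensor product of the reduced complexes of a positive and a negative crossing. -/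
noncomputable def antiDc (ζ₁ ζ₂ : MvPolynomial U ℚ) :
    (Corner × Corner → MvPolynomial U ℚ) → Corner × Corner → MvPolynomial U ℚ :=
  tensorFormula (posDc ζ₁) (cornerSignT U) (negDc ζ₂)

theorem δ_ξ : L.δ L.ξ = 1 := by
  have := L.δ_ξ_mul 1
  rwa [mul_one] at this

theorem δ_one : L.δ 1 = 0 := by
  have := L.δ_rename 1
  rwa [map_one] at this

section

variable (x : Corner × Corner → MvPolynomial U ℚ) (y : Corner → MvPolynomial V ℚ)

/-- The projection keeps the row of the positive corner `w0` and sets `ξ = 0`; whatever enters this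
row from `w1` or `p0` carries a factor `ξ`. The minus signs on the negative corners `w0`, `w1`
compensate the sign `(-1)^t` of the positive `w0` in `d_c`. -/
theorem antiProj_dg : ofCoords L.antiProjCoord
      (antiDg (rename β p) L.ξ (-rename β p) (L.ξ + rename β η) x) =
    cornerDg (-p) η (ofCoords L.antiProjCoord x) := by
  funext i
  cases i <;> simp only [ofCoords_apply, antiProjCoord, antiDg, tensorFormula, cornerDg,
    cornerSignA, LinearMap.neg_apply, LinearMap.comp_apply, coord_apply, εL_apply, map_add,
    map_neg, map_mul, L.ε_rename, L.ε_ξ, map_one, map_zero] <;> ring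

theorem antiProj_dc : ofCoords L.antiProjCoord
      (antiDc L.ξ (L.ξ + rename β η) x) = negDc η (ofCoords L.antiProjCoord x) := by
  funext i
  cases i <;> simp only [ofCoords_apply, antiProjCoord, antiDc, tensorFormula, posDc, negDc,
    cornerSignT, LinearMap.neg_apply, LinearMap.comp_apply, coord_apply, εL_apply, map_add,
    map_neg, map_mul, L.ε_rename, L.ε_ξ, map_one, map_zero] <;> ring

/-- A naive lift to the row of `w0` errs by multiples of `ξ`, since the negative square has `ξ+η` in
place of `η`. The copies of the coordinate `w1` at `(w1, w0)`, `(p0, p1)` and `(p1, p0)` cancel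
these errors, so the inclusion respects both differentials strictly. -/
theorem antiIncl_dg : ofCoords (antiInclCoord β) (cornerDg (-p) η y) =
    antiDg (rename β p) L.ξ (-rename β p) (L.ξ + rename β η) (ofCoords (antiInclCoord β) y) := by
  funext ⟨i, j⟩
  cases i <;> cases j <;> simp only [ofCoords_apply, antiInclCoord, antiDg, tensorFormula,
    cornerDg, cornerSignA, LinearMap.neg_apply, LinearMap.comp_apply, coord_apply, renameL_apply,
    map_neg, map_mul, map_zero, LinearMap.zero_apply] <;> ring

theorem antiIncl_dc : ofCoords (antiInclCoord β) (negDc η y) =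
    antiDc L.ξ (L.ξ + rename β η) (ofCoords (antiInclCoord β) y) := by
  funext ⟨i, j⟩
  cases i <;> cases j <;> simp only [ofCoords_apply, antiInclCoord, antiDc, tensorFormula,
    posDc, negDc, cornerSignT, LinearMap.neg_apply, LinearMap.comp_apply, coord_apply,
    renameL_apply, map_mul, map_zero, LinearMap.zero_apply] <;> ring

theorem antiProj_antiIncl : ofCoords L.antiProjCoord (ofCoords (antiInclCoord β) y) = y := by
  funext i
  cases i <;> simp only [ofCoords_apply, antiInclCoord, antiProjCoord, LinearMap.neg_apply,
    LinearMap.comp_apply, coord_apply, renameL_apply, εL_apply, map_neg, L.ε_rename, neg_neg]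

/-- The homotopy inverts the positive `d_c`: `δ` divides by `ξ` from `w0` to `p0`, and the identity
goes from `w1` to `p1`. As `δ` is not linear over `ξ`, commuting with `d_g` requires the correction
by the retraction of `(w0, w1)` at `(p1, w0)`. -/
theorem antiHomotopy_dg : ofCoords L.antiHomotopyCoord
      (antiDg (rename β p) L.ξ (-rename β p) (L.ξ + rename β η) x) =
    antiDg (rename β p) L.ξ (-rename β p) (L.ξ + rename β η) (ofCoords L.antiHomotopyCoord x) := by
  funext ⟨i, j⟩
  have h := L.spec (x (w1, j))
  cases i <;> cases j <;> simp only [ofCoords_apply, antiHomotopyCoord, antiDg, tensorFormula,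
    cornerDg, cornerSignA, LinearMap.comp_apply, LinearMap.sub_apply,
    coord_apply, renameL_apply, εL_apply,
    map_add, map_neg, map_mul, map_zero, LinearMap.zero_apply, L.δ_mul, L.δ_rename, L.δ_ξ,
    L.δ_one, L.ε_rename, L.ε_ξ] <;> first | ring1 | linear_combination (-rename β p) * h

/-- In the row of `w0` this is `h = ε h + ξ δ h`. In the other rows it comes from `δ (ξ h) = h` and
from the unit entry `p1 → w1`. -/
theorem antiHomotopy_spec :
    x - ofCoords (antiInclCoord β) (ofCoords L.antiProjCoord x) =
      (antiDc L.ξ (L.ξ + rename β η) (ofCoords L.antiHomotopyCoord x) +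
        ofCoords L.antiHomotopyCoord (antiDc L.ξ (L.ξ + rename β η) x)) := by
  funext ⟨i, j⟩
  have h := L.spec (x (i, j))
  cases i <;> cases j <;> simp only [Pi.sub_apply, Pi.add_apply, ofCoords_apply, antiHomotopyCoord,
    antiInclCoord, antiProjCoord, antiDc, tensorFormula,
    posDc, negDc, cornerSignT, LinearMap.neg_apply, LinearMap.comp_apply, LinearMap.sub_apply,
    coord_apply, renameL_apply, εL_apply,
    map_add, map_neg, map_mul, map_zero, LinearMap.zero_apply, L.δ_mul, L.δ_rename, L.δ_ξ,
    L.δ_one, L.ε_ξ, L.ε_rename] <;> first | ring1 | linear_combination h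

end

variable {p η} (hp : IsWeightedHomogeneous (qWeight V) p 2)
  (hη : IsWeightedHomogeneous (qWeight V) η 2)
  (hp₁ : IsWeightedHomogeneous (qWeight U) (rename β p) 2)
  (hp₂ : IsWeightedHomogeneous (qWeight U) (-rename β p) 2)
  (hη₂ : IsWeightedHomogeneous (qWeight U) (L.ξ + rename β η) 2)

theorem neg_cell {W : Type} {d : ℤ} {P : Prop} {y : MvPolynomial W ℚ} (h : y ∈ cell W d P) :
    -y ∈ cell W d P := Submodule.neg_mem _ h

theorem δ_place {i q q' a a' t t' j k m n : ℤ} {y : MvPolynomial U ℚ}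
    (h : y ∈ cell U (i - q) (a = j ∧ t = k)) (hq : q' = q + 2) (ha : a' = a + m) (ht : t' = t + n) :
    L.δ y ∈ cell U (i - q') (a' = j + m ∧ t' = k + n) :=
  L.δ_cell h (by rw [hq]; ring) (by omega)

theorem antiProj_degree : HasDegree
    (C := (redPos (rename β p) L.ξ hp₁ L.ξ_deg).tensor (redNeg _ _ hp₂ hη₂))
    (D := (redNeg (-p) η (isWeightedHomogeneous_neg hp) hη).shift (-2) 0 1)
    0 0 (ofCoords L.antiProjCoord) := by
  intro i j k x hx
  refine forall_corner ?_ ?_ ?_ ?_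
  · exact cell.neg_place (L.ε_cell (hx (w0, w0))) rfl rfl rfl
  · exact cell.neg_place (L.ε_cell (hx (w0, w1))) rfl rfl rfl
  · exact cell.place (L.ε_cell (hx (w0, p0))) rfl rfl rfl
  · exact cell.place (L.ε_cell (hx (w0, p1))) rfl rfl rfl

theorem antiIncl_degree : HasDegree
    (C := (redNeg (-p) η (isWeightedHomogeneous_neg hp) hη).shift (-2) 0 1)
    (D := (redPos (rename β p) L.ξ hp₁ L.ξ_deg).tensor (redNeg _ _ hp₂ hη₂))
    0 0 (ofCoords (antiInclCoord β)) := by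
  intro i j k y hy
  rintro ⟨b, c⟩
  cases b <;> cases c
  · exact cell.neg_place (rename_cell β (hy w0)) rfl rfl rfl
  · exact cell.neg_place (rename_cell β (hy w1)) rfl rfl rfl
  · exact cell.place (rename_cell β (hy p0)) rfl rfl rfl
  · exact cell.place (rename_cell β (hy p1)) rfl rfl rfl
  · exact cell.neg_place (rename_cell β (hy w1)) rfl rfl rfl
  · exact Submodule.zero_mem (cell U _ _)
  · exact Submodule.zero_mem (cell U _ _)
  · exact Submodule.zero_mem (cell U _ _)
  · exact Submodule.zero_mem (cell U _ _)
  · exact Submodule.zero_mem (cell U _ _)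
  · exact Submodule.zero_mem (cell U _ _)
  · exact cell.neg_place (rename_cell β (hy w1)) rfl rfl rfl
  · exact Submodule.zero_mem (cell U _ _)
  · exact Submodule.zero_mem (cell U _ _)
  · exact cell.neg_place (rename_cell β (hy w1)) rfl rfl rfl
  · exact Submodule.zero_mem (cell U _ _)

theorem antiHomotopy_degree : HasDegree
    (C := (redPos (rename β p) L.ξ hp₁ L.ξ_deg).tensor (redNeg _ _ hp₂ hη₂))
    (D := (redPos (rename β p) L.ξ hp₁ L.ξ_deg).tensor (redNeg _ _ hp₂ hη₂))
    0 (-1) (ofCoords L.antiHomotopyCoord) := by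
  intro i j k x hx
  rintro ⟨b, c⟩
  cases b <;> cases c
  · exact Submodule.zero_mem (cell U _ _)
  · exact Submodule.zero_mem (cell U _ _)
  · exact Submodule.zero_mem (cell U _ _)
  · exact Submodule.zero_mem (cell U _ _)
  · exact Submodule.zero_mem (cell U _ _)
  · exact Submodule.zero_mem (cell U _ _)
  · exact Submodule.zero_mem (cell U _ _)
  · exact Submodule.zero_mem (cell U _ _)
  · exact L.δ_place (hx (w0, w0)) rfl rfl rfl
  · exact L.δ_place (hx (w0, w1)) rfl rfl rfl
  · exact L.δ_place (hx (w0, p0)) rfl rfl rfl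
  · exact L.δ_place (hx (w0, p1)) rfl rfl rfl
  · exact Submodule.sub_mem (cell U _ _) (cell.move (hx (w1, w0)) rfl rfl rfl)
      (cell.move (rename_cell β (L.ε_cell (hx (w0, w1)))) rfl rfl rfl)
  · exact cell.move (hx (w1, w1)) rfl rfl rfl
  · exact cell.move (hx (w1, p0)) rfl rfl rfl
  · exact cell.move (hx (w1, p1)) rfl rfl rfl

theorem antiProj_smul (q : MvPolynomial V ℚ) (x : Corner × Corner → MvPolynomial U ℚ) :
    ofCoords L.antiProjCoord (rename β q • x) = rename id q • ofCoords L.antiProjCoord x := by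
  funext i
  rw [rename_id_apply]
  cases i <;> simp only [ofCoords_apply, antiProjCoord, LinearMap.neg_apply, LinearMap.comp_apply,
    coord_apply, Pi.smul_apply, smul_eq_mul, εL_apply, map_mul, L.ε_rename, mul_neg]

theorem antiIncl_smul (q : MvPolynomial V ℚ) (y : Corner → MvPolynomial V ℚ) :
    ofCoords (antiInclCoord β) (rename id q • y) =
      rename β q • ofCoords (antiInclCoord β) y := by
  funext ⟨i, j⟩
  rw [rename_id_apply]
  cases i <;> cases j <;> simp only [ofCoords_apply, antiInclCoord, LinearMap.neg_apply,
    LinearMap.comp_apply, LinearMap.zero_apply,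
    coord_apply, Pi.smul_apply, smul_eq_mul, renameL_apply, map_mul, mul_neg, mul_zero]

theorem antiHomotopy_smul (q : MvPolynomial V ℚ) (x : Corner × Corner → MvPolynomial U ℚ) :
    ofCoords L.antiHomotopyCoord (rename β q • x) =
      rename β q • ofCoords L.antiHomotopyCoord x := by
  funext ⟨i, j⟩
  cases i <;> cases j <;> simp only [ofCoords_apply, antiHomotopyCoord, LinearMap.sub_apply,
    LinearMap.comp_apply, LinearMap.zero_apply, L.δ_rename_mul, εL_apply, L.ε_rename, mul_sub,
    coord_apply, Pi.smul_apply, smul_eq_mul, renameL_apply, map_mul, mul_zero]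

/-- The core of the type IIb move for antiparallel strands: a variable and two corners of the
reduced complexes are eliminated. -/
theorem antiparallel : HomotopyEquivalent β id
    ((redPos (rename β p) L.ξ hp₁ L.ξ_deg).tensor (redNeg _ _ hp₂ hη₂))
    ((redNeg (-p) η (isWeightedHomogeneous_neg hp) hη).shift (-2) 0 1) :=
  HomotopyEquivalent.ofStrictRetract
    ((redPos_formula hp₁ L.ξ_deg).tensor (redNeg_formula hp₂ hη₂)).dg_eq
    ((redPos_formula hp₁ L.ξ_deg).tensor (redNeg_formula hp₂ hη₂)).dc_eq
    (redNeg_formula (isWeightedHomogeneous_neg hp) hη).dg_eq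
    (redNeg_formula (isWeightedHomogeneous_neg hp) hη).dc_eq
    (ofCoords L.antiProjCoord) (ofCoords (antiInclCoord β)) (ofCoords L.antiHomotopyCoord)
    L.antiProj_smul antiIncl_smul L.antiHomotopy_smul
    (L.antiProj_degree hp hη hp₁ hp₂ hη₂) (L.antiIncl_degree hp hη hp₁ hp₂ hη₂)
    (L.antiHomotopy_degree hp₁ hp₂ hη₂)
    (L.antiProj_dg p η) (L.antiIncl_dg p η) (L.antiProj_dc η) (L.antiIncl_dc η)
    (L.antiHomotopy_dg p η) (L.antiHomotopy_spec η) L.antiProj_antiIncl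

end Elimination

end Antiparallel

end KR


namespace KR

open MvPolynomial

/-! ### Change of marks and removal of arcs in diagrams -/

section Diagrams

variable {V U W : Type}

theorem koszulMatrix_map (f : MvPolynomial V ℚ →ₐ[ℚ] MvPolynomial W ℚ) (p₁ p₂ : MvPolynomial V ℚ) :
    (koszulMatrix p₁ p₂).map f = koszulMatrix (f p₁) (f p₂) := by
  ext1 i j
  fin_cases i <;> fin_cases j <;> simp [koszulMatrix]

theorem chiIn_map (f : V → W) (x₂ y₁ : V) :
    (chiIn x₂ y₁).map (rename f) = chiIn (f x₂) (f y₁) := by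
  ext1 i j
  fin_cases i <;> fin_cases j <;> simp [chiIn]

theorem chiOut_map (f : V → W) (x₂ y₁ : V) :
    (chiOut x₂ y₁).map (rename f) = chiOut (f x₂) (f y₁) := by
  ext1 i j
  fin_cases i <;> fin_cases j <;> simp [chiOut]

theorem fromBlocks_rename {ι κ : Type} (f : V → W) {A A' : Matrix ι ι _} {B B' : Matrix ι κ _}
    {C C' : Matrix κ ι _} {D D' : Matrix κ κ _}
    (hA : A.map (rename f) = A') (hB : B.map (rename f) = B') (hC : C.map (rename f) = C')
    (hD : D.map (rename f) = D') : (Matrix.fromBlocks A B C D).map (rename (R := ℚ) f) =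
      Matrix.fromBlocks A' B' C' D' := by
  rw [Matrix.fromBlocks_map, hA, hB, hC, hD]

theorem zero_rename {ι κ : Type} (f : V → W) :
    (0 : Matrix ι κ (MvPolynomial V ℚ)).map (rename f) = 0 :=
  Matrix.map_zero _ (map_zero _)

theorem parComplex_map (f : V → W) (x₁ x₂ y₁ y₂ : V) :
    (parComplex x₁ x₂ y₁ y₂).dg.map (rename f) = (parComplex (f x₁) (f x₂) (f y₁) (f y₂)).dg :=
  (koszulMatrix_map (rename f) _ _).trans (by simp [parComplex, koszul2])

theorem virComplex_map (f : V → W) (x₁ x₂ y₁ y₂ : V) :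
    (virComplex x₁ x₂ y₁ y₂).dg.map (rename f) = (virComplex (f x₁) (f x₂) (f y₁) (f y₂)).dg :=
  (koszulMatrix_map (rename f) _ _).trans (by simp [virComplex, koszul2])

theorem wideComplex_map (f : V → W) (x₁ x₂ y₁ y₂ : V) :
    (wideComplex x₁ x₂ y₁ y₂).dg.map (rename f) = (wideComplex (f x₁) (f x₂) (f y₁) (f y₂)).dg :=
  (koszulMatrix_map (rename f) _ _).trans (by simp [wideComplex, koszul2])

theorem Equivalent.piece_map (f : V → W) (p : Piece V) :
    Equivalent (p.map f).complex (p.complex.rename f) := by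
  match p with
  | .arc x y =>
    exact ((Equivalent.koszul1_map (lin_q x y) (rename f) (isGraded_rename f)).trans
      (Equivalent.koszul1_eq _ (lin_q (f x) (f y)) (by simp))).symm
  | .crossing .pos x₁ x₂ y₁ y₂ =>
    refine Equivalent.ofEntries (Equiv.refl _) (fun _ => rfl) (fun _ => rfl) (fun _ => rfl) ?_ ?_
    · exact fun i j => congrFun (congrFun (fromBlocks_rename f (parComplex_map f x₁ x₂ y₁ y₂)
        (zero_rename f) (zero_rename f) (wideComplex_map f x₁ x₂ y₁ y₂)) i) j
    · exact fun i j => congrFun (congrFun (fromBlocks_rename f (zero_rename f) (zero_rename f)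
        (chiIn_map f x₂ y₁) (zero_rename f)) i) j
  | .crossing .neg x₁ x₂ y₁ y₂ =>
    refine Equivalent.ofEntries (Equiv.refl _) (fun _ => rfl) (fun _ => rfl) (fun _ => rfl) ?_ ?_
    · exact fun i j => congrFun (congrFun (fromBlocks_rename f (wideComplex_map f x₁ x₂ y₁ y₂)
        (zero_rename f) (zero_rename f) (parComplex_map f x₁ x₂ y₁ y₂)) i) j
    · exact fun i j => congrFun (congrFun (fromBlocks_rename f (zero_rename f) (zero_rename f)
        (chiOut_map f x₂ y₁) (zero_rename f)) i) j
  | .crossing .vir x₁ x₂ y₁ y₂ =>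
    refine Equivalent.ofEntries (Equiv.refl _) (fun _ => rfl) (fun _ => rfl) (fun _ => rfl) ?_ ?_
    · exact fun i j => congrFun (congrFun (virComplex_map f x₁ x₂ y₁ y₂) i) j
    · exact fun i j => congrFun (congrFun (zero_rename f) i) j

theorem Equivalent.map_congr {C : Bicomplex V} {φ ψ : MvPolynomial V ℚ →ₐ[ℚ] MvPolynomial W ℚ}
    (hφ : IsGraded φ) (hψ : IsGraded ψ) (h : ∀ p, φ p = ψ p) :
    Equivalent (C.map φ hφ) (C.map ψ hψ) :=
  Equivalent.ofEntries (Equiv.refl _) (fun _ => rfl) (fun _ => rfl) (fun _ => rfl)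
    (fun _ _ => (h _).symm) (fun _ _ => (h _).symm)

/-- The bicomplex of a diagram with renamed marks. -/
theorem Equivalent.cpx_map (f : V → W) (l : List (Piece V)) :
    Equivalent (cpx (l.map (Piece.map f))) ((cpx l).rename f) := by
  induction l with
  | nil =>
    exact Equivalent.ofEntries (Equiv.refl _) (fun _ => rfl) (fun _ => rfl) (fun _ => rfl)
      (fun _ _ => map_zero (rename f)) (fun _ _ => map_zero (rename f))
  | cons p l ih =>
    exact ((Equivalent.piece_map f p).tensor_right _).trans ((ih.tensor_left _).trans
      (Equivalent.map_tensor p.complex (cpx l) (rename f) (isGraded_rename f)).symm)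

theorem Equivalent.cpx_perm {l l' : List (Piece V)} (h : l.Perm l') :
    Equivalent (cpx l) (cpx l') := by
  induction h with
  | nil => exact HomotopyEquivalent.refl _ _
  | cons p _ ih => exact ih.tensor_left p.complex
  | swap p p' l => exact Equivalent.tensor_left_comm p'.complex p.complex (cpx l)
  | trans _ _ ih ih' => exact HomotopyEquivalent.trans ih ih'

/-- The two equations of a virtual crossing are those of two arcs that pass through each other, so
virtual crossings disappear from the computation. -/
theorem Equivalent.cpx_vir (x₁ x₂ y₁ y₂ : V) (l : List (Piece V)) :
    Equivalent (cpx (.crossing .vir x₁ x₂ y₁ y₂ :: l)) (cpx (.arc x₁ y₂ :: .arc x₂ y₁ :: l)) :=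
  ((Equivalent.koszul2 (lin_q x₂ y₁) (lin_q x₁ y₂)).tensor_right (cpx l)).trans
    (Equivalent.tensor_assoc (arcComplex x₁ y₂) (arcComplex x₂ y₁) (cpx l))

/-- A mark `x` and a mark `y` at the ends of an arc are identified. -/
noncomputable def Elimination.ofArc (f : U → V) (β : V → U) (x y : U) (hxy : x ≠ y)
    (hf : f x = f y) (hβ : ∀ v, f (β v) = v)
    (h : ∀ u, β (f u) = u ∨ (u = x ∧ β (f u) = y) ∨ (u = y ∧ β (f u) = x)) : Elimination β := by
  classical
  exact
  { ρ := fun u => X (f u)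
    ξ := X y - X x
    ρ_deg := fun u => isWeightedHomogeneous_X ℚ (qWeight V) _
    ξ_deg := lin_q x y
    ρ_section := fun v => by rw [hβ]
    ξ_ne := fun h0 => hxy ((X_injective (sub_eq_zero.mp h0)).symm)
    ξ_kills := by simp [hf]
    -- Either end of the arc may be the dropped one: `x = y - ξ` or `y = x + ξ`.
    coeff := fun u => if β (f u) = u then 0 else if u = x then -1 else 1
    coeff_spec := fun u => by
      rcases h u with h | ⟨h, h'⟩ | ⟨h, h'⟩
      · rw [if_pos h, rename_X, h]
        simp
      · rw [rename_X, h', if_neg (h ▸ hxy.symm), if_pos h, h]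
        simp
      · rw [rename_X, h', if_neg (h ▸ hxy), if_neg (h ▸ hxy.symm), h]
        simp }

/-- Removal of an arc. -/
theorem HomotopyEquivalent.removeArc (f : U → V) (β : V → U) (x y : U) (hxy : x ≠ y)
    (hf : f x = f y) (hβ : ∀ v, f (β v) = v)
    (h : ∀ u, β (f u) = u ∨ (u = x ∧ β (f u) = y) ∨ (u = y ∧ β (f u) = x)) (l : List (Piece U)) :
    HomotopyEquivalent β id (cpx (.arc x y :: l)) (cpx (l.map (Piece.map f))) :=
  ((Elimination.ofArc f β x y hxy hf hβ h).equivalent (cpx l)).trans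
    ((Equivalent.map_congr (Elimination.ofArc f β x y hxy hf hβ h).ε_graded (isGraded_rename f)
      fun p => DFunLike.congr_fun (algHom_ext (fun u => (aeval_X _ u).trans (rename_X f u).symm))
          p).trans (Equivalent.cpx_map f l).symm)

theorem piece_map_map (f : U → V) (g : V → W) (p : Piece U) :
    (p.map f).map g = p.map (g ∘ f) := by
  cases p <;> rfl

theorem list_map_map (f : U → V) (g : V → W) (l : List (Piece U)) :
    (l.map (Piece.map f)).map (Piece.map g) = l.map (Piece.map (g ∘ f)) := by
  rw [List.map_map]
  exact List.map_congr_left fun p _ => piece_map_map f g p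

theorem list_map_id (l : List (Piece U)) : l.map (Piece.map id) = l := by
  refine (List.map_congr_left fun p _ => ?_).trans (List.map_id l)
  cases p <;> rfl

theorem lift_map (n : ℕ) (l : List (Piece V)) (g : V ⊕ Fin n → W) :
    (lift n l).map (Piece.map g) = l.map (Piece.map (g ∘ Sum.inl)) := list_map_map _ _ l

/-- The identification of the mark `z = inr 0` with `b`, where `w = inr 1` is the new mark. -/
def forgetLeft (b : V) : V ⊕ Fin 2 → Option V :=
  Sum.elim some fun i => if i = 0 then some b else none

/-- The marks without `inr 0`. -/
def keepRight : Option V → V ⊕ Fin 2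
  | some v => Sum.inl v
  | none => Sum.inr 1

/-- A type IIb configuration with a virtual crossing reduces to a crossing. -/
theorem HomotopyEquivalent.virNegIIb (a b c e : V) (l : List (Piece V)) :
    HomotopyEquivalent Sum.inl id (cpx (virNegIIb a b c e l))
      (cpx (.crossing .neg c a e b :: l)) := by
  have h1 := (Equivalent.cpx_vir (Sum.inl a) (Sum.inr 0) (Sum.inl b) (Sum.inr 1)
    (.crossing .neg (Sum.inl c) (Sum.inr 1) (Sum.inl e) (Sum.inr 0) :: lift 2 l)).trans
      (Equivalent.cpx_perm (List.Perm.swap _ _ _))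
  -- The arc from `inr 0` to `b` removes the mark `inr 0`. In `h3` the arc from `a` removes `inr 1`,
  -- which by then is `none`.
  have h2 := HomotopyEquivalent.removeArc (forgetLeft b) keepRight (Sum.inr 0) (Sum.inl b) (by simp)
    rfl (by rintro (_ | v) <;> rfl)
    (by
      rintro (v | i)
      · exact Or.inl rfl
      · fin_cases i
        · exact Or.inr (Or.inl ⟨rfl, rfl⟩)
        · exact Or.inl rfl)
    (.arc (Sum.inl a) (Sum.inr 1) ::
      .crossing .neg (Sum.inl c) (Sum.inr 1) (Sum.inl e) (Sum.inr 0) :: lift 2 l)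
  have h3 := HomotopyEquivalent.removeArc (fun o : Option V => o.getD a) some (some a) none
      (by simp)
    rfl (fun _ => rfl)
    (by
      rintro (_ | v)
      · exact Or.inr (Or.inr ⟨rfl, rfl⟩)
      · exact Or.inl rfl)
    (.crossing .neg (some c) none (some e) (some b) :: l.map (Piece.map some))
  have e1 : (l.map (Piece.map some)).map (Piece.map fun o : Option V => o.getD a) = l :=
    (list_map_map _ _ l).trans (list_map_id l)
  have e2 : (lift 2 l).map (Piece.map (forgetLeft b)) = l.map (Piece.map some) := lift_map _ _ _
  have h4 := (h1.restrict keepRight).trans h2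
  rw [List.map_cons, List.map_cons, e2] at h4
  have h5 := (h4.restrict some).trans h3
  rw [List.map_cons, e1] at h5
  exact h5

end Diagrams

end KR


namespace KR

open MvPolynomial

/-! ### Elimination of the inner marks between a positive and a negative crossing -/

section TypeIIb

variable {V U W : Type}

/-- Elimination of a variable in the tensor product of two reduced crossings. -/
theorem Elimination.equivalent_posNeg {β : V → U} (L : Elimination β)
    {P ζ σ Q θ : MvPolynomial U ℚ}
    (hP : IsWeightedHomogeneous (qWeight U) P 2) (hζ : IsWeightedHomogeneous (qWeight U) ζ 2)
    (hσ : IsWeightedHomogeneous (qWeight U) σ 2) (hQ : IsWeightedHomogeneous (qWeight U) Q 2)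
    (hθ : IsWeightedHomogeneous (qWeight U) θ 2) {P' ζ' σ' Q' θ' : MvPolynomial V ℚ}
    (hP' : IsWeightedHomogeneous (qWeight V) P' 2) (hζ' : IsWeightedHomogeneous (qWeight V) ζ' 2)
    (hσ' : IsWeightedHomogeneous (qWeight V) σ' 2) (hQ' : IsWeightedHomogeneous (qWeight V) Q' 2)
    (hθ' : IsWeightedHomogeneous (qWeight V) θ' 2)
    (eP : L.ε P = P') (eζ : L.ε ζ = ζ') (eσ : L.ε σ = σ') (eQ : L.ε Q = Q') (eθ : L.ε θ = θ')
    (E : Bicomplex V) :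
    HomotopyEquivalent β id
      (((koszul1 L.ξ 2 L.ξ_deg).tensor (redPos P ζ hP hζ)).tensor
        (((koszul1 σ 2 hσ).tensor (redNeg Q θ hQ hθ)).tensor (E.rename β)))
      (((redPos P' ζ' hP' hζ').tensor
        ((koszul1 σ' 2 hσ').tensor (redNeg Q' θ' hQ' hθ'))).tensor E) := by
  set R := redPos P ζ hP hζ
  set S := (koszul1 σ 2 hσ).tensor (redNeg Q θ hQ hθ)
  -- The linear factor is brought to the front, so that all the rest is the bicomplex in which the
  -- mark is eliminated.
  have h1 : Equivalent (((koszul1 L.ξ 2 L.ξ_deg).tensor R).tensor (S.tensor (E.rename β)))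
      (L.source ((R.tensor S).tensor (E.rename β))) :=
    (Equivalent.tensor_assoc _ R _).trans
      (Equivalent.tensor_left (Equivalent.tensor_assoc R S (E.rename β)).symm _)
  have h2 : Equivalent (L.target (R.tensor S))
      ((redPos P' ζ' hP' hζ').tensor ((koszul1 σ' 2 hσ').tensor (redNeg Q' θ' hQ' hθ'))) :=
    (Equivalent.map_tensor R S L.ε L.ε_graded).trans
      ((Equivalent.tensor_right ((Equivalent.redPos_map hP hζ L.ε L.ε_graded).trans
        (Equivalent.redPos_eq _ _ hP' hζ' eP eζ)) _).trans
      (Equivalent.tensor_left ((Equivalent.map_tensor _ _ L.ε L.ε_graded).trans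
        ((Equivalent.tensor_right ((Equivalent.koszul1_map hσ L.ε L.ε_graded).trans
          (Equivalent.koszul1_eq _ hσ' eσ)) _).trans
        (Equivalent.tensor_left ((Equivalent.redNeg_map hQ hθ L.ε L.ε_graded).trans
          (Equivalent.redNeg_eq _ _ hQ' hθ' eQ eθ)) _))) _))
  exact (h1.restrict β).trans ((L.equivalent_tensor (R.tensor S) E).trans (h2.tensor_right E))

/-- The second step of the type IIb move for antiparallel strands. -/
theorem Elimination.antiparallel_tensor {β : V → U} (L : Elimination β)
    {P Q θ τ : MvPolynomial U ℚ}
    (hP : IsWeightedHomogeneous (qWeight U) P 2) (hQ : IsWeightedHomogeneous (qWeight U) Q 2)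
    (hθ : IsWeightedHomogeneous (qWeight U) θ 2) (hτ : IsWeightedHomogeneous (qWeight U) τ 2)
    {p η σ : MvPolynomial V ℚ}
    (hp : IsWeightedHomogeneous (qWeight V) p 2) (hη : IsWeightedHomogeneous (qWeight V) η 2)
    (hσ : IsWeightedHomogeneous (qWeight V) σ 2) (k l : ℚ) (eτ : τ = rename β σ)
    (eP : P = -rename β p) (eQ : Q = rename β p + C k * τ)
    (eθ : θ = L.ξ + rename β η + C l * τ) (E : Bicomplex V) :
    HomotopyEquivalent β id
      (((redPos P L.ξ hP L.ξ_deg).tensor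
        ((koszul1 τ 2 hτ).tensor (redNeg Q θ hQ hθ))).tensor (E.rename β))
      ((((koszul1 σ 2 hσ).tensor (redNeg p η hp hη)).tensor E).shift (-2) 0 1) := by
  subst eτ
  have hn : IsWeightedHomogeneous (qWeight V) (-p) 2 := isWeightedHomogeneous_neg hp
  have h₁ : IsWeightedHomogeneous (qWeight U) (rename β (-p)) 2 := isGraded_rename β _ _ hn
  have h₂ : IsWeightedHomogeneous (qWeight U) (-rename β (-p)) 2 := isWeightedHomogeneous_neg h₁
  have h₃ : IsWeightedHomogeneous (qWeight U) (L.ξ + rename β η) 2 :=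
    L.ξ_deg.add (isGraded_rename β _ _ hη)
  set R := redPos (rename β (-p)) L.ξ h₁ L.ξ_deg
  set S := redNeg (-rename β (-p)) (L.ξ + rename β η) h₂ h₃
  set K := koszul1 (rename β σ) 2 hτ
  -- Next to `[τ]` only the classes of `Q` and `θ` modulo `τ` matter. The double negation appears
  -- because `antiparallel` is applied with `-p`.
  have e1 : Equivalent (K.tensor (redNeg Q θ hQ hθ)) (K.tensor S) :=
    Equivalent.redNeg_congr hτ hQ hθ h₂ h₃ (-k) (-l) (by rw [eQ, map_neg, C_neg]; ring)
      (by rw [eθ, C_neg]; ring)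
  have e2 : Equivalent (redPos P L.ξ hP L.ξ_deg) R :=
    Equivalent.redPos_eq _ _ _ _ (by rw [eP, map_neg]) rfl
  -- Neither the remaining Koszul factor nor `E` involves the mark to be removed; together they form
  -- a tensor factor over the edge ring.
  have e3 : Equivalent (K.tensor (E.rename β)) (((koszul1 σ 2 hσ).tensor E).rename β) :=
    (Equivalent.tensor_right (Equivalent.koszul1_map hσ (rename β) (isGraded_rename β)).symm
      (E.rename β)).trans (Equivalent.map_tensor _ E (rename β) (isGraded_rename β)).symm
  have e4 : Equivalent (((redPos P L.ξ hP L.ξ_deg).tensor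
        (K.tensor (redNeg Q θ hQ hθ))).tensor (E.rename β))
      ((R.tensor S).tensor (((koszul1 σ 2 hσ).tensor E).rename β)) :=
    (Equivalent.tensor_right ((Equivalent.tensor_left e1 _).trans
        ((Equivalent.tensor_right e2 _).trans
      ((Equivalent.tensor_left (Equivalent.tensor_comm K S) R).trans
        (Equivalent.tensor_assoc R S K).symm))) (E.rename β)).trans
      ((Equivalent.tensor_assoc (R.tensor S) K (E.rename β)).trans (Equivalent.tensor_left e3 _))
  have e5 := HomotopyEquivalent.tensor ((koszul1 σ 2 hσ).tensor E)
    (L.antiparallel hn hη h₁ h₂ h₃)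
  have e6 : Equivalent (redNeg (- -p) η (isWeightedHomogeneous_neg hn) hη) (redNeg p η hp hη) :=
    Equivalent.redNeg_eq _ _ _ _ (neg_neg p) rfl
  have e7 : Equivalent (((redNeg (- -p) η (isWeightedHomogeneous_neg hn) hη).shift (-2) 0 1).tensor
        (((koszul1 σ 2 hσ).tensor E).rename id))
      ((((koszul1 σ 2 hσ).tensor (redNeg p η hp hη)).tensor E).shift (-2) 0 1) :=
    (Equivalent.shift_tensor _ _ _ _ _).trans (HomotopyEquivalent.shift
      ((Equivalent.tensor_left (Equivalent.rename_id _) _).trans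
        ((Equivalent.tensor_right e6 _).trans ((Equivalent.tensor_left_comm _ _ E).trans
          (Equivalent.tensor_assoc _ _ E).symm))) (-2) 0 1)
  exact (e4.restrict β).trans (e5.trans e7)

end TypeIIb

end KR


namespace KR

open MvPolynomial

/-! ### The two type IIb reductions and the symmetry of a negative crossing -/

section TypeIIbMoves

variable {V : Type}

/-- The marks without `inr 1`. -/
def keepLeft : Option V → V ⊕ Fin 2
  | some v => Sum.inl v
  | none => Sum.inr 0

/-- Elimination of the mark `inr 1`. -/
noncomputable def Elimination.lastMark (r : MvPolynomial (Option V) ℚ)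
    (ξ : MvPolynomial (V ⊕ Fin 2) ℚ) (hr : IsWeightedHomogeneous (qWeight _) r 2)
    (hξ : IsWeightedHomogeneous (qWeight _) ξ 2)
    (h : X (Sum.inr 1) = MvPolynomial.rename keepLeft r + C 1 * ξ) :
    Elimination (keepLeft : Option V → V ⊕ Fin 2) :=
  Elimination.ofMark keepLeft (Sum.inr 1) (Sum.elim some fun _ => none)
    (by
      rintro (v | i) h
      · rfl
      · fin_cases i
        · rfl
        · exact absurd rfl h)
    (by rintro (_ | v) <;> rfl) (by rintro (_ | v) <;> simp [keepLeft]) r ξ hr hξ 1 one_ne_zero h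

/-- Elimination of the mark `none`. -/
noncomputable def Elimination.optionMark (b : V) (ξ : MvPolynomial (Option V) ℚ)
    (hξ : IsWeightedHomogeneous (qWeight _) ξ 2) (k : ℚ) (hk : k ≠ 0)
    (h : X none = MvPolynomial.rename some (X b) + C k * ξ) :
    Elimination (some : V → Option V) :=
  Elimination.ofMark some none (fun o => o.getD b)
    (by
      rintro (_ | v) h
      · exact absurd rfl h
      · rfl)
    (fun _ => rfl) (by simp) (X b) ξ (isWeightedHomogeneous_X ℚ (qWeight V) b) hξ k hk h

theorem Elimination.lastMark_ε_inl {r : MvPolynomial (Option V) ℚ}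
    {ξ : MvPolynomial (V ⊕ Fin 2) ℚ} (hr : IsWeightedHomogeneous (qWeight _) r 2)
    (hξ : IsWeightedHomogeneous (qWeight _) ξ 2)
    (h : X (Sum.inr 1) = MvPolynomial.rename keepLeft r + C 1 * ξ) (v : V) :
    (Elimination.lastMark r ξ hr hξ h).ε (X (Sum.inl v)) = X (some v) :=
  (aeval_X _ _).trans (if_neg (by simp))

theorem Elimination.lastMark_ε_zero {r : MvPolynomial (Option V) ℚ}
    {ξ : MvPolynomial (V ⊕ Fin 2) ℚ} (hr : IsWeightedHomogeneous (qWeight _) r 2)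
    (hξ : IsWeightedHomogeneous (qWeight _) ξ 2)
    (h : X (Sum.inr 1) = MvPolynomial.rename keepLeft r + C 1 * ξ) :
    (Elimination.lastMark r ξ hr hξ h).ε (X (Sum.inr 0)) = X none :=
  (aeval_X _ _).trans (if_neg (by simp))

theorem Elimination.lastMark_ε_one {r : MvPolynomial (Option V) ℚ}
    {ξ : MvPolynomial (V ⊕ Fin 2) ℚ} (hr : IsWeightedHomogeneous (qWeight _) r 2)
    (hξ : IsWeightedHomogeneous (qWeight _) ξ 2)
    (h : X (Sum.inr 1) = MvPolynomial.rename keepLeft r + C 1 * ξ) :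
    (Elimination.lastMark r ξ hr hξ h).ε (X (Sum.inr 1)) = r :=
  (aeval_X _ _).trans (if_pos rfl)

/-- The outer diagram has no inner marks. In this form it is carried through both eliminations one
after the other. -/
theorem Equivalent.cpx_lift (l : List (Piece V)) :
    Equivalent (cpx (lift 2 l)) (((cpx l).rename some).rename keepLeft) :=
  (Equivalent.cpx_map Sum.inl l).trans (Equivalent.map_map (rename some) (isGraded_rename _)
    (rename keepLeft) (isGraded_rename _) (rename Sum.inl) (isGraded_rename _)
    fun p => rename_rename _ _ p).symm

/-- A type IIb configuration with a positive crossing reduces to a crossing. -/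
theorem HomotopyEquivalent.posNegIIb (a b c e : V) (l : List (Piece V)) :
    HomotopyEquivalent Sum.inl id (cpx (posNegIIb a b c e l))
      ((cpx (.crossing .neg c a e b :: l)).shift (-2) 0 1) := by
  -- With `z = inr 0` and `w = inr 1`, the positive crossing has `σ = b+w-a-z`, whence `w = a+z-b`.
  let L₁ := Elimination.lastMark (X (some a) + X none - X (some b))
    (X (Sum.inl b) + X (Sum.inr 1) - X (Sum.inl a) - X (Sum.inr 0))
    (by
      rw [add_sub_assoc]
      exact (isWeightedHomogeneous_X ℚ (qWeight _) _).add (lin_q _ _)) (sum_q _ _ _ _)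
    (by simp [keepLeft]; ring)
  -- The `ζ` of the positive crossing is `ξ = b-z`; setting it to zero removes `z`, now called
  -- `none`.
  let L₂ := Elimination.optionMark b (X (some b) - X none) (lin_q _ _) (-1) (by simp) (by simp)
  have θ_deg : IsWeightedHomogeneous (qWeight (Option V))
      (X (some b) + X (some e) - X (some a) - X none : MvPolynomial (Option V) ℚ) 2 := sum_q _ _ _ _
  have e1 := L₁.equivalent_posNeg (lin_q (Sum.inl a) (Sum.inl b)) (lin_q (Sum.inr 0) (Sum.inl b))
    (sum_q (Sum.inl c) (Sum.inr 1) (Sum.inl e) (Sum.inr 0)) (lin_q (Sum.inl c) (Sum.inl e))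
    (lin_q (Sum.inr 1) (Sum.inl e)) (lin_q (some a) (some b)) (lin_q none (some b))
    (sum_q (some c) (some a) (some e) (some b)) (lin_q (some c) (some e)) θ_deg
    (by simp [L₁, Elimination.lastMark_ε_inl])
    (by simp [L₁, Elimination.lastMark_ε_inl, Elimination.lastMark_ε_zero])
    (by
      simp [L₁, Elimination.lastMark_ε_inl, Elimination.lastMark_ε_zero,
        Elimination.lastMark_ε_one]
      ring)
    (by simp [L₁, Elimination.lastMark_ε_inl])
    (by
      simp [L₁, Elimination.lastMark_ε_inl, Elimination.lastMark_ε_one]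
      ring) ((cpx l).rename some)
  -- With `τ = e+b-c-a`, the negative crossing has `e-c = (a-b) + τ`, opposite to the positive `b-a`
  -- modulo `τ`, and its `ζ` is `e+b-a-z = ξ + (e-a)`. Hence the constants 1 and 0.
  have e2 := L₂.antiparallel_tensor (lin_q (some a) (some b)) (lin_q (some c) (some e)) θ_deg
    (sum_q (some c) (some a) (some e) (some b)) (lin_q b a) (lin_q a e) (sum_q c a e b) 1 0
    (by simp) (by simp) (by simp; ring)
    (by simp [L₂, Elimination.optionMark, Elimination.ofMark]; ring) (cpx l)
  -- The remaining square contains `a-b` where the crossing `(c,a;e,b)` has `e-c`; the two agree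
  -- modulo `σ`.
  have e3 : Equivalent (((koszul1 (X e + X b - X c - X a) 2 (sum_q c a e b)).tensor
      (redNeg (X a - X b) (X e - X a) (lin_q b a) (lin_q a e))).tensor (cpx l))
      (cpx (.crossing .neg c a e b :: l)) :=
    Equivalent.tensor_right ((Equivalent.redNeg_congr (sum_q c a e b) (lin_q b a) (lin_q a e)
      (lin_q c e) (lin_q a e) 1 0 (by simp; ring) (by simp)).trans
      (Equivalent.neg c a e b).symm) (cpx l)
  have e0 : Equivalent (cpx (KR.posNegIIb a b c e l)) _ :=
    (Equivalent.tensor_right (Equivalent.pos _ _ _ _) _).trans (Equivalent.tensor_left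
      ((Equivalent.tensor_right (Equivalent.neg _ _ _ _) _).trans
        (Equivalent.tensor_left (Equivalent.cpx_lift l) _)) _)
  have h1 := (e0.restrict keepLeft).trans e1
  exact ((h1.restrict some).trans e2).trans (e3.shift _ _ _)

open Piece in
/-- The same for the mirrored configuration. -/
theorem HomotopyEquivalent.posNegIIb' (a b c e : V) (l : List (Piece V)) :
    HomotopyEquivalent Sum.inl id
      (cpx (crossing .pos (Sum.inr 0) (Sum.inl a) (Sum.inr 1) (Sum.inl b) ::
        crossing .neg (Sum.inr 1) (Sum.inl c) (Sum.inr 0) (Sum.inl e) :: lift 2 l))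
      ((cpx (.crossing .neg a c b e :: l)).shift (-2) 0 1) := by
  -- Again `w = a+z-b`. This time the positive `ζ` is `w-a = z-b`, and the negative crossing has
  -- `z-w = b-a` exactly, so both correction constants below are 0.
  let L₁ := Elimination.lastMark (X (some a) + X none - X (some b))
    (X (Sum.inr 1) + X (Sum.inl b) - X (Sum.inr 0) - X (Sum.inl a))
    (by
      rw [add_sub_assoc]
      exact (isWeightedHomogeneous_X ℚ (qWeight _) _).add (lin_q _ _)) (sum_q _ _ _ _)
    (by simp [keepLeft]; ring)
  let L₂ := Elimination.optionMark b (X none - X (some b)) (lin_q _ _) 1 (by simp) (by simp)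
  have e1 := L₁.equivalent_posNeg (lin_q (Sum.inr 0) (Sum.inr 1)) (lin_q (Sum.inl a) (Sum.inr 1))
    (sum_q (Sum.inr 1) (Sum.inl c) (Sum.inr 0) (Sum.inl e)) (lin_q (Sum.inr 1) (Sum.inr 0))
    (lin_q (Sum.inl c) (Sum.inr 0)) (lin_q (some b) (some a)) (lin_q (some b) none)
    (sum_q (some a) (some c) (some b) (some e)) (lin_q (some a) (some b)) (lin_q (some c) none)
    (by simp [L₁, Elimination.lastMark_ε_zero, Elimination.lastMark_ε_one]; ring)
    (by simp [L₁, Elimination.lastMark_ε_inl, Elimination.lastMark_ε_one]; ring)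
    (by
      simp [L₁, Elimination.lastMark_ε_inl, Elimination.lastMark_ε_zero,
        Elimination.lastMark_ε_one]
      ring)
    (by simp [L₁, Elimination.lastMark_ε_zero, Elimination.lastMark_ε_one]; ring)
    (by simp [L₁, Elimination.lastMark_ε_inl, Elimination.lastMark_ε_zero])
    ((cpx l).rename some)
  have e2 := L₂.antiparallel_tensor (lin_q (some b) (some a)) (lin_q (some a) (some b))
    (lin_q (some c) none)
    (sum_q (some a) (some c) (some b) (some e)) (lin_q a b) (lin_q c b) (sum_q a c b e) 0 0
    (by simp) (by simp) (by simp)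
    (by simp [L₂, Elimination.optionMark, Elimination.ofMark]) (cpx l)
  have e3 : Equivalent (((koszul1 (X b + X e - X a - X c) 2 (sum_q a c b e)).tensor
      (redNeg (X b - X a) (X b - X c) (lin_q a b) (lin_q c b))).tensor (cpx l))
      (cpx (.crossing .neg a c b e :: l)) :=
    Equivalent.tensor_right (Equivalent.neg a c b e).symm (cpx l)
  have e0 : Equivalent (cpx (crossing .pos (Sum.inr 0) (Sum.inl a) (Sum.inr 1) (Sum.inl b) ::
        crossing .neg (Sum.inr 1) (Sum.inl c) (Sum.inr 0) (Sum.inl e) :: lift 2 l)) _ :=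
    (Equivalent.tensor_right (Equivalent.pos _ _ _ _) _).trans (Equivalent.tensor_left
      ((Equivalent.tensor_right (Equivalent.neg _ _ _ _) _).trans
        (Equivalent.tensor_left (Equivalent.cpx_lift l) _)) _)
  have h1 := (e0.restrict keepLeft).trans e1
  exact ((h1.restrict some).trans e2).trans (e3.shift _ _ _)

/-- The sign of the basis element `w1`. -/
def wideSign : Corner → ℤ
  | .w1 => 1
  | _ => 0

/-- Changing the sign of the basis element `w1` alone reverses both entries that contain `ζ`. -/
theorem Equivalent.redNeg_neg_right {p ζ : MvPolynomial V ℚ}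
    (hp : IsWeightedHomogeneous (qWeight V) p 2) (hζ : IsWeightedHomogeneous (qWeight V) ζ 2) :
    Equivalent (redNeg p ζ hp hζ) (redNeg p (-ζ) hp (isWeightedHomogeneous_neg hζ)) := by
  refine Equivalent.ofEquiv (Equiv.refl _) wideSign (fun _ => rfl) (fun _ => rfl)
    (fun _ => rfl) ?_ ?_
  · intro (i : Corner) (j : Corner)
    change cornerDgMatrix p (-ζ) i j = (sg (wideSign i) * sg (wideSign j)) • cornerDgMatrix p ζ i j
    cases i <;> cases j <;> simp [cornerDgMatrix, wideSign, sg]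
  · intro (i : Corner) (j : Corner)
    change negDcMatrix (-ζ) i j = (sg (wideSign i) * sg (wideSign j)) • negDcMatrix ζ i j
    cases i <;> cases j <;> simp [negDcMatrix, wideSign, sg]

/-- The two strands of a negative crossing play the same role. -/
theorem Equivalent.neg_swap (x₁ x₂ y₁ y₂ : V) :
    Equivalent (negComplex x₁ x₂ y₁ y₂) (negComplex x₂ x₁ y₂ y₁) := by
  -- Signs of the basis reverse `p` and `ζ`. Adding `σ` then turns `-(y₁-x₁)` into `y₂-x₂` and
  -- `-(y₁-x₂)` into `y₂-x₁`.
  have h1 := (Equivalent.redNeg_neg (lin_q x₁ y₁) (lin_q x₂ y₁)).trans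
    (Equivalent.redNeg_neg_right (isWeightedHomogeneous_neg (lin_q x₁ y₁)) (lin_q x₂ y₁))
  have h2 := Equivalent.redNeg_congr (sum_q x₁ x₂ y₁ y₂) (isWeightedHomogeneous_neg (lin_q x₁ y₁))
    (isWeightedHomogeneous_neg (lin_q x₂ y₁)) (lin_q x₂ y₂) (lin_q x₁ y₂) 1 1
    (by rw [C_1]; ring) (by rw [C_1]; ring)
  have h3 := Equivalent.koszul1_eq (sum_q x₁ x₂ y₁ y₂) (sum_q x₂ x₁ y₂ y₁) (by ring)
  exact (Equivalent.neg x₁ x₂ y₁ y₂).trans ((Equivalent.tensor_left h1 _).trans (h2.trans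
    ((Equivalent.tensor_right h3 _).trans (Equivalent.neg x₂ x₁ y₂ y₁).symm)))

end TypeIIbMoves

end KR


namespace KR

open MvPolynomial

/-! ### The cancellation behind the parallel type II move -/

section Parallel

variable {V U : Type} {β : V → U} (L L' : Elimination β)

open Corner

namespace Elimination

/-- The linear coefficient of a polynomial at `ξ`, in the expansion `h = ε h + ξ (∂ h) + ξ ξ' k`. -/
noncomputable def second : MvPolynomial U ℚ →ₗ[ℚ] MvPolynomial V ℚ := L'.εL ∘ₗ L.δ

/-- The coefficient `k` in the expansion `h = ε h + ξ (∂ h) + ξ ξ' k`. -/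
noncomputable def third : MvPolynomial U ℚ →ₗ[ℚ] MvPolynomial U ℚ := L'.δ ∘ₗ L.δ

theorem second_apply (h : MvPolynomial U ℚ) : L.second L' h = L'.ε (L.δ h) := rfl

theorem third_apply (h : MvPolynomial U ℚ) : L.third L' h = L'.δ (L.δ h) := rfl

variable {c : MvPolynomial V ℚ} (h : MvPolynomial U ℚ)
  (p : MvPolynomial V ℚ)

theorem εL_rename_mul : L.εL (rename β p * h) = p * L.εL h := by
  rw [εL_apply, map_mul, L.ε_rename, εL_apply]

theorem εL_ξ_mul : L.εL (L.ξ * h) = 0 := by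
  rw [εL_apply, map_mul, L.ε_ξ, zero_mul]

theorem second_rename_mul : L.second L' (rename β p * h) = p * L.second L' h := by
  rw [second_apply, L.δ_rename_mul, map_mul, L'.ε_rename, second_apply]

theorem third_rename_mul : L.third L' (rename β p * h) = rename β p * L.third L' h := by
  rw [third_apply, L.δ_rename_mul, L'.δ_rename_mul, third_apply]

theorem δ_eq_second : L.δ h = rename β (L.second L' h) + L'.ξ * L.third L' h := L'.spec _

/-- Division with remainder, first by `ξ` and then by `ξ' = ξ+c`. Modulo `ξξ'`, the equation of the
wide edge, the ring is free over `ℚ[V]` with basis `1, ξ`; this splits the term wide ⊗ wide. -/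
theorem expansion (e : L'.ξ = L.ξ + rename β c) :
    h = rename β (L.εL h) + L.ξ * rename β (L.second L' h) +
    L.ξ * (L.ξ + rename β c) * L.third L' h := by
  have h1 := L.spec h
  have h2 := L.δ_eq_second L' h
  rw [e] at h2
  rw [εL_apply]
  linear_combination h1 + L.ξ * h2

/-- Modulo `ξξ'` one has `ξ² = -cξ`, so multiplication by `ξ` makes the constant coefficient the
linear one and contributes `-c` times the old linear one. -/
theorem second_ξ_mul (e : L'.ξ = L.ξ + rename β c) :
    L.second L' (L.ξ * h) = L.εL h - c * L.second L' h := by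
  have h1 : L'.ε L.ξ = -c := by
    have := congrArg L'.ε e
    rw [L'.ε_ξ, map_add, L'.ε_rename] at this
    linear_combination -this
  have h2 := congrArg L'.ε (L.expansion L' h e)
  rw [← e, map_add, map_add, map_mul, map_mul, map_mul, h1, L'.ε_ξ, L'.ε_rename, L'.ε_rename] at h2
  rw [second_apply, L.δ_ξ_mul, h2]
  ring

/-- From `ξ² = ξξ' - cξ`: the old linear coefficient moves into the quotient by `ξξ'`. -/
theorem third_ξ_mul (e : L'.ξ = L.ξ + rename β c) :
    L.third L' (L.ξ * h) =
    rename β (L.second L' h) + L.ξ * L.third L' h := by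
  rw [third_apply, L.δ_ξ_mul]
  refine L'.δ_eq ?_
  have h2 := L.second_ξ_mul L' h e
  rw [second_apply, L.δ_ξ_mul] at h2
  rw [h2, map_sub, map_mul]
  linear_combination -L.expansion L' h e + (rename β (L.second L' h) + L.ξ * L.third L' h) * e

variable (d : MvPolynomial V ℚ)

/-- The coordinates of the projection for the parallel type II move. -/
noncomputable def parProjCoord (c d : MvPolynomial V ℚ) : Fin 2 →
    (Corner × Corner → MvPolynomial U ℚ) →ₗ[ℚ] MvPolynomial V ℚ
  | 0 => L.εL ∘ₗ coord (p0, p0) + L.second L' ∘ₗ coord (w0, w0)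
  | 1 => L.εL ∘ₗ coord (p0, p1) +
      LinearMap.mulLeft ℚ (d + c) ∘ₗ L.second L' ∘ₗ coord (w0, w1)

/-- The homotopy for the projection for the parallel type II move. -/
noncomputable def parProjHomotopyCoord : Fin 2 →
    (Corner × Corner → MvPolynomial U ℚ) →ₗ[ℚ] MvPolynomial V ℚ
  | 0 => 0
  | 1 => -(L.second L' ∘ₗ coord (w0, p0))

/-- The coordinates of the inclusion for the parallel type II move. -/
noncomputable def parInclCoord (β : V → U) (c d : MvPolynomial V ℚ) : Corner × Corner →
    (Fin 2 → MvPolynomial V ℚ) →ₗ[ℚ] MvPolynomial U ℚ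
  | (p0, p0) => renameL β ∘ₗ coord 0
  | (w0, w0) => -(renameL β ∘ₗ LinearMap.mulLeft ℚ (d + c) ∘ₗ coord 0)
  | (p1, p0) => renameL β ∘ₗ coord 1
  | (p0, p1) => renameL β ∘ₗ coord 1
  | (w1, w0) => -(renameL β ∘ₗ coord 1)
  | (w0, w1) => -(renameL β ∘ₗ coord 1)
  | _ => 0

/-- The homotopy for the inclusion for the parallel type II move. -/
noncomputable def parInclHomotopyCoord (β : V → U) : Corner × Corner →
    (Fin 2 → MvPolynomial V ℚ) →ₗ[ℚ] MvPolynomial U ℚ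
  | (p1, w0) => -(renameL β ∘ₗ coord 0)
  | _ => 0

/-- The homotopy with respect to `d_c` for the parallel type II move. -/
noncomputable def parHomotopyCoord (c d : MvPolynomial V ℚ) : Corner × Corner →
    (Corner × Corner → MvPolynomial U ℚ) →ₗ[ℚ] MvPolynomial U ℚ
  | (w0, w0) => renameL β ∘ₗ L.εL ∘ₗ coord (p0, w0)
  | (w0, w1) => renameL β ∘ₗ L.εL ∘ₗ coord (p0, w1)
  | (w1, w0) => renameL β ∘ₗ L.εL ∘ₗ coord (p0, w1)
  | (w0, p0) => -(renameL β ∘ₗ L.second L' ∘ₗ coord (w0, w0))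
  | (w1, p0) => -(renameL β ∘ₗ L.second L' ∘ₗ coord (w0, w1))
  | (w0, p1) => -(LinearMap.mulLeft ℚ (rename β d + L.ξ + rename β c) ∘ₗ renameL β ∘ₗ
      L.second L' ∘ₗ coord (w0, w1))
  | _ => 0

/-- The homotopy with respect to `d_g` for the parallel type II move. -/
noncomputable def parCorrectionCoord (c : MvPolynomial V ℚ) : Corner × Corner →
    (Corner × Corner → MvPolynomial U ℚ) →ₗ[ℚ] MvPolynomial U ℚ
  | (p1, p0) => renameL β ∘ₗ L.second L' ∘ₗ coord (p0, p0) +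
      LinearMap.mulLeft ℚ (L.ξ + rename β c) ∘ₗ L.third L' ∘ₗ coord (p0, p0)
  | (p1, p1) => renameL β ∘ₗ L.second L' ∘ₗ coord (p0, p1) +
      LinearMap.mulLeft ℚ (L.ξ + rename β c) ∘ₗ L.third L' ∘ₗ coord (p0, p1) +
      renameL β ∘ₗ L.second L' ∘ₗ coord (w0, w1)
  | (p1, w0) => renameL β ∘ₗ L.second L' ∘ₗ coord (p0, w0) +
      LinearMap.mulLeft ℚ (L.ξ + rename β c) ∘ₗ L.third L' ∘ₗ coord (p0, w0)
  | (p1, w1) => renameL β ∘ₗ L.second L' ∘ₗ coord (p0, w1) +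
      LinearMap.mulLeft ℚ (L.ξ + rename β c) ∘ₗ L.third L' ∘ₗ coord (p0, w1)
  | (w1, w0) => L.third L' ∘ₗ coord (w0, w0)
  | (w1, w1) => L.third L' ∘ₗ coord (w0, w1)
  | (w0, p1) => -(renameL β ∘ₗ L.second L' ∘ₗ coord (w0, p0))
  | (w1, p0) => L.third L' ∘ₗ coord (w0, p0)
  | (w1, p1) => L.third L' ∘ₗ coord (w0, p1)
  | _ => 0

/-- `d_g` in the tensor product of the reduced complexes of a negative and a positive crossing. -/
noncomputable def parDg (c d : MvPolynomial V ℚ) :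
    (Corner × Corner → MvPolynomial U ℚ) → Corner × Corner → MvPolynomial U ℚ :=
  tensorFormula (cornerDg L.ξ (L.ξ + rename β c)) (cornerSignA U)
    (cornerDg (rename β d - L.ξ) (rename β d + L.ξ + rename β c))

/-- `d_c` in the tensor product of the reduced complexes of a negative and a positive crossing. -/
noncomputable def parDc (c d : MvPolynomial V ℚ) :
    (Corner × Corner → MvPolynomial U ℚ) → Corner × Corner → MvPolynomial U ℚ :=
  tensorFormula (negDc (L.ξ + rename β c)) (cornerSignT U) (posDc (rename β d + L.ξ + rename β c))

section

variable (x : Corner × Corner → MvPolynomial U ℚ) (y : Fin 2 → MvPolynomial V ℚ)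

/-- The surviving `[d]` is read off from the constant coefficient on arcs ⊗ arcs and the coefficient
of `ξ` on wide ⊗ wide. Since `(d-ξ)(d+ξ+c) = d(d+c) - ξξ'`, the latter needs the factor `d+c` in
Hochschild degree 1. -/
theorem parProj_dg (e : L'.ξ = L.ξ + rename β c) :
    ofCoords (L.parProjCoord L' c d) (L.parDg c d x) =
    koszul1Dg d (ofCoords (L.parProjCoord L' c d) x) := by
  funext i
  fin_cases i <;> simp only [ofCoords_apply, parProjCoord, parDg, tensorFormula, cornerDg,
    cornerSignA, koszul1Dg, LinearMap.add_apply, LinearMap.comp_apply,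
    LinearMap.mulLeft_apply, coord_apply, map_add, map_sub, map_zero,
    mul_assoc, add_mul, sub_mul, one_mul, mul_zero, mul_add, mul_sub,
    L.εL_rename_mul, L.εL_ξ_mul, L.second_rename_mul, L.second_ξ_mul L' (e := e)] <;> ring

/-- In contrast to the antiparallel case, the projection commutes with `d_c` only up to a homotopy
for `d_g`, namely the linear coefficient at `(w0, p0)`. -/
theorem parProj_dc (e : L'.ξ = L.ξ + rename β c) :
    ofCoords (L.parProjCoord L' c d) (L.parDc c d x) - (fun _ => 0) =
    koszul1Dg d (ofCoords (L.parProjHomotopyCoord L') x) +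
      ofCoords (L.parProjHomotopyCoord L') (L.parDg c d x) := by
  funext i
  fin_cases i <;> simp only [Pi.sub_apply, Pi.add_apply, ofCoords_apply, parProjCoord,
    parProjHomotopyCoord, parDg, parDc, tensorFormula, cornerDg,
    cornerSignA, cornerSignT, negDc, posDc, koszul1Dg, LinearMap.neg_apply, LinearMap.add_apply,
    LinearMap.comp_apply, LinearMap.zero_apply,
    LinearMap.mulLeft_apply, coord_apply, map_add, map_sub, map_neg, map_zero,
    mul_assoc, add_mul, sub_mul, neg_mul, one_mul, mul_zero, mul_add, mul_sub, mul_neg,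
    L.εL_rename_mul, L.εL_ξ_mul, L.second_rename_mul, L.second_ξ_mul L' (e := e)] <;> ring

theorem parIncl_dg : ofCoords (parInclCoord β c d) (koszul1Dg d y) =
    L.parDg c d (ofCoords (parInclCoord β c d) y) := by
  funext ⟨i, j⟩
  cases i <;> cases j <;> simp only [ofCoords_apply, parInclCoord, parDg, tensorFormula, cornerDg,
    cornerSignA, koszul1Dg, LinearMap.neg_apply, LinearMap.comp_apply, LinearMap.zero_apply,
    LinearMap.mulLeft_apply, coord_apply, renameL_apply, map_add, map_mul, map_zero] <;> ring

theorem parIncl_dc : ofCoords (parInclCoord β c d) (fun _ => 0) -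
      L.parDc c d (ofCoords (parInclCoord β c d) y) =
    L.parDg c d (ofCoords (parInclHomotopyCoord β) y) +
      ofCoords (parInclHomotopyCoord β) (koszul1Dg d y) := by
  funext ⟨i, j⟩
  cases i <;> cases j <;> simp only [Pi.sub_apply, Pi.add_apply, ofCoords_apply, parInclCoord,
    parInclHomotopyCoord, parDg, parDc, tensorFormula, cornerDg, negDc, posDc, cornerSignT,
    cornerSignA, koszul1Dg, LinearMap.neg_apply, LinearMap.comp_apply, LinearMap.zero_apply,
    LinearMap.mulLeft_apply, coord_apply, renameL_apply, map_add, map_mul, map_zero] <;> ring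

theorem parHomotopy_dg (e : L'.ξ = L.ξ + rename β c) :
    ofCoords (L.parHomotopyCoord L' c d) (L.parDg c d x) =
    L.parDg c d (ofCoords (L.parHomotopyCoord L' c d) x) := by
  funext ⟨i, j⟩
  cases i <;> cases j <;> simp only [ofCoords_apply, parHomotopyCoord, parDg, tensorFormula,
    cornerDg, cornerSignA, LinearMap.neg_apply, LinearMap.comp_apply,
    LinearMap.zero_apply, renameL_apply, map_mul,
    LinearMap.mulLeft_apply, coord_apply, map_add, map_sub, map_zero,
    mul_assoc, add_mul, sub_mul, one_mul, mul_zero, mul_add, mul_sub, mul_neg,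
    L.εL_rename_mul, L.εL_ξ_mul, L.second_rename_mul, L.second_ξ_mul L' (e := e)] <;> ring

theorem parProj_parIncl : ofCoords (L.parProjCoord L' c d) (ofCoords (parInclCoord β c d) y) = y :=
    by
  have h1 : ∀ p, L.second L' (rename β p) = 0 := fun p => by
    rw [second_apply, L.δ_rename, map_zero]
  funext i
  fin_cases i <;> simp only [ofCoords_apply, parProjCoord, parInclCoord, LinearMap.neg_apply,
    LinearMap.add_apply, LinearMap.comp_apply, renameL_apply, εL_apply,
    L.ε_rename, h1, LinearMap.mulLeft_apply, coord_apply, map_neg] <;> simp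

/-- Of the two coefficients of wide ⊗ wide modulo `ξξ'`, the constant one cancels against arcs ⊗
wide and the linear one against wide ⊗ arcs, leaving a copy of arcs ⊗ arcs. These cancellations hold
only modulo entries of `d_g`, and `parCorrectionCoord` is the homotopy that accounts for the
remaining multiples. -/
theorem parHomotopy_spec (e : L'.ξ = L.ξ + rename β c) :
    x - ofCoords (parInclCoord β c d) (ofCoords (L.parProjCoord L' c d) x) =
      (L.parDc c d (ofCoords (L.parHomotopyCoord L' c d) x) +
        ofCoords (L.parHomotopyCoord L' c d) (L.parDc c d x)) +
      (L.parDg c d (ofCoords (L.parCorrectionCoord L' c) x) +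
        ofCoords (L.parCorrectionCoord L' c) (L.parDg c d x)) := by
  funext ⟨i, j⟩
  have h := L.expansion L' (x (i, j)) e
  cases i <;> cases j <;> simp only [Pi.sub_apply, Pi.add_apply, ofCoords_apply, parHomotopyCoord,
    parCorrectionCoord, parInclCoord, parProjCoord, parDg, parDc, tensorFormula,
    cornerDg, cornerSignA, cornerSignT, negDc, posDc, LinearMap.neg_apply, LinearMap.add_apply,
    LinearMap.comp_apply, LinearMap.zero_apply, renameL_apply, map_mul,
    LinearMap.mulLeft_apply, coord_apply, map_add, map_sub, map_neg, map_zero,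
    mul_assoc, add_mul, sub_mul, neg_mul, one_mul, mul_zero, mul_add, mul_sub, mul_neg,
    L.εL_rename_mul, L.εL_ξ_mul, L.second_rename_mul, L.second_ξ_mul L' (e := e),
    L.third_rename_mul, L.third_ξ_mul L' (e := e)] <;> first | ring1 | linear_combination h

end

theorem parProj_smul (q : MvPolynomial V ℚ) (x : Corner × Corner → MvPolynomial U ℚ) :
    ofCoords (L.parProjCoord L' c d) (rename β q • x) =
      rename id q • ofCoords (L.parProjCoord L' c d) x := by
  funext i
  rw [rename_id_apply]
  fin_cases i <;> simp only [ofCoords_apply, parProjCoord, LinearMap.add_apply,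
    LinearMap.comp_apply, coord_apply, Pi.smul_apply, smul_eq_mul, LinearMap.mulLeft_apply,
    L.εL_rename_mul, L.second_rename_mul] <;> ring

theorem parProjHomotopy_smul (q : MvPolynomial V ℚ) (x : Corner × Corner → MvPolynomial U ℚ) :
    ofCoords (L.parProjHomotopyCoord L') (rename β q • x) =
      rename id q • ofCoords (L.parProjHomotopyCoord L') x := by
  funext i
  rw [rename_id_apply]
  fin_cases i <;> simp only [ofCoords_apply, parProjHomotopyCoord, LinearMap.neg_apply,
    LinearMap.comp_apply, LinearMap.zero_apply, coord_apply, Pi.smul_apply, smul_eq_mul,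
    L.second_rename_mul] <;> ring

theorem parIncl_smul (q : MvPolynomial V ℚ) (y : Fin 2 → MvPolynomial V ℚ) :
    ofCoords (parInclCoord β c d) (rename id q • y) =
      rename β q • ofCoords (parInclCoord β c d) y := by
  funext ⟨i, j⟩
  rw [rename_id_apply]
  cases i <;> cases j <;> simp only [ofCoords_apply, parInclCoord, LinearMap.neg_apply,
    LinearMap.comp_apply, LinearMap.zero_apply, LinearMap.mulLeft_apply,
    coord_apply, Pi.smul_apply, smul_eq_mul, renameL_apply, map_mul] <;> ring

theorem parInclHomotopy_smul (q : MvPolynomial V ℚ) (y : Fin 2 → MvPolynomial V ℚ) :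
    ofCoords (parInclHomotopyCoord β) (rename id q • y) =
      rename β q • ofCoords (parInclHomotopyCoord β) y := by
  funext ⟨i, j⟩
  rw [rename_id_apply]
  cases i <;> cases j <;> simp only [ofCoords_apply, parInclHomotopyCoord, LinearMap.neg_apply,
    LinearMap.comp_apply, LinearMap.zero_apply,
    coord_apply, Pi.smul_apply, smul_eq_mul, renameL_apply, map_mul] <;> ring

theorem parHomotopy_smul (q : MvPolynomial V ℚ) (x : Corner × Corner → MvPolynomial U ℚ) :
    ofCoords (L.parHomotopyCoord L' c d) (rename β q • x) =
      rename β q • ofCoords (L.parHomotopyCoord L' c d) x := by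
  funext ⟨i, j⟩
  cases i <;> cases j <;> simp only [ofCoords_apply, parHomotopyCoord, LinearMap.neg_apply,
    LinearMap.comp_apply, LinearMap.zero_apply, LinearMap.mulLeft_apply, L.second_rename_mul,
    L.εL_rename_mul, coord_apply, Pi.smul_apply, smul_eq_mul, renameL_apply, map_mul] <;> ring

theorem parCorrection_smul (q : MvPolynomial V ℚ) (x : Corner × Corner → MvPolynomial U ℚ) :
    ofCoords (L.parCorrectionCoord L' c) (rename β q • x) =
      rename β q • ofCoords (L.parCorrectionCoord L' c) x := by
  funext ⟨i, j⟩
  cases i <;> cases j <;> simp only [ofCoords_apply, parCorrectionCoord, LinearMap.neg_apply,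
    LinearMap.add_apply, LinearMap.comp_apply, LinearMap.zero_apply, LinearMap.mulLeft_apply,
    L.second_rename_mul, L.third_rename_mul, coord_apply, Pi.smul_apply, smul_eq_mul,
    renameL_apply, map_mul] <;> ring

theorem second_place {i q q' a a' t t' j k m n : ℤ} {y : MvPolynomial U ℚ}
    (h : y ∈ cell U (i - q) (a = j ∧ t = k)) (hq : q' = q + 2) (ha : a' = a + m) (ht : t' = t + n) :
    L.second L' y ∈ cell V (i - q') (a' = j + m ∧ t' = k + n) :=
  L'.ε_cell (L.δ_place h hq ha ht)

theorem third_place {i q q' a a' t t' j k m n : ℤ} {y : MvPolynomial U ℚ}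
    (h : y ∈ cell U (i - q) (a = j ∧ t = k)) (hq : q' = q + 4) (ha : a' = a + m) (ht : t' = t + n) :
    L.third L' y ∈ cell U (i - q') (a' = j + m ∧ t' = k + n) :=
  L'.δ_cell (L.δ_cell h rfl id) (by rw [hq]; ring) (by omega)

theorem εL_place {i q q' a a' t t' j k m n : ℤ} {y : MvPolynomial U ℚ}
    (h : y ∈ cell U (i - q) (a = j ∧ t = k)) (hq : q' = q) (ha : a' = a + m) (ht : t' = t + n) :
    L.εL y ∈ cell V (i - q') (a' = j + m ∧ t' = k + n) :=
  cell.move (L.ε_cell h) hq ha ht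

theorem mul_place {W : Type} {i q q' a t j k : ℤ} {P y : MvPolynomial W ℚ}
    (hP : IsWeightedHomogeneous (qWeight W) P 2)
    (h : y ∈ cell W (i - q) (a = j ∧ t = k)) (hq : q = q' + 2) :
    P * y ∈ cell W (i - q') (a = j ∧ t = k) :=
  cell.mono (cell.mul hP h) (by rw [hq]; ring) id

variable {L L'} {d : MvPolynomial V ℚ} (hd : IsWeightedHomogeneous (qWeight V) d 2)
  (h₁ : IsWeightedHomogeneous (qWeight U) (L.ξ + rename β c) 2)
  (h₂ : IsWeightedHomogeneous (qWeight U) (rename β d - L.ξ) 2)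
  (h₃ : IsWeightedHomogeneous (qWeight U) (rename β d + L.ξ + rename β c) 2)

theorem parProj_degree (hcd : IsWeightedHomogeneous (qWeight V) (d + c) 2) : HasDegree
    (C := (redNeg L.ξ (L.ξ + rename β c) L.ξ_deg h₁).tensor (redPos _ _ h₂ h₃))
    (D := koszul1 d 2 hd) 0 0 (ofCoords (L.parProjCoord L' c d)) := by
  intro i j k x hx
  refine forall_fin_two ?_ ?_
  · exact Submodule.add_mem (cell V _ _) (L.εL_place (hx (p0, p0)) rfl rfl rfl)
      (L.second_place L' (hx (w0, w0)) rfl rfl rfl)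
  · refine Submodule.add_mem (cell V _ _) (L.εL_place (hx (p0, p1)) rfl rfl rfl)
      (mul_place hcd (L.second_place L' (hx (w0, w1)) (q' := 4) rfl rfl rfl) rfl)

theorem parProjHomotopy_degree : HasDegree
    (C := (redNeg L.ξ (L.ξ + rename β c) L.ξ_deg h₁).tensor (redPos _ _ h₂ h₃))
    (D := koszul1 d 2 hd) 1 1 (ofCoords (L.parProjHomotopyCoord L')) := by
  intro i j k x hx
  refine forall_fin_two (Submodule.zero_mem (cell V _ _)) ?_
  exact neg_cell (L.second_place L' (hx (w0, p0)) rfl rfl rfl)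

theorem parIncl_degree (hcd : IsWeightedHomogeneous (qWeight V) (d + c) 2) : HasDegree
    (C := koszul1 d 2 hd)
    (D := (redNeg L.ξ (L.ξ + rename β c) L.ξ_deg h₁).tensor (redPos _ _ h₂ h₃))
    0 0 (ofCoords (parInclCoord β c d)) := by
  intro i j k y hy
  rintro ⟨b, c⟩
  cases b <;> cases c
  case p0.p0 => exact cell.place (rename_cell β (hy (0 : Fin 2))) rfl rfl rfl
  case w0.w0 =>
    exact cell.neg_place (rename_cell β (mul_place hcd (hy (0 : Fin 2)) (q' := -2) rfl)) rfl rfl rfl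
  case p1.p0 => exact cell.place (rename_cell β (hy (1 : Fin 2))) rfl rfl rfl
  case p0.p1 => exact cell.place (rename_cell β (hy (1 : Fin 2))) rfl rfl rfl
  case w1.w0 => exact cell.neg_place (rename_cell β (hy (1 : Fin 2))) rfl rfl rfl
  case w0.w1 => exact cell.neg_place (rename_cell β (hy (1 : Fin 2))) rfl rfl rfl
  all_goals exact Submodule.zero_mem (cell U _ _)

theorem parInclHomotopy_degree : HasDegree
    (C := koszul1 d 2 hd)
    (D := (redNeg L.ξ (L.ξ + rename β c) L.ξ_deg h₁).tensor (redPos _ _ h₂ h₃))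
    1 1 (ofCoords (parInclHomotopyCoord β)) := by
  intro i j k y hy
  rintro ⟨b, c⟩
  cases b <;> cases c
  case p1.w0 => exact neg_cell (cell.move (rename_cell β (hy (0 : Fin 2))) rfl rfl rfl)
  all_goals exact Submodule.zero_mem (cell U _ _)

theorem parHomotopy_degree : HasDegree
    (C := (redNeg L.ξ (L.ξ + rename β c) L.ξ_deg h₁).tensor (redPos _ _ h₂ h₃))
    (D := (redNeg L.ξ (L.ξ + rename β c) L.ξ_deg h₁).tensor (redPos _ _ h₂ h₃))
    0 (-1) (ofCoords (L.parHomotopyCoord L' c d)) := by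
  intro i j k x hx
  rintro ⟨b, b'⟩
  cases b <;> cases b'
  case w0.w0 => exact rename_cell β (L.εL_place (hx (p0, w0)) rfl rfl rfl)
  case w0.w1 => exact rename_cell β (L.εL_place (hx (p0, w1)) rfl rfl rfl)
  case w1.w0 => exact rename_cell β (L.εL_place (hx (p0, w1)) rfl rfl rfl)
  case w0.p0 => exact neg_cell (rename_cell β (L.second_place L' (hx (w0, w0)) rfl rfl rfl))
  case w1.p0 => exact neg_cell (rename_cell β (L.second_place L' (hx (w0, w1)) rfl rfl rfl))
  case w0.p1 =>
    exact neg_cell (mul_place h₃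
      (rename_cell β (L.second_place L' (hx (w0, w1)) (q' := 4) rfl rfl rfl)) rfl)
  all_goals exact Submodule.zero_mem (cell U _ _)

theorem parCorrection_degree : HasDegree
    (C := (redNeg L.ξ (L.ξ + rename β c) L.ξ_deg h₁).tensor (redPos _ _ h₂ h₃))
    (D := (redNeg L.ξ (L.ξ + rename β c) L.ξ_deg h₁).tensor (redPos _ _ h₂ h₃))
    1 0 (ofCoords (L.parCorrectionCoord L' c)) := by
  intro i j k x hx
  rintro ⟨b, b'⟩
  cases b <;> cases b'
  case p1.p0 =>
    exact Submodule.add_mem (cell U _ _)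
      (rename_cell β (L.second_place L' (hx (p0, p0)) rfl rfl rfl))
      (mul_place h₁ (L.third_place L' (hx (p0, p0)) (q' := 4) rfl rfl rfl) rfl)
  case p1.p1 =>
    exact Submodule.add_mem (cell U _ _) (Submodule.add_mem (cell U _ _)
      (rename_cell β (L.second_place L' (hx (p0, p1)) rfl rfl rfl))
      (mul_place h₁ (L.third_place L' (hx (p0, p1)) (q' := 6) rfl rfl rfl) rfl))
      (rename_cell β (L.second_place L' (hx (w0, w1)) rfl rfl rfl))
  case p1.w0 =>
    exact Submodule.add_mem (cell U _ _)
      (rename_cell β (L.second_place L' (hx (p0, w0)) rfl rfl rfl))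
      (mul_place h₁ (L.third_place L' (hx (p0, w0)) (q' := 2) rfl rfl rfl) rfl)
  case p1.w1 =>
    exact Submodule.add_mem (cell U _ _)
      (rename_cell β (L.second_place L' (hx (p0, w1)) rfl rfl rfl))
      (mul_place h₁ (L.third_place L' (hx (p0, w1)) (q' := 6) rfl rfl rfl) rfl)
  case w1.w0 => exact L.third_place L' (hx (w0, w0)) rfl rfl rfl
  case w1.w1 => exact L.third_place L' (hx (w0, w1)) rfl rfl rfl
  case w0.p1 => exact neg_cell (rename_cell β (L.second_place L' (hx (w0, p0)) rfl rfl rfl))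
  case w1.p0 => exact L.third_place L' (hx (w0, p0)) rfl rfl rfl
  case w1.p1 => exact L.third_place L' (hx (w0, p1)) rfl rfl rfl
  all_goals exact Submodule.zero_mem (cell U _ _)

/-- The core of the type II move for parallel strands. -/
theorem parallel (hc : IsWeightedHomogeneous (qWeight V) c 2)
    (e : L'.ξ = L.ξ + rename β c) : HomotopyEquivalent β id
    ((redNeg L.ξ (L.ξ + rename β c) L.ξ_deg h₁).tensor (redPos _ _ h₂ h₃)) (koszul1 d 2 hd) :=
  HomotopyEquivalent.ofRetract
    ((redNeg_formula L.ξ_deg h₁).tensor (redPos_formula h₂ h₃)).dg_eq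
    ((redNeg_formula L.ξ_deg h₁).tensor (redPos_formula h₂ h₃)).dc_eq
    (koszul1_formula hd).dg_eq (koszul1_formula hd).dc_eq
    (ofCoords (L.parProjCoord L' c d)) (ofCoords (parInclCoord β c d))
    (ofCoords (L.parProjHomotopyCoord L')) (ofCoords (parInclHomotopyCoord β))
    (ofCoords (L.parHomotopyCoord L' c d)) (ofCoords (L.parCorrectionCoord L' c))
    (L.parProj_smul L' d) (parIncl_smul d) (L.parProjHomotopy_smul L') parInclHomotopy_smul
    (L.parHomotopy_smul L' d) (L.parCorrection_smul L')
    (parProj_degree hd h₁ h₂ h₃ (hd.add hc)) (parIncl_degree hd h₁ h₂ h₃ (hd.add hc))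
    (parProjHomotopy_degree hd h₁ h₂ h₃) (parInclHomotopy_degree hd h₁ h₂ h₃)
    (parHomotopy_degree h₁ h₂ h₃) (parCorrection_degree h₁ h₂ h₃)
    (fun x => L.parProj_dg L' d x e) (L.parIncl_dg d) (fun x => L.parProj_dc L' d x e)
    (L.parIncl_dc d) (fun x => L.parHomotopy_dg L' d x e) (fun x => L.parHomotopy_spec L' d x e)
    (L.parProj_parIncl L' d)

end Elimination

end Parallel

end KR


namespace KR

open MvPolynomial

/-! ### The type II move for parallel strands -/

section ParallelMove

variable {V U : Type}

/-- Elimination of a variable in the tensor product of two reduced crossings. -/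
theorem Elimination.equivalent_negPos {β : V → U} (L : Elimination β)
    {P ζ σ Q θ : MvPolynomial U ℚ}
    (hP : IsWeightedHomogeneous (qWeight U) P 2) (hζ : IsWeightedHomogeneous (qWeight U) ζ 2)
    (hσ : IsWeightedHomogeneous (qWeight U) σ 2) (hQ : IsWeightedHomogeneous (qWeight U) Q 2)
    (hθ : IsWeightedHomogeneous (qWeight U) θ 2) {P' ζ' σ' Q' θ' : MvPolynomial V ℚ}
    (hP' : IsWeightedHomogeneous (qWeight V) P' 2) (hζ' : IsWeightedHomogeneous (qWeight V) ζ' 2)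
    (hσ' : IsWeightedHomogeneous (qWeight V) σ' 2) (hQ' : IsWeightedHomogeneous (qWeight V) Q' 2)
    (hθ' : IsWeightedHomogeneous (qWeight V) θ' 2)
    (eP : L.ε P = P') (eζ : L.ε ζ = ζ') (eσ : L.ε σ = σ') (eQ : L.ε Q = Q') (eθ : L.ε θ = θ')
    (E : Bicomplex V) :
    HomotopyEquivalent β id
      (((koszul1 L.ξ 2 L.ξ_deg).tensor (redNeg P ζ hP hζ)).tensor
        (((koszul1 σ 2 hσ).tensor (redPos Q θ hQ hθ)).tensor (E.rename β)))
      (((redNeg P' ζ' hP' hζ').tensor (redPos Q' θ' hQ' hθ')).tensor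
        ((koszul1 σ' 2 hσ').tensor E)) := by
  set R := redNeg P ζ hP hζ
  set S := redPos Q θ hQ hθ
  set K := koszul1 σ 2 hσ
  have h1 : Equivalent (((koszul1 L.ξ 2 L.ξ_deg).tensor R).tensor ((K.tensor S).tensor
      (E.rename β)))
      (L.source (((R.tensor S).tensor K).tensor (E.rename β))) :=
    (Equivalent.tensor_assoc _ R _).trans
      (Equivalent.tensor_left ((Equivalent.tensor_assoc R (K.tensor S) (E.rename β)).symm.trans
        (Equivalent.tensor_right ((Equivalent.tensor_left (Equivalent.tensor_comm K S) R).trans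
          (Equivalent.tensor_assoc R S K).symm) _)) _)
  have h2 : Equivalent (L.target ((R.tensor S).tensor K))
      (((redNeg P' ζ' hP' hζ').tensor (redPos Q' θ' hQ' hθ')).tensor (koszul1 σ' 2 hσ')) :=
    (Equivalent.map_tensor (R.tensor S) K L.ε L.ε_graded).trans
      ((Equivalent.tensor_right ((Equivalent.map_tensor R S L.ε L.ε_graded).trans
        ((Equivalent.tensor_right ((Equivalent.redNeg_map hP hζ L.ε L.ε_graded).trans
          (Equivalent.redNeg_eq _ _ hP' hζ' eP eζ)) _).trans
        (Equivalent.tensor_left ((Equivalent.redPos_map hQ hθ L.ε L.ε_graded).trans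
          (Equivalent.redPos_eq _ _ hQ' hθ' eQ eθ)) _))) _).trans
      (Equivalent.tensor_left ((Equivalent.koszul1_map hσ L.ε L.ε_graded).trans
          (Equivalent.koszul1_eq _ hσ' eσ)) _))
  exact (h1.restrict β).trans ((L.equivalent_tensor ((R.tensor S).tensor K) E).trans
    ((h2.tensor_right E).trans (Equivalent.tensor_assoc _ _ E)))

/-- The second step of the type II move for parallel strands. -/
theorem Elimination.parallel_tensor {β : V → U} (L L' : Elimination β)
    {m m' n n' τ : MvPolynomial U ℚ}
    (hm : IsWeightedHomogeneous (qWeight U) m 2) (hm' : IsWeightedHomogeneous (qWeight U) m' 2)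
    (hn : IsWeightedHomogeneous (qWeight U) n 2) (hn' : IsWeightedHomogeneous (qWeight U) n' 2)
    (hτ : IsWeightedHomogeneous (qWeight U) τ 2) {c d σ : MvPolynomial V ℚ}
    (hc : IsWeightedHomogeneous (qWeight V) c 2) (hd : IsWeightedHomogeneous (qWeight V) d 2)
    (hσ : IsWeightedHomogeneous (qWeight V) σ 2) (eτ : rename β σ = τ) (em : m = L.ξ)
    (em' : m' = L'.ξ) (ec : L'.ξ = L.ξ + rename β c) (en : n = rename β d - L.ξ)
    (en' : n' = rename β d + L.ξ + rename β c) (E : Bicomplex V) :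
    HomotopyEquivalent β id
      (((redNeg m m' hm hm').tensor (redPos n n' hn hn')).tensor
        ((koszul1 τ 2 hτ).tensor (E.rename β)))
      ((koszul1 d 2 hd).tensor ((koszul1 σ 2 hσ).tensor E)) := by
  have e1 : Equivalent ((koszul1 τ 2 hτ).tensor (E.rename β))
      (((koszul1 σ 2 hσ).tensor E).rename β) :=
    (Equivalent.tensor_right ((Equivalent.koszul1_map hσ (rename β) (isGraded_rename β)).trans
      (Equivalent.koszul1_eq _ hτ eτ)).symm (E.rename β)).trans
      (Equivalent.map_tensor _ E (rename β) (isGraded_rename β)).symm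
  have h₁ : IsWeightedHomogeneous (qWeight U) (L.ξ + rename β c) 2 := by rwa [← ec, ← em']
  have h₂ : IsWeightedHomogeneous (qWeight U) (rename β d - L.ξ) 2 := by rwa [← en]
  have h₃ : IsWeightedHomogeneous (qWeight U) (rename β d + L.ξ + rename β c) 2 := by rwa [← en']
  have e2 : Equivalent ((redNeg m m' hm hm').tensor (redPos n n' hn hn'))
      ((redNeg L.ξ (L.ξ + rename β c) L.ξ_deg h₁).tensor (redPos _ _ h₂ h₃)) :=
    (Equivalent.tensor_right (Equivalent.redNeg_eq _ _ _ _ em (em'.trans ec)) _).trans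
      (Equivalent.tensor_left (Equivalent.redPos_eq _ _ _ _ en en') _)
  have e3 := HomotopyEquivalent.tensor ((koszul1 σ 2 hσ).tensor E)
    (Elimination.parallel (L' := L') hd h₁ h₂ h₃ hc ec)
  exact (((Equivalent.tensor_left e1 _).trans (Equivalent.tensor_right e2 _)).restrict β).trans
    (e3.trans (Equivalent.tensor_left (Equivalent.rename_id _) _))

/-- Serves to replace `y₁+y₂-x₁-x₂` by `y₂-x₂` next to the factor `y₁-x₁`, which recovers the
equations of two separate arcs. -/
theorem Equivalent.koszul1_congr {σ τ τ' : MvPolynomial V ℚ}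
    (hσ : IsWeightedHomogeneous (qWeight V) σ 2) (hτ : IsWeightedHomogeneous (qWeight V) τ 2)
    (hτ' : IsWeightedHomogeneous (qWeight V) τ' 2) (k : ℚ) (h : τ' = τ + C k * σ) :
    Equivalent ((koszul1 σ 2 hσ).tensor (koszul1 τ 2 hτ))
      ((koszul1 σ 2 hσ).tensor (koszul1 τ' 2 hτ')) := by
  by_cases σ_ne : σ = 0
  · exact (Equivalent.koszul1_eq hτ hτ' (by rw [h, σ_ne, mul_zero, add_zero])).tensor_left _
  · have h0 := isWeightedHomogeneous_zero ℚ (qWeight V)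
    have h1 : IsWeightedHomogeneous (qWeight V) (C k : MvPolynomial V ℚ) 0 :=
      isWeightedHomogeneous_C _ _
    refine Equivalent.koszul_congr hσ σ_ne (koszul1 τ 2 hτ) (koszul1 τ' 2 hτ').dg_q
      (koszul1 τ' 2 hτ').dc_q (koszul1 τ' 2 hτ').dg_at (koszul1 τ' 2 hτ').dc_at
      (koszul1 τ' 2 hτ').dg_dg (koszul1 τ' 2 hτ').dc_dc (koszul1 τ' 2 hτ').dg_dc
      (!![0, C k; 0, 0] : Matrix (Fin 2) (Fin 2) (MvPolynomial V ℚ)) 0 ?_ (fun _ _ => h0 _) ?_ ?_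
    · intro (i : Fin 2) (j : Fin 2)
      fin_cases i <;> fin_cases j <;> first | exact h0 _ | exact h1
    · ext1 (i : Fin 2) (j : Fin 2)
      change (!![0, τ'; 0, 0] : Matrix (Fin 2) (Fin 2) (MvPolynomial V ℚ)) i j =
        (!![0, τ; 0, 0] : Matrix (Fin 2) (Fin 2) (MvPolynomial V ℚ)) i j +
          σ * (!![0, C k; 0, 0] : Matrix (Fin 2) (Fin 2) (MvPolynomial V ℚ)) i j
      fin_cases i <;> fin_cases j <;> simp [h, mul_comm]
    · rw [smul_zero, add_zero]
      rfl

open Piece in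
/-- The type II move for parallel strands, where the first crossing is negative. -/
theorem HomotopyEquivalent.negPos (x₁ x₂ y₁ y₂ : V) (l : List (Piece V)) :
    HomotopyEquivalent Sum.inl id
      (cpx (crossing .neg (Sum.inl x₁) (Sum.inl x₂) (Sum.inr 0) (Sum.inr 1) ::
          crossing .pos (Sum.inr 0) (Sum.inr 1) (Sum.inl y₁) (Sum.inl y₂) :: lift 2 l))
      (cpx (arc x₁ y₁ :: arc x₂ y₂ :: l)) := by
  -- The linear factor of the negative crossing gives `inr 1 = x₁ + x₂ - inr 0`.
  let L₁ := Elimination.lastMark (X (some x₁) + X (some x₂) - X none)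
    (X (Sum.inr 0) + X (Sum.inr 1) - X (Sum.inl x₁) - X (Sum.inl x₂))
    (by
      rw [add_sub_assoc]
      exact (isWeightedHomogeneous_X ℚ (qWeight _) _).add (lin_q _ _)) (sum_q _ _ _ _)
    (by simp [keepLeft]; ring)
  -- For the remaining inner mark `z = none`, the two polynomials of the negative square are `ξ =
  -- z-x₁` and `ξ' = z-x₂`. So `c = x₁-x₂` and `d = y₁-x₁` in the notation of `parallel`.
  let L₂ := Elimination.optionMark x₁ (X none - X (some x₁)) (lin_q _ _) 1 (by simp) (by simp)
  let L₃ := Elimination.optionMark x₂ (X none - X (some x₂)) (lin_q _ _) 1 (by simp) (by simp)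
  have n_deg : IsWeightedHomogeneous (qWeight (Option V))
      (X (some y₁) + X none - X (some x₁) - X (some x₂) : MvPolynomial (Option V) ℚ) 2 :=
    sum_q _ _ _ _
  have e1 := L₁.equivalent_negPos (lin_q (Sum.inl x₁) (Sum.inr 0)) (lin_q (Sum.inl x₂) (Sum.inr 0))
    (sum_q (Sum.inr 0) (Sum.inr 1) (Sum.inl y₁) (Sum.inl y₂)) (lin_q (Sum.inr 0) (Sum.inl y₁))
    (lin_q (Sum.inr 1) (Sum.inl y₁)) (lin_q (some x₁) none) (lin_q (some x₂) none)
    (sum_q (some x₁) (some x₂) (some y₁) (some y₂)) (lin_q none (some y₁)) n_deg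
    (by simp [L₁, Elimination.lastMark_ε_inl, Elimination.lastMark_ε_zero])
    (by simp [L₁, Elimination.lastMark_ε_inl, Elimination.lastMark_ε_zero])
    (by
      simp [L₁, Elimination.lastMark_ε_inl, Elimination.lastMark_ε_zero,
        Elimination.lastMark_ε_one]
      ring)
    (by simp [L₁, Elimination.lastMark_ε_inl, Elimination.lastMark_ε_zero])
    (by
      simp [L₁, Elimination.lastMark_ε_inl, Elimination.lastMark_ε_one]
      ring) ((cpx l).rename some)
  have e2 := Elimination.parallel_tensor L₂ L₃ (lin_q (some x₁) none) (lin_q (some x₂) none)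
    (lin_q none (some y₁)) n_deg (sum_q (some x₁) (some x₂) (some y₁) (some y₂)) (lin_q x₂ x₁)
    (lin_q x₁ y₁) (sum_q x₁ x₂ y₁ y₂) (by simp) rfl rfl
    (by simp [L₂, L₃, Elimination.optionMark, Elimination.ofMark])
    (by simp [L₂, Elimination.optionMark, Elimination.ofMark])
    (by simp [L₂, Elimination.optionMark, Elimination.ofMark]; ring) (cpx l)
  have e3 : Equivalent ((koszul1 (X y₁ - X x₁) 2 (lin_q x₁ y₁)).tensor
      ((koszul1 (X y₁ + X y₂ - X x₁ - X x₂) 2 (sum_q x₁ x₂ y₁ y₂)).tensor (cpx l)))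
      (cpx (arc x₁ y₁ :: arc x₂ y₂ :: l)) :=
    (Equivalent.tensor_assoc _ _ (cpx l)).symm.trans ((Equivalent.tensor_right
      (Equivalent.koszul1_congr (lin_q x₁ y₁) (sum_q x₁ x₂ y₁ y₂) (lin_q x₂ y₂) (-1)
        (by simp; ring)) (cpx l)).trans (Equivalent.tensor_assoc _ _ (cpx l)))
  have e0 : Equivalent (cpx (crossing .neg (Sum.inl x₁) (Sum.inl x₂) (Sum.inr 0) (Sum.inr 1) ::
      crossing .pos (Sum.inr 0) (Sum.inr 1) (Sum.inl y₁) (Sum.inl y₂) :: lift 2 l)) _ :=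
    (Equivalent.tensor_right (Equivalent.neg _ _ _ _) _).trans (Equivalent.tensor_left
      ((Equivalent.tensor_right (Equivalent.pos _ _ _ _) _).trans
        (Equivalent.tensor_left (Equivalent.cpx_lift l) _)) _)
  have h1 := (e0.restrict keepLeft).trans e1
  exact ((h1.restrict some).trans e2).trans e3

end ParallelMove

end KR


namespace KR

open MvPolynomial

section Detection

variable {V W : Type} {C : Bicomplex V} {D : Bicomplex W}

/-! ## Homological degrees of the homology -/

/-- The homology is not zero in the homological degree `k`. -/
def Bicomplex.HasHomology (C : Bicomplex V) (k : ℤ) : Prop := ∃ i j, C.grHH i j k ≠ ⊥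

theorem HHIso.hasHomology (h : HHIso C D) (k : ℤ) : C.HasHomology k ↔ D.HasHomology k := by
  obtain ⟨e, he⟩ := h
  refine exists_congr fun i => exists_congr fun j => ?_
  rw [← he, ne_eq, ne_eq, Submodule.map_eq_bot_iff]

theorem grHH_shift (C : Bicomplex V) (l m n i j k : ℤ) :
    (C.shift l m n).grHH i j k = C.grHH (i - l) (j - m) (k - n) := by
  change homologyPart C.dcStar (homologyPart C.dgMap ((C.shift l m n).gr i j k)) = _
  rw [gr_shift]
  rfl

theorem hasHomology_shift (C : Bicomplex V) (l m n k : ℤ) :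
    (C.shift l m n).HasHomology k ↔ C.HasHomology (k - n) := by
  constructor
  · rintro ⟨i, j, h⟩
    exact ⟨i - l, j - m, by rwa [grHH_shift] at h⟩
  · rintro ⟨i, j, h⟩
    refine ⟨i + l, j + m, ?_⟩
    rwa [grHH_shift, add_sub_cancel_right, add_sub_cancel_right]

/-- A functional that kills `im d_g` and `d_c (ker d_g)` is well defined on homology, so a nonzero
value shows that the class survives. Vanishing on `d_c y` is demanded only for `d_g`-cycles `y`; the
trefoil in degree 0 needs this weaker form. -/
theorem hasHomology_of_functional {k : ℤ} (i j : ℤ) (z : C.Mod) (φ : C.Mod →ₗ[ℚ] ℚ)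
    (hz : z ∈ C.gr i j k) (dg_z : C.dgMap z = 0) (dc_z : ∃ y, C.dgMap y = C.dcMap z)
    (φ_z : φ z ≠ 0) (φ_dg : ∀ y, φ (C.dgMap y) = 0)
    (φ_dc : ∀ y, C.dgMap y = 0 → φ (C.dcMap y) = 0) : C.HasHomology k := by
  refine ⟨i, j, fun h => φ_z ?_⟩
  have h1 : z ∈ C.cycles := mem_cycles.mpr ⟨dg_z, dc_z⟩
  have h2 : C.class ⟨z, h1⟩ ∈ C.grHH i j k := mem_grHH.mpr ⟨⟨z, h1⟩, hz, rfl⟩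
  rw [h, Submodule.mem_bot, class_eq_zero] at h2
  obtain ⟨y, y', hy, e⟩ := mem_boundaries.mp h2
  change C.dgMap y + C.dcMap y' = z at e
  rw [← e, map_add, φ_dg, φ_dc y' hy, add_zero]

theorem not_hasHomology_of_forall {k : ℤ}
    (h : ∀ i j, ∀ x ∈ C.gr i j k, x ∈ C.cycles → x = 0) : ¬ C.HasHomology k := by
  rintro ⟨i, j, h1⟩
  refine h1 ((Submodule.eq_bot_iff _).mpr fun z hz => ?_)
  obtain ⟨x, hx, rfl⟩ := mem_grHH.mp hz
  rw [class_eq_zero, h i j x hx x.2]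
  exact Submodule.zero_mem _

theorem not_hasHomology_of_t {k : ℤ} (h : ∀ b, C.t b ≠ k) : ¬ C.HasHomology k :=
  not_hasHomology_of_forall fun _ _ x hx _ => funext fun b => by
    by_contra h1
    exact h b ((hx b).2 h1).2

theorem Equivalent.cpx_append (l l' : List (Piece V)) :
    Equivalent (cpx (l ++ l')) ((cpx l).tensor (cpx l')) := by
  induction l with
  | nil =>
    exact (Equivalent.tensor_unit _).symm.trans (Equivalent.tensor_comm _ _)
  | cons p l ih =>
    exact (Equivalent.tensor_left ih p.complex).trans (Equivalent.tensor_assoc _ _ _).symm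

theorem HHIso.relabel (e : V ≃ W) {l : List (Piece V)} {l' : List (Piece W)}
    (h : (l.map (Piece.map e)).Perm l') : HHIso (cpx l) (cpx l') :=
  ((HomotopyEquivalent.relabel (cpx l) e).hhIso).trans
    ((Equivalent.cpx_map e l).symm.trans (Equivalent.cpx_perm h)).hhIso

theorem HHIso.removeArc (f : V → W) (β : W → V) (x y : V) (hxy : x ≠ y)
    (hf : f x = f y) (hβ : ∀ v, f (β v) = v)
    (h : ∀ u, β (f u) = u ∨ (u = x ∧ β (f u) = y) ∨ (u = y ∧ β (f u) = x)) (l : List (Piece V))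
    (l' : List (Piece W)) (hl : l.map (Piece.map f) = l') :
    HHIso (cpx (.arc x y :: l)) (cpx l') := by
  subst hl
  exact (HomotopyEquivalent.removeArc f β x y hxy hf hβ h l).hhIso

theorem Equivalent.shift_shift (C : Bicomplex V) (l m n l' m' n' l'' m'' n'' : ℤ)
    (hl : l + l' = l'') (hm : m + m' = m'') (hn : n + n' = n'') :
    Equivalent ((C.shift l m n).shift l' m' n') (C.shift l'' m'' n'') :=
  Equivalent.ofEntries (Equiv.refl _) (fun i => by subst hl; exact (add_assoc _ _ _).symm)
    (fun i => by subst hm; exact (add_assoc _ _ _).symm)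
    (fun i => by subst hn; exact (add_assoc _ _ _).symm) (fun _ _ => rfl) (fun _ _ => rfl)

end Detection

/-! ### Reduction of the example diagrams -/

section Examples

open Piece

/-- The first type IIb reduction creates the negative crossing `(7,4;6,0)`, which forms a mirrored
type IIb configuration with the positive crossing `(6,5;7,1)`. Each of the two reductions
contributes `t q⁻²`. -/
theorem exampleUnknot_leftTrefoil : HHIso (cpx exampleUnknot) ((cpx leftTrefoil).shift (-4) 0 2) :=
    by
  have h1 := (HomotopyEquivalent.posNegIIb (4 : Fin 8) 0 7 6 exampleRest).hhIso
  -- The marks 6 and 7 become the inner marks `inr 0` and `inr 1` of the mirrored configuration.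
  have h2 : HHIso (cpx _) (cpx (crossing .neg 7 4 6 0 :: exampleRest)) := HHIso.relabel
    (l := crossing .pos (Sum.inr 0) (Sum.inl 5) (Sum.inr 1) (Sum.inl 1) ::
        crossing .neg (Sum.inr 1) (Sum.inl 4) (Sum.inr 0) (Sum.inl 0) ::
        lift 2 [crossing .neg 0 1 2 3, crossing .neg 2 3 4 5])
    (finSumFinEquiv : Fin 6 ⊕ Fin 2 ≃ Fin 8)
    (((List.Perm.swap _ _ _).trans (List.Perm.cons (crossing .neg 7 4 6 0)
      (List.perm_append_comm (l₁ := [crossing .pos 6 5 7 1]) (l₂ := [crossing .neg 0 1 2 3,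
          crossing .neg 2 3 4 5])))))
  have h3 := (HomotopyEquivalent.posNegIIb' (5 : Fin 6) 1 4 0
    [crossing .neg 0 1 2 3, crossing .neg 2 3 4 5]).hhIso
  -- The second reduction yields `(5,4;1,0)`, which is the last crossing `(4,5;0,1)` of the trefoil
  -- with its strands named in the other order.
  have h4 : Equivalent (cpx (crossing .neg 5 4 1 0 :: [crossing .neg 0 1 2 3,
      crossing .neg 2 3 4 5]))
      (cpx leftTrefoil) :=
    (Equivalent.tensor_right (Equivalent.neg_swap 5 4 1 0) _).trans
      (Equivalent.cpx_perm (l := crossing .neg 4 5 0 1 :: [crossing .neg 0 1 2 3,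
          crossing .neg 2 3 4 5])
        (List.perm_append_comm (l₁ := [crossing .neg 4 5 0 1])
          (l₂ := [crossing .neg 0 1 2 3, crossing .neg 2 3 4 5])))
  have h5 := h2.symm.trans (h3.trans (h4.hhIso.shift (-2) 0 1))
  exact (h1.trans (h5.shift (-2) 0 1)).trans
    (Equivalent.shift_shift _ _ _ _ _ _ _ (-4) 0 2 rfl rfl rfl).hhIso

/-- The closure of the braid with one negative crossing. -/
def negCurl : List (Piece (Fin 2)) := [crossing .neg 0 1 0 1]

/-- Without the two arcs, the positive crossing cancels the second negative one as parallel strands.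
The first negative crossing is left with its outgoing ends joined to its incoming ends. -/
theorem exampleArcs_negCurl :
    HHIso (cpx (arcsIIb 4 0 7 6 exampleRest)) (cpx negCurl) := by
  -- The arc from 4 to 6 is contracted to the mark 4, and the mark 7 is renumbered 6.
  have h1 : HHIso (cpx (arcsIIb 4 0 7 6 exampleRest)) _ :=
    HHIso.removeArc ![0, 1, 2, 3, 4, 5, 4, 6] ![0, 1, 2, 3, 4, 5, 7] (4 : Fin 8) 6
      (by decide) rfl (by decide) (by decide) (arc 7 0 :: exampleRest)
      [arc (6 : Fin 7) 0, crossing .neg 0 1 2 3, crossing .neg 2 3 4 5, crossing .pos 4 5 6 1] rfl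
  have h2 := HHIso.removeArc ![0, 1, 2, 3, 4, 5, 0] ![0, 1, 2, 3, 4, 5] (6 : Fin 7) 0
    (by decide) rfl (by decide) (by decide)
    [crossing .neg 0 1 2 3, crossing .neg 2 3 4 5, crossing .pos 4 5 6 1]
    [crossing .neg (0 : Fin 6) 1 2 3, crossing .neg 2 3 4 5, crossing .pos 4 5 0 1] rfl
  have h3 := HHIso.relabel
    (l := crossing .neg (Sum.inl 2) (Sum.inl 3) (Sum.inr 0) (Sum.inr 1) ::
        crossing .pos (Sum.inr 0) (Sum.inr 1) (Sum.inl 0) (Sum.inl 1) ::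
        lift 2 [crossing .neg 0 1 2 3])
    (l' := [crossing .neg (0 : Fin 6) 1 2 3, crossing .neg 2 3 4 5, crossing .pos 4 5 0 1])
    (finSumFinEquiv : Fin 4 ⊕ Fin 2 ≃ Fin 6)
    (List.perm_append_comm (l₁ := [crossing .neg 2 3 4 5, crossing .pos 4 5 0 1])
      (l₂ := [crossing .neg 0 1 2 3]))
  have h4 := (HomotopyEquivalent.negPos (2 : Fin 4) 3 0 1 [crossing .neg 0 1 2 3]).hhIso
  have h5 := HHIso.removeArc ![0, 1, 0, 2] ![0, 1, 3] (2 : Fin 4) 0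
    (by decide) rfl (by decide) (by decide) [arc 3 1, crossing .neg 0 1 2 3]
    [arc (2 : Fin 3) 1, crossing .neg 0 1 0 2] rfl
  have h6 := HHIso.removeArc ![0, 1, 1] ![0, 1] (2 : Fin 3) 1
    (by decide) rfl (by decide) (by decide) [crossing .neg 0 1 0 2] negCurl rfl
  exact h1.trans (h2.trans (h3.symm.trans (h4.trans (h5.trans h6))))

end Examples

end KR


namespace KR

open MvPolynomial

section PureTensors

variable {V : Type} {C D : Bicomplex V}

/-! ## The homology of closed braids on two strands -/

/-- The tensor product of two elements. -/
noncomputable def pureTensor (x : C.Mod) (y : D.Mod) : (C.tensor D).Mod :=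
  fun b : C.ι × D.ι => x b.1 * y b.2

theorem pureTensor_mem_gr {i j k i' j' k' : ℤ} {x : C.Mod} {y : D.Mod} (hx : x ∈ C.gr i j k)
    (hy : y ∈ D.gr i' j' k') : pureTensor x y ∈ (C.tensor D).gr (i + i') (j + j') (k + k') := by
  intro (b : C.ι × D.ι)
  refine ⟨?_, fun h => ?_⟩
  · have h := ((hx b.1).1 : IsWeightedHomogeneous _ _ _).mul ((hy b.2).1 :
      IsWeightedHomogeneous _ _ _)
    have e : i + i' - (C.q b.1 + D.q b.2) = i - C.q b.1 + (i' - D.q b.2) := by ring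
    change IsWeightedHomogeneous _ _ (i + i' - (C.q b.1 + D.q b.2))
    rw [e]
    exact h
  · have h1 := (hx b.1).2 (left_ne_zero_of_mul h)
    have h2 := (hy b.2).2 (right_ne_zero_of_mul h)
    exact ⟨congrArg₂ (· + ·) h1.1 h2.1, congrArg₂ (· + ·) h1.2 h2.2⟩

theorem smul_mem_gr {i j k d : ℤ} {g : MvPolynomial V ℚ} {x : C.Mod}
    (hg : IsWeightedHomogeneous (qWeight V) g d) (hx : x ∈ C.gr i j k) :
    g • x ∈ C.gr (d + i) j k := by
  intro b
  refine ⟨?_, fun h => (hx b).2 (right_ne_zero_of_mul h)⟩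
  rw [add_sub_assoc]
  exact hg.mul ((hx b).1 : IsWeightedHomogeneous _ _ _)

theorem Bicomplex.dgMap_smul (g : MvPolynomial V ℚ) (x : C.Mod) :
    C.dgMap (g • x) = g • C.dgMap x :=
  Matrix.mulVec_smul C.dg g x

theorem Bicomplex.dcMap_smul (g : MvPolynomial V ℚ) (x : C.Mod) :
    C.dcMap (g • x) = g • C.dcMap x :=
  Matrix.mulVec_smul C.dc g x

theorem smul_pureTensor (g : MvPolynomial V ℚ) (x : C.Mod) (y : D.Mod) :
    pureTensor (g • x) y = g • pureTensor x y :=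
  funext fun _ => mul_assoc _ _ _

theorem pureTensor_smul (g : MvPolynomial V ℚ) (x : C.Mod) (y : D.Mod) :
    pureTensor x (g • y) = g • pureTensor x y :=
  funext fun _ => mul_left_comm _ _ _

theorem pureTensor_add (x : C.Mod) (y y' : D.Mod) :
    pureTensor x (y + y') = pureTensor x y + pureTensor x y' :=
  funext fun _ => mul_add _ _ _

theorem dgMap_pureTensor {i j k : ℤ} {x : C.Mod} (hx : x ∈ C.gr i j k) (y : D.Mod) :
    (C.tensor D).dgMap (pureTensor x y) =
      pureTensor (C.dgMap x) y + (MvPolynomial.C (sg j) : MvPolynomial V ℚ) • pureTensor x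
          (D.dgMap y) := by
  refine funext fun b : C.ι × D.ι => (tensor_dgMap C D _ b.1 b.2).trans ?_
  have h1 : (fun c => pureTensor x y (c, b.2)) = y b.2 • x := funext fun _ => mul_comm _ _
  have h2 : (fun e => pureTensor x y (b.1, e)) = x b.1 • y := rfl
  have h3 := congrFun (signOp_a_gr hx) b.1
  rw [signOp_apply, Pi.smul_apply] at h3
  rw [h1, h2, Bicomplex.dgMap_smul, Bicomplex.dgMap_smul, Pi.smul_apply, Pi.smul_apply,
    smul_eq_mul, smul_eq_mul, ← smul_mul_assoc, h3, smul_mul_assoc, smul_eq_C_mul, mul_comm (y b.2)]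
  rfl

theorem dcMap_pureTensor {i j k : ℤ} {x : C.Mod} (hx : x ∈ C.gr i j k) (y : D.Mod) :
    (C.tensor D).dcMap (pureTensor x y) =
      pureTensor (C.dcMap x) y + (MvPolynomial.C (sg k) : MvPolynomial V ℚ) • pureTensor x
          (D.dcMap y) := by
  refine funext fun b : C.ι × D.ι => (tensor_dcMap C D _ b.1 b.2).trans ?_
  have h1 : (fun c => pureTensor x y (c, b.2)) = y b.2 • x := funext fun _ => mul_comm _ _
  have h2 : (fun e => pureTensor x y (b.1, e)) = x b.1 • y := rfl
  have h3 := congrFun (signOp_t_gr hx) b.1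
  rw [signOp_apply, Pi.smul_apply] at h3
  rw [h1, h2, Bicomplex.dcMap_smul, Bicomplex.dcMap_smul, Pi.smul_apply, Pi.smul_apply,
    smul_eq_mul, smul_eq_mul, ← smul_mul_assoc, h3, smul_mul_assoc, smul_eq_C_mul, mul_comm (y b.2)]
  rfl

end PureTensors

/-! ### Homology of a single negative crossing -/

section NegativeCrossings

variable {V : Type}

open Corner

/-- The complex of a negative crossing with the equations `σ = 0`, `p = 0` for its incoming and
outgoing ends. -/
noncomputable def negCrossing (σ p ζ : MvPolynomial V ℚ)
    (hσ : IsWeightedHomogeneous (qWeight V) σ 2) (hp : IsWeightedHomogeneous (qWeight V) p 2)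
    (hζ : IsWeightedHomogeneous (qWeight V) ζ 2) : Bicomplex V :=
  (koszul1 σ 2 hσ).tensor (redNeg p ζ hp hζ)

variable {σ p ζ : MvPolynomial V ℚ} (hσ : IsWeightedHomogeneous (qWeight V) σ 2)
  (hp : IsWeightedHomogeneous (qWeight V) p 2) (hζ : IsWeightedHomogeneous (qWeight V) ζ 2)

theorem negCrossing_formula : (negCrossing σ p ζ hσ hp hζ).HasFormula
    (tensorFormula (koszul1Dg σ) (koszul1Sign V) (cornerDg p ζ))
    (tensorFormula (fun _ => 0) (fun _ => 1) (negDc ζ))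
    (fun b => koszul1Sign V b.1 * cornerSignA V b.2) (fun b => 1 * cornerSignT V b.2) :=
  (koszul1_formula hσ).tensor (redNeg_formula hp hζ)

/-- The basis element of a corner. -/
noncomputable def cornerBasis (V : Type) (c : Corner) (b : Fin 2 × Corner) : MvPolynomial V ℚ :=
  if b.1 = 0 ∧ b.2 = c then 1 else 0

theorem cornerBasis_mem_gr (c : Corner) :
    cornerBasis V c ∈ (negCrossing σ p ζ hσ hp hζ).gr (negQ c) (cornerA c) (negT c) := by
  intro (b : Fin 2 × Corner)
  by_cases h : b.1 = 0 ∧ b.2 = c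
  · obtain ⟨b1, b2⟩ := b
    obtain ⟨rfl, rfl⟩ := h
    refine ⟨?_, fun _ => ⟨zero_add _, zero_add _⟩⟩
    have h1 : negQ b2 - (0 + negQ b2) = 0 := by ring
    have h2 : cornerBasis V b2 (0, b2) = 1 := if_pos ⟨rfl, rfl⟩
    change IsWeightedHomogeneous _ (cornerBasis V b2 (0, b2)) (negQ b2 - (0 + negQ b2))
    rw [h1, h2]
    exact isWeightedHomogeneous_one ℚ (qWeight V)
  · have h1 : cornerBasis V c b = 0 := if_neg h
    exact ⟨by rw [h1]; exact Submodule.zero_mem _, fun h2 => absurd h1 h2⟩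

theorem forall_fin_two_corner {P : Fin 2 × Corner → Prop} (h : ∀ c, P (0, c)) (h' : ∀ c, P (1, c)) :
    ∀ b, P b := fun b => forall_fin_two (P := fun k => ∀ c, P (k, c)) h h' b.1 b.2

theorem negCrossing.dg_w0 :
    (negCrossing σ p ζ hσ hp hζ).dgMap (cornerBasis V w0) = 0 := by
  refine ((negCrossing_formula hσ hp hζ).dg_eq _).trans
    (funext (forall_fin_two_corner (fun c => ?_) (fun c => ?_))) <;> cases c <;>
    simp [tensorFormula, koszul1Dg, cornerDg, cornerBasis] <;> rfl

theorem negCrossing.dg_p0 :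
    (negCrossing σ p ζ hσ hp hζ).dgMap (cornerBasis V p0) = 0 := by
  refine ((negCrossing_formula hσ hp hζ).dg_eq _).trans
    (funext (forall_fin_two_corner (fun c => ?_) (fun c => ?_))) <;> cases c <;>
    simp [tensorFormula, koszul1Dg, cornerDg, cornerBasis] <;> rfl

theorem negCrossing.dg_p1 :
    (negCrossing σ p ζ hσ hp hζ).dgMap (cornerBasis V p1) = p • cornerBasis V p0 := by
  refine ((negCrossing_formula hσ hp hζ).dg_eq _).trans
    (funext (forall_fin_two_corner (fun c => ?_) (fun c => ?_))) <;> cases c <;>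
    simp [tensorFormula, koszul1Dg, cornerDg, cornerBasis, koszul1Sign]

theorem negCrossing.dc_w0 :
    (negCrossing σ p ζ hσ hp hζ).dcMap (cornerBasis V w0) = cornerBasis V p0 := by
  refine ((negCrossing_formula hσ hp hζ).dc_eq _).trans
    (funext (forall_fin_two_corner (fun c => ?_) (fun c => ?_))) <;> cases c <;>
    simp [tensorFormula, negDc, cornerBasis]

theorem negCrossing.dc_p0 :
    (negCrossing σ p ζ hσ hp hζ).dcMap (cornerBasis V p0) = 0 := by
  refine ((negCrossing_formula hσ hp hζ).dc_eq _).trans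
    (funext (forall_fin_two_corner (fun c => ?_) (fun c => ?_))) <;> cases c <;>
    simp [tensorFormula, negDc, cornerBasis] <;> rfl

theorem negCrossing.dc_p1 :
    (negCrossing σ p ζ hσ hp hζ).dcMap (cornerBasis V p1) = 0 := by
  refine ((negCrossing_formula hσ hp hζ).dc_eq _).trans
    (funext (forall_fin_two_corner (fun c => ?_) (fun c => ?_))) <;> cases c <;>
    simp [tensorFormula, negDc, cornerBasis] <;> rfl

theorem Equivalent.negCrossing (x₁ x₂ y₁ y₂ : V) :
    Equivalent (Piece.crossing .neg x₁ x₂ y₁ y₂).complex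
      (negCrossing (X y₁ + X y₂ - X x₁ - X x₂) (X y₁ - X x₁) (X y₁ - X x₂) (sum_q _ _ _ _)
        (lin_q _ _) (lin_q _ _)) :=
  Equivalent.neg x₁ x₂ y₁ y₂

theorem Equivalent.cpx_neg (x₁ x₂ y₁ y₂ : V) :
    Equivalent (cpx [Piece.crossing .neg x₁ x₂ y₁ y₂])
      (KR.negCrossing (X y₁ + X y₂ - X x₁ - X x₂) (X y₁ - X x₁) (X y₁ - X x₂) (sum_q _ _ _ _)
        (lin_q _ _) (lin_q _ _)) :=
  (Equivalent.tensor_unit _).trans (Equivalent.negCrossing x₁ x₂ y₁ y₂)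

theorem constantCoeff_eq_zero {p : MvPolynomial V ℚ} (hp : IsWeightedHomogeneous (qWeight V) p 2) :
    constantCoeff p = 0 := by
  rw [constantCoeff_eq]
  exact hp.coeff_eq_zero 0 (by simp [Finsupp.weight])

/-- The constant term as a linear map. -/
noncomputable def constantTerm (V : Type) : MvPolynomial V ℚ →ₗ[ℚ] ℚ where
  toFun := constantCoeff
  map_add' := map_add _
  map_smul' c f := by simp

theorem constantTerm_apply (f : MvPolynomial V ℚ) : constantTerm V f = constantCoeff f := rfl

/-- The derivative at the origin in the direction `v`. -/
noncomputable def linearTerm (v : V → ℚ) : MvPolynomial V ℚ →ₗ[ℚ] ℚ :=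
  constantTerm V ∘ₗ (mkDerivation ℚ fun i => C (v i)).toLinearMap

theorem linearTerm_apply (v : V → ℚ) (f : MvPolynomial V ℚ) :
    linearTerm v f = constantCoeff (mkDerivation ℚ (fun i => (C (v i) : MvPolynomial V ℚ)) f) := rfl

theorem linearTerm_X (v : V → ℚ) (i : V) : linearTerm v (X i) = v i := by
  simp [linearTerm_apply, mkDerivation_X]

theorem linearTerm_mul (v : V → ℚ) (f g : MvPolynomial V ℚ) : linearTerm v (f * g) =
    constantCoeff f * linearTerm v g + constantCoeff g * linearTerm v f := by
  simp [linearTerm_apply, Derivation.leibniz]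

/-- A functional on a coordinate. -/
noncomputable def atCoord {ι : Type} (ψ : MvPolynomial V ℚ →ₗ[ℚ] ℚ) (b : ι) :
    (ι → MvPolynomial V ℚ) →ₗ[ℚ] ℚ := ψ ∘ₗ LinearMap.proj b

theorem atCoord_apply {ι : Type} (ψ : MvPolynomial V ℚ →ₗ[ℚ] ℚ) (b : ι)
    (x : ι → MvPolynomial V ℚ) : atCoord ψ b x = ψ (x b) := rfl

/-- With `σ = p = 0` the differential `d_g` vanishes, and `d_c` reaches the corner `p1` only through
multiples of `ζ`, which the constant term kills. -/
theorem negCrossing.hasHomology_zero (h : σ = 0) (h' : p = 0) :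
    (negCrossing σ p ζ hσ hp hζ).HasHomology 0 := by
  have key_dg : ∀ y : Fin 2 × Corner → MvPolynomial V ℚ, atCoord (constantTerm V) (0, p1)
      (tensorFormula (koszul1Dg σ) (koszul1Sign V) (cornerDg p ζ) y) = 0 := fun y => by
    simp [atCoord_apply, constantTerm_apply, tensorFormula, koszul1Dg, cornerDg, h]
  have key_dc : ∀ y : Fin 2 × Corner → MvPolynomial V ℚ, atCoord (constantTerm V) (0, p1)
      (tensorFormula (fun _ => 0) (fun _ => 1) (negDc ζ) y) = 0 := fun y => by
    simp [atCoord_apply, constantTerm_apply, tensorFormula, negDc, constantCoeff_eq_zero hζ]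
  have key : atCoord (constantTerm V) (0, p1) (cornerBasis V p1) = 1 := by
    simp [atCoord_apply, constantTerm_apply, cornerBasis]
  refine hasHomology_of_functional 2 1 (cornerBasis V p1) (atCoord (constantTerm V) (((0 : Fin 2),
      p1) : Fin 2 × Corner))
    (cornerBasis_mem_gr hσ hp hζ p1) ?_
    ⟨0, (map_zero _).trans (negCrossing.dc_p1 hσ hp hζ).symm⟩ (ne_of_eq_of_ne key one_ne_zero)
    (fun y => (congrArg _ ((negCrossing_formula hσ hp hζ).dg_eq y)).trans (key_dg y))
    (fun y _ => (congrArg _ ((negCrossing_formula hσ hp hζ).dc_eq y)).trans (key_dc y))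
  refine (negCrossing.dg_p1 hσ hp hζ).trans ?_
  subst h'
  exact zero_smul (MvPolynomial V ℚ) (cornerBasis V p0)

/-- Here `d_g = 0`, and `d_c` is injective on the wide corners, its entries being `1` and `ζ ≠ 0`.
Cycles therefore live on the arcs, in homological degree 0. -/
theorem negCrossing.not_hasHomology (h : σ = 0) (h' : p = 0) (h'' : ζ ≠ 0) {k : ℤ} (hk : k ≠ 0) :
    ¬ (negCrossing σ p ζ hσ hp hζ).HasHomology k := by
  have key_dg : ∀ y : Fin 2 × Corner → MvPolynomial V ℚ,
      tensorFormula (koszul1Dg σ) (koszul1Sign V) (cornerDg p ζ) y = 0 := fun y => by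
    refine funext (forall_fin_two_corner (fun c => ?_) (fun c => ?_)) <;> cases c <;>
      simp [tensorFormula, koszul1Dg, cornerDg, h, h']
  refine not_hasHomology_of_forall fun i j (x : Fin 2 × Corner → MvPolynomial V ℚ) hx hx' => ?_
  obtain ⟨-, y, hy⟩ := mem_cycles.mp hx'
  have h1 : tensorFormula (fun _ => 0) (fun _ => 1) (negDc ζ) x = 0 :=
    ((negCrossing_formula hσ hp hζ).dc_eq x).symm.trans
      (hy.symm.trans (((negCrossing_formula hσ hp hζ).dg_eq y).trans (key_dg y)))
  funext (b : Fin 2 × Corner)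
  obtain ⟨l, c⟩ := b
  by_contra hne
  have ht : 0 + negT c = k := ((hx (l, c)).2 hne).2
  have h2 := congrFun h1 (l, p0)
  have h3 := congrFun h1 (l, p1)
  cases c
  · exact hne (show x (l, w0) = (0 : MvPolynomial V ℚ) by simpa [tensorFormula, negDc] using h2)
  · exact hne (show x (l, w1) = (0 : MvPolynomial V ℚ) by simpa [tensorFormula, negDc,
      h''] using h3)
  · exact hk ht.symm
  · exact hk ht.symm

/-- The element `p • w0` represents a class because `d_c` sends it to `p • p0 = d_g p1`. Evaluation
at a point where `σ` and `ζ` vanish kills `σ` and `pζ`, the only entries that lead into `w0`; it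
does not kill `p`. -/
theorem negCrossing.hasHomology_neg_one (ρ : V → ℚ) (h : aeval ρ σ = 0) (h' : aeval ρ ζ = 0)
    (h'' : aeval ρ p ≠ 0) : (negCrossing σ p ζ hσ hp hζ).HasHomology (-1) := by
  have key_dg : ∀ y : Fin 2 × Corner → MvPolynomial V ℚ, atCoord (aeval ρ).toLinearMap (0, w0)
      (tensorFormula (koszul1Dg σ) (koszul1Sign V) (cornerDg p ζ) y) = 0 := fun y => by
    change aeval ρ (σ * y (1, w0) + 1 * (p * ζ * y (0, w1))) = 0
    rw [map_add, map_mul, map_mul, map_mul, map_mul, h, h', zero_mul, mul_zero, zero_mul, mul_zero,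
      add_zero]
  have key_dc : ∀ y : Fin 2 × Corner → MvPolynomial V ℚ, atCoord (aeval ρ).toLinearMap (0, w0)
      (tensorFormula (fun _ => 0) (fun _ => 1) (negDc ζ) y) = 0 := fun y => by
    simp [atCoord_apply, tensorFormula, negDc]
  have key : atCoord (aeval ρ).toLinearMap (0, w0) (p • cornerBasis V w0) = aeval ρ p := by
    simp [atCoord_apply, cornerBasis]
  refine hasHomology_of_functional (2 + 0) 0 (p • cornerBasis V w0)
    (atCoord (aeval ρ).toLinearMap (((0 : Fin 2), w0) : Fin 2 × Corner))
    (smul_mem_gr hp (cornerBasis_mem_gr hσ hp hζ w0)) ?_ ⟨cornerBasis V p1, ?_⟩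
    (ne_of_eq_of_ne key h'')
    (fun y => (congrArg _ ((negCrossing_formula hσ hp hζ).dg_eq y)).trans (key_dg y))
    (fun y _ => (congrArg _ ((negCrossing_formula hσ hp hζ).dc_eq y)).trans (key_dc y))
  · exact (Bicomplex.dgMap_smul p _).trans
      ((congrArg (p • ·) (negCrossing.dg_w0 hσ hp hζ)).trans (smul_zero p))
  · exact (negCrossing.dg_p1 hσ hp hζ).trans
      ((Bicomplex.dcMap_smul p _).trans (congrArg (p • ·) (negCrossing.dc_w0 hσ hp hζ))).symm

/-- Joining each outgoing end to the incoming end below it makes `σ` and `p` vanish identically, so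
both preceding criteria apply. -/
theorem negCurl_equivalent : Equivalent (cpx negCurl) (KR.negCrossing 0 0 (X 0 - X 1)
    (isWeightedHomogeneous_zero _ _ _) (isWeightedHomogeneous_zero _ _ _) (lin_q _ _)) :=
  (Equivalent.cpx_neg (0 : Fin 2) 1 0 1).trans
    ((Equivalent.tensor_right (Equivalent.koszul1_eq _ _ (by ring)) _).trans
      (Equivalent.tensor_left (Equivalent.redNeg_eq _ _ _ _ (by ring) rfl) _))

theorem negCurl_hasHomology (k : ℤ) : (cpx negCurl).HasHomology k ↔ k = 0 := by
  rw [negCurl_equivalent.hhIso.hasHomology]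
  constructor
  · intro h
    by_contra hk
    refine negCrossing.not_hasHomology _ _ _ rfl rfl (fun h0 => ?_) hk h
    have h1 := X_injective (R := ℚ) (sub_eq_zero.mp h0)
    exact absurd h1 (by decide)
  · rintro rfl
    exact negCrossing.hasHomology_zero _ _ _ rfl rfl

end NegativeCrossings

end KR


namespace KR

open MvPolynomial

/-! ### Differentials of pure tensors of three elements -/

section ThreeTensors

variable {V : Type} {A B D : Bicomplex V} {x x' : A.Mod} {y y' : B.Mod} {z z' : D.Mod}
  {g₁ g₂ g₃ : MvPolynomial V ℚ} {i j k i' j' k' : ℤ}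

theorem dgMap_pureTensor₃ (hx : x ∈ A.gr i j k) (hy : y ∈ B.gr i' j' k')
    (h₁ : A.dgMap x = g₁ • x') (h₂ : B.dgMap y = g₂ • y') (h₃ : D.dgMap z = g₃ • z') :
    (A.tensor (B.tensor D)).dgMap (pureTensor x (pureTensor y z)) =
      g₁ • pureTensor x' (pureTensor y z) + (C (sg j) : MvPolynomial V ℚ) •
        (g₂ • pureTensor x (pureTensor y' z) + (C (sg j') : MvPolynomial V ℚ) •
          g₃ • pureTensor x (pureTensor y z')) := by
  rw [dgMap_pureTensor hx, dgMap_pureTensor hy, h₁, h₂, h₃, smul_pureTensor, smul_pureTensor,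
    pureTensor_smul, pureTensor_add, pureTensor_smul, pureTensor_smul, pureTensor_smul]

theorem dcMap_pureTensor₃ (hx : x ∈ A.gr i j k) (hy : y ∈ B.gr i' j' k')
    (h₁ : A.dcMap x = g₁ • x') (h₂ : B.dcMap y = g₂ • y') (h₃ : D.dcMap z = g₃ • z') :
    (A.tensor (B.tensor D)).dcMap (pureTensor x (pureTensor y z)) =
      g₁ • pureTensor x' (pureTensor y z) + (C (sg k) : MvPolynomial V ℚ) •
        (g₂ • pureTensor x (pureTensor y' z) + (C (sg k') : MvPolynomial V ℚ) •
          g₃ • pureTensor x (pureTensor y z')) := by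
  rw [dcMap_pureTensor hx, dcMap_pureTensor hy, h₁, h₂, h₃, smul_pureTensor, smul_pureTensor,
    pureTensor_smul, pureTensor_add, pureTensor_smul, pureTensor_smul, pureTensor_smul]

end ThreeTensors

/-! ### Homology classes of three negative crossings -/

section ThreeCrossings

variable {V : Type}

open Corner

/-- The index set of a product of three crossings. -/
abbrev ThreeCorners : Type := (Fin 2 × Corner) × ((Fin 2 × Corner) × (Fin 2 × Corner))

/-- The index of three corners. -/
def threeCorners (c₁ c₂ c₃ : Corner) : ThreeCorners := ((0, c₁), ((0, c₂), (0, c₃)))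

variable {σ₁ σ₂ σ₃ p₁ p₂ p₃ ζ₁ ζ₂ ζ₃ : MvPolynomial V ℚ}

/-- The differential `d_g` of a product of three negative crossings. -/
noncomputable def threeDg (σ₁ σ₂ σ₃ p₁ p₂ p₃ ζ₁ ζ₂ ζ₃ : MvPolynomial V ℚ) :
    (ThreeCorners → MvPolynomial V ℚ) → ThreeCorners → MvPolynomial V ℚ :=
  tensorFormula (tensorFormula (koszul1Dg σ₁) (koszul1Sign V) (cornerDg p₁ ζ₁))
    (fun b => koszul1Sign V b.1 * cornerSignA V b.2)
    (tensorFormula (tensorFormula (koszul1Dg σ₂) (koszul1Sign V) (cornerDg p₂ ζ₂))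
      (fun b => koszul1Sign V b.1 * cornerSignA V b.2)
      (tensorFormula (koszul1Dg σ₃) (koszul1Sign V) (cornerDg p₃ ζ₃)))

/-- The differential `d_c` of a product of three negative crossings. -/
noncomputable def threeDc (ζ₁ ζ₂ ζ₃ : MvPolynomial V ℚ) :
    (ThreeCorners → MvPolynomial V ℚ) → ThreeCorners → MvPolynomial V ℚ :=
  tensorFormula (tensorFormula (fun _ => 0) (fun _ => 1) (negDc ζ₁))
    (fun b => 1 * cornerSignT V b.2)
    (tensorFormula (tensorFormula (fun _ => 0) (fun _ => 1) (negDc ζ₂))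
      (fun b => 1 * cornerSignT V b.2)
      (tensorFormula (fun _ => 0) (fun _ => 1) (negDc ζ₃)))

variable (hσ₁ : IsWeightedHomogeneous (qWeight V) σ₁ 2)
  (hσ₂ : IsWeightedHomogeneous (qWeight V) σ₂ 2) (hσ₃ : IsWeightedHomogeneous (qWeight V) σ₃ 2)
  (hp₁ : IsWeightedHomogeneous (qWeight V) p₁ 2) (hp₂ : IsWeightedHomogeneous (qWeight V) p₂ 2)
  (hp₃ : IsWeightedHomogeneous (qWeight V) p₃ 2) (hζ₁ : IsWeightedHomogeneous (qWeight V) ζ₁ 2)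
  (hζ₂ : IsWeightedHomogeneous (qWeight V) ζ₂ 2) (hζ₃ : IsWeightedHomogeneous (qWeight V) ζ₃ 2)

/-- The product of three negative crossings. -/
noncomputable def threeNegCrossings : Bicomplex V :=
  (negCrossing σ₁ p₁ ζ₁ hσ₁ hp₁ hζ₁).tensor
    ((negCrossing σ₂ p₂ ζ₂ hσ₂ hp₂ hζ₂).tensor (negCrossing σ₃ p₃ ζ₃ hσ₃ hp₃ hζ₃))

theorem threeNegCrossings_dg
    (y : (threeNegCrossings hσ₁ hσ₂ hσ₃ hp₁ hp₂ hp₃ hζ₁ hζ₂ hζ₃).Mod) :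
    (threeNegCrossings hσ₁ hσ₂ hσ₃ hp₁ hp₂ hp₃ hζ₁ hζ₂ hζ₃).dgMap y =
      threeDg σ₁ σ₂ σ₃ p₁ p₂ p₃ ζ₁ ζ₂ ζ₃ y :=
  ((negCrossing_formula hσ₁ hp₁ hζ₁).tensor
    ((negCrossing_formula hσ₂ hp₂ hζ₂).tensor (negCrossing_formula hσ₃ hp₃ hζ₃))).dg_eq y

theorem threeNegCrossings_dc
    (y : (threeNegCrossings hσ₁ hσ₂ hσ₃ hp₁ hp₂ hp₃ hζ₁ hζ₂ hζ₃).Mod) :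
    (threeNegCrossings hσ₁ hσ₂ hσ₃ hp₁ hp₂ hp₃ hζ₁ hζ₂ hζ₃).dcMap y = threeDc ζ₁ ζ₂ ζ₃ y :=
  ((negCrossing_formula hσ₁ hp₁ hζ₁).tensor
    ((negCrossing_formula hσ₂ hp₂ hζ₂).tensor (negCrossing_formula hσ₃ hp₃ hζ₃))).dc_eq y

/-- The basis element of three corners. -/
noncomputable def threeBasis (V : Type) (c₁ c₂ c₃ : Corner) (b : ThreeCorners) : MvPolynomial V ℚ :=
  cornerBasis V c₁ b.1 * (cornerBasis V c₂ b.2.1 * cornerBasis V c₃ b.2.2)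

theorem threeBasis_mem_gr (c₁ c₂ c₃ : Corner) :
    threeBasis V c₁ c₂ c₃ ∈ (threeNegCrossings hσ₁ hσ₂ hσ₃ hp₁ hp₂ hp₃ hζ₁ hζ₂ hζ₃).gr
      (negQ c₁ + (negQ c₂ + negQ c₃)) (cornerA c₁ + (cornerA c₂ + cornerA c₃))
      (negT c₁ + (negT c₂ + negT c₃)) := by
  have h := pureTensor_mem_gr (cornerBasis_mem_gr hσ₁ hp₁ hζ₁ c₁)
    (pureTensor_mem_gr (cornerBasis_mem_gr hσ₂ hp₂ hζ₂ c₂) (cornerBasis_mem_gr hσ₃ hp₃ hζ₃ c₃))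
  exact h

theorem threeBasis_apply (c₁ c₂ c₃ d₁ d₂ d₃ : Corner) :
    threeBasis V c₁ c₂ c₃ (threeCorners d₁ d₂ d₃) =
      if d₁ = c₁ ∧ d₂ = c₂ ∧ d₃ = c₃ then 1 else 0 := by
  by_cases h₁ : d₁ = c₁ <;> by_cases h₂ : d₂ = c₂ <;> by_cases h₃ : d₃ = c₃ <;>
    simp [threeBasis, threeCorners, cornerBasis, h₁, h₂, h₃]

theorem threeNegCrossings_dg_basis {c₁ c₂ c₃ d₁ d₂ d₃ : Corner} {g₁ g₂ g₃ : MvPolynomial V ℚ}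
    (h₁ : (negCrossing σ₁ p₁ ζ₁ hσ₁ hp₁ hζ₁).dgMap (cornerBasis V c₁) = g₁ • cornerBasis V d₁)
    (h₂ : (negCrossing σ₂ p₂ ζ₂ hσ₂ hp₂ hζ₂).dgMap (cornerBasis V c₂) = g₂ • cornerBasis V d₂)
    (h₃ : (negCrossing σ₃ p₃ ζ₃ hσ₃ hp₃ hζ₃).dgMap (cornerBasis V c₃) = g₃ • cornerBasis V d₃) :
    (threeNegCrossings hσ₁ hσ₂ hσ₃ hp₁ hp₂ hp₃ hζ₁ hζ₂ hζ₃).dgMap (threeBasis V c₁ c₂ c₃) =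
      g₁ • threeBasis V d₁ c₂ c₃ + (C (sg (cornerA c₁)) : MvPolynomial V ℚ) •
        (g₂ • threeBasis V c₁ d₂ c₃ + (C (sg (cornerA c₂)) : MvPolynomial V ℚ) •
          g₃ • threeBasis V c₁ c₂ d₃) :=
  dgMap_pureTensor₃ (cornerBasis_mem_gr hσ₁ hp₁ hζ₁ c₁) (cornerBasis_mem_gr hσ₂ hp₂ hζ₂ c₂)
    h₁ h₂ h₃

theorem threeNegCrossings_dc_basis {c₁ c₂ c₃ d₁ d₂ d₃ : Corner} {g₁ g₂ g₃ : MvPolynomial V ℚ}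
    (h₁ : (negCrossing σ₁ p₁ ζ₁ hσ₁ hp₁ hζ₁).dcMap (cornerBasis V c₁) = g₁ • cornerBasis V d₁)
    (h₂ : (negCrossing σ₂ p₂ ζ₂ hσ₂ hp₂ hζ₂).dcMap (cornerBasis V c₂) = g₂ • cornerBasis V d₂)
    (h₃ : (negCrossing σ₃ p₃ ζ₃ hσ₃ hp₃ hζ₃).dcMap (cornerBasis V c₃) = g₃ • cornerBasis V d₃) :
    (threeNegCrossings hσ₁ hσ₂ hσ₃ hp₁ hp₂ hp₃ hζ₁ hζ₂ hζ₃).dcMap (threeBasis V c₁ c₂ c₃) =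
      g₁ • threeBasis V d₁ c₂ c₃ + (C (sg (negT c₁)) : MvPolynomial V ℚ) •
        (g₂ • threeBasis V c₁ d₂ c₃ + (C (sg (negT c₂)) : MvPolynomial V ℚ) •
          g₃ • threeBasis V c₁ c₂ d₃) :=
  dcMap_pureTensor₃ (cornerBasis_mem_gr hσ₁ hp₁ hζ₁ c₁) (cornerBasis_mem_gr hσ₂ hp₂ hζ₂ c₂)
    h₁ h₂ h₃

theorem eq_zero_smul {ι : Type} {x : ι → MvPolynomial V ℚ} (h : x = 0)
    (y : ι → MvPolynomial V ℚ) : x = (0 : MvPolynomial V ℚ) • y := by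
  rw [h, zero_smul]

theorem eq_one_smul {ι : Type} {x y : ι → MvPolynomial V ℚ} (h : x = y) :
    x = (1 : MvPolynomial V ℚ) • y := by
  rw [h, one_smul]

theorem sg_neg_one : sg (-1) = -1 := by simp [sg]

theorem three_smul_eq_zero (g h : MvPolynomial V ℚ) (t t' t'' : ThreeCorners → MvPolynomial V ℚ) :
    (0 : MvPolynomial V ℚ) • t + g • ((0 : MvPolynomial V ℚ) • t' + h • (0 :
        MvPolynomial V ℚ) • t'') =
      0 := by
  simp only [zero_smul, smul_zero, add_zero]

theorem linearTerm_add (v w : V → ℚ) (f : MvPolynomial V ℚ) :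
    linearTerm (v + w) f = linearTerm v f + linearTerm w f := by
  have h : (mkDerivation ℚ fun i => (C ((v + w) i) : MvPolynomial V ℚ)) =
      mkDerivation ℚ (fun i => C (v i)) + mkDerivation ℚ fun i => C (w i) :=
    derivation_ext fun i => by simp [mkDerivation_X]
  rw [linearTerm_apply, h, Derivation.add_apply, map_add]
  rfl

/-- All entries of `d_g` lack a constant term, so the linear part of `d_g y` is a linear part of an
entry times a constant term of `y`. The entries `σᵢ` die in the direction `v`, and `pᵢζᵢ` is
quadratic; only the arc entries `pᵢ` remain. -/
theorem threeDg_linearTerm (v : V → ℚ)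
    (c₁ : constantCoeff σ₁ = 0) (c₂ : constantCoeff σ₂ = 0) (c₃ : constantCoeff σ₃ = 0)
    (c₁' : constantCoeff p₁ = 0) (c₂' : constantCoeff p₂ = 0) (c₃' : constantCoeff p₃ = 0)
    (c₁'' : constantCoeff ζ₁ = 0) (c₂'' : constantCoeff ζ₂ = 0) (c₃'' : constantCoeff ζ₃ = 0)
    (h₁ : linearTerm v σ₁ = 0) (h₂ : linearTerm v σ₂ = 0) (h₃ : linearTerm v σ₃ = 0)
    (y : ThreeCorners → MvPolynomial V ℚ) :
    linearTerm v (threeDg σ₁ σ₂ σ₃ p₁ p₂ p₃ ζ₁ ζ₂ ζ₃ y (threeCorners w0 w0 p0)) =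
        linearTerm v p₃ * constantCoeff (y (threeCorners w0 w0 p1)) ∧
    linearTerm v (threeDg σ₁ σ₂ σ₃ p₁ p₂ p₃ ζ₁ ζ₂ ζ₃ y (threeCorners w0 p0 w0)) =
        linearTerm v p₂ * constantCoeff (y (threeCorners w0 p1 w0)) ∧
    linearTerm v (threeDg σ₁ σ₂ σ₃ p₁ p₂ p₃ ζ₁ ζ₂ ζ₃ y (threeCorners p0 w0 w0)) =
        linearTerm v p₁ * constantCoeff (y (threeCorners p1 w0 w0)) ∧
    linearTerm v (threeDg σ₁ σ₂ σ₃ p₁ p₂ p₃ ζ₁ ζ₂ ζ₃ y (threeCorners p0 w0 p0)) =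
        linearTerm v p₁ * constantCoeff (y (threeCorners p1 w0 p0)) +
        linearTerm v p₃ * constantCoeff (y (threeCorners p0 w0 p1)) ∧
    linearTerm v (threeDg σ₁ σ₂ σ₃ p₁ p₂ p₃ ζ₁ ζ₂ ζ₃ y (threeCorners p0 p0 w0)) =
        linearTerm v p₁ * constantCoeff (y (threeCorners p1 p0 w0)) +
        linearTerm v p₂ * constantCoeff (y (threeCorners p0 p1 w0)) := by
  refine ⟨?_, ?_, ?_, ?_, ?_⟩ <;>
    simp [threeDg, tensorFormula, threeCorners, koszul1Dg, cornerDg, koszul1Sign, cornerSignA,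
      linearTerm_mul, c₁, c₂, c₃, c₁', c₂', c₃', c₁'', c₂'', c₃'', h₁, h₂, h₃, mul_comm]

theorem threeNegCrossings_dg_wwp : (threeNegCrossings hσ₁ hσ₂ hσ₃ hp₁ hp₂ hp₃ hζ₁ hζ₂ hζ₃).dgMap
    (threeBasis V w0 w0 p0) = 0 :=
  (threeNegCrossings_dg_basis hσ₁ hσ₂ hσ₃ hp₁ hp₂ hp₃ hζ₁ hζ₂ hζ₃
    (eq_zero_smul (negCrossing.dg_w0 hσ₁ hp₁ hζ₁) (cornerBasis V w0))
    (eq_zero_smul (negCrossing.dg_w0 hσ₂ hp₂ hζ₂) (cornerBasis V w0))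
    (eq_zero_smul (negCrossing.dg_p0 hσ₃ hp₃ hζ₃) (cornerBasis V p0))).trans
    (three_smul_eq_zero _ _ _ _ _)

theorem threeNegCrossings_dg_p1wp :
    (threeNegCrossings hσ₁ hσ₂ hσ₃ hp₁ hp₂ hp₃ hζ₁ hζ₂ hζ₃).dgMap (threeBasis V p1 w0 p0) =
      p₁ • threeBasis V p0 w0 p0 := by
  have e : ∀ t t' t'' : ThreeCorners → MvPolynomial V ℚ,
      p₁ • t + (C (sg (cornerA p1)) : MvPolynomial V ℚ) • ((0 : MvPolynomial V ℚ) • t' +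
        (C (sg (cornerA w0)) : MvPolynomial V ℚ) • (0 : MvPolynomial V ℚ) • t'') = p₁ • t := by
    intro t t' t''
    simp only [zero_smul, smul_zero, add_zero]
  exact (threeNegCrossings_dg_basis hσ₁ hσ₂ hσ₃ hp₁ hp₂ hp₃ hζ₁ hζ₂ hζ₃
    (negCrossing.dg_p1 hσ₁ hp₁ hζ₁)
    (eq_zero_smul (negCrossing.dg_w0 hσ₂ hp₂ hζ₂) (cornerBasis V w0))
    (eq_zero_smul (negCrossing.dg_p0 hσ₃ hp₃ hζ₃) (cornerBasis V p0))).trans (e _ _ _)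

theorem threeNegCrossings_dg_wp1p :
    (threeNegCrossings hσ₁ hσ₂ hσ₃ hp₁ hp₂ hp₃ hζ₁ hζ₂ hζ₃).dgMap (threeBasis V w0 p1 p0) =
      p₂ • threeBasis V w0 p0 p0 := by
  have e : ∀ t t' t'' : ThreeCorners → MvPolynomial V ℚ,
      (0 : MvPolynomial V ℚ) • t' + (C (sg (cornerA w0)) : MvPolynomial V ℚ) • (p₂ • t +
        (C (sg (cornerA p1)) : MvPolynomial V ℚ) • (0 : MvPolynomial V ℚ) • t'') = p₂ • t := by
    intro t t' t''
    simp only [zero_smul, smul_zero, add_zero, zero_add, cornerA, sg_zero, C_1, one_smul]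
  exact (threeNegCrossings_dg_basis hσ₁ hσ₂ hσ₃ hp₁ hp₂ hp₃ hζ₁ hζ₂ hζ₃
    (eq_zero_smul (negCrossing.dg_w0 hσ₁ hp₁ hζ₁) (cornerBasis V w0))
    (negCrossing.dg_p1 hσ₂ hp₂ hζ₂)
    (eq_zero_smul (negCrossing.dg_p0 hσ₃ hp₃ hζ₃) (cornerBasis V p0))).trans (e _ _ _)

theorem threeNegCrossings_dg_wpp1 :
    (threeNegCrossings hσ₁ hσ₂ hσ₃ hp₁ hp₂ hp₃ hζ₁ hζ₂ hζ₃).dgMap (threeBasis V w0 p0 p1) =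
      p₃ • threeBasis V w0 p0 p0 := by
  have e : ∀ t t' t'' : ThreeCorners → MvPolynomial V ℚ,
      (0 : MvPolynomial V ℚ) • t' + (C (sg (cornerA w0)) : MvPolynomial V ℚ) •
        ((0 : MvPolynomial V ℚ) • t'' + (C (sg (cornerA p0)) : MvPolynomial V ℚ) • p₃ • t) =
      p₃ • t := by
    intro t t' t''
    simp only [zero_smul, zero_add, cornerA, sg_zero, C_1, one_smul]
  exact (threeNegCrossings_dg_basis hσ₁ hσ₂ hσ₃ hp₁ hp₂ hp₃ hζ₁ hζ₂ hζ₃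
    (eq_zero_smul (negCrossing.dg_w0 hσ₁ hp₁ hζ₁) (cornerBasis V w0))
    (eq_zero_smul (negCrossing.dg_p0 hσ₂ hp₂ hζ₂) (cornerBasis V p0))
    (negCrossing.dg_p1 hσ₃ hp₃ hζ₃)).trans (e _ _ _)

theorem threeNegCrossings_dc_wwp :
    (threeNegCrossings hσ₁ hσ₂ hσ₃ hp₁ hp₂ hp₃ hζ₁ hζ₂ hζ₃).dcMap (threeBasis V w0 w0 p0) =
      threeBasis V p0 w0 p0 - threeBasis V w0 p0 p0 := by
  have e : ∀ t t' t'' : ThreeCorners → MvPolynomial V ℚ,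
      (1 : MvPolynomial V ℚ) • t + (C (sg (negT w0)) : MvPolynomial V ℚ) •
        ((1 : MvPolynomial V ℚ) • t' + (C (sg (negT w0)) : MvPolynomial V ℚ) •
          (0 : MvPolynomial V ℚ) • t'') = t - t' := by
    intro t t' t''
    simp only [zero_smul, smul_zero, add_zero, negT, sg_neg_one, C_1, C_neg, one_smul, neg_smul,
      sub_eq_add_neg]
  exact (threeNegCrossings_dc_basis hσ₁ hσ₂ hσ₃ hp₁ hp₂ hp₃ hζ₁ hζ₂ hζ₃
    (eq_one_smul (negCrossing.dc_w0 hσ₁ hp₁ hζ₁)) (eq_one_smul (negCrossing.dc_w0 hσ₂ hp₂ hζ₂))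
    (eq_zero_smul (negCrossing.dc_p0 hσ₃ hp₃ hζ₃) (cornerBasis V p0))).trans (e _ _ _)

theorem smul_sub_eq (hp : p₁ + p₂ + p₃ = 0) (t t' : ThreeCorners → MvPolynomial V ℚ) :
    p₁ • t + (p₂ • t' + p₃ • t') = p₁ • (t - t') := by
  have hp' : p₂ = -p₁ - p₃ := by linear_combination hp
  rw [hp', sub_smul, neg_smul, smul_sub]
  abel

/-- The class is `p₁ • (w0, w0, p0)`. Its image under `d_c` is `p₁ • ((p0, w0, p0) - (w0, p0, p0))`.
By `p₂ + p₃ = -p₁` this is `d_g` of the sum of `(p1, w0, p0)`, `(w0, p1, p0)` and `(w0, p0, p1)`. A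
functional built from first derivatives at the three corners of this degree detects it. -/
theorem threeNegCrossings_hasHomology_neg_two (v w : V → ℚ)
    (h₁ : linearTerm v σ₁ = 0) (h₂ : linearTerm v σ₂ = 0) (h₃ : linearTerm v σ₃ = 0)
    (h₁' : linearTerm w σ₁ = 0) (h₂' : linearTerm w σ₂ = 0) (h₃' : linearTerm w σ₃ = 0)
    (v_p₃ : linearTerm v p₃ = 0) (vw_p₂ : linearTerm (v + w) p₂ = 0) (w_p₁ : linearTerm w p₁ = 0)
    (v_p₁ : linearTerm v p₁ ≠ 0) (hp : p₁ + p₂ + p₃ = 0) :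
    (threeNegCrossings hσ₁ hσ₂ hσ₃ hp₁ hp₂ hp₃ hζ₁ hζ₂ hζ₃).HasHomology (-2) := by
  have c := fun v h₁ h₂ h₃ => threeDg_linearTerm v (constantCoeff_eq_zero hσ₁)
    (constantCoeff_eq_zero hσ₂) (constantCoeff_eq_zero hσ₃) (constantCoeff_eq_zero hp₁)
    (constantCoeff_eq_zero hp₂) (constantCoeff_eq_zero hp₃) (constantCoeff_eq_zero hζ₁)
    (constantCoeff_eq_zero hζ₂) (constantCoeff_eq_zero hζ₃) h₁ h₂ h₃
  -- Each direction annihilates the polynomial `pᵢ` of the arc corner at which it is used, so `φ`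
  -- vanishes on the image of `d_g`.
  let φ : (ThreeCorners → MvPolynomial V ℚ) →ₗ[ℚ] ℚ :=
    atCoord (linearTerm v) (threeCorners w0 w0 p0) +
      atCoord (linearTerm (v + w)) (threeCorners w0 p0 w0) +
      atCoord (linearTerm w) (threeCorners p0 w0 w0)
  have hφ : ∀ y, φ y = linearTerm v (y (threeCorners w0 w0 p0)) +
      linearTerm (v + w) (y (threeCorners w0 p0 w0)) +
      linearTerm w (y (threeCorners p0 w0 w0)) := fun y => rfl
  have key_dg : ∀ y, φ (threeDg σ₁ σ₂ σ₃ p₁ p₂ p₃ ζ₁ ζ₂ ζ₃ y) = 0 := fun y => by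
    rw [hφ, (c v h₁ h₂ h₃ y).1, (c (v + w) (by rw [linearTerm_add, h₁, h₁', add_zero])
      (by rw [linearTerm_add, h₂, h₂', add_zero]) (by rw [linearTerm_add, h₃, h₃',
          add_zero]) y).2.1,
      (c w h₁' h₂' h₃' y).2.2.1, v_p₃, vw_p₂, w_p₁]
    ring
  -- The corner `(w0, w0, w0)` reaches the three corners with signs `+, -, +`, and `v - (v + w) + w
  -- = 0`.
  have key_dc : ∀ y, φ (threeDc ζ₁ ζ₂ ζ₃ y) = 0 := fun y => by
    have e₁ : threeDc ζ₁ ζ₂ ζ₃ y (threeCorners w0 w0 p0) = y (threeCorners w0 w0 w0) := by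
      simp [threeDc, tensorFormula, threeCorners, negDc, cornerSignT]
    have e₂ : threeDc ζ₁ ζ₂ ζ₃ y (threeCorners w0 p0 w0) = -y (threeCorners w0 w0 w0) := by
      simp [threeDc, tensorFormula, threeCorners, negDc, cornerSignT]
    have e₃ : threeDc ζ₁ ζ₂ ζ₃ y (threeCorners p0 w0 w0) = y (threeCorners w0 w0 w0) := by
      simp [threeDc, tensorFormula, threeCorners, negDc, cornerSignT]
    rw [hφ, e₁, e₂, e₃, map_neg, linearTerm_add]
    ring
  have key : φ (p₁ • threeBasis V w0 w0 p0) = linearTerm v p₁ := by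
    rw [hφ, Pi.smul_apply, Pi.smul_apply, Pi.smul_apply, threeBasis_apply, threeBasis_apply,
      threeBasis_apply]
    simp
  refine hasHomology_of_functional _ _ (p₁ • threeBasis V w0 w0 p0) φ
    (smul_mem_gr hp₁ (threeBasis_mem_gr hσ₁ hσ₂ hσ₃ hp₁ hp₂ hp₃ hζ₁ hζ₂ hζ₃ w0 w0 p0)) ?_
    ⟨threeBasis V p1 w0 p0 + (threeBasis V w0 p1 p0 + threeBasis V w0 p0 p1), ?_⟩
    (ne_of_eq_of_ne key v_p₁)
    (fun y => (congrArg φ (threeNegCrossings_dg _ _ _ _ _ _ _ _ _ y)).trans (key_dg y))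
    (fun y _ => (congrArg φ (threeNegCrossings_dc _ _ _ _ _ _ _ _ _ y)).trans (key_dc y))
  · exact (Bicomplex.dgMap_smul p₁ _).trans ((congrArg (p₁ • ·)
      (threeNegCrossings_dg_wwp hσ₁ hσ₂ hσ₃ hp₁ hp₂ hp₃ hζ₁ hζ₂ hζ₃)).trans (smul_zero p₁))
  · exact (map_add _ _ _).trans ((congrArg₂ (· + ·)
      (threeNegCrossings_dg_p1wp hσ₁ hσ₂ hσ₃ hp₁ hp₂ hp₃ hζ₁ hζ₂ hζ₃) ((map_add _ _ _).trans
      (congrArg₂ (· + ·) (threeNegCrossings_dg_wp1p hσ₁ hσ₂ hσ₃ hp₁ hp₂ hp₃ hζ₁ hζ₂ hζ₃)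
        (threeNegCrossings_dg_wpp1 hσ₁ hσ₂ hσ₃ hp₁ hp₂ hp₃ hζ₁ hζ₂ hζ₃)))).trans
      ((smul_sub_eq hp _ _).trans ((congrArg (p₁ • ·)
        (threeNegCrossings_dc_wwp hσ₁ hσ₂ hσ₃ hp₁ hp₂ hp₃ hζ₁ hζ₂ hζ₃)).symm.trans
        (Bicomplex.dcMap_smul p₁ _).symm)))

/-- The sum of the three basis elements with exactly one corner `p1` and two corners `p0` is a
`d_g`-cycle because `p₁ + p₂ + p₃ = 0`, and `d_c` kills it. The constant term at `(p1, p0, p0)`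
detects it, provided that no `d_g`-cycle has a constant term at `(p1, w0, p0)` or `(p1, p0, w0)`. -/
theorem threeNegCrossings_hasHomology_zero (v w : V → ℚ)
    (h₁ : linearTerm v σ₁ = 0) (h₂ : linearTerm v σ₂ = 0) (h₃ : linearTerm v σ₃ = 0)
    (h₁' : linearTerm w σ₁ = 0) (h₂' : linearTerm w σ₂ = 0) (h₃' : linearTerm w σ₃ = 0)
    (v_p₃ : linearTerm v p₃ = 0) (w_p₂ : linearTerm w p₂ = 0)
    (v_p₁ : linearTerm v p₁ ≠ 0) (w_p₁ : linearTerm w p₁ ≠ 0) (hp : p₁ + p₂ + p₃ = 0) :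
    (threeNegCrossings hσ₁ hσ₂ hσ₃ hp₁ hp₂ hp₃ hζ₁ hζ₂ hζ₃).HasHomology 0 := by
  have c := fun v h₁ h₂ h₃ => threeDg_linearTerm v (constantCoeff_eq_zero hσ₁)
    (constantCoeff_eq_zero hσ₂) (constantCoeff_eq_zero hσ₃) (constantCoeff_eq_zero hp₁)
    (constantCoeff_eq_zero hp₂) (constantCoeff_eq_zero hp₃) (constantCoeff_eq_zero hζ₁)
    (constantCoeff_eq_zero hζ₂) (constantCoeff_eq_zero hζ₃) h₁ h₂ h₃
  let φ : (ThreeCorners → MvPolynomial V ℚ) →ₗ[ℚ] ℚ :=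
    atCoord (constantTerm V) (threeCorners p1 p0 p0)
  have hφ : ∀ y, φ y = constantCoeff (y (threeCorners p1 p0 p0)) := fun y => rfl
  have key_dg : ∀ y, φ (threeDg σ₁ σ₂ σ₃ p₁ p₂ p₃ ζ₁ ζ₂ ζ₃ y) = 0 := fun y => by
    rw [hφ]
    simp [threeDg, tensorFormula, threeCorners, koszul1Dg, cornerDg, constantCoeff_eq_zero hσ₁,
      constantCoeff_eq_zero hσ₂, constantCoeff_eq_zero hσ₃, constantCoeff_eq_zero hp₂,
      constantCoeff_eq_zero hp₃]
  -- For a `d_g`-cycle, the linear term in direction `v` at `(p0, w0, p0)` forces the constant term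
  -- at `(p1, w0, p0)` to vanish, since `v` kills `p₃` but not `p₁`. Direction `w`, which kills `p₂`
  -- but not `p₁`, does the same for `(p1, p0, w0)`.
  have key_dc : ∀ y, threeDg σ₁ σ₂ σ₃ p₁ p₂ p₃ ζ₁ ζ₂ ζ₃ y = 0 → φ (threeDc ζ₁ ζ₂ ζ₃ y) = 0 :=
      fun y hy => by
    have e₁ := (c v h₁ h₂ h₃ y).2.2.2.1
    have e₂ := (c w h₁' h₂' h₃' y).2.2.2.2
    rw [hy, Pi.zero_apply, map_zero, v_p₃, zero_mul, add_zero, eq_comm, mul_eq_zero,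
      or_iff_right v_p₁] at e₁
    rw [hy, Pi.zero_apply, map_zero, w_p₂, zero_mul, add_zero, eq_comm, mul_eq_zero,
      or_iff_right w_p₁] at e₂
    have e : threeDc ζ₁ ζ₂ ζ₃ y (threeCorners p1 p0 p0) = ζ₁ * y (threeCorners w1 p0 p0) +
        (y (threeCorners p1 w0 p0) + y (threeCorners p1 p0 w0)) := by
      simp [threeDc, tensorFormula, threeCorners, negDc, cornerSignT]
    rw [hφ, e, map_add, map_add, map_mul, e₁, e₂, constantCoeff_eq_zero hζ₁, zero_mul, add_zero,
      add_zero]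
  have key : φ (threeBasis V p1 p0 p0 + (threeBasis V p0 p1 p0 + threeBasis V p0 p0 p1)) = 1 := by
    rw [hφ, Pi.add_apply, Pi.add_apply, threeBasis_apply, threeBasis_apply, threeBasis_apply]
    simp
  have z_dc : ∀ (d₁ d₂ d₃ : Corner), (negCrossing σ₁ p₁ ζ₁ hσ₁ hp₁ hζ₁).dcMap
      (cornerBasis V d₁) = 0 →
      (negCrossing σ₂ p₂ ζ₂ hσ₂ hp₂ hζ₂).dcMap (cornerBasis V d₂) = 0 →
      (negCrossing σ₃ p₃ ζ₃ hσ₃ hp₃ hζ₃).dcMap (cornerBasis V d₃) = 0 →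
      (threeNegCrossings hσ₁ hσ₂ hσ₃ hp₁ hp₂ hp₃ hζ₁ hζ₂ hζ₃).dcMap (threeBasis V d₁ d₂ d₃) = 0 :=
          by
    intro d₁ d₂ d₃ e₁ e₂ e₃
    refine (threeNegCrossings_dc_basis hσ₁ hσ₂ hσ₃ hp₁ hp₂ hp₃ hζ₁ hζ₂ hζ₃
      (eq_zero_smul e₁ (cornerBasis V d₁)) (eq_zero_smul e₂ (cornerBasis V d₂))
      (eq_zero_smul e₃ (cornerBasis V d₃))).trans ?_
    exact three_smul_eq_zero _ _ _ _ _
  have deg := threeBasis_mem_gr hσ₁ hσ₂ hσ₃ hp₁ hp₂ hp₃ hζ₁ hζ₂ hζ₃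
  refine hasHomology_of_functional 2 1
    (threeBasis V p1 p0 p0 + (threeBasis V p0 p1 p0 + threeBasis V p0 p0 p1)) φ
    (Submodule.add_mem _ (deg p1 p0 p0) (Submodule.add_mem _ (deg p0 p1 p0) (deg p0 p0 p1))) ?_
    ⟨0, (map_zero _).trans (Eq.symm ?_)⟩ (ne_of_eq_of_ne key one_ne_zero)
    (fun y => (congrArg φ (threeNegCrossings_dg _ _ _ _ _ _ _ _ _ y)).trans (key_dg y))
    (fun y hy => (congrArg φ (threeNegCrossings_dc _ _ _ _ _ _ _ _ _ y)).trans (key_dc y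
      ((threeNegCrossings_dg _ _ _ _ _ _ _ _ _ y).symm.trans hy)))
  · have e₁ := threeNegCrossings_dg_basis hσ₁ hσ₂ hσ₃ hp₁ hp₂ hp₃ hζ₁ hζ₂ hζ₃
      (negCrossing.dg_p1 hσ₁ hp₁ hζ₁)
      (eq_zero_smul (negCrossing.dg_p0 hσ₂ hp₂ hζ₂) (cornerBasis V p0))
      (eq_zero_smul (negCrossing.dg_p0 hσ₃ hp₃ hζ₃) (cornerBasis V p0))
    have e₂ := threeNegCrossings_dg_basis hσ₁ hσ₂ hσ₃ hp₁ hp₂ hp₃ hζ₁ hζ₂ hζ₃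
      (eq_zero_smul (negCrossing.dg_p0 hσ₁ hp₁ hζ₁) (cornerBasis V p0))
      (negCrossing.dg_p1 hσ₂ hp₂ hζ₂)
      (eq_zero_smul (negCrossing.dg_p0 hσ₃ hp₃ hζ₃) (cornerBasis V p0))
    have e₃ := threeNegCrossings_dg_basis hσ₁ hσ₂ hσ₃ hp₁ hp₂ hp₃ hζ₁ hζ₂ hζ₃
      (eq_zero_smul (negCrossing.dg_p0 hσ₁ hp₁ hζ₁) (cornerBasis V p0))
      (eq_zero_smul (negCrossing.dg_p0 hσ₂ hp₂ hζ₂) (cornerBasis V p0))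
      (negCrossing.dg_p1 hσ₃ hp₃ hζ₃)
    refine (map_add _ _ _).trans ((congrArg₂ (· + ·) e₁ ((map_add _ _ _).trans
      (congrArg₂ (· + ·) e₂ e₃))).trans ?_)
    have e : ∀ t t₁ t₂ t₃ t₄ t₅ t₆ : ThreeCorners → MvPolynomial V ℚ,
        (p₁ • t + (C (sg (cornerA p1)) : MvPolynomial V ℚ) •
            ((0 : MvPolynomial V ℚ) • t₁ + (C (sg (cornerA p0)) : MvPolynomial V ℚ) •
              (0 : MvPolynomial V ℚ) • t₂)) +
          (((0 : MvPolynomial V ℚ) • t₃ + (C (sg (cornerA p0)) : MvPolynomial V ℚ) •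
            (p₂ • t + (C (sg (cornerA p1)) : MvPolynomial V ℚ) • (0 : MvPolynomial V ℚ) • t₄)) +
          ((0 : MvPolynomial V ℚ) • t₅ + (C (sg (cornerA p0)) : MvPolynomial V ℚ) •
            ((0 : MvPolynomial V ℚ) • t₆ + (C (sg (cornerA p0)) : MvPolynomial V ℚ) •
              p₃ • t))) = 0 := fun t t₁ t₂ t₃ t₄ t₅ t₆ => by
      simp only [cornerA, sg_zero, zero_smul, smul_zero, add_zero, zero_add, C_1, one_smul,
        ← add_smul]
      rw [← add_assoc, hp, zero_smul]
    exact e _ _ _ _ _ _ _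
  · refine (map_add _ _ _).trans ((congrArg₂ (· + ·) (z_dc _ _ _ (negCrossing.dc_p1 hσ₁ hp₁ hζ₁)
      (negCrossing.dc_p0 hσ₂ hp₂ hζ₂) (negCrossing.dc_p0 hσ₃ hp₃ hζ₃)) ((map_add _ _ _).trans
      (congrArg₂ (· + ·) (z_dc _ _ _ (negCrossing.dc_p0 hσ₁ hp₁ hζ₁)
      (negCrossing.dc_p1 hσ₂ hp₂ hζ₂) (negCrossing.dc_p0 hσ₃ hp₃ hζ₃))
      (z_dc _ _ _ (negCrossing.dc_p0 hσ₁ hp₁ hζ₁)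
      (negCrossing.dc_p0 hσ₂ hp₂ hζ₂) (negCrossing.dc_p1 hσ₃ hp₃ hζ₃))))).trans ?_)
    simp only [add_zero]

end ThreeCrossings

end KR


namespace KR

open MvPolynomial

/-! ### Homology of the examples and failure of invariance -/

section Examples

open Piece

theorem leftTrefoil_equivalent : Equivalent (cpx leftTrefoil)
    (threeNegCrossings (sum_q (0 : Fin 6) 1 2 3) (sum_q (2 : Fin 6) 3 4 5) (sum_q (4 : Fin 6) 5 0 1)
      (lin_q 0 2) (lin_q 2 4) (lin_q 4 0) (lin_q 1 2) (lin_q 3 4) (lin_q 5 0)) :=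
  (Equivalent.tensor_right (Equivalent.negCrossing 0 1 2 3) _).trans
    (Equivalent.tensor_left ((Equivalent.tensor_right (Equivalent.negCrossing 2 3 4 5) _).trans
      (Equivalent.tensor_left (Equivalent.cpx_neg 4 5 0 1) _)) _)

theorem leftTrefoil_hasHomology_neg_two : (cpx leftTrefoil).HasHomology (-2) := by
  rw [leftTrefoil_equivalent.hhIso.hasHomology]
  -- Moving the two marks at one level of the braid in opposite directions keeps every `σ` at zero;
  -- `v` moves the level of 2 and 3, and `w` that of 4 and 5.
  refine threeNegCrossings_hasHomology_neg_two _ _ _ _ _ _ _ _ _ ![0, 0, 1, -1, 0, 0]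
    ![0, 0, 0, 0, 1, -1] ?_ ?_ ?_ ?_ ?_ ?_ ?_ ?_ ?_ ?_ (by ring) <;>
    simp [linearTerm_X]

theorem leftTrefoil_hasHomology_zero : (cpx leftTrefoil).HasHomology 0 := by
  rw [leftTrefoil_equivalent.hhIso.hasHomology]
  -- Now `w` moves both levels at once, so that `p₂ = x₄ - x₂` is constant along it.
  refine threeNegCrossings_hasHomology_zero _ _ _ _ _ _ _ _ _ ![0, 0, 1, -1, 0, 0]
    ![0, 0, 1, -1, 1, -1] ?_ ?_ ?_ ?_ ?_ ?_ ?_ ?_ ?_ ?_ (by ring) <;>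
    simp [linearTerm_X]

theorem exampleUnknot_hasHomology_zero : (cpx exampleUnknot).HasHomology 0 := by
  rw [exampleUnknot_leftTrefoil.hasHomology, hasHomology_shift]
  exact leftTrefoil_hasHomology_neg_two

theorem exampleUnknot_hasHomology_two : (cpx exampleUnknot).HasHomology 2 := by
  rw [exampleUnknot_leftTrefoil.hasHomology, hasHomology_shift]
  exact leftTrefoil_hasHomology_zero

/-- Two complexes are not isomorphic up to a shift if the homology of the first one lies in several
homological degrees and the homology of the second one does not. -/
theorem not_hhIso_shift {V W : Type} {C : Bicomplex V} {D : Bicomplex W} {k k' k'' : ℤ}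
    (hC : C.HasHomology k) (hC' : C.HasHomology k') (hk : k ≠ k')
    (hD : ∀ k, D.HasHomology k → k = k'') (l m n : ℤ) : ¬ HHIso C (D.shift l m n) := by
  intro h
  have h1 := hD _ ((hasHomology_shift _ _ _ _ _).mp ((h.hasHomology k).mp hC))
  have h2 := hD _ ((hasHomology_shift _ _ _ _ _).mp ((h.hasHomology k').mp hC'))
  omega

theorem exampleUnknot_not_arcs (l m n : ℤ) : ¬ HHIso (cpx exampleUnknot)
    ((cpx (arcsIIb 4 0 7 6 exampleRest)).shift l m n) :=
  not_hhIso_shift exampleUnknot_hasHomology_zero exampleUnknot_hasHomology_two (by decide)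
    (fun k h => (negCurl_hasHomology k).mp ((exampleArcs_negCurl.hasHomology k).mp h)) l m n

theorem cpx_t_of_arc {V : Type} (l : List (V × V)) (b : (cpx (l.map fun e => arc e.1 e.2)).ι) :
    (cpx (l.map fun e => arc e.1 e.2)).t b = 0 := by
  induction l with
  | nil => rfl
  | cons e l ih =>
    change (0 : ℤ) + (cpx (l.map fun e => arc e.1 e.2)).t (Prod.snd b) = 0
    rw [ih, add_zero]

theorem arcs_hasHomology {V : Type} (l : List (V × V)) (k : ℤ)
    (h : (cpx (l.map fun e => arc e.1 e.2)).HasHomology k) : k = 0 := by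
  by_contra hk
  exact not_hasHomology_of_t (fun b hb => hk (hb.symm.trans (cpx_t_of_arc l b))) h

theorem exampleUnknot_not_circle (l m n : ℤ) : ¬ HHIso (cpx exampleUnknot)
    ((cpx circle).shift l m n) :=
  not_hhIso_shift exampleUnknot_hasHomology_zero exampleUnknot_hasHomology_two (by decide)
    (arcs_hasHomology [(0, 1), (1, 0)]) l m n

theorem neg_hasHomology_neg_one : (cpx [crossing .neg (2 : Fin 4) 0 3 1]).HasHomology (-1) := by
  rw [(Equivalent.cpx_neg (2 : Fin 4) 0 3 1).hhIso.hasHomology]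
  -- At this point `σ = x₃+x₁-x₂-x₀` and `ζ = x₃-x₀` vanish, while `p = x₃-x₂` is -1.
  refine negCrossing.hasHomology_neg_one _ _ _ ![0, 1, 1, 0] ?_ ?_ ?_ <;> simp

/-- The arcs `b → a` and `e → c` close the crossing `(c,a;e,b)` to the closure of the braid with one
negative crossing. -/
theorem negClosure_hasHomology_zero :
    (cpx [crossing .neg (2 : Fin 4) 0 3 1, arc 1 0, arc 3 2]).HasHomology 0 := by
  have h1 := HHIso.removeArc ![0, 0, 1, 2] ![0, 2, 3] (1 : Fin 4) 0 (by decide) rfl (by decide)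
    (by decide) [arc 3 2, crossing .neg (2 : Fin 4) 0 3 1]
    [arc 2 1, crossing .neg (1 : Fin 3) 0 2 0] rfl
  have h2 := HHIso.removeArc ![1, 0, 0] ![1, 0] (2 : Fin 3) 1 (by decide) rfl (by decide)
    (by decide) [crossing .neg (1 : Fin 3) 0 2 0] negCurl rfl
  have h3 := Equivalent.cpx_perm (l := [crossing .neg (2 : Fin 4) 0 3 1, arc 1 0, arc 3 2])
    (l' := [arc 1 0, arc 3 2, crossing .neg (2 : Fin 4) 0 3 1])
    (List.perm_append_comm (l₁ := [crossing .neg (2 : Fin 4) 0 3 1]) (l₂ := [arc 1 0, arc 3 2]))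
  rw [(h3.hhIso.trans (h1.trans h2)).hasHomology, negCurl_hasHomology]

/-- An equivalence over the edge ring survives tensoring with the closing arcs `b → a` and `e → c`.
The shifted negative crossing has homology in degree `-1+1 = 0` when open and in degree `0+1 = 1`
when closed. Both arc complexes live in degree `n` only, so `n` would be 0 and 1. -/
theorem posNegIIb_not_arcs (l m n : ℤ) : ¬ HomotopyEquivalent (B := Fin 4) Sum.inl id
    (cpx (posNegIIb (0 : Fin 4) 1 2 3 [])) ((cpx (arcsIIb (0 : Fin 4) 1 2 3 [])).shift l m n) := by
  intro h
  have h1 : Equivalent ((cpx [crossing .neg (2 : Fin 4) 0 3 1]).shift (-2) 0 1)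
      ((cpx [arc (0 : Fin 4) 3, arc 2 1]).shift l m n) :=
    (HomotopyEquivalent.posNegIIb (0 : Fin 4) 1 2 3 []).symm.trans h
  have h2 : Equivalent ((cpx [crossing .neg (2 : Fin 4) 0 3 1, arc 1 0, arc 3 2]).shift (-2) 0 1)
      ((cpx [arc (0 : Fin 4) 3, arc 2 1, arc 1 0, arc 3 2]).shift l m n) :=
    ((Equivalent.cpx_append [crossing .neg (2 : Fin 4) 0 3 1] [arc 1 0, arc 3 2]).shift
      (-2) 0 1).trans ((Equivalent.shift_tensor _ _ _ _ _).symm.trans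
        ((Equivalent.tensor_right h1 _).trans ((Equivalent.shift_tensor _ _ _ _ _).trans
          ((Equivalent.cpx_append [arc (0 : Fin 4) 3, arc 2 1] [arc 1 0,
              arc 3 2]).symm.shift l m n))))
  have h3 : ((cpx [arc (0 : Fin 4) 3, arc 2 1]).shift l m n).HasHomology 0 :=
    (h1.hhIso.hasHomology 0).mp ((hasHomology_shift _ _ _ _ _).mpr neg_hasHomology_neg_one)
  have h4 : ((cpx [arc (0 : Fin 4) 3, arc 2 1, arc 1 0, arc 3 2]).shift l m n).HasHomology 1 :=
    (h2.hhIso.hasHomology 1).mp ((hasHomology_shift _ _ _ _ _).mpr negClosure_hasHomology_zero)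
  rw [hasHomology_shift] at h3 h4
  have h5 := arcs_hasHomology [(0, 3), (2, 1)] _ h3
  have h6 := arcs_hasHomology [(0, 3), (2, 1), (1, 0), (3, 2)] _ h4
  omega

end Examples

end KR


namespace KR

section Planarity

variable {V W : Type}

/-! ## Planar diagrams -/

open Piece

theorem ins_map (e : V → W) (p : Piece V) : (p.map e).ins = p.ins.map e := by
  cases p <;> rfl

theorem outs_map (e : V → W) (p : Piece V) : (p.map e).outs = p.outs.map e := by
  cases p <;> rfl

theorem turns_map (e : V → W) (p : Piece V) :
    (p.map e).turns = p.turns.map (Prod.map (Prod.map e id) (Prod.map e id)) := by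
  cases p <;> rfl

theorem classical_map (e : V → W) (p : Piece V) : (p.map e).Classical ↔ p.Classical := by
  cases p <;> rfl

theorem faceStep_map (e : V ≃ W) (l : List (Piece V)) (d d' : V × Bool) :
    faceStep (l.map (Piece.map e)) (Prod.map e id d) (Prod.map e id d') ↔ faceStep l d d' := by
  have h : Function.Injective (Prod.map (Prod.map e id) (Prod.map e id) :
      (V × Bool) × (V × Bool) → (W × Bool) × (W × Bool)) :=
    (e.injective.prodMap Function.injective_id).prodMap (e.injective.prodMap Function.injective_id)
  unfold faceStep
  simp only [List.mem_map, exists_exists_and_eq_and, turns_map]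
  refine exists_congr fun p => and_congr Iff.rfl ?_
  rw [← List.mem_map_of_injective h]
  simp [List.mem_map]

theorem pieceStep_map (e : V ≃ W) (l : List (Piece V)) (v w : V) :
    pieceStep (l.map (Piece.map e)) (e v) (e w) ↔ pieceStep l v w := by
  unfold pieceStep
  simp only [List.mem_map, exists_exists_and_eq_and, ins_map, outs_map, ← List.map_append,
    EmbeddingLike.apply_eq_iff_eq, exists_eq_right]

/-- Planarity is decided by computation on marks `Fin n`, whereas the moves produce diagrams on sums
of types; this transports the result. -/
theorem IsPlanarLinkDiagram.relabel (e : V ≃ W) {l : List (Piece V)} {l' : List (Piece W)}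
    (h : (l.map (Piece.map e)).Perm l') (hl : IsPlanarLinkDiagram l) : IsPlanarLinkDiagram l' := by
  obtain ⟨⟨h1, h2, h3, h4⟩, h5, h6⟩ := hl
  have hi : ((l.flatMap Piece.ins).map e).Perm (l'.flatMap Piece.ins) := by
    have := h.flatMap_right Piece.ins
    simpa only [List.flatMap_map, List.map_flatMap, ins_map] using this
  have ho : ((l.flatMap Piece.outs).map e).Perm (l'.flatMap Piece.outs) := by
    have := h.flatMap_right Piece.outs
    simpa only [List.flatMap_map, List.map_flatMap, outs_map] using this
  refine ⟨⟨hi.nodup_iff.mp (h1.map e.injective), fun w => ?_, ho.nodup_iff.mp (h3.map e.injective),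
    fun w => ?_⟩, fun p hp => ?_, ?_⟩
  · exact hi.mem_iff.mp (List.mem_map.mpr ⟨e.symm w, h2 _, e.apply_symm_apply w⟩)
  · exact ho.mem_iff.mp (List.mem_map.mpr ⟨e.symm w, h4 _, e.apply_symm_apply w⟩)
  · obtain ⟨q, hq, rfl⟩ := List.mem_map.mp (h.mem_iff.mpr hp)
    exact (classical_map e q).mpr (h5 q hq)
  · have e1 : Nat.card (Quot (faceStep l')) = Nat.card (Quot (faceStep l)) := by
      refine (Nat.card_congr (Quot.congr (e.prodCongr (Equiv.refl Bool)) fun d d' => ?_)).symm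
      refine (faceStep_map e l d d').symm.trans (exists_congr fun p => ?_)
      exact and_congr h.mem_iff Iff.rfl
    have e2 : Nat.card (Quot (pieceStep l')) = Nat.card (Quot (pieceStep l)) := by
      refine (Nat.card_congr (Quot.congr e fun d d' => ?_)).symm
      refine (pieceStep_map e l d d').symm.trans (exists_congr fun p => ?_)
      exact and_congr h.mem_iff Iff.rfl
    rw [e1, e2, ← Nat.card_congr e, ← h.length_eq, List.length_map]
    exact h6

/-- Here `f` is an invariant and `g` a choice of representatives, so the generated equivalence
relation need not be described. -/
theorem card_quot_eq {α : Type} {r : α → α → Prop} {m : ℕ} (f : α → Fin m) (g : Fin m → α)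
    (hf : ∀ x y, r x y → f x = f y) (hg : ∀ i, f (g i) = i)
    (h : ∀ x, Quot.mk r x = Quot.mk r (g (f x))) : Nat.card (Quot r) = m := by
  have e : Quot r ≃ Fin m :=
    { toFun := Quot.lift f hf
      invFun := fun i => Quot.mk r (g i)
      left_inv := fun x => by
        induction x using Quot.ind with
        | mk x => exact (h x).symm
      right_inv := hg }
  rw [Nat.card_congr e, Nat.card_fin]

/-- A connected diagram is planar if its ends are partitioned into the right number of faces.
The second component of `face` is the number of steps to the chosen corner of the face. -/
theorem isPlanarLinkDiagram_of_faces {n m : ℕ} {l : List (Piece (Fin (n + 1)))}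
    (hl : IsLinkDiagram l) (hc : ∀ p ∈ l, p.Classical) (face : Fin (n + 1) × Bool → Fin m × ℕ)
    (corner : Fin m → Fin (n + 1) × Bool)
    (h_face : ∀ p ∈ l, ∀ t ∈ p.turns, (face (t.1.1, !t.1.2)).1 = (face t.2).1)
    (h_corner : ∀ i, (face (corner i)).1 = i)
    (h_zero : ∀ v b, (face (v, b)).2 = 0 → (v, b) = corner (face (v, b)).1)
    (h_step : ∀ v b, (face (v, b)).2 ≠ 0 →
      ∃ p ∈ l, ∃ t ∈ p.turns, t.1 = (v, !b) ∧ (face t.2).2 < (face (v, b)).2)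
    (h_piece : ∀ v, v ≠ 0 → ∃ p ∈ l, v ∈ p.ins ++ p.outs ∧ ∃ w ∈ p.ins ++ p.outs, w < v)
    (h_count : (l.length : ℤ) - (n + 1) + m = 2) : IsPlanarLinkDiagram l := by
  have h1 : Nat.card (Quot (faceStep l)) = m := by
    have hf : ∀ d d', faceStep l d d' → (face d).1 = (face d').1 := by
      rintro ⟨v, b⟩ d' ⟨p, hp, ht⟩
      simpa using h_face p hp _ ht
    refine card_quot_eq (fun d => (face d).1) corner hf h_corner ?_
    -- Walking along the face lowers the step counter until the chosen corner is reached.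
    have key : ∀ k d, (face d).2 = k →
        Quot.mk (faceStep l) d = Quot.mk (faceStep l) (corner (face d).1) := by
      intro k
      induction k using Nat.strong_induction_on with
      | _ k ih =>
        rintro ⟨v, b⟩ hd
        by_cases h0 : (face (v, b)).2 = 0
        · exact congrArg _ (h_zero v b h0)
        · obtain ⟨p, hp, ⟨t, t'⟩, ht, rfl, hlt⟩ := h_step v b h0
          have hs : faceStep l (v, b) t' := ⟨p, hp, ht⟩
          rw [Quot.sound hs, ih _ (hd ▸ hlt) t' rfl, hf _ _ hs]
    exact fun d => key _ d rfl
  have h2 : Nat.card (Quot (pieceStep l)) = 1 := by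
    refine card_quot_eq (fun _ => (0 : Fin 1)) (fun _ => 0) (fun _ _ _ => rfl)
      (fun i => Subsingleton.elim _ _) fun v => ?_
    -- Each nonzero mark shares a piece with a smaller one, so every mark is connected to 0.
    induction v using WellFoundedLT.induction with
    | _ v ih =>
      by_cases h0 : v = 0
      · rw [h0]
      · obtain ⟨p, hp, hv, w, hw, hlt⟩ := h_piece v h0
        rw [Quot.sound (⟨p, hp, hv, hw⟩ : pieceStep l v w), ih w hlt]
  refine ⟨hl, hc, ?_⟩
  rw [h1, h2, Nat.card_fin]
  push_cast
  linarith

instance decidableClassical : (p : Piece V) → Decidable p.Classical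
  | .arc _ _ => isTrue trivial
  | .crossing .pos _ _ _ _ => isTrue fun h => nomatch h
  | .crossing .neg _ _ _ _ => isTrue fun h => nomatch h
  | .crossing .vir _ _ _ _ => isFalse fun h => h rfl

/-- The two functions on the marks that describe a function on the ends. -/
def onEnds {n : ℕ} {α : Type} (f g : Fin n → α) (d : Fin n × Bool) : α := cond d.2 (f d.1) (g d.1)

-- The tables give, for the incoming and then for the outgoing end of each mark, its face and the
-- number of steps to the corner. The Euler characteristic is `3 - 6 + 5 = 2`.
set_option maxRecDepth 10000 in
theorem leftTrefoil_isPlanar : IsPlanarLinkDiagram leftTrefoil := by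
  refine isPlanarLinkDiagram_of_faces (m := 5) (by unfold IsLinkDiagram; decide) (by decide)
    (onEnds ![(0, 0), (1, 1), (0, 1), (3, 1), (0, 2), (4, 1)]
      ![(1, 0), (2, 0), (3, 0), (2, 2), (4, 0), (2, 1)])
    ![(0, true), (0, false), (1, false), (2, false), (4, false)]
    (by decide) (by decide) (by decide) (by decide) (by decide) (by decide)

end Planarity

end KR


namespace KR

/-! ### The example as a diagram of the unknot -/

section Isotopy

open Piece Sum

-- The marks 8 and 9 stand for the inner marks `inr 0` and `inr 1`. The Euler characteristic is `5 -
-- 10 + 7 = 2`.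
set_option maxRecDepth 10000 in
theorem exampleUnknot_isPlanar_fin : IsPlanarLinkDiagram ([crossing .pos 4 8 0 9,
    crossing .neg 7 9 6 8, crossing .neg 0 1 2 3, crossing .neg 2 3 4 5, crossing .pos 6 5 7 1] :
    List (Piece (Fin 10))) := by
  refine isPlanarLinkDiagram_of_faces (m := 7) (by unfold IsLinkDiagram; decide) (by decide)
    (onEnds ![(0, 0), (1, 3), (0, 1), (3, 1), (0, 2), (4, 1), (5, 0), (5, 1), (4, 3), (1, 1)]
      ![(1, 0), (2, 0), (3, 0), (2, 2), (4, 0), (2, 1), (4, 2), (1, 2), (6, 0), (6, 1)])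
    ![(0, true), (0, false), (1, false), (2, false), (4, false), (6, true), (8, false)]
    (by decide) (by decide) (by decide) (by decide) (by decide) (by decide)

set_option maxRecDepth 10000 in
theorem exampleArcs_isPlanar : IsPlanarLinkDiagram (arcsIIb (4 : Fin 8) 0 7 6 exampleRest) := by
  refine isPlanarLinkDiagram_of_faces (m := 5) (by unfold IsLinkDiagram; decide) (by decide)
    (onEnds ![(0, 0), (1, 2), (0, 1), (3, 1), (0, 2), (4, 1), (0, 3), (0, 4)]
      ![(1, 0), (2, 0), (3, 0), (2, 2), (4, 0), (2, 1), (4, 2), (1, 1)])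
    ![(0, true), (0, false), (1, false), (2, false), (4, false)]
    (by decide) (by decide) (by decide) (by decide) (by decide) (by decide)

set_option maxRecDepth 10000 in
theorem oneArc_isPlanar : IsPlanarLinkDiagram ([arc 6 0, crossing .neg 0 1 2 3,
    crossing .neg 2 3 4 5, crossing .pos 4 5 6 1] :
    List (Piece (Fin 7))) := by
  refine isPlanarLinkDiagram_of_faces (m := 5) (by unfold IsLinkDiagram; decide) (by decide)
    (onEnds ![(0, 0), (1, 2), (0, 1), (3, 1), (0, 2), (4, 1), (0, 3)]
      ![(1, 0), (2, 0), (3, 0), (2, 2), (4, 0), (2, 1), (1, 1)])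
    ![(0, true), (0, false), (1, false), (2, false), (4, false)]
    (by decide) (by decide) (by decide) (by decide) (by decide) (by decide)

set_option maxRecDepth 10000 in
theorem noArc_isPlanar : IsPlanarLinkDiagram ([crossing .neg 0 1 2 3, crossing .neg 2 3 4 5,
    crossing .pos 4 5 0 1] :
    List (Piece (Fin 6))) := by
  refine isPlanarLinkDiagram_of_faces (m := 5) (by unfold IsLinkDiagram; decide) (by decide)
    (onEnds ![(0, 0), (1, 1), (0, 1), (3, 1), (0, 2), (4, 1)]
      ![(1, 0), (2, 0), (3, 0), (2, 2), (4, 0), (2, 1)])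
    ![(0, true), (0, false), (1, false), (2, false), (4, false)]
    (by decide) (by decide) (by decide) (by decide) (by decide) (by decide)

set_option maxRecDepth 10000 in
theorem twoArcs_isPlanar : IsPlanarLinkDiagram ([arc 2 0, arc 3 1, crossing .neg 0 1 2 3] :
    List (Piece (Fin 4))) := by
  refine isPlanarLinkDiagram_of_faces (m := 3) (by unfold IsLinkDiagram; decide) (by decide)
    (onEnds ![(0, 0), (1, 3), (0, 1), (1, 2)]
      ![(1, 0), (2, 0), (1, 1), (2, 1)])
    ![(0, true), (0, false), (1, false)]
    (by decide) (by decide) (by decide) (by decide) (by decide) (by decide)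

set_option maxRecDepth 10000 in
theorem negCurl_arc_isPlanar : IsPlanarLinkDiagram ([arc 2 1, crossing .neg 0 1 0 2] :
    List (Piece (Fin 3))) := by
  refine isPlanarLinkDiagram_of_faces (m := 3) (by unfold IsLinkDiagram; decide) (by decide)
    (onEnds ![(0, 0), (1, 2), (1, 1)]
      ![(1, 0), (2, 0), (2, 1)])
    ![(0, true), (0, false), (1, false)]
    (by decide) (by decide) (by decide) (by decide) (by decide) (by decide)

set_option maxRecDepth 10000 in
theorem negCurl_isPlanar : IsPlanarLinkDiagram negCurl := by
  refine isPlanarLinkDiagram_of_faces (m := 3) (by unfold IsLinkDiagram; decide) (by decide)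
    (onEnds ![(0, 0), (1, 1)]
      ![(1, 0), (2, 0)])
    ![(0, true), (0, false), (1, false)]
    (by decide) (by decide) (by decide) (by decide) (by decide) (by decide)

set_option maxRecDepth 10000 in
theorem circle_one_isPlanar : IsPlanarLinkDiagram ([arc 0 0] :
    List (Piece (Fin 1))) := by
  refine isPlanarLinkDiagram_of_faces (m := 2) (by unfold IsLinkDiagram; decide) (by decide)
    (onEnds ![(0, 0)]
      ![(1, 0)])
    ![(0, true), (0, false)]
    (by decide) (by decide) (by decide) (by decide) (by decide) (by decide)

set_option maxRecDepth 10000 in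
theorem circle_isPlanar : IsPlanarLinkDiagram circle := by
  refine isPlanarLinkDiagram_of_faces (m := 2) (by unfold IsLinkDiagram; decide) (by decide)
    (onEnds ![(0, 0), (0, 1)]
      ![(1, 0), (1, 1)])
    ![(0, true), (0, false)]
    (by decide) (by decide) (by decide) (by decide) (by decide) (by decide)

theorem exampleUnknot_isPlanar : IsPlanarLinkDiagram exampleUnknot :=
  exampleUnknot_isPlanar_fin.relabel (finSumFinEquiv : Fin 8 ⊕ Fin 2 ≃ Fin 10).symm
    (List.Perm.of_eq (by rfl))

theorem Isotopic.relabel {V W : Type} (e : V ≃ W) {l : List (Piece V)} {l' : List (Piece W)}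
    (h : (l.map (Piece.map e)).Perm l') (hl : IsPlanarLinkDiagram l) : Isotopic ⟨V, l⟩ ⟨W, l'⟩ :=
  .rel _ _ ⟨hl, hl.relabel e h, .relabel e l l' h⟩

/-- The move `unmark` deletes the mark `none`; the bijection `e` puts the mark to be deleted in this
position. -/
theorem Isotopic.removeArc {V W : Type} (e : W ≃ Option V) (v : V) {l : List (Piece W)}
    (m : List (Piece (Option V))) {l' : List (Piece V)}
    (h : (l.map (Piece.map e)).Perm (arc (some v) none :: m))
    (h' : m.map (Piece.map fun o => o.getD v) = l') (hl : IsPlanarLinkDiagram l)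
    (hl' : IsPlanarLinkDiagram l') : Isotopic ⟨W, l⟩ ⟨V, l'⟩ := by
  subst h'
  exact (Isotopic.relabel e h hl).trans _ _ _ (.rel _ _ ⟨hl.relabel e h, hl', .unmark v m⟩)

theorem exampleUnknot_isotopic_arcs :
    Isotopic ⟨_, exampleUnknot⟩ ⟨_, arcsIIb 4 0 7 6 exampleRest⟩ :=
  .rel _ _ ⟨exampleUnknot_isPlanar, exampleArcs_isPlanar, .R2c 4 0 7 6 exampleRest⟩

/-- After the type IIb pair is pulled apart, a positive and a negative crossing cancel by `R2b`, and
the last negative crossing is a curl removed by `R1right`. The remaining moves rename or erase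
marks. -/
theorem exampleUnknot_isotopic_circle : Isotopic ⟨_, exampleUnknot⟩ ⟨_, circle⟩ := by
  have h1 : Isotopic ⟨_, arcsIIb (4 : Fin 8) 0 7 6 exampleRest⟩ ⟨Fin 7, _⟩ :=
    Isotopic.removeArc ⟨![some 0, some 1, some 2, some 3, some 4, some 5, none, some 6],
      fun o => o.elim 6 ![0, 1, 2, 3, 4, 5, 7], by decide, by decide⟩ 4
      [arc (some 6) (some 0), crossing .neg (some 0) (some 1) (some 2) (some 3),
        crossing .neg (some 2) (some 3) (some 4) (some 5),
        crossing .pos none (some 5) (some 6) (some 1)] (List.Perm.of_eq (by rfl)) rfl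
      exampleArcs_isPlanar oneArc_isPlanar
  have h2 : Isotopic ⟨Fin 7, _⟩ ⟨Fin 6, _⟩ :=
    Isotopic.removeArc ⟨![none, some 1, some 2, some 3, some 4, some 5, some 0],
      fun o => o.elim 0 ![6, 1, 2, 3, 4, 5], by decide, by decide⟩ 0
      [crossing .neg none (some 1) (some 2) (some 3),
        crossing .neg (some 2) (some 3) (some 4) (some 5),
        crossing .pos (some 4) (some 5) (some 0) (some 1)] (List.Perm.of_eq (by rfl)) rfl
      oneArc_isPlanar noArc_isPlanar
  have p3 : ([crossing .neg (0 : Fin 6) 1 2 3, crossing .neg 2 3 4 5,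
      crossing .pos 4 5 0 1].map (Piece.map (finSumFinEquiv : Fin 4 ⊕ Fin 2 ≃ Fin 6).symm)).Perm
      (crossing .neg (inl 2) (inl 3) (inr 0) (inr 1) ::
        crossing .pos (inr 0) (inr 1) (inl 0) (inl 1) ::
        lift 2 [crossing .neg (0 : Fin 4) 1 2 3]) :=
    List.perm_append_comm (l₁ := [crossing .neg (inl 0) (inl 1) (inl 2) (inl 3)])
      (l₂ := [crossing .neg (inl 2) (inl 3) (inr 0) (inr 1),
        crossing .pos (inr 0) (inr 1) (inl 0) (inl 1)])
  have h3 := Isotopic.relabel _ p3 noArc_isPlanar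
  have h4 : Isotopic ⟨Fin 4 ⊕ Fin 2, _⟩ ⟨Fin 4, _⟩ :=
    .rel _ _ ⟨noArc_isPlanar.relabel _ p3, twoArcs_isPlanar,
      .R2b 2 3 0 1 [crossing .neg (0 : Fin 4) 1 2 3]⟩
  have h5 : Isotopic ⟨Fin 4, _⟩ ⟨Fin 3, _⟩ :=
    Isotopic.removeArc ⟨![none, some 1, some 0, some 2], fun o => o.elim 0 ![2, 1, 3],
      by decide, by decide⟩ 0 [arc (some 2) (some 1), crossing .neg none (some 1) (some 0) (some 2)]
      (List.Perm.of_eq (by rfl)) rfl twoArcs_isPlanar negCurl_arc_isPlanar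
  have h6 : Isotopic ⟨Fin 3, _⟩ ⟨Fin 2, _⟩ :=
    Isotopic.removeArc ⟨![some 0, none, some 1], fun o => o.elim 1 ![0, 2],
      by decide, by decide⟩ 1 [crossing .neg (some 0) none (some 0) (some 1)]
      (List.Perm.of_eq (by rfl)) rfl negCurl_arc_isPlanar negCurl_isPlanar
  have p7 : (negCurl.map (Piece.map (finSumFinEquiv : Fin 1 ⊕ Fin 1 ≃ Fin 2).symm)).Perm
      (crossing .neg (inl 0) (inr 0) (inl 0) (inr 0) :: lift 1 ([] : List (Piece (Fin 1)))) :=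
    List.Perm.of_eq (by rfl)
  have h7 := Isotopic.relabel _ p7 negCurl_isPlanar
  have h8 : Isotopic ⟨Fin 1 ⊕ Fin 1, _⟩ ⟨Fin 1, _⟩ :=
    .rel _ _ ⟨negCurl_isPlanar.relabel _ p7, circle_one_isPlanar,
      .R1right .neg (fun h => nomatch h) 0 0 ([] : List (Piece (Fin 1)))⟩
  -- The standard circle has two marks; erasing one meets the chain from the other end.
  have h9 : Isotopic ⟨Fin 2, circle⟩ ⟨Fin 1, _⟩ :=
    Isotopic.removeArc ⟨![some 0, none], fun o => o.elim 1 ![0], by decide, by decide⟩ 0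
      [arc none (some 0)] (List.Perm.of_eq (by rfl)) rfl circle_isPlanar circle_one_isPlanar
  exact exampleUnknot_isotopic_arcs.trans _ _ _ (h1.trans _ _ _ (h2.trans _ _ _ (h3.trans _ _ _
    (h4.trans _ _ _ (h5.trans _ _ _ (h6.trans _ _ _ (h7.trans _ _ _ (h8.trans _ _ _
      (h9.symm _ _)))))))))

end Isotopy

end KR

/-! ### Assembly of the theorem -/

theorem mainTheorem1 :
    -- the local statement, with boundary marks `a, b, c, e = 0, 1, 2, 3`
    (KR.HomotopyEquivalent (B := Fin 4) Sum.inl Sum.inl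
      (KR.cpx (KR.posNegIIb (0 : Fin 4) 1 2 3 []))
      ((KR.cpx (KR.virNegIIb (0 : Fin 4) 1 2 3 [])).shift (-2) 0 1)) ∧
    (∀ l m n : ℤ, ¬ KR.HomotopyEquivalent (B := Fin 4) Sum.inl id
      (KR.cpx (KR.posNegIIb (0 : Fin 4) 1 2 3 []))
      ((KR.cpx (KR.arcsIIb (0 : Fin 4) 1 2 3 [])).shift l m n)) ∧
    -- `H(D₁) ≅ t q⁻² H(D₃)`
    (∀ (V : Type) (a b c e : V) (rest : List (KR.Piece V)),
      KR.IsLinkDiagram (KR.arcsIIb a b c e rest) →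
      KR.HHIso (KR.cpx (KR.posNegIIb a b c e rest))
        ((KR.cpx (KR.virNegIIb a b c e rest)).shift (-2) 0 1)) ∧
    -- the explicit example
    KR.Isotopic ⟨_, KR.exampleUnknot⟩ ⟨_, KR.arcsIIb 4 0 7 6 KR.exampleRest⟩ ∧
    KR.Isotopic ⟨_, KR.exampleUnknot⟩ ⟨_, KR.circle⟩ ∧
    KR.IsPlanarLinkDiagram KR.leftTrefoil ∧
    KR.HHIso (KR.cpx KR.exampleUnknot) ((KR.cpx KR.leftTrefoil).shift (-4) 0 2) ∧
    (∀ l m n : ℤ, ¬ KR.HHIso (KR.cpx KR.exampleUnknot)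
      ((KR.cpx (KR.arcsIIb 4 0 7 6 KR.exampleRest)).shift l m n)) ∧
    (∀ l m n : ℤ, ¬ KR.HHIso (KR.cpx KR.exampleUnknot)
      ((KR.cpx KR.circle).shift l m n)) := by
  refine ⟨?_, KR.posNegIIb_not_arcs, fun V a b c e rest _ => ?_, KR.exampleUnknot_isotopic_arcs,
    KR.exampleUnknot_isotopic_circle, KR.leftTrefoil_isPlanar, KR.exampleUnknot_leftTrefoil,
    KR.exampleUnknot_not_arcs, KR.exampleUnknot_not_circle⟩
  -- Both tangles reduce to the negative crossing `(c,a;e,b)`, the first with the shift `t q⁻²`; the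
  -- same comparison, with the rest of the diagram attached, gives the statement on homology.
  · exact (KR.HomotopyEquivalent.posNegIIb 0 1 2 3 []).trans
      ((KR.HomotopyEquivalent.virNegIIb 0 1 2 3 []).shift (-2) 0 1).symm
  · exact ((KR.HomotopyEquivalent.posNegIIb a b c e rest).trans
      ((KR.HomotopyEquivalent.virNegIIb a b c e rest).shift (-2) 0 1).symm).hhIso
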